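/- **Setting.** Let $k$ binary features be given, and a list of $n$ positive data $x_p\in\{0,1\}^k$ and $m$ negative data $y_q\in\{0,1\}^k$. For a feature $i$ let $\mathbf B_i\in\{0,1\}^{nm}$ be the bit string with entries $x_p(i)\oplus y_q(i)$, and $\|\mathbf B_i\|$ its number of ones. A set $S$ of features is *consistent* if every position $h\le nm$ has $\mathbf B_i[h]=1$ for some $i\in S$. *CWC* sorts the features by increasing $\|\mathbf B_i\|$ (ties by index), starts with the set $S$ of all features, runs through the features in this order and deletes a feature from $S$ whenever the remaining set is consistent; its output is the final $S$. Two parties $A$ and $B$ hold private data; together these form the $n$ positive and $m$ negative data (the number of data of each party is public). **Cryptosystem.** $E$ is a bitwise fully homomorphic public-key cryptosystem as TFHE: probabilistic encryption of bits, homomorphic $\oplus$ and $\cdot$ on ciphertexts, and re-encryption of ciphertexts, all computable by circuits of size polynomial in the security parameter; decryption is correct after any number of these operations. Integers are encrypted bit by bit, and addition, comparison and selection of encrypted integers are built from the two gates. $E$ is *secure* if (i) encryptions of $0$ and of $1$ are computationally indistinguishable given the public key, and (ii) a re-encryption of a ciphertext is computationally indistinguishable from a fresh encryption of the same bit, also for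 the owner of the secret key. Each party has its own key pair; $E_A,E_B$ denote encryption with the keys of $A$ and $B$. **Protocol (improved secure CWC).** 1. $A$ obtains the data of $B$ encrypted by $E_B$, encrypts its own data by $E_B$, and computes homomorphically the encrypted tuples $\mathcal F_i=(i,\|\mathbf B_i\|,\mathbf B_i)$. 2. Mix network: for every component $v$ of every tuple, $A$ draws a uniform mask $r$ and sends $E_B[v+r]$, re-encrypted, and $E_A[r]$; $B$ draws uniform masks $r'$ and a uniformly random secret permutation $\pi$ of the tuples, and returns the re-encrypted $E_B[v+r+r']$ and $E_A[r+r']$ with the tuples permuted by $\pi$; $A$ decrypts $r+r'$ and removes it homomorphically. Thus $A$ holds the encrypted tuples in shuffled order, and the position of a tuple is the new name of its feature. 3. $A$ sorts the encrypted pairs $(i,\|\mathbf B_i\|)$, each together with its encrypted new name, by $\|\mathbf B_i\|$ and then $i$, homomorphically with Batcher's odd-even merge sorting network. 4. $A$ sends the sorted new names, encrypted by $E_B$, with uniform noise added, and re-encrypted; $B$ decrypts and returns these masked values; $A$ removes the noise and learns the sorting permutation in terms of the new names. 5. $A$ moves each encrypted $\mathbf B_i$ to its position in the sorted order. 6. $A$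 executes the deletion loop of CWC homomorphically on the sorted strings, obtaining for every feature an encrypted bit that tells whether it is selected, and sends these bits, re-encrypted and ordered by the new names, to $B$. 7. $B$ decrypts them, undoes the renaming by $\pi$, and shares the set of selected features with $A$. One unit of time is charged for each encryption, decryption, re-encryption, sending or copying of, or homomorphic operation (addition, comparison, selection, logical gate) on, a single plain or encrypted integer or bit, and for each array access and random draw; one unit of space is a register for one integer or bit. **Theorem 2.** (a) There is an absolute constant $C$ such that for all $k,m,n\ge 1$ the protocol takes time (of both parties together) at most $C\,(kmn+k\log^2 k)$ and space at most $C\,kmn$. (b) For every such $E$, the protocol simulates CWC: in every execution both parties end with the output of CWC on the joint data. (c) If $E$ is secure, then the protocol does not reveal the private data of the parties, in the semi-honest model: for all sequences of sizes $k,m,n$ (with their splitting between the parties) that are polynomially bounded in the security parameter, and for each party, there is a family of probabilistic circuits of polynomial size which, given only the party's own data and the output of CWC, produces a string that is computationally indistinguishable (by polynomial-size circuits) from the party's view, i.e. from its data, its random coins, the other party's public key and all messages it receives; this holds for all data of both parties. -/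

import Mathlib

open Filter

namespace SecureCWC

/-! ### The plaintext algorithm CWC

A data set over the features `0, …, k-1` is given by the list `pos` of its positive data and the
list `neg` of its negative data. -/

section Plain

variable {k : ℕ}

/-- The bit string `B_i`: one bit for each pair (positive datum `x`, negative datum `y`), in
lexicographic order, which is `1` iff `x` and `y` differ in the feature `i`. -/
def bitString (pos neg : List (Fin k → Bool)) (i : Fin k) : List Bool :=
  pos.flatMap fun x => neg.map fun y => Bool.xor (x i) (y i)

/-- `‖B_i‖`, the number of ones in `B_i`. -/
def bitWeight (pos neg : List (Fin k → Bool)) (i : Fin k) : ℕ :=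
  (bitString pos neg i).count true

/-- A set of features is consistent if every pair (positive, negative) is told apart by one of
its features. -/
abbrev Consistent (pos neg : List (Fin k → Bool)) (S : Finset (Fin k)) : Prop :=
  ∀ h ∈ List.range (pos.length * neg.length), ∃ i ∈ S, (bitString pos neg i).getD h false = true

/-- The features in increasing order of `‖B_i‖`; ties are resolved by the index (`mergeSort` is
stable). -/
def sortedFeatures (pos neg : List (Fin k → Bool)) : List (Fin k) :=
  (List.finRange k).mergeSort fun i j => decide (bitWeight pos neg i ≤ bitWeight pos neg j)

/-- The output of CWC: starting from all features, run through the features in sorted order and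
drop a feature whenever what remains is consistent. -/
def cwc (pos neg : List (Fin k → Bool)) : Finset (Fin k) :=
  (sortedFeatures pos neg).foldl
    (fun S i => if Consistent pos neg (S.erase i) then S.erase i else S) Finset.univ

end Plain

/-! ### Boolean circuits and efficiency

Efficient means: computed by (non-uniform) Boolean circuits of polynomial size. -/

/-- `StraightLine L`: the functions in `L` are the successive wires of a Boolean circuit with input
bits indexed by `ι` (the last wire first): each one is an input, a constant or the NAND of two
previous ones. -/
inductive StraightLine {ι : Type} : List ((ι → Bool) → Bool) → Prop
  | nil : StraightLine []
  | input (i : ι) {L} : StraightLine L → StraightLine ((fun x => x i) :: L)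
  | const (b : Bool) {L} : StraightLine L → StraightLine ((fun _ => b) :: L)
  | nand {f g : (ι → Bool) → Bool} {L} : f ∈ L → g ∈ L → StraightLine L →
      StraightLine ((fun x => !(f x && g x)) :: L)

/-- `f` is computed by a Boolean circuit with at most `s` wires. -/
def CircuitSizeLE {ι κ : Type} (f : (ι → Bool) → κ → Bool) (s : ℕ) : Prop :=
  ∃ L : List ((ι → Bool) → Bool), StraightLine L ∧ L.length ≤ s ∧ ∀ j, (fun x => f x j) ∈ L

/-- A sequence of natural numbers bounded by a polynomial. -/
def PolyBounded (a : ℕ → ℕ) : Prop := ∃ p : Polynomial ℕ, ∀ l, a l ≤ p.eval l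

/-- A family of functions (indexed by the security parameter) with circuits of polynomial size. -/
def PolySize {ι κ : ℕ → Type} (f : ∀ l, (ι l → Bool) → κ l → Bool) : Prop :=
  ∃ p : Polynomial ℕ, ∀ l, CircuitSizeLE (f l) (p.eval l)

/-- Negligible: decaying faster than any inverse polynomial in the security parameter. -/
def Negligible (a : ℕ → ℝ) : Prop :=
  Asymptotics.SuperpolynomialDecay atTop (fun l : ℕ => (l : ℝ)) a

/-- Strings of `n` bits. -/
abbrev Bits (n : ℕ) : Type := Fin n → Bool

/-- The uniform distribution on a finite non-empty type. -/
noncomputable abbrev unif (α : Type) [Fintype α] [Nonempty α] : PMF α := PMF.uniformOfFintype α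

/-- The probability that a random bit is `1`. -/
noncomputable def prTrue (d : PMF Bool) : ℝ := (d true).toReal

/-- A list of bits as an input of a circuit (padded with zeros). -/
def pad (v : List Bool) : ℕ → Bool := fun i => v.getD i false

/-- The `t` least significant bits of `v`. -/
def natBits (t v : ℕ) : List Bool := (List.range t).map v.testBit

/-- Computational indistinguishability of two ensembles by circuits of polynomial size. -/
def CompIndist (X Y : ℕ → PMF (List Bool)) : Prop :=
  ∀ D : ∀ _ : ℕ, (ℕ → Bool) → Unit → Bool, PolySize D →
    Negligible fun l =>
      |prTrue ((X l).map fun v => D l (pad v) ()) - prTrue ((Y l).map fun v => D l (pad v) ())|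

/-! ### Bitwise fully homomorphic public-key encryption -/

/-- The algorithms of a bitwise homomorphic probabilistic public-key cryptosystem, for each value
`l` of the security parameter. Random coins are explicit arguments. -/
structure BitCrypto where
  pkLen : ℕ → ℕ
  skLen : ℕ → ℕ
  ctLen : ℕ → ℕ
  genCoins : ℕ → ℕ
  encCoins : ℕ → ℕ
  reCoins : ℕ → ℕ
  /-- key generation: public key -/
  genPk : ∀ l, Bits (genCoins l) → Bits (pkLen l)
  /-- key generation: secret key (from the same coins) -/
  genSk : ∀ l, Bits (genCoins l) → Bits (skLen l)
  enc : ∀ l, Bits (pkLen l) → Bool → Bits (encCoins l) → Bits (ctLen l)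
  dec : ∀ l, Bits (skLen l) → Bits (ctLen l) → Bool
  /-- homomorphic addition modulo 2 -/
  xor : ∀ l, Bits (pkLen l) → Bits (ctLen l) → Bits (ctLen l) → Bits (ctLen l)
  /-- homomorphic multiplication -/
  and : ∀ l, Bits (pkLen l) → Bits (ctLen l) → Bits (ctLen l) → Bits (ctLen l)
  /-- re-encryption of a ciphertext with the public key -/
  reenc : ∀ l, Bits (pkLen l) → Bits (ctLen l) → Bits (reCoins l) → Bits (ctLen l)

namespace BitCrypto

variable (E : BitCrypto)

/-- `E.IsCt l pk b c`: `c` is a ciphertext of `b`, obtained from encryptions by any number of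
homomorphic operations and re-encryptions. -/
inductive IsCt (l : ℕ) (pk : Bits (E.pkLen l)) : Bool → Bits (E.ctLen l) → Prop
  | enc (b : Bool) (r) : IsCt l pk b (E.enc l pk b r)
  | xor {b b' : Bool} {c c'} : IsCt l pk b c → IsCt l pk b' c' →
      IsCt l pk (Bool.xor b b') (E.xor l pk c c')
  | and {b b' : Bool} {c c'} : IsCt l pk b c → IsCt l pk b' c' →
      IsCt l pk (b && b') (E.and l pk c c')
  | reenc {b : Bool} {c} (r) : IsCt l pk b c → IsCt l pk b (E.reenc l pk c r)

/-- Decryption is correct on all ciphertexts, after any number of homomorphic operations. -/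
def Correct : Prop :=
  ∀ l (g : Bits (E.genCoins l)) (b : Bool) (c : Bits (E.ctLen l)),
    E.IsCt l (E.genPk l g) b c → E.dec l (E.genSk l g) c = b

/-- All lengths are polynomial and all algorithms have circuits of polynomial size. -/
def Efficient : Prop :=
  PolyBounded E.pkLen ∧ PolyBounded E.skLen ∧ PolyBounded E.ctLen ∧
  PolyBounded E.genCoins ∧ PolyBounded E.encCoins ∧ PolyBounded E.reCoins ∧
  PolySize (ι := fun l => Fin (E.genCoins l)) (fun l x => E.genPk l x) ∧
  PolySize (ι := fun l => Fin (E.genCoins l)) (fun l x => E.genSk l x) ∧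
  PolySize (ι := fun l => Fin (E.pkLen l) ⊕ Unit ⊕ Fin (E.encCoins l))
    (fun l x => E.enc l (fun i => x (.inl i)) (x (.inr (.inl ()))) (fun i => x (.inr (.inr i)))) ∧
  PolySize (ι := fun l => Fin (E.skLen l) ⊕ Fin (E.ctLen l)) (κ := fun _ => Unit)
    (fun l x _ => E.dec l (fun i => x (.inl i)) (fun i => x (.inr i))) ∧
  PolySize (ι := fun l => Fin (E.pkLen l) ⊕ Fin (E.ctLen l) ⊕ Fin (E.ctLen l))
    (fun l x => E.xor l (fun i => x (.inl i)) (fun i => x (.inr (.inl i)))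
      (fun i => x (.inr (.inr i)))) ∧
  PolySize (ι := fun l => Fin (E.pkLen l) ⊕ Fin (E.ctLen l) ⊕ Fin (E.ctLen l))
    (fun l x => E.and l (fun i => x (.inl i)) (fun i => x (.inr (.inl i)))
      (fun i => x (.inr (.inr i)))) ∧
  PolySize (ι := fun l => Fin (E.pkLen l) ⊕ Fin (E.ctLen l) ⊕ Fin (E.reCoins l))
    (fun l x => E.reenc l (fun i => x (.inl i)) (fun i => x (.inr (.inl i)))
      (fun i => x (.inr (.inr i))))

/-- A bitwise fully homomorphic encryption scheme. -/
def IsFHE : Prop := E.Correct ∧ E.Efficient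

/-- Ciphertext indistinguishability (IND-CPA): given the public key, encryptions of `0` and of `1`
are indistinguishable. -/
def CtIndist : Prop :=
  ∀ D : ∀ l, (Fin (E.pkLen l) ⊕ Fin (E.ctLen l) → Bool) → Unit → Bool, PolySize D →
    Negligible fun l =>
      |prTrue ((unif (Bits (E.genCoins l) × Bits (E.encCoins l))).map fun t =>
          D l (Sum.elim (E.genPk l t.1) (E.enc l (E.genPk l t.1) false t.2)) ()) -
        prTrue ((unif (Bits (E.genCoins l) × Bits (E.encCoins l))).map fun t =>
          D l (Sum.elim (E.genPk l t.1) (E.enc l (E.genPk l t.1) true t.2)) ())|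

/-- Re-encryption hides the origin of a ciphertext: for all keys and all ciphertexts, a
re-encryption is indistinguishable from a fresh encryption of the same bit. (The distinguishing
circuits may depend on the keys, the secret key included, and on the ciphertext.) -/
def ReencIndist : Prop :=
  ∀ (g : ∀ l, Bits (E.genCoins l)) (b : ℕ → Bool) (c : ∀ l, Bits (E.ctLen l)),
    (∀ l, E.IsCt l (E.genPk l (g l)) (b l) (c l)) →
    ∀ D : ∀ l, (Fin (E.ctLen l) → Bool) → Unit → Bool, PolySize D →
      Negligible fun l =>
        |prTrue ((unif (Bits (E.reCoins l))).map fun r =>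
            D l (E.reenc l (E.genPk l (g l)) (c l) r) ()) -
          prTrue ((unif (Bits (E.encCoins l))).map fun r =>
            D l (E.enc l (E.genPk l (g l)) (b l) r) ())|

/-- The cryptosystem is secure. -/
def Secure : Prop := E.CtIndist ∧ E.ReencIndist

end BitCrypto

/-! ### Arithmetic on bitwise encrypted integers

An integer is encrypted bit by bit, least significant bit first. The operations are built from the
two gates `xor` and `and` on (encrypted) bits. -/

section Arithmetic

variable {C : Type} (xor and : C → C → C)

/-- Ripple-carry adder with carry-in; the result has the length of the first summand. -/
def addCarry : C → List C → List C → List C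
  | _, [], _ => []
  | c, x :: xs, [] => xor x c :: addCarry (and x c) xs []
  | c, x :: xs, y :: ys =>
      xor (xor x y) c :: addCarry (xor (and (xor x c) (xor y c)) c) xs ys

/-- Addition modulo `2 ^ (length of the first summand)`. -/
def addBits : List C → List C → List C
  | x :: xs, y :: ys => xor x y :: addCarry xor and (and x y) xs ys
  | xs, _ => xs

/-- Comparison of the more significant bits, given the result on the less significant ones. -/
def ltAux : C → List C → List C → C
  | r, x :: xs, y :: ys => ltAux (xor r (and (xor x y) (xor r y))) xs ys
  | r, _, _ => r

/-- The bit `x <? y`, for integers of the same length. -/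
def ltBits : List C → List C → List C
  | x :: xs, y :: ys => [ltAux xor and (xor y (and x y)) xs ys]
  | _, _ => []

/-- Logical or, bit by bit. -/
def orBits : List C → List C → List C :=
  List.zipWith fun x y => xor (xor x y) (and x y)

/-- The integer `x` if the bit `c` is `1`, and `y` otherwise. -/
def muxBits : List C → List C → List C → List C
  | c :: _, xs, ys => List.zipWith (fun x y => xor y (and c (xor x y))) xs ys
  | _, _, _ => []

/-- Binary homomorphic operations; `cat` forms an encrypted pair, the second component being the
more significant one. -/
inductive HomOp
  | add | xor | and | or | lt | cat

/-- The meaning of the operations. -/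
def HomOp.eval : HomOp → List C → List C → List C
  | .add => addBits xor and
  | .xor => List.zipWith xor
  | .and => List.zipWith and
  | .or => orBits xor and
  | .lt => ltBits xor and
  | .cat => fun xs ys => xs ++ ys

end Arithmetic

/-! ### Two-party programs

Two random access machines with registers. Every instruction takes one unit of time; in particular
one unit is charged for an encryption, a decryption or a homomorphic operation on (encrypted)
integers. -/

inductive Party
  | A | B
  deriving DecidableEq

def Party.other : Party → Party
  | .A => .B
  | .B => .A

/-- The components of the tuple (index, weight, bit string) that belongs to a feature. -/
inductive Field
  | name | weight | bit (h : ℕ)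
  deriving DecidableEq

/-- Names of registers (each party has its own ones). -/
inductive Reg
  | pos (p i : ℕ) | neg (q i : ℕ)
  | item (i : ℕ) (f : Field) | mask (i : ℕ) (f : Field) | noise (i : ℕ) (f : Field)
  | perm (i : ℕ)
  | key (j : ℕ) | label (j : ℕ) | pad (j : ℕ) | masked (j : ℕ) | rank (j : ℕ)
  | srt (j h : ℕ) | z (j h : ℕ) | cum (h : ℕ) | keep (j : ℕ)
  | sel (j : ℕ) | out (i : ℕ) | tmp (t : ℕ)
  deriving DecidableEq

/-- A register holds a plaintext integer and an encrypted integer (a list of encrypted bits). -/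
structure Cell (C : Type) where
  val : ℕ
  ct : List C

/-- Instructions. `P` is the party that acts; `K` is the party whose public key is used. -/
inductive Instr
  /-- plaintext of `d` := `v` -/
  | const (P : Party) (d : Reg) (v : ℕ)
  /-- plaintext of `d` := plaintext of `s` minus plaintext of `t`, modulo `2 ^ w` -/
  | sub (P : Party) (w : ℕ) (d s t : Reg)
  /-- copy the register `s` to `d` -/
  | move (P : Party) (d s : Reg)
  /-- copy entry number `v` of the array `arr` to `d`, where `v` is the plaintext of `i` -/
  | load (P : Party) (d : Reg) (arr : List Reg) (i : Reg)
  /-- copy `s` to entry number `v` of the array `arr`, where `v` is the plaintext of `i` -/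
  | store (P : Party) (arr : List Reg) (i s : Reg)
  /-- plaintext of `d` := uniformly random integer in `{0, …, b}` -/
  | coin (P : Party) (d : Reg) (b : ℕ)
  /-- ciphertext of `d` := encryption of the `w` lowest bits of the plaintext of `s` -/
  | enc (P K : Party) (w : ℕ) (d s : Reg)
  /-- plaintext of `d` := decryption, with the party's own secret key, of the ciphertext of `s` -/
  | dec (P : Party) (d s : Reg)
  /-- ciphertext of `d` := result of a homomorphic operation on the ciphertexts of `s` and `t` -/
  | hom (P K : Party) (o : HomOp) (d s t : Reg)
  /-- ciphertext of `d` := ciphertext of `s` or `t`, according to the encrypted bit `c` -/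
  | mux (P K : Party) (d c s t : Reg)
  /-- re-encrypt the ciphertext of `d` -/
  | reenc (P K : Party) (d : Reg)
  /-- send the ciphertext of `s` to the register `d` of the other party -/
  | sendCt (P : Party) (d s : Reg)
  /-- send the `w` lowest bits of the plaintext of `s` to the register `d` of the other party -/
  | sendVal (P : Party) (w : ℕ) (d s : Reg)

abbrev Program := List Instr

/-- The registers that an instruction mentions. -/
def Instr.regs : Instr → List (Party × Reg)
  | .const P d _ => [(P, d)]
  | .sub P _ d s t => [(P, d), (P, s), (P, t)]
  | .move P d s => [(P, d), (P, s)]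
  | .load P d arr i => (P, d) :: (P, i) :: arr.map fun r => (P, r)
  | .store P arr i s => (P, i) :: (P, s) :: arr.map fun r => (P, r)
  | .coin P d _ => [(P, d)]
  | .enc P _ _ d s => [(P, d), (P, s)]
  | .dec P d s => [(P, d), (P, s)]
  | .hom P _ _ d s t => [(P, d), (P, s), (P, t)]
  | .mux P _ d c s t => [(P, d), (P, c), (P, s), (P, t)]
  | .reenc P _ d => [(P, d)]
  | .sendCt P d s => [(P.other, d), (P, s)]
  | .sendVal P _ d s => [(P.other, d), (P, s)]

/-- Running time: the number of instructions (of both parties) that are executed. -/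
def Program.time (pr : Program) : ℕ := pr.length

/-- Space: the number of registers (of both parties) in use. -/
def Program.space (pr : Program) : ℕ := (pr.flatMap Instr.regs).toFinset.card

/-- The memories of the two parties, and their views so far. The view of a party consists of its
input, all its random coins and all messages that it received. -/
structure State (C : Type) where
  mem : Party → Reg → Cell C
  view : Party → List Bool

namespace State

variable {C : Type} (st : State C)

def put (P : Party) (d : Reg) (x : Cell C) : State C :=
  { st with mem := Function.update st.mem P (Function.update (st.mem P) d x) }

def setVal (P : Party) (d : Reg) (v : ℕ) : State C := st.put P d ⟨v, (st.mem P d).ct⟩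

def setCt (P : Party) (d : Reg) (c : List C) : State C := st.put P d ⟨(st.mem P d).val, c⟩

def see (P : Party) (v : List Bool) : State C :=
  { st with view := Function.update st.view P (st.view P ++ v) }

end State

/-- The integer with the given bits, least significant bit first. -/
def ofBits (v : List Bool) : ℕ := v.foldr (fun b n => b.toNat + 2 * n) 0

/-- The bits of a list of bit strings. -/
def flat {n : ℕ} (c : List (Bits n)) : List Bool := c.flatMap List.ofFn

/-- The effect of an instruction; `g` are the coins with which the parties generated their keys. -/
noncomputable def Instr.exec (E : BitCrypto) (l : ℕ) (g : Party → Bits (E.genCoins l)) :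
    Instr → State (Bits (E.ctLen l)) → PMF (State (Bits (E.ctLen l)))
  | .const P d v, st => PMF.pure (st.setVal P d v)
  | .sub P w d s t, st =>
      PMF.pure (st.setVal P d
        (((st.mem P s).val + 2 ^ w - (st.mem P t).val % 2 ^ w) % 2 ^ w))
  | .move P d s, st => PMF.pure (st.put P d (st.mem P s))
  | .load P d arr i, st =>
      PMF.pure (match arr[(st.mem P i).val]? with
        | some r => st.put P d (st.mem P r)
        | none => st)
  | .store P arr i s, st =>
      PMF.pure (match arr[(st.mem P i).val]? with
        | some r => st.put P r (st.mem P s)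
        | none => st)
  | .coin P d b, st =>
      (unif (Fin (b + 1))).map fun v => (st.setVal P d v).see P (natBits b.size v)
  | .enc P K w d s, st =>
      (unif (Fin w → Bits (E.encCoins l))).map fun r =>
        (st.setCt P d (List.ofFn fun j : Fin w =>
          E.enc l (E.genPk l (g K)) ((st.mem P s).val.testBit j) (r j))).see P (flat (List.ofFn r))
  | .dec P d s, st =>
      PMF.pure (st.setVal P d (ofBits ((st.mem P s).ct.map (E.dec l (E.genSk l (g P))))))
  | .hom P K o d s t, st =>
      PMF.pure (st.setCt P d
        (o.eval (E.xor l (E.genPk l (g K))) (E.and l (E.genPk l (g K)))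
          (st.mem P s).ct (st.mem P t).ct))
  | .mux P K d c s t, st =>
      PMF.pure (st.setCt P d
        (muxBits (E.xor l (E.genPk l (g K))) (E.and l (E.genPk l (g K)))
          (st.mem P c).ct (st.mem P s).ct (st.mem P t).ct))
  | .reenc P K d, st =>
      (unif (Fin (st.mem P d).ct.length → Bits (E.reCoins l))).map fun r =>
        (st.setCt P d (List.ofFn fun j =>
          E.reenc l (E.genPk l (g K)) ((st.mem P d).ct.get j) (r j))).see P (flat (List.ofFn r))
  | .sendCt P d s, st =>
      PMF.pure ((st.setCt P.other d (st.mem P s).ct).see P.other (flat (st.mem P s).ct))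
  | .sendVal P w d s, st =>
      PMF.pure ((st.setVal P.other d ((st.mem P s).val % 2 ^ w)).see P.other
        (natBits w (st.mem P s).val))

/-- Execution of a program. -/
noncomputable def runProgram (E : BitCrypto) (l : ℕ) (g : Party → Bits (E.genCoins l)) :
    Program → State (Bits (E.ctLen l)) → PMF (State (Bits (E.ctLen l)))
  | [], st => PMF.pure st
  | i :: is, st => (i.exec E l g st).bind (runProgram E l g is)

/-! ### Batcher's odd-even merge sort -/

/-- Comparators that merge the two sorted halves of the wires `lo + r * i`, `i < 2 ^ t`. -/
def oddEvenMerge : ℕ → ℕ → ℕ → List (ℕ × ℕ)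
  | 0, _, _ => []
  | 1, lo, r => [(lo, lo + r)]
  | t + 2, lo, r =>
      oddEvenMerge (t + 1) lo (2 * r) ++ oddEvenMerge (t + 1) (lo + r) (2 * r) ++
        (List.range (2 ^ (t + 1) - 1)).map fun i => (lo + r * (2 * i + 1), lo + r * (2 * i + 2))

/-- Comparators that sort the wires `lo + i`, `i < 2 ^ t`. -/
def oddEvenSort : ℕ → ℕ → List (ℕ × ℕ)
  | 0, _ => []
  | t + 1, lo => oddEvenSort t lo ++ oddEvenSort t (lo + 2 ^ t) ++ oddEvenMerge (t + 1) lo 1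

/-- Sorting network on `k` wires (the further wires up to a power of two are thought to carry
values that exceed all others). -/
def sortNetwork (k : ℕ) : List (ℕ × ℕ) :=
  (oddEvenSort (Nat.clog 2 k) 0).filter fun c => decide (c.2 < k)

/-! ### The improved secure CWC protocol -/

/-- The public sizes: the number `k` of features, and the numbers of positive and of negative data
of each party. -/
structure Sizes where
  k : ℕ
  npos : Party → ℕ
  nneg : Party → ℕ

namespace Sizes

variable (s : Sizes)

/-- number of positive data -/
def n : ℕ := s.npos .A + s.npos .B

/-- number of negative data -/
def m : ℕ := s.nneg .A + s.nneg .B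

/-- bit length of the integers: `k` and `n * m` are less than `2 ^ s.width` -/
def width : ℕ := (s.k + s.n * s.m).size

/-- index of the first positive datum of a party in the joint data -/
def posStart : Party → ℕ
  | .A => 0
  | .B => s.npos .A

/-- index of the first negative datum of a party in the joint data -/
def negStart : Party → ℕ
  | .A => 0
  | .B => s.nneg .A

end Sizes

def loop (n : ℕ) (body : ℕ → Program) : Program := (List.range n).flatMap body

namespace Protocol

open Party Reg Instr

variable (s : Sizes)

def fieldWidth : Field → ℕ
  | .bit _ => 1
  | _ => s.width

/-- The components of a tuple. -/
def fields : List Field := .name :: .weight :: (List.range (s.n * s.m)).map .bit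

/-- Do something for every component of every tuple. -/
def forItems (body : ℕ → Field → Program) : Program :=
  loop s.k fun i => (fields s).flatMap (body i)

/-- Preprocessing, first part. Both parties encrypt their data with the key of `B`, and `B` sends its
encrypted data to `A`. -/
def shareData : Program :=
  loop (s.npos A) (fun p => loop s.k fun i => [enc A B 1 (pos p i) (pos p i)]) ++
  loop (s.nneg A) (fun q => loop s.k fun i => [enc A B 1 (neg q i) (neg q i)]) ++
  loop (s.npos B) (fun p => loop s.k fun i =>
    [enc B B 1 (pos (s.posStart B + p) i) (pos (s.posStart B + p) i),
     sendCt B (pos (s.posStart B + p) i) (pos (s.posStart B + p) i)]) ++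
  loop (s.nneg B) (fun q => loop s.k fun i =>
    [enc B B 1 (neg (s.negStart B + q) i) (neg (s.negStart B + q) i),
     sendCt B (neg (s.negStart B + q) i) (neg (s.negStart B + q) i)])

/-- Preprocessing, second part. `A` computes the encrypted tuples (index, weight, bit string);
bit number `m * p + q` is `x_p(F_i) ⊕ y_q(F_i)`, and the weight is the sum of the bits. -/
def computeItems : Program :=
  loop s.k fun i =>
    [const A (tmp 0) i, enc A B s.width (item i .name) (tmp 0),
     const A (tmp 0) 0, enc A B s.width (item i .weight) (tmp 0)] ++
    loop s.n fun p => loop s.m fun q =>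
      [hom A B .xor (item i (.bit (s.m * p + q))) (pos p i) (neg q i),
       hom A B .add (item i .weight) (item i .weight) (item i (.bit (s.m * p + q)))]

/-- Mix network, first message: for every component `x` of every tuple, `A` draws a random `r` and
sends `E_B[x + r]` and `E_A[r]`. -/
def mixSend : Program :=
  forItems s fun i f =>
    [coin A (mask i f) (2 ^ fieldWidth s f - 1),
     enc A A (fieldWidth s f) (mask i f) (mask i f),
     enc A B (fieldWidth s f) (tmp 0) (mask i f),
     hom A B .add (tmp 0) (item i f) (tmp 0),
     reenc A B (tmp 0),
     sendCt A (item i f) (tmp 0),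
     sendCt A (mask i f) (mask i f)]

/-- `B` draws a uniformly random permutation (Fisher and Yates). -/
def drawPerm : Program :=
  loop s.k (fun i => [const B (perm i) i]) ++
  (List.range s.k).reverse.flatMap fun i =>
    [coin B (tmp 0) i,
     load B (tmp 1) ((List.range s.k).map perm) (tmp 0),
     move B (tmp 2) (perm i),
     move B (perm i) (tmp 1),
     store B ((List.range s.k).map perm) (tmp 0) (tmp 2)]

/-- Mix network, second message: `B` draws a random `r'` for every component, computes re-encrypted
`E_B[x + r + r']` and `E_A[r + r']`, and sends the tuples in permuted order. -/
def mixReply : Program :=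
  forItems s (fun i f =>
    [coin B (noise i f) (2 ^ fieldWidth s f - 1),
     enc B B (fieldWidth s f) (tmp 0) (noise i f),
     hom B B .add (item i f) (item i f) (tmp 0),
     reenc B B (item i f),
     enc B A (fieldWidth s f) (tmp 0) (noise i f),
     hom B A .add (mask i f) (mask i f) (tmp 0),
     reenc B A (mask i f)]) ++
  forItems s fun j f =>
    [load B (tmp 0) ((List.range s.k).map fun i => item i f) (perm j),
     sendCt B (item j f) (tmp 0),
     load B (tmp 0) ((List.range s.k).map fun i => mask i f) (perm j),
     sendCt B (mask j f) (tmp 0)]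

/-- Mix network, end: `A` removes the masks. -/
def mixEnd : Program :=
  const A (tmp 1) 0 ::
  forItems s fun j f =>
    [dec A (mask j f) (mask j f),
     sub A (fieldWidth s f) (tmp 0) (tmp 1) (mask j f),
     enc A B (fieldWidth s f) (tmp 0) (tmp 0),
     hom A B .add (item j f) (item j f) (tmp 0)]

/-- `A` compares two encrypted pairs (index, weight) by weight, then by index, and exchanges
them, together with their labels, if they are in the wrong order. -/
def compareExchange (a b : ℕ) : Program :=
  [hom A B .lt (tmp 0) (key b) (key a),
   mux A B (tmp 1) (tmp 0) (key b) (key a),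
   mux A B (key b) (tmp 0) (key a) (key b),
   move A (key a) (tmp 1),
   mux A B (tmp 1) (tmp 0) (label b) (label a),
   mux A B (label b) (tmp 0) (label a) (label b),
   move A (label a) (tmp 1)]

/-- `A` sorts the encrypted pairs (index, weight). The label of a pair is the position of the tuple
in the shuffled list, that is, the new name of the feature. -/
def sortItems : Program :=
  loop s.k (fun j =>
    [hom A B .cat (key j) (item j .name) (item j .weight),
     const A (tmp 0) j, enc A B s.width (label j) (tmp 0)]) ++
  (sortNetwork s.k).flatMap fun c => compareExchange c.1 c.2

/-- `A` sends the sorted new names with random noise; `B` decrypts and returns them; `A` removes the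
noise. -/
def openRanks : Program :=
  loop s.k (fun j =>
    [coin A (Reg.pad j) (2 ^ s.width - 1),
     enc A B s.width (tmp 0) (Reg.pad j),
     hom A B .add (tmp 0) (label j) (tmp 0),
     reenc A B (tmp 0),
     sendCt A (masked j) (tmp 0)]) ++
  loop s.k (fun j =>
    [dec B (masked j) (masked j), sendVal B s.width (masked j) (masked j)]) ++
  loop s.k fun j => [sub A s.width (rank j) (masked j) (Reg.pad j)]

/-- `A` moves each bit string to its correct position. -/
def moveStrings : Program :=
  loop s.k fun j => loop (s.n * s.m) fun h =>
    [load A (srt j h) ((List.range s.k).map fun i => item i (.bit h)) (rank j)]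

/-- `A` executes CWC on the sorted encrypted bit strings. `z i h` is the disjunction of the bits
number `h` of the strings `i, …, k-1`; `cum h` is the disjunction of the bits number `h` of the
selected strings; string `i` is selected iff not all `z (i+1) h ∨ cum h` are `1`. -/
def selectFeatures : Program :=
  [const A (tmp 0) 0, enc A B 1 (tmp 0) (tmp 0), const A (tmp 1) 1, enc A B 1 (tmp 1) (tmp 1)] ++
  loop (s.n * s.m) (fun h => [move A (z s.k h) (tmp 0), move A (cum h) (tmp 0)]) ++
  ((List.range s.k).reverse.flatMap fun i =>
    loop (s.n * s.m) fun h => [hom A B .or (z i h) (z (i + 1) h) (srt i h)]) ++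
  loop s.k fun i =>
    move A (keep i) (tmp 1) ::
    loop (s.n * s.m) (fun h =>
      [hom A B .or (tmp 2) (z (i + 1) h) (cum h), hom A B .and (keep i) (keep i) (tmp 2)]) ++
    [hom A B .xor (keep i) (keep i) (tmp 1)] ++
    loop (s.n * s.m) fun h =>
      [hom A B .and (tmp 2) (keep i) (srt i h), hom A B .or (cum h) (cum h) (tmp 2)]

/-- `A` sends the encrypted selection bits of the renamed features; `B` decrypts them, undoes the
renaming and shares the result with `A`. -/
def openResult : Program :=
  loop s.k (fun j => [store A ((List.range s.k).map sel) (rank j) (keep j)]) ++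
  loop s.k (fun j => [reenc A B (sel j), sendCt A (sel j) (sel j)]) ++
  loop s.k (fun j =>
    [dec B (sel j) (sel j), store B ((List.range s.k).map out) (perm j) (sel j)]) ++
  loop s.k fun i => [sendVal B 1 (out i) (out i)]

end Protocol

open Protocol in
/-- The improved secure CWC protocol. -/
def improvedCWC (s : Sizes) : Program :=
  shareData s ++ computeItems s ++
  mixSend s ++ drawPerm s ++ mixReply s ++ mixEnd s ++
  sortItems s ++ openRanks s ++ moveStrings s ++
  selectFeatures s ++ openResult s

/-! ### Inputs, executions, and security against semi-honest parties -/

/-- The private data of a party: the feature values of its positive and of its negative data. -/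
structure PrivateData (k npos nneg : ℕ) where
  pos : Fin npos → Fin k → Bool
  neg : Fin nneg → Fin k → Bool

/-- All bits of the private data of a party. -/
def PrivateData.bits {k npos nneg : ℕ} (d : PrivateData k npos nneg) : List Bool :=
  (List.ofFn d.pos ++ List.ofFn d.neg).flatMap List.ofFn

/-- The inputs of both parties. -/
abbrev Inputs (s : Sizes) : Type := ∀ P : Party, PrivateData s.k (s.npos P) (s.nneg P)

/-- The output that both parties shall learn: the result of CWC on the joint data. -/
def result {s : Sizes} (d : Inputs s) : Finset (Fin s.k) :=
  cwc (List.ofFn (d .A).pos ++ List.ofFn (d .B).pos) (List.ofFn (d .A).neg ++ List.ofFn (d .B).neg)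

/-- The output as a string of `k` bits. -/
def resultBits {s : Sizes} (d : Inputs s) : List Bool :=
  List.ofFn fun i : Fin s.k => decide (i ∈ result d)

/-- Feature `i` of datum number `p`, where the data are numbered from `start` on. -/
def rowEntry {k n : ℕ} (rows : Fin n → Fin k → Bool) (start p i : ℕ) : ℕ :=
  if h : start ≤ p ∧ p - start < n ∧ i < k then (rows ⟨p - start, h.2.1⟩ ⟨i, h.2.2⟩).toNat else 0

/-- At the beginning, the memory of a party holds its private data, and its view consists of these
data, the coins of its key generation, and the public key of the other party. -/
def initState (E : BitCrypto) (l : ℕ) (s : Sizes) (d : Inputs s)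
    (g : Party → Bits (E.genCoins l)) : State (Bits (E.ctLen l)) where
  mem P r :=
    match r with
    | .pos p i => ⟨rowEntry (d P).pos (s.posStart P) p i, []⟩
    | .neg q i => ⟨rowEntry (d P).neg (s.negStart P) q i, []⟩
    | _ => ⟨0, []⟩
  view P := (d P).bits ++ List.ofFn (g P) ++ List.ofFn (E.genPk l (g P.other))

/-- A complete execution: the parties generate their keys independently and run the protocol. -/
noncomputable def execution (E : BitCrypto) (l : ℕ) (s : Sizes) (d : Inputs s) :
    PMF (State (Bits (E.ctLen l))) :=
  (unif (Bits (E.genCoins l))).bind fun gA => (unif (Bits (E.genCoins l))).bind fun gB =>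
    let g : Party → Bits (E.genCoins l) := fun P => match P with
      | .A => gA
      | .B => gB
    runProgram E l g (improvedCWC s) (initState E l s d g)

/-- Both parties end with the result of CWC in their output registers, in every execution. -/
def Simulates (E : BitCrypto) : Prop :=
  ∀ (l : ℕ) (s : Sizes) (d : Inputs s), ∀ st ∈ (execution E l s d).support,
    ∀ (P : Party) (i : Fin s.k), (st.mem P (.out i)).val = if i ∈ result d then 1 else 0

/-- The view of a party in an execution. -/
noncomputable def viewOf (E : BitCrypto) (l : ℕ) (s : Sizes) (d : Inputs s) (P : Party) :
    PMF (List Bool) :=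
  (execution E l s d).map fun st => st.view P

/-- Coins of a probabilistic machine: independent uniform integers in `{0, …, b}` for the
elements `b` of the list `bs`, written in binary. -/
noncomputable def coinBits : List ℕ → PMF (List Bool)
  | [] => PMF.pure []
  | b :: bs => (unif (Fin (b + 1))).bind fun v =>
      (coinBits bs).map fun r => natBits b.size v ++ r

/-- A family of probabilistic circuits. -/
structure ProbCircuits where
  /-- which coins are drawn -/
  coins : ℕ → List ℕ
  /-- number of output bits -/
  outLen : ℕ → ℕ
  /-- output bits as a function of the input followed by the coins -/
  fn : ∀ l, (ℕ → Bool) → Fin (outLen l) → Bool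

namespace ProbCircuits

variable (S : ProbCircuits)

/-- The random output on an input. -/
noncomputable def run (l : ℕ) (x : List Bool) : PMF (List Bool) :=
  (coinBits (S.coins l)).map fun r => List.ofFn (S.fn l (pad (x ++ r)))

/-- Polynomial size. -/
def Efficient : Prop :=
  PolyBounded (fun l => ((S.coins l).map fun b => b.size + 1).sum) ∧ PolyBounded S.outLen ∧
    PolySize S.fn

end ProbCircuits

/-- Privacy against semi-honest parties: for sizes of polynomial growth, the view of each party can
be simulated efficiently from its own data and the result of CWC alone (the sizes are public). -/
def IsPrivate (E : BitCrypto) : Prop :=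
  ∀ s : ℕ → Sizes,
    PolyBounded (fun l => (s l).k) →
    (∀ P, PolyBounded (fun l => (s l).npos P)) → (∀ P, PolyBounded (fun l => (s l).nneg P)) →
    ∀ P : Party, ∃ S : ProbCircuits, S.Efficient ∧
      ∀ d : ∀ l, Inputs (s l),
        CompIndist (fun l => viewOf E l (s l) (d l) P)
          (fun l => S.run l ((d l P).bits ++ resultBits (d l)))

end SecureCWC

/-! Correctness and privacy both rest on a plaintext machine (`lstep`, `lrun`). It executes the same
program on plaintext bits. Each bit remembers under whose key it would be encrypted and, if it was
just encrypted or re-encrypted by the party whose view is not recorded, a symbol for the ciphertext.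
All integer operations are composed of two gates and `IsCt` is closed under these gates, so an
execution and a run of the machine stay in correspondence (`Rel.step`); the correctness of the
cryptosystem is needed only at decryptions.

For correctness it therefore suffices to run the machine with given coins, phase by phase
(`protocol_exec`). The mathematics of the phases is as follows. The shuffle of Fisher and Yates
yields a permutation. Masks cancel modulo powers of two. Batcher's network sorts, by the 0-1
principle (`merge_sorts`, `sortNetwork_sorts`). The sort keys are distinct, so the result is the
stable order used by CWC (`sortedFeatures_eq`). A string is selected iff some position is covered
neither by later strings nor by the selected earlier ones, which is the consistency test of CWC
(`mem_cwc`).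

Privacy is a hybrid argument followed by an exact identity. Re-encryptions by the other party are
replaced by fresh encryptions (`near_real_lrun`). Then plaintexts under the other party's key are
replaced by `0` (`near_lrun_hide`), which is possible because the run of the machine involves no
keys. Both replacements cost at most (length of the program) × (number of bits) × (a negligible
number). This number must not depend on the part of the view that is hard-wired into the attack;
`exists_negligible_bound` provides that.

What is left of the view are the party's own coins, the output, and some masked values. For `A`
these are the sums of masks and the sorted new names. For `B` they are the masked components and the
masked ranks, together with the selection bits in an order that `B` itself has drawn. A bijection of
the coins, depending on the data, turns this view into one that does not mention the data
(`expect_lrun_ideal`): masks are translated modulo `2 ^ w`, and for `A` the secret permutation is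
exchanged for the permutation of sorted names. The latter is injective, since for fixed data the
sorted names determine the shuffle (`perm_eq_of_sortedName_eq`). The simulator samples the resulting
view. Its circuits may distinguish all values of a mask, because `2 ^ width` is polynomial in the
sizes (`exists_simulator`).

The complexity bounds count instructions and registers. Everything except the sorting network is
linear in `k * n * m`; the network has at most a constant times `k log² k` comparators. -/

open Filter

namespace SecureCWC

/-! ### Expectations, and closeness of numbers in `[0, ∞]` -/

/-- The expectation of a non-negative function. -/
noncomputable def expect {α : Type} (p : PMF α) (f : α → ENNReal) : ENNReal := ∑' x, p x * f x

theorem expect_pure {α : Type} (a : α) (f : α → ENNReal) : expect (PMF.pure a) f = f a := by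
  unfold expect
  rw [tsum_eq_single a]
  · simp
  · intro b hb; simp [hb]

theorem expect_bind {α β : Type} (p : PMF α) (q : α → PMF β) (f : β → ENNReal) :
    expect (p.bind q) f = expect p fun x => expect (q x) f := by
  unfold expect
  simp only [PMF.bind_apply, ← ENNReal.tsum_mul_right, ← ENNReal.tsum_mul_left]
  rw [ENNReal.tsum_comm]
  simp only [mul_assoc]

theorem expect_map {α β : Type} (p : PMF α) (h : α → β) (f : β → ENNReal) :
    expect (p.map h) f = expect p fun x => f (h x) := by
  rw [← PMF.bind_pure_comp, expect_bind]
  simp [expect_pure]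

/-- Tonelli's theorem: in `[0, ∞]` no summability is needed, so independent draws may be made in any
order. The hybrid arguments thereby isolate the draw that is to be exchanged. -/
theorem expect_comm {α β : Type} (p : PMF α) (q : PMF β) (f : α → β → ENNReal) :
    (expect p fun x => expect q fun y => f x y) = expect q fun y => expect p fun x => f x y := by
  unfold expect
  simp only [← ENNReal.tsum_mul_left]
  rw [ENNReal.tsum_comm]
  simp only [mul_left_comm]

theorem expect_const {α : Type} (p : PMF α) (c : ENNReal) : (expect p fun _ => c) = c := by
  unfold expect
  rw [ENNReal.tsum_mul_right, p.tsum_coe, one_mul]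

theorem expect_add {α : Type} (p : PMF α) (f g : α → ENNReal) :
    (expect p fun x => f x + g x) = expect p f + expect p g := by
  unfold expect
  simp only [mul_add, ENNReal.tsum_add]

theorem expect_mono {α : Type} (p : PMF α) {f g : α → ENNReal} (h : ∀ x ∈ p.support, f x ≤ g x) :
    expect p f ≤ expect p g := by
  unfold expect
  refine ENNReal.tsum_le_tsum fun x => ?_
  by_cases hx : x ∈ p.support
  · exact mul_le_mul_right (h x hx) _
  · rw [PMF.mem_support_iff, not_not] at hx; simp [hx]

theorem expect_congr {α : Type} (p : PMF α) {f g : α → ENNReal} (h : ∀ x ∈ p.support, f x = g x) :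
    expect p f = expect p g :=
  le_antisymm (expect_mono p fun x hx => (h x hx).le) (expect_mono p fun x hx => (h x hx).ge)

/-- `a` and `b` differ by at most `ε`. -/
def Near (a b ε : ENNReal) : Prop := a ≤ b + ε ∧ b ≤ a + ε

theorem Near.of_eq {a b : ENNReal} (h : a = b) (ε : ENNReal) : Near a b ε := by
  subst h; exact ⟨le_self_add, le_self_add⟩

theorem Near.trans {a b c ε δ : ENNReal} (h : Near a b ε) (h' : Near b c δ) :
    Near a c (ε + δ) := by
  constructor
  · calc a ≤ b + ε := h.1
      _ ≤ (c + δ) + ε := by gcongr; exact h'.1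
      _ = c + (ε + δ) := by ring
  · calc c ≤ b + δ := h'.2
      _ ≤ (a + ε) + δ := by gcongr; exact h.2
      _ = a + (ε + δ) := by ring

theorem Near.mono {a b ε δ : ENNReal} (h : Near a b ε) (hd : ε ≤ δ) : Near a b δ :=
  ⟨h.1.trans (by gcongr), h.2.trans (by gcongr)⟩

/-- Averaging keeps the error because the masses add up to one. Only the support counts, so facts
that hold for all possible coins may be used in the comparison. -/
theorem Near.expect {α : Type} (p : PMF α) {f g : α → ENNReal} {ε : ENNReal}
    (h : ∀ x ∈ p.support, Near (f x) (g x) ε) : Near (expect p f) (expect p g) ε := by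
  constructor
  · rw [← expect_const p ε, ← expect_add]
    exact expect_mono p fun x hx => (h x hx).1
  · rw [← expect_const p ε, ← expect_add]
    exact expect_mono p fun x hx => (h x hx).2

/-- The indicator of a bit. -/
noncomputable def ind (b : Bool) : ENNReal := if b then 1 else 0

theorem prTrue_map {α : Type} (p : PMF α) (h : α → Bool) :
    prTrue (p.map h) = (expect p fun x => ind (h x)).toReal := by
  unfold prTrue expect ind
  rw [PMF.map_apply]
  congr 1
  refine tsum_congr fun x => ?_
  cases hx : h x <;> simp [hx]

theorem expect_ind_le {α : Type} (p : PMF α) (h : α → Bool) :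
    (expect p fun x => ind (h x)) ≤ 1 := by
  calc (expect p fun x => ind (h x)) ≤ expect p fun _ => 1 := expect_mono p fun x _ => by
        unfold ind; split <;> simp
    _ = 1 := expect_const p 1

/-- The bounds by one exclude `⊤`, which `toReal` would send to zero. Together with
`near_of_abs_sub_le` this translates between real-valued advantages and the errors of the hybrid
arguments. -/
theorem abs_sub_le_of_near {a b : ENNReal} {ε : ℝ} (ha : a ≤ 1) (hb : b ≤ 1) (hε : 0 ≤ ε)
    (h : Near a b (ENNReal.ofReal ε)) : |a.toReal - b.toReal| ≤ ε := by
  have ha' : a ≠ ⊤ := (ha.trans_lt ENNReal.one_lt_top).ne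
  have hb' : b ≠ ⊤ := (hb.trans_lt ENNReal.one_lt_top).ne
  have h1 := ENNReal.toReal_mono (by simp [hb']) h.1
  have h2 := ENNReal.toReal_mono (by simp [ha']) h.2
  rw [ENNReal.toReal_add hb' (by simp), ENNReal.toReal_ofReal hε] at h1
  rw [ENNReal.toReal_add ha' (by simp), ENNReal.toReal_ofReal hε] at h2
  rw [abs_le]; constructor <;> linarith

theorem near_of_abs_sub_le {a b : ENNReal} {ε : ℝ} (ha : a ≤ 1) (hb : b ≤ 1)
    (h : |a.toReal - b.toReal| ≤ ε) : Near a b (ENNReal.ofReal ε) := by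
  have ha' : a ≠ ⊤ := (ha.trans_lt ENNReal.one_lt_top).ne
  have hb' : b ≠ ⊤ := (hb.trans_lt ENNReal.one_lt_top).ne
  have hε : 0 ≤ ε := (abs_nonneg _).trans h
  rw [abs_le] at h
  constructor
  · rw [← ENNReal.ofReal_toReal ha', ← ENNReal.ofReal_toReal hb', ← ENNReal.ofReal_add (by simp) hε]
    exact ENNReal.ofReal_le_ofReal (by linarith)
  · rw [← ENNReal.ofReal_toReal ha', ← ENNReal.ofReal_toReal hb', ← ENNReal.ofReal_add (by simp) hε]
    exact ENNReal.ofReal_le_ofReal (by linarith)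

/-! ### Uniform distributions -/

theorem unif_map_equiv {α β : Type} [Fintype α] [Nonempty α] [Fintype β] [Nonempty β] (e : α ≃ β) :
    (unif α).map e = unif β := by
  ext b
  rw [PMF.map_apply, tsum_eq_single (e.symm b)]
  · simp [PMF.uniformOfFintype_apply, Fintype.card_congr e]
  · intro a ha
    rw [if_neg]
    rintro rfl; simp at ha

theorem unif_prod {α β : Type} [Fintype α] [Nonempty α] [Fintype β] [Nonempty β] :
    unif (α × β) = (unif α).bind fun a => (unif β).map fun b => (a, b) := by
  ext ⟨a, b⟩
  rw [PMF.bind_apply, tsum_eq_single a]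
  · rw [PMF.map_apply, tsum_eq_single b]
    · simp [PMF.uniformOfFintype_apply, ENNReal.mul_inv]
    · intro b' hb'; rw [if_neg]; simpa using fun h => hb' h.symm
  · intro a' ha'
    rw [PMF.map_apply]
    simp [Ne.symm ha']

theorem expect_unif_prod {α β : Type} [Fintype α] [Nonempty α] [Fintype β] [Nonempty β]
    (f : α × β → ENNReal) :
    expect (unif (α × β)) f = expect (unif α) fun a => expect (unif β) fun b => f (a, b) := by
  rw [unif_prod, expect_bind]; simp only [expect_map]

theorem expect_unif_equiv {α β : Type} [Fintype α] [Nonempty α] [Fintype β] [Nonempty β]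
    (e : α ≃ β) (f : β → ENNReal) :
    expect (unif β) f = expect (unif α) fun a => f (e a) := by
  rw [← unif_map_equiv e, expect_map]

/-- The coordinates of a uniformly random function in the range of an injection are uniform. -/
theorem unif_map_comp_injective {ι κ R : Type} [Fintype ι] [DecidableEq ι] [Fintype κ]
    [DecidableEq κ] [Fintype R] [Nonempty R] (e : ι → κ) (he : Function.Injective e) :
    (unif (κ → R)).map (fun f => f ∘ e) = unif (ι → R) := by
  classical
  -- The coordinates in the range of `e` are separated from the others, which are then integrated
  -- out.
  let eq1 : (κ → R) ≃ ({x // x ∈ Set.range e} → R) × ({x // ¬ x ∈ Set.range e} → R) :=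
    Equiv.piEquivPiSubtypeProd (fun x => x ∈ Set.range e) fun _ => R
  let eq2 : ({x // x ∈ Set.range e} → R) ≃ (ι → R) :=
    Equiv.arrowCongr (Equiv.ofInjective e he).symm (Equiv.refl R)
  have h : (fun f : κ → R => f ∘ e) = fun f => eq2 (eq1 f).1 := by
    funext f i
    simp [eq2, eq1, Equiv.arrowCongr, Equiv.piEquivPiSubtypeProd]
  rw [h]
  change (unif (κ → R)).map ((fun x : (_ × _) => eq2 x.1) ∘ eq1) = _
  rw [← PMF.map_comp, unif_map_equiv eq1, unif_prod, PMF.map_bind]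
  simp only [PMF.map_comp]
  have : ∀ a : {x // x ∈ Set.range e} → R,
      PMF.map ((fun x : ({x // x ∈ Set.range e} → R) × ({x // ¬ x ∈ Set.range e} → R) => eq2 x.1) ∘
        fun b => (a, b)) (unif ({x // ¬ x ∈ Set.range e} → R)) = PMF.pure (eq2 a) := by
    intro a
    exact PMF.map_const (unif ({x // ¬ x ∈ Set.range e} → R)) (eq2 a)
  simp only [this]
  change (unif _).bind (PMF.pure ∘ eq2) = _
  rw [PMF.bind_pure_comp, unif_map_equiv]

theorem expect_unif_comp {ι κ R : Type} [Fintype ι] [DecidableEq ι] [Fintype κ]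
    [DecidableEq κ] [Fintype R] [Nonempty R] (e : ι → κ) (he : Function.Injective e)
    (F : (ι → R) → ENNReal) :
    (expect (unif (κ → R)) fun f => F (f ∘ e)) = expect (unif (ι → R)) F := by
  rw [← unif_map_comp_injective e he, expect_map]

/-- A coordinate of a uniformly random dependent function can be drawn separately. -/
theorem expect_unif_pi_split {κ : Type} {R : κ → Type} [Fintype κ] [DecidableEq κ]
    [∀ x, Fintype (R x)] [∀ x, Nonempty (R x)] (x : κ) (H : R x → (∀ x, R x) → ENNReal)
    (hH : ∀ y f z, H y (Function.update f x z) = H y f) :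
    (expect (unif (∀ x, R x)) fun f => H (f x) f) =
      expect (unif (R x)) fun y => expect (unif (∀ x, R x)) fun f => H y f := by
  classical
  -- A function is its value at `x` together with its restriction to the other indices. By `hH` the
  -- value at `x` of the second argument of `H` is irrelevant, so one draw can be replaced by two
  -- independent ones.
  let e := Equiv.piSplitAt x R
  have h0 : ∀ y f z, H y (e.symm (z, f)) = H y (e.symm (y, f)) := by
    intro y f z
    rw [← hH y (e.symm (y, f)) z]
    congr 1
    funext j
    by_cases hj : j = x
    · subst hj; simp [e, Equiv.piSplitAt]
    · simp [e, Equiv.piSplitAt, hj]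
  rw [expect_unif_equiv e.symm, expect_unif_prod]
  refine expect_congr _ fun y _ => ?_
  rw [expect_unif_equiv e.symm, expect_unif_prod]
  simp only [h0 y]
  rw [expect_const]
  refine expect_congr _ fun f _ => ?_
  congr 1
  simp [e, Equiv.piSplitAt]

/-- Replace independent random components one by one. -/
theorem near_vector {α β C : Type} [Fintype α] [Nonempty α] [Fintype β] [Nonempty β]
    (f : ℕ → α → C) (h : ℕ → β → C) (Y : (ℕ → C) → ENNReal) (ε : ENNReal) (n : ℕ)
    (H : ∀ t < n, ∀ g : ℕ → C, Near (expect (unif α) fun r => Y (Function.update g t (f t r)))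
      (expect (unif β) fun r => Y (Function.update g t (h t r))) ε) (g : ℕ → C) :
    Near (expect (unif (Fin n → α)) fun r => Y fun t => if ht : t < n then f t (r ⟨t, ht⟩) else g t)
      (expect (unif (Fin n → β)) fun r => Y fun t => if ht : t < n then h t (r ⟨t, ht⟩) else g t)
      (n * ε) := by
  induction n generalizing g with
  | zero => simpa [expect_const] using Near.of_eq rfl 0
  | succ n ih =>
    -- The last component is drawn separately and written into the default function, so that the
    -- induction hypothesis applies to the first `n` components.
    have key : ∀ {γ : Type} [Fintype γ] [Nonempty γ] (f : ℕ → γ → C),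
        (expect (unif (Fin (n + 1) → γ)) fun r =>
          Y fun t => if ht : t < n + 1 then f t (r ⟨t, ht⟩) else g t) =
        expect (unif γ) fun x => expect (unif (Fin n → γ)) fun r => Y fun t =>
          if ht : t < n then f t (r ⟨t, ht⟩) else Function.update g n (f n x) t := by
      intro γ _ _ f
      rw [expect_unif_equiv (Fin.snocEquiv fun _ => γ), expect_unif_prod]
      refine expect_congr _ fun x _ => expect_congr _ fun r _ => ?_
      congr 1
      funext t
      rcases lt_trichotomy t n with ht | ht | ht
      · have h' : t < n + 1 := by omega
        simp only [ht, h', dif_pos, Fin.snocEquiv, Equiv.coe_fn_mk]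
        congr 1
        exact Fin.snoc_castSucc (α := fun _ => γ) x r ⟨t, ht⟩
      · subst ht
        simp only [lt_add_one, dif_pos, lt_irrefl, dif_neg, not_false_eq_true, Function.update_self,
          Fin.snocEquiv, Equiv.coe_fn_mk]
        congr 1
        exact Fin.snoc_last (α := fun _ => γ) x r
      · have h1 : ¬ t < n := by omega
        have h2 : ¬ t < n + 1 := by omega
        simp [h1, h2, ht.ne']
    rw [key f, key h]
    -- The first `n` components are exchanged while the last one still comes from `f n`, at the cost
    -- `n * ε`; exchanging the last one costs another `ε`.
    have step1 := Near.expect (unif α) (fun x _ => ih (fun t ht => H t (by omega))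
      (Function.update g n (f n x)))
    refine (step1.trans ?_).mono (le_of_eq (show _ = ((n : ENNReal) * ε + ε) by push_cast; ring).symm)
    rw [expect_comm, expect_comm (unif β)]
    refine Near.expect _ fun r _ => ?_
    have : ∀ z, (fun t => if ht : t < n then h t (r ⟨t, ht⟩) else Function.update g n z t) =
        Function.update (fun t => if ht : t < n then h t (r ⟨t, ht⟩) else g t) n z := by
      intro z; funext t
      by_cases ht : t = n
      · subst ht; simp
      · simp [ht]
    simp only [this]
    exact H n (by omega) _

/-! ### Negligible functions -/

theorem negligible_of_abs_le {a b : ℕ → ℝ} (hb : Negligible b) (h : ∀ l, |a l| ≤ b l) :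
    Negligible a :=
  Asymptotics.SuperpolynomialDecay.trans_eventually_abs_le hb
    (Eventually.of_forall fun l => (h l).trans (le_abs_self _))

theorem negligible_poly_mul {a : ℕ → ℝ} (ha : Negligible a) {N : ℕ → ℕ} (hN : PolyBounded N) :
    Negligible fun l => N l * |a l| := by
  obtain ⟨p, hp⟩ := hN
  have h1 : Negligible fun l => |a l| := 
    Asymptotics.SuperpolynomialDecay.trans_eventually_abs_le ha (Eventually.of_forall fun l => by simp)
  have h2 := Asymptotics.SuperpolynomialDecay.polynomial_mul h1 (p.map (Nat.castRingHom ℝ))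
  refine negligible_of_abs_le h2 fun l => ?_
  rw [abs_mul, abs_abs, Nat.abs_cast]
  have : (Polynomial.eval (l : ℝ) (p.map (Nat.castRingHom ℝ))) = (p.eval l : ℕ) := by
    rw [← Nat.coe_castRingHom, Polynomial.eval_map, Polynomial.eval₂_at_apply]
  rw [this]
  have := hp l
  gcongr

theorem negligible_add {a b : ℕ → ℝ} (ha : Negligible a) (hb : Negligible b) :
    Negligible fun l => a l + b l := Asymptotics.SuperpolynomialDecay.add ha hb

/-- For each value of the security parameter there is an attack which is at least half as good as
every other one. -/
theorem exists_negligible_bound {X : ℕ → Type} (Q : ∀ l, X l → Prop)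
    (val : ∀ l, X l → ℝ) (h0 : ∀ l, ∃ x, Q l x) (h1 : ∀ l x, val l x ≤ 1) (hpos : ∀ l x, 0 ≤ val l x)
    (h : ∀ x : ∀ l, X l, (∀ l, Q l (x l)) → Negligible fun l => val l (x l)) :
    ∃ ε : ℕ → ℝ, Negligible ε ∧ ∀ l x, Q l x → val l x ≤ ε l := by
  have : ∀ l, ∃ x, Q l x ∧ ∀ y, Q l y → val l y ≤ 2 * val l x := by
    intro l
    by_contra hc
    push Not at hc
    obtain ⟨x0, hx0⟩ := h0 l
    have hb : BddAbove (val l '' {x | Q l x}) := ⟨1, by rintro _ ⟨x, -, rfl⟩; exact h1 l x⟩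
    have hle : ∀ x, Q l x → val l x ≤ sSup (val l '' {x | Q l x}) := fun x hx => le_csSup hb ⟨x, hx, rfl⟩
    obtain ⟨y, hy, hxy⟩ := hc x0 hx0
    have hS : 0 < sSup (val l '' {x | Q l x}) := by
      have := hle y hy
      have := hpos l x0
      linarith
    -- An attack above half of the supremum is, by `hc`, less than half as good as another one,
    -- which then lies above the supremum.
    obtain ⟨_, ⟨x, hx, rfl⟩, hlt⟩ := exists_lt_of_lt_csSup (⟨_, x0, hx0, rfl⟩ : (val l '' {x | Q l x}).Nonempty)
      (half_lt_self hS)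
    obtain ⟨z, hz, hxz⟩ := hc x hx
    have := hle z hz
    linarith
  choose x hx hmax using this
  have hn := h x hx
  exact ⟨fun l => val l (x l) + val l (x l), negligible_add hn hn, fun l y hy => by
    have := hmax l y hy
    linarith⟩

/-! ### Polynomial bounds -/

namespace PolyBounded

theorem mono {a b : ℕ → ℕ} (hb : PolyBounded b) (h : ∀ l, a l ≤ b l) : PolyBounded a := by
  obtain ⟨p, hp⟩ := hb
  exact ⟨p, fun l => (h l).trans (hp l)⟩

theorem const (c : ℕ) : PolyBounded fun _ => c := ⟨Polynomial.C c, fun l => by simp⟩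

theorem add {a b : ℕ → ℕ} (ha : PolyBounded a) (hb : PolyBounded b) :
    PolyBounded fun l => a l + b l := by
  obtain ⟨p, hp⟩ := ha
  obtain ⟨q, hq⟩ := hb
  exact ⟨p + q, fun l => by simpa using add_le_add (hp l) (hq l)⟩

theorem mul {a b : ℕ → ℕ} (ha : PolyBounded a) (hb : PolyBounded b) :
    PolyBounded fun l => a l * b l := by
  obtain ⟨p, hp⟩ := ha
  obtain ⟨q, hq⟩ := hb
  exact ⟨p * q, fun l => by simpa using Nat.mul_le_mul (hp l) (hq l)⟩

end PolyBounded

/-! ### Coins of probabilistic circuits -/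

/-- The coins as a function of independent uniform integers. -/
theorem coinBits_ofFn (n : ℕ) (b : Fin n → ℕ) :
    coinBits (List.ofFn b) =
      (unif (∀ q : Fin n, Fin (b q + 1))).map fun v =>
        (List.ofFn fun q => natBits (b q).size (v q)).flatten := by
  induction n with
  | zero =>
    simp only [List.ofFn_zero, coinBits, List.flatten_nil]
    exact (PMF.map_const _ _).symm
  | succ n ih =>
    rw [List.ofFn_succ, coinBits, ← unif_map_equiv (Fin.consEquiv fun q : Fin (n+1) => Fin (b q + 1)),
      unif_prod, PMF.map_comp, PMF.map_bind]
    congr 1; funext x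
    rw [ih, PMF.map_comp, PMF.map_comp]
    congr 1
    funext v
    simp [Function.comp_def, List.ofFn_succ, Fin.consEquiv]

section

/-! ### Circuits -/

variable {ι : Type}

/-- Wires are functions, and a gate refers to its operands by membership only. Hence the wires on
top survive when the lower ones are replaced by any circuit that contains them. -/
theorem StraightLine.weaken {L₁ L₀ M : List ((ι → Bool) → Bool)} (h : StraightLine (L₁ ++ L₀))
    (hM : StraightLine M) (hs : ∀ f ∈ L₀, f ∈ M) : StraightLine (L₁ ++ M) := by
  induction L₁ with
  | nil => exact hM
  | cons f L₁ ih =>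
    have hsub : ∀ g ∈ L₁ ++ L₀, g ∈ L₁ ++ M := by
      intro g hg
      rw [List.mem_append] at hg ⊢
      exact hg.imp_right (hs g)
    simp only [List.cons_append] at h ⊢
    cases h with
    | input i h => exact .input i (ih h)
    | const b h => exact .const b (ih h)
    | nand hf hg h => exact .nand (hsub _ hf) (hsub _ hg) (ih h)

/-- `f` needs at most `s` wires in addition to those in `L₀`. -/
def BitSizeOver (L₀ : List ((ι → Bool) → Bool)) (f : (ι → Bool) → Bool) (s : ℕ) : Prop :=
  ∃ L, StraightLine (L ++ L₀) ∧ L.length ≤ s ∧ f ∈ L ++ L₀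

/-- `f` is computed by a circuit with at most `s` wires. -/
abbrev BitSize (f : (ι → Bool) → Bool) (s : ℕ) : Prop := BitSizeOver [] f s

namespace BitSizeOver

variable {L₀ : List ((ι → Bool) → Bool)} {f g h : (ι → Bool) → Bool} {s t u : ℕ}

theorem mono (hf : BitSizeOver L₀ f s) (hst : s ≤ t) : BitSizeOver L₀ f t := by
  obtain ⟨L, h1, h2, h3⟩ := hf
  exact ⟨L, h1, h2.trans hst, h3⟩

theorem of_mem (h0 : StraightLine L₀) (hf : f ∈ L₀) : BitSizeOver L₀ f s := ⟨[], h0, by simp, hf⟩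

theorem input (h0 : StraightLine L₀) (i : ι) : BitSizeOver L₀ (fun x => x i) 1 :=
  ⟨[fun x => x i], .input i h0, by simp, by simp⟩

theorem const (h0 : StraightLine L₀) (b : Bool) : BitSizeOver L₀ (fun _ => b) 1 :=
  ⟨[fun _ => b], .const b h0, by simp, by simp⟩

theorem of_bitSize (h0 : StraightLine L₀) (hf : BitSize f s) : BitSizeOver L₀ f s := by
  obtain ⟨L, h1, h2, h3⟩ := hf
  refine ⟨L, h1.weaken h0 (by simp), h2, ?_⟩
  rw [List.append_nil] at h3
  exact List.mem_append_left _ h3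

/-- Two circuits side by side. -/
theorem join (hf : BitSizeOver L₀ f s) (hg : BitSizeOver L₀ g t) :
    ∃ L, StraightLine (L ++ L₀) ∧ L.length ≤ s + t ∧ f ∈ L ++ L₀ ∧ g ∈ L ++ L₀ := by
  obtain ⟨L, h1, h2, h3⟩ := hf
  obtain ⟨M, k1, k2, k3⟩ := hg
  refine ⟨L ++ M, ?_, ?_, ?_, ?_⟩
  · rw [List.append_assoc]
    exact h1.weaken k1 fun f hf => List.mem_append_right _ hf
  · simp; omega
  · simp only [List.mem_append] at h3 ⊢; tauto
  · simp only [List.mem_append] at k3 ⊢; tauto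

theorem nand (hf : BitSizeOver L₀ f s) (hg : BitSizeOver L₀ g t) :
    BitSizeOver L₀ (fun x => !(f x && g x)) (s + t + 1) := by
  obtain ⟨L, h1, h2, h3, h4⟩ := hf.join hg
  exact ⟨_ :: L, .nand h3 h4 h1, by simp; omega, by simp⟩

theorem not (hf : BitSizeOver L₀ f s) : BitSizeOver L₀ (fun x => !f x) (s + 1) := by
  obtain ⟨L, h1, h2, h3⟩ := hf
  refine ⟨_ :: L, .nand h3 h3 h1, by simp; omega, ?_⟩
  simp [Bool.and_self]

theorem and (hf : BitSizeOver L₀ f s) (hg : BitSizeOver L₀ g t) :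
    BitSizeOver L₀ (fun x => f x && g x) (s + t + 2) := by
  simpa using (hf.nand hg).not

theorem or (hf : BitSizeOver L₀ f s) (hg : BitSizeOver L₀ g t) :
    BitSizeOver L₀ (fun x => f x || g x) (s + t + 3) := by
  have := hf.not.nand hg.not
  simp only [Bool.not_and, Bool.not_not] at this
  exact this.mono (by omega)

theorem any {α : Type} (h0 : StraightLine L₀) (l : List α) (F : α → (ι → Bool) → Bool)
    (hF : ∀ a ∈ l, BitSizeOver L₀ (F a) s) :
    BitSizeOver L₀ (fun x => l.any fun a => F a x) (l.length * (s + 3) + 1) := by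
  induction l with
  | nil => simpa using const h0 false
  | cons a l ih =>
    have := (hF a (by simp)).or (ih fun b hb => hF b (by simp [hb]))
    simp only [List.any_cons]
    exact this.mono (by simp; ring_nf; omega)

theorem all {α : Type} (h0 : StraightLine L₀) (l : List α) (F : α → (ι → Bool) → Bool)
    (hF : ∀ a ∈ l, BitSizeOver L₀ (F a) s) :
    BitSizeOver L₀ (fun x => l.all fun a => F a x) (l.length * (s + 2) + 1) := by
  induction l with
  | nil => simpa using const h0 true
  | cons a l ih =>
    have := (hF a (by simp)).and (ih fun b hb => hF b (by simp [hb]))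
    simp only [List.all_cons]
    exact this.mono (by simp; ring_nf; omega)

end BitSizeOver

/-- Circuits for several functions side by side. -/
theorem exists_straightLine_of_forall {α : Type} {L₀ : List ((ι → Bool) → Bool)}
    (h0 : StraightLine L₀) (l : List α) (F : α → (ι → Bool) → Bool) {s : ℕ}
    (hF : ∀ a ∈ l, BitSizeOver L₀ (F a) s) :
    ∃ L, StraightLine (L ++ L₀) ∧ L.length ≤ l.length * s ∧ ∀ a ∈ l, F a ∈ L ++ L₀ := by
  induction l with
  | nil => exact ⟨[], h0, by simp, by simp⟩
  | cons a l ih =>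
    obtain ⟨L, h1, h2, h3⟩ := ih fun b hb => hF b (by simp [hb])
    obtain ⟨M, k1, k2, k3⟩ := hF a (by simp)
    refine ⟨M ++ L, ?_, ?_, ?_⟩
    · rw [List.append_assoc]
      exact k1.weaken h1 fun f hf => List.mem_append_right _ hf
    · simp only [List.length_append, List.length_cons]; ring_nf; omega
    · intro b hb
      rcases List.mem_cons.1 hb with rfl | hb
      · simp only [List.mem_append] at k3 ⊢; tauto
      · have := h3 b hb
        simp only [List.mem_append] at this ⊢; tauto

theorem CircuitSizeLE.bit {κ : Type} {f : (ι → Bool) → κ → Bool} {s : ℕ} (h : CircuitSizeLE f s)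
    (j : κ) : BitSize (fun x => f x j) s := by
  obtain ⟨L, h1, h2, h3⟩ := h
  exact ⟨L, by simpa using h1, h2, by simpa using h3 j⟩

theorem circuitSizeLE_of_bits {n : ℕ} {f : (ι → Bool) → Fin n → Bool} {s : ℕ}
    (h : ∀ j, BitSize (fun x => f x j) s) : CircuitSizeLE f (n * s) := by
  obtain ⟨L, h1, h2, h3⟩ := exists_straightLine_of_forall .nil (List.finRange n)
    (fun j x => f x j) fun j _ => h j
  refine ⟨L, by simpa using h1, by simpa using h2, fun j => by simpa using h3 j (by simp)⟩

theorem circuitSizeLE_of_bit {f : (ι → Bool) → Unit → Bool} {s : ℕ}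
    (h : BitSize (fun x => f x ()) s) : CircuitSizeLE f s := by
  obtain ⟨L, h1, h2, h3⟩ := h
  exact ⟨L, by simpa using h1, h2, fun j => by simpa using h3⟩

/-- Substitution of circuits for the inputs of a circuit. -/
theorem BitSize.comp {κ : Type} {f : (κ → Bool) → Bool} {t s : ℕ} (hf : BitSize f t)
    (σ : κ → (ι → Bool) → Bool) (hσ : ∀ i, BitSize (σ i) s) :
    BitSize (fun x => f fun i => σ i x) (t * (s + 1)) := by
  obtain ⟨L, h1, h2, h3⟩ := hf
  rw [List.append_nil] at h1 h3
  -- The circuit is rebuilt wire by wire. An input wire becomes a copy of the circuit for `σ i`,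
  -- every other wire stays one wire; in all cases at most `s + 1` wires are added.
  have key : ∃ M, StraightLine M ∧ M.length ≤ L.length * (s + 1) ∧
      ∀ f ∈ L, (fun x => f fun i => σ i x) ∈ M := by
    clear h2 h3
    induction h1 with
    | nil => exact ⟨[], .nil, by simp, by simp⟩
    | input i _ ih =>
      obtain ⟨M, k1, k2, k3⟩ := ih
      obtain ⟨N, n1, n2, n3⟩ := hσ i
      refine ⟨N ++ M, n1.weaken k1 (by simp), ?_, ?_⟩
      · simp only [List.length_append, List.length_cons]; ring_nf at k2 ⊢; omega
      · intro f hf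
        rcases List.mem_cons.1 hf with rfl | hf
        · rw [List.append_nil] at n3; exact List.mem_append_left _ n3
        · exact List.mem_append_right _ (k3 f hf)
    | const b _ ih =>
      obtain ⟨M, k1, k2, k3⟩ := ih
      refine ⟨_ :: M, .const b k1, ?_, ?_⟩
      · simp only [List.length_cons]; ring_nf at k2 ⊢; omega
      · intro f hf
        rcases List.mem_cons.1 hf with rfl | hf
        · simp
        · exact List.mem_cons_of_mem _ (k3 f hf)
    | nand hf hg _ ih =>
      obtain ⟨M, k1, k2, k3⟩ := ih
      refine ⟨_ :: M, .nand (k3 _ hf) (k3 _ hg) k1, ?_, ?_⟩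
      · simp only [List.length_cons]; ring_nf at k2 ⊢; omega
      · intro f hf
        rcases List.mem_cons.1 hf with rfl | hf
        · simp
        · exact List.mem_cons_of_mem _ (k3 f hf)
  obtain ⟨M, k1, k2, k3⟩ := key
  exact ⟨M, by simpa using k1, k2.trans (Nat.mul_le_mul_right _ h2), by simpa using k3 f h3⟩

/-- `F 0, …, F (k - 1)` are wires of one circuit with at most `s` wires. -/
def VecSize (k : ℕ) (F : ℕ → (ι → Bool) → Bool) (s : ℕ) : Prop :=
  ∃ L, StraightLine L ∧ L.length ≤ s ∧ ∀ c < k, F c ∈ L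

theorem VecSize.bit {k : ℕ} {F : ℕ → (ι → Bool) → Bool} {s : ℕ} (h : VecSize k F s) {c : ℕ}
    (hc : c < k) : BitSize (F c) s := by
  obtain ⟨L, h1, h2, h3⟩ := h
  exact ⟨L, by simpa using h1, h2, by simpa using h3 c hc⟩

/-- Multiplication of a Boolean vector by a Boolean matrix. -/
theorem VecSize.step {k : ℕ} {F : ℕ → (ι → Bool) → Bool} {s : ℕ} (h : VecSize k F s)
    (e : ℕ → ℕ → (ι → Bool) → Bool) {t : ℕ} (he : ∀ c < k, ∀ q < k, BitSize (e c q) t) :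
    VecSize k (fun c x => (List.range k).any fun q => e c q x && F q x)
      (s + k * (k * (t + 5) + 1)) := by
  obtain ⟨L, h1, h2, h3⟩ := h
  obtain ⟨M, k1, k2, k3⟩ := exists_straightLine_of_forall h1 (List.range k)
    (fun c x => (List.range k).any fun q => e c q x && F q x) (s := k * (t + 5) + 1) (by
      intro c hc
      -- The functions `F q` are wires already and cost nothing here. Therefore repeated
      -- multiplication adds to the size instead of multiplying it. The constant `5` is two wires
      -- for the conjunction and three for the disjunction.
      have := BitSizeOver.any h1 (List.range k) (fun q x => e c q x && F q x) (s := t + 2) (by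
        intro q hq
        exact (BitSizeOver.of_bitSize h1 (he c (List.mem_range.1 hc) q (List.mem_range.1 hq))).and
          (.of_mem (s := 0) h1 (h3 q (List.mem_range.1 hq))))
      simpa using this)
  refine ⟨M ++ L, k1, ?_, fun c hc => k3 c (List.mem_range.2 hc)⟩
  simp only [List.length_append, List.length_range] at k2 ⊢
  omega

end

/-! ### Arithmetic on bit strings -/

/-! ### Relations that are preserved by the gates. -/

section Parametricity

variable {C C' : Type} {R : C → C' → Prop} {xor and : C → C → C} {xor' and' : C' → C' → C'}

theorem forall₂_zipWith {f : C → C → C} {f' : C' → C' → C'}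
    (hf : ∀ {x x' y y'}, R x x' → R y y' → R (f x y) (f' x' y')) {xs xs' ys ys'}
    (h : List.Forall₂ R xs xs') (k : List.Forall₂ R ys ys') :
    List.Forall₂ R (List.zipWith f xs ys) (List.zipWith f' xs' ys') := by
  induction h generalizing ys ys' with
  | nil => simp
  | cons hx _ ih =>
    cases k with
    | nil => simp
    | cons hy k => exact .cons (hf hx hy) (ih k)

variable (hx : ∀ {x x' y y'}, R x x' → R y y' → R (xor x y) (xor' x' y'))
  (ha : ∀ {x x' y y'}, R x x' → R y y' → R (and x y) (and' x' y'))

include hx ha in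
theorem forall₂_addCarry {c c' xs xs' ys ys'} (hc : R c c')
    (h : List.Forall₂ R xs xs') (k : List.Forall₂ R ys ys') :
    List.Forall₂ R (addCarry xor and c xs ys) (addCarry xor' and' c' xs' ys') := by
  induction h generalizing c c' ys ys' with
  | nil => simp [addCarry]
  | cons hxx _ ih =>
    cases k with
    | nil => simp only [addCarry]; exact .cons (hx hxx hc) (ih (ha hxx hc) .nil)
    | cons hy k =>
      simp only [addCarry]
      exact .cons (hx (hx hxx hy) hc) (ih (hx (ha (hx hxx hc) (hx hy hc)) hc) k)

include hx ha in
theorem rel_ltAux {r r' xs xs' ys ys'} (hr : R r r')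
    (h : List.Forall₂ R xs xs') (k : List.Forall₂ R ys ys') :
    R (ltAux xor and r xs ys) (ltAux xor' and' r' xs' ys') := by
  induction h generalizing r r' ys ys' with
  | nil => simpa [ltAux] using hr
  | cons hxx _ ih =>
    cases k with
    | nil => simpa [ltAux] using hr
    | cons hy k =>
      simp only [ltAux]
      exact ih (hx hr (ha (hx hxx hy) (hx hr hy))) k

-- The operations use nothing but the two gates, so they preserve every relation that the gates
-- preserve. This is applied to the correspondence of ciphertexts and bits, to the graph of a change
-- of tags, and to the relation between a tagged bit and its plaintext.
include hx ha in
theorem forall₂_homOp (o : HomOp) {xs xs' ys ys'}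
    (h : List.Forall₂ R xs xs') (k : List.Forall₂ R ys ys') :
    List.Forall₂ R (o.eval xor and xs ys) (o.eval xor' and' xs' ys') := by
  cases o with
  | add =>
    cases h with
    | nil => simp [HomOp.eval, addBits]
    | cons hxx h =>
      cases k with
      | nil => simpa [HomOp.eval, addBits] using ⟨hxx, h⟩
      | cons hy k =>
        simp only [HomOp.eval, addBits]
        exact .cons (hx hxx hy) (forall₂_addCarry hx ha (ha hxx hy) h k)
  | xor => exact forall₂_zipWith hx h k
  | and => exact forall₂_zipWith ha h k
  | or => exact forall₂_zipWith (fun a b => hx (hx a b) (ha a b)) h k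
  | lt =>
    cases h with
    | nil => simp [HomOp.eval, ltBits]
    | cons hxx h =>
      cases k with
      | nil => simp [HomOp.eval, ltBits]
      | cons hy k =>
        simp only [HomOp.eval, ltBits]
        exact .cons (rel_ltAux hx ha (hx hy (ha hxx hy)) h k) .nil
  | cat => exact List.rel_append h k

include hx ha in
theorem forall₂_muxBits {cs cs' xs xs' ys ys'} (hc : List.Forall₂ R cs cs')
    (h : List.Forall₂ R xs xs') (k : List.Forall₂ R ys ys') :
    List.Forall₂ R (muxBits xor and cs xs ys) (muxBits xor' and' cs' xs' ys') := by
  cases hc with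
  | nil => simp [muxBits]
  | cons hc _ => exact forall₂_zipWith (fun a b => hx b (ha hc (hx a b))) h k

end Parametricity

/-! ### Integers and their lists of bits. -/

@[simp] theorem ofBits_nil : ofBits [] = 0 := rfl

@[simp] theorem ofBits_cons (b : Bool) (v : List Bool) :
    ofBits (b :: v) = b.toNat + 2 * ofBits v := rfl

theorem ofBits_lt (v : List Bool) : ofBits v < 2 ^ v.length := by
  induction v with
  | nil => simp
  | cons b v ih =>
    have := Bool.toNat_le b
    simp only [ofBits_cons, List.length_cons, pow_succ]; omega

theorem ofBits_append (u v : List Bool) : ofBits (u ++ v) = ofBits u + 2 ^ u.length * ofBits v := by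
  induction u with
  | nil => simp
  | cons b u ih => simp only [List.cons_append, ofBits_cons, ih, List.length_cons, pow_succ]; ring

@[simp] theorem length_natBits (t v : ℕ) : (natBits t v).length = t := by simp [natBits]

theorem natBits_succ (t v : ℕ) : natBits (t + 1) v = v.testBit 0 :: natBits t (v / 2) := by
  simp [natBits, List.range_succ_eq_map, Function.comp_def, Nat.testBit_succ]

theorem ofBits_natBits (t v : ℕ) : ofBits (natBits t v) = v % 2 ^ t := by
  induction t generalizing v with
  | zero => simp [natBits, Nat.mod_one]
  | succ t ih =>
    rw [natBits_succ, ofBits_cons, ih, pow_succ', Nat.mod_mul, Nat.testBit_zero]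
    rcases Nat.mod_two_eq_zero_or_one v with h | h <;> simp [h]

theorem natBits_ofBits (v : List Bool) : natBits v.length (ofBits v) = v := by
  induction v with
  | nil => rfl
  | cons b v ih =>
    rw [List.length_cons, natBits_succ]
    have h1 : (ofBits (b :: v)) / 2 = ofBits v := by
      cases b <;> simp <;> omega
    have h2 : (ofBits (b :: v)).testBit 0 = b := by
      cases b <;> simp [Nat.testBit_zero]
    rw [h1, h2, ih]

theorem natBits_mod (t v : ℕ) : natBits t (v % 2 ^ t) = natBits t v := by
  have := natBits_ofBits (natBits t v)
  rwa [ofBits_natBits, length_natBits] at this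

/-! ### The integer operations on plaintext bits. -/

section BoolArith

local notation "add" => addBits Bool.xor Bool.and

/-- Reduction modulo `2 * N` leaves the lowest bit alone and reduces the rest modulo `N`; this is
the inductive step for the adder. -/
theorem bit_add_two_mul_mod {b q x : ℕ} (N : ℕ) (hb : b < 2) (hx : x = b + 2 * q) :
    x % (2 * N) = b + 2 * (q % N) := by
  rw [Nat.mod_mul, show x % 2 = b by omega, show x / 2 = q by omega]

theorem ofBits_addCarry (c : Bool) (xs ys : List Bool) :
    ofBits (addCarry Bool.xor Bool.and c xs ys) =
      (ofBits xs + ofBits ys + c.toNat) % 2 ^ xs.length := by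
  induction xs generalizing c ys with
  | nil => simp [addCarry, Nat.mod_one]
  | cons x xs ih =>
    cases ys with
    | nil =>
      simp only [addCarry, ofBits_cons, ih, List.length_cons, pow_succ', ofBits_nil]
      refine (bit_add_two_mul_mod _ (Bool.toNat_lt _) ?_).symm
      cases x <;> cases c <;> simp <;> omega
    | cons y ys =>
      simp only [addCarry, ofBits_cons, ih, List.length_cons, pow_succ']
      refine (bit_add_two_mul_mod _ (Bool.toNat_lt _) ?_).symm
      cases x <;> cases y <;> cases c <;> simp <;> omega

theorem ofBits_addBits (xs ys : List Bool) :
    ofBits (add xs ys) = (ofBits xs + ofBits ys) % 2 ^ xs.length := by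
  cases xs with
  | nil => simp [addBits, Nat.mod_one]
  | cons x xs =>
    cases ys with
    | nil =>
      simp only [addBits, ofBits_nil, add_zero]
      rw [Nat.mod_eq_of_lt (ofBits_lt _)]
    | cons y ys =>
      -- The first position of `addBits` is a half adder, that is, a full adder with carry zero.
      have := ofBits_addCarry false (x :: xs) (y :: ys)
      simp only [Bool.toNat_false, add_zero] at this
      rw [← this]
      cases x <;> cases y <;> simp [addBits, addCarry]

theorem length_addCarry {C : Type} (xor and : C → C → C) (c : C) (xs ys : List C) :
    (addCarry xor and c xs ys).length = xs.length := by
  induction xs generalizing c ys with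
  | nil => simp [addCarry]
  | cons x xs ih => cases ys <;> simp [addCarry, ih]

theorem length_addBits {C : Type} (xor and : C → C → C) (xs ys : List C) :
    (addBits xor and xs ys).length = xs.length := by
  cases xs <;> cases ys <;> simp [addBits, length_addCarry]

/-- The gate formula gives `r` if the two current bits agree and `y` if they differ. So the most
significant difference decides, and `r` survives only if there is none. -/
theorem ltAux_eq (r : Bool) (xs ys : List Bool) (h : xs.length = ys.length) :
    ltAux Bool.xor Bool.and r xs ys =
      if ofBits xs = ofBits ys then r else decide (ofBits xs < ofBits ys) := by
  induction xs generalizing r ys with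
  | nil =>
    cases ys with
    | nil => simp [ltAux]
    | cons y ys => simp at h
  | cons x xs ih =>
    cases ys with
    | nil => simp at h
    | cons y ys =>
      simp only [ltAux, ofBits_cons]
      rw [ih _ _ (by simpa using h)]
      rcases lt_trichotomy (ofBits xs) (ofBits ys) with h1 | h1 | h1
      · have e1 : ¬ ofBits xs = ofBits ys := by omega
        have e2 : ¬ x.toNat + 2 * ofBits xs = y.toNat + 2 * ofBits ys := by
          cases x <;> cases y <;> simp <;> omega
        have e3 : x.toNat + 2 * ofBits xs < y.toNat + 2 * ofBits ys := by
          cases x <;> cases y <;> simp <;> omega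
        simp [e1, e2, e3, h1]
      · simp only [h1, lt_irrefl]; cases x <;> cases y <;> cases r <;> simp
      · have e1 : ¬ ofBits xs = ofBits ys := by omega
        have e2 : ¬ x.toNat + 2 * ofBits xs = y.toNat + 2 * ofBits ys := by
          cases x <;> cases y <;> simp <;> omega
        have e3 : ¬ x.toNat + 2 * ofBits xs < y.toNat + 2 * ofBits ys := by
          cases x <;> cases y <;> simp <;> omega
        have e4 : ¬ ofBits xs < ofBits ys := by omega
        simp [e1, e2, e3, e4]

theorem ltBits_eq (xs ys : List Bool) (h : xs.length = ys.length) (h0 : xs ≠ []) :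
    ltBits Bool.xor Bool.and xs ys = [decide (ofBits xs < ofBits ys)] := by
  cases xs with
  | nil => simp at h0
  | cons x xs =>
    cases ys with
    | nil => simp at h
    | cons y ys =>
      have := ltAux_eq false (x :: xs) (y :: ys) h
      simp only [ltAux] at this
      simp only [ltBits]
      congr 1
      -- The lowest position uses a simplified formula: it is the general step started with the
      -- answer `false`.
      rw [show (Bool.xor y (Bool.and x y)) =
        Bool.xor false (Bool.and (Bool.xor x y) (Bool.xor false y)) by cases x <;> cases y <;> rfl,
        this]
      split <;> simp [*]

theorem muxBits_eq (c : Bool) (xs ys : List Bool) (h : xs.length = ys.length) :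
    muxBits Bool.xor Bool.and [c] xs ys = if c then xs else ys := by
  simp only [muxBits]
  induction xs generalizing ys with
  | nil =>
    cases ys with
    | nil => simp
    | cons y ys => simp at h
  | cons x xs ih =>
    cases ys with
    | nil => simp at h
    | cons y ys =>
      rw [List.zipWith_cons_cons, ih _ (by simpa using h)]
      cases c <;> cases x <;> cases y <;> simp

end BoolArith

/-! ### A machine on plaintext bits

The machine executes programs on plaintexts. A bit comes with the party under whose key it would be
encrypted, and, where the ciphertext is known exactly, with a symbol for it (its tag). The view of
the party `P` is a list of bits and of symbols for ciphertexts. -/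

/-- A bit of a register of the plaintext machine. -/
structure LBit (C : Type) where
  key : Option Party
  bit : Bool
  tag : Option C

/-- The random coins of one instruction. -/
@[ext]
structure Coin (ec rc : ℕ) where
  int : ℕ
  enc : ℕ → Bits ec
  re : ℕ → Bits rc

/-- A state of the plaintext machine; `ok` says that all operations have been legal. -/
structure LState (C : Type) where
  mem : Party → Reg → Cell (LBit C)
  view : List (Bool ⊕ C)
  ok : Prop

namespace LBit

variable {C C' : Type}

def map (φ : C → C') (x : LBit C) : LBit C' := ⟨x.key, x.bit, x.tag.map φ⟩

/-- The result is known to be a ciphertext only if both operands are under `K`. It never has a tag: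
the result of a gate is not a fresh ciphertext, and it may be shown to the observed party only after
a re-encryption. -/
def op (f : Bool → Bool → Bool) (K : Party) (x y : LBit C) : LBit C :=
  ⟨if x.key = some K ∧ y.key = some K then some K else none, f x.bit y.bit, none⟩

end LBit

/-- Replace all tags. -/
def retag {C : Type} (tag : ℕ → Option C) (xs : List (LBit C)) : List (LBit C) :=
  xs.mapIdx fun j x => ⟨x.key, x.bit, tag j⟩

namespace LState

variable {C C' : Type} (a : LState C)

def put (P : Party) (d : Reg) (x : Cell (LBit C)) : LState C :=
  { a with mem := Function.update a.mem P (Function.update (a.mem P) d x) }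

def setVal (P : Party) (d : Reg) (v : ℕ) : LState C := a.put P d ⟨v, (a.mem P d).ct⟩

def setCt (P : Party) (d : Reg) (c : List (LBit C)) : LState C := a.put P d ⟨(a.mem P d).val, c⟩

/-- If `Q` is the party `P` whose view is recorded, extend the view. -/
def see (P Q : Party) (v : List (Bool ⊕ C)) : LState C :=
  { a with view := if Q = P then a.view ++ v else a.view }

/-- Side conditions are accumulated rather than checked. They are verified once, for complete runs,
and then are available at every intermediate step. -/
def assume (p : Prop) : LState C := { a with ok := a.ok ∧ p }

end LState

def Cell.map {C C' : Type} (φ : C → C') (x : Cell (LBit C)) : Cell (LBit C') :=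
  ⟨x.val, x.ct.map (LBit.map φ)⟩

def LState.map {C C' : Type} (φ : C → C') (a : LState C) : LState C' :=
  ⟨fun P r => (a.mem P r).map φ, a.view.map (Sum.map id φ), a.ok⟩

/-- Encryptions of the `w` lowest bits of `v` with the key of `K`. -/
def encBits {C : Type} (K : Party) (w v : ℕ) : List (LBit C) :=
  (List.range w).map fun j => ⟨some K, v.testBit j, none⟩

/-- The effect of a re-encryption, except for the tags. -/
def recode {C : Type} (K : Party) (xs : List (LBit C)) : List (LBit C) :=
  xs.map fun x => ⟨if x.key = some K then some K else none, x.bit, none⟩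

/-- Tags for encryptions by the party `Q`. -/
def freshTags {C : Type} {ec : ℕ} (mk : Party → Bool → Bits ec → C) (P Q K : Party)
    (xs : List (LBit C)) (r : ℕ → Bits ec) (j : ℕ) : Option C :=
  if Q = P then none else (xs[j]?).map fun x => mk K x.bit (r j)

/-- The bits of the first `n` coins. -/
def coinStr {C : Type} {c : ℕ} (n : ℕ) (r : ℕ → Bits c) : List (Bool ⊕ C) :=
  (List.range n).flatMap fun j => (List.ofFn (r j)).map .inl

/-- A step of the plaintext machine that records the view of `P`. Integers are assumed to have at
most `W` bits where they are encrypted. -/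
def lstep {C : Type} {ec rc : ℕ} (P : Party) (W : ℕ) (mk : Party → Bool → Bits ec → C)
    (i : Instr) (y : Coin ec rc) (a : LState C) : LState C :=
  match i with
  | .const Q d v => a.setVal Q d v
  | .sub Q w d s t =>
      a.setVal Q d (((a.mem Q s).val + 2 ^ w - (a.mem Q t).val % 2 ^ w) % 2 ^ w)
  | .move Q d s => a.put Q d (a.mem Q s)
  | .load Q d arr i =>
      match arr[(a.mem Q i).val]? with
      | some r => a.put Q d (a.mem Q r)
      | none => a
  | .store Q arr i s =>
      match arr[(a.mem Q i).val]? with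
      | some r => a.put Q r (a.mem Q s)
      | none => a
  | .coin Q d b => (a.setVal Q d y.int).see P Q ((natBits b.size y.int).map .inl)
  | .enc Q K w d s =>
      (((a.setCt Q d (retag (freshTags mk P Q K (encBits K w (a.mem Q s).val) y.enc)
        (encBits K w (a.mem Q s).val)))).see P Q (coinStr w y.enc)).assume (w ≤ W)
  | .dec Q d s =>
      (a.setVal Q d (ofBits ((a.mem Q s).ct.map LBit.bit))).assume
        (∀ x ∈ (a.mem Q s).ct, x.key = some Q)
  | .hom Q K o d s t =>
      a.setCt Q d (o.eval (LBit.op Bool.xor K) (LBit.op Bool.and K) (a.mem Q s).ct (a.mem Q t).ct)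
  | .mux Q K d c s t =>
      a.setCt Q d (muxBits (LBit.op Bool.xor K) (LBit.op Bool.and K) (a.mem Q c).ct (a.mem Q s).ct
        (a.mem Q t).ct)
  | .reenc Q K d =>
      (((a.setCt Q d (retag (freshTags mk P Q K (recode K (a.mem Q d).ct) y.enc)
        (recode K (a.mem Q d).ct)))).see P Q (coinStr (a.mem Q d).ct.length y.re)).assume
        ((a.mem Q d).ct.length ≤ W ∧ ∀ x ∈ (a.mem Q d).ct, x.key = some K)
  | .sendCt Q d s =>
      ((a.setCt Q.other d (a.mem Q s).ct).see P Q.other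
        ((a.mem Q s).ct.filterMap fun x => x.tag.map .inr)).assume
        (Q.other = P → ∀ x ∈ (a.mem Q s).ct, x.tag.isSome)
  | .sendVal Q w d s =>
      (a.setVal Q.other d ((a.mem Q s).val % 2 ^ w)).see P Q.other
        ((natBits w (a.mem Q s).val).map .inl)

/-! #### Naturality in the symbols for ciphertexts -/

section Naturality

variable {C C' : Type} (φ : C → C')

theorem LState.map_put (a : LState C) (Q : Party) (d : Reg) (x : Cell (LBit C)) :
    (a.put Q d x).map φ = (a.map φ).put Q d (x.map φ) := by
  simp only [LState.map, LState.put, LState.mk.injEq, and_true]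
  funext P r
  by_cases hP : P = Q
  · subst hP
    by_cases hr : r = d
    · subst hr; simp
    · simp [hr]
  · simp [hP]

theorem LState.map_mem (a : LState C) (Q : Party) (d : Reg) :
    (a.map φ).mem Q d = (a.mem Q d).map φ := rfl

theorem LState.map_setVal (a : LState C) (Q : Party) (d : Reg) (v : ℕ) :
    (a.setVal Q d v).map φ = (a.map φ).setVal Q d v := by
  simp [LState.setVal, LState.map_put, LState.map_mem, Cell.map]

theorem LState.map_setCt (a : LState C) (Q : Party) (d : Reg) (c : List (LBit C)) :
    (a.setCt Q d c).map φ = (a.map φ).setCt Q d (c.map (LBit.map φ)) := by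
  simp [LState.setCt, LState.map_put, LState.map_mem, Cell.map]

theorem LState.map_see (a : LState C) (P Q : Party) (v : List (Bool ⊕ C)) :
    (a.see P Q v).map φ = (a.map φ).see P Q (v.map (Sum.map id φ)) := by
  by_cases h : Q = P <;> simp [LState.see, LState.map, h]

theorem LState.map_assume (a : LState C) (p : Prop) :
    (a.assume p).map φ = (a.map φ).assume p := rfl

/-- Parametricity for the graph of `LBit.map φ`. -/
theorem map_homOp (o : HomOp) (K : Party) (xs ys : List (LBit C)) :
    (o.eval (LBit.op Bool.xor K) (LBit.op Bool.and K) xs ys).map (LBit.map φ) =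
      o.eval (LBit.op Bool.xor K) (LBit.op Bool.and K) (xs.map (LBit.map φ))
        (ys.map (LBit.map φ)) := by
  have h : ∀ zs : List (LBit C), List.Forall₂ (fun x y => LBit.map φ x = y) zs
      (zs.map (LBit.map φ)) := fun zs => by
    rw [List.forall₂_map_right_iff]; exact List.forall₂_same.2 fun _ _ => rfl
  have := forall₂_homOp (R := fun x y => LBit.map φ x = y)
    (xor := LBit.op Bool.xor K) (and := LBit.op Bool.and K)
    (xor' := LBit.op Bool.xor K) (and' := LBit.op Bool.and K)
    (by rintro x _ y _ rfl rfl; rfl) (by rintro x _ y _ rfl rfl; rfl) o (h xs) (h ys)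
  rw [← List.forall₂_map_left_iff (R := fun x y => x = y) (f := LBit.map φ),
    List.forall₂_eq_eq_eq] at this
  exact this

theorem map_muxBits (K : Party) (cs xs ys : List (LBit C)) :
    (muxBits (LBit.op Bool.xor K) (LBit.op Bool.and K) cs xs ys).map (LBit.map φ) =
      muxBits (LBit.op Bool.xor K) (LBit.op Bool.and K) (cs.map (LBit.map φ))
        (xs.map (LBit.map φ)) (ys.map (LBit.map φ)) := by
  have h : ∀ zs : List (LBit C), List.Forall₂ (fun x y => LBit.map φ x = y) zs
      (zs.map (LBit.map φ)) := fun zs => by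
    rw [List.forall₂_map_right_iff]; exact List.forall₂_same.2 fun _ _ => rfl
  have := forall₂_muxBits (R := fun x y => LBit.map φ x = y)
    (xor := LBit.op Bool.xor K) (and := LBit.op Bool.and K)
    (xor' := LBit.op Bool.xor K) (and' := LBit.op Bool.and K)
    (by rintro x _ y _ rfl rfl; rfl) (by rintro x _ y _ rfl rfl; rfl) (h cs) (h xs) (h ys)
  rw [← List.forall₂_map_left_iff (R := fun x y => x = y) (f := LBit.map φ),
    List.forall₂_eq_eq_eq] at this
  exact this

theorem map_retag (tag : ℕ → Option C) (xs : List (LBit C)) :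
    (retag tag xs).map (LBit.map φ) =
      retag (fun j => (tag j).map φ) (xs.map (LBit.map φ)) := by
  refine List.ext_getElem? fun j => ?_
  simp only [retag, List.getElem?_map, List.getElem?_mapIdx, Option.map_map]
  rfl

theorem map_encBits (K : Party) (w v : ℕ) :
    (encBits K w v).map (LBit.map φ) = encBits (C := C') K w v := by
  simp [encBits, LBit.map, Function.comp_def]

theorem map_recode (K : Party) (xs : List (LBit C)) :
    (recode K xs).map (LBit.map φ) = recode K (xs.map (LBit.map φ)) := by
  simp only [recode, List.map_map]
  rfl

theorem map_freshTags {ec : ℕ} (mk : Party → Bool → Bits ec → C) (P Q K : Party)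
    (xs : List (LBit C)) (r : ℕ → Bits ec) (j : ℕ) :
    (freshTags mk P Q K xs r j).map φ =
      freshTags (fun K b r => φ (mk K b r)) P Q K (xs.map (LBit.map φ)) r j := by
  simp only [freshTags]
  split
  · rfl
  · simp only [List.getElem?_map, Option.map_map]
    rfl

theorem map_coinStr {c : ℕ} (n : ℕ) (r : ℕ → Bits c) :
    (coinStr n r : List (Bool ⊕ C)).map (Sum.map id φ) = coinStr n r := by
  simp [coinStr, List.map_flatMap, Function.comp_def]

/-- Tags are copied, dropped, or created by `mk`, but never inspected. Hence a change of symbols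
commutes with execution, and legality does not depend on the kind of symbols. -/
theorem lstep_map {ec rc : ℕ} (P : Party) (W : ℕ) (mk : Party → Bool → Bits ec → C)
    (i : Instr) (y : Coin ec rc) (a : LState C) :
    (lstep P W mk i y a).map φ = lstep P W (fun K b r => φ (mk K b r)) i y (a.map φ) := by
  cases i with
  | const => simp [lstep, LState.map_setVal]
  | sub => simp [lstep, LState.map_setVal, LState.map_mem, Cell.map]
  | move => simp [lstep, LState.map_put, LState.map_mem]
  | load Q d arr i =>
    simp only [lstep, LState.map_mem, Cell.map]
    cases arr[(a.mem Q i).val]? <;> simp [LState.map_put, Cell.map]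
  | store Q arr i s =>
    simp only [lstep, LState.map_mem, Cell.map]
    cases arr[(a.mem Q i).val]? <;> simp [LState.map_put, Cell.map]
  | coin => simp [lstep, LState.map_setVal, LState.map_see, Function.comp_def]
  | enc => 
    simp [lstep, LState.map_setCt, LState.map_see, LState.map_assume, map_retag, map_freshTags,
      map_encBits, map_coinStr, LState.map_mem, Cell.map]
  | dec =>
    simp [lstep, LState.map_setVal, LState.map_assume, LState.map_mem, Cell.map, Function.comp_def,
      LBit.map]
  | hom => simp [lstep, LState.map_setCt, map_homOp, LState.map_mem, Cell.map]
  | mux => simp [lstep, LState.map_setCt, map_muxBits, LState.map_mem, Cell.map]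
  | reenc =>
    simp only [lstep, LState.map_setCt, LState.map_see, LState.map_assume, map_retag, map_freshTags,
      map_recode, map_coinStr, LState.map_mem, Cell.map]
    simp [LBit.map]
  | sendCt => 
    simp [lstep, LState.map_setCt, LState.map_see, LState.map_assume, LState.map_mem, Cell.map,
      List.map_filterMap, List.filterMap_map, Function.comp_def, LBit.map]
  | sendVal =>
    simp [lstep, LState.map_setVal, LState.map_see, LState.map_mem, Cell.map, Function.comp_def]

end Naturality

/-! #### Random runs -/

/-- The largest value of the random integer that an instruction draws. -/
def Instr.bound : Instr → ℕ
  | .coin _ _ b => b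
  | _ => 0

/-- The coins for encryptions and re-encryptions of an integer. -/
abbrev Blk (W ec rc : ℕ) : Type := (Fin W → Bits ec) × (Fin W → Bits rc)

def Coin.ofBlk {W ec rc : ℕ} (v : ℕ) (t : Blk W ec rc) : Coin ec rc where
  int := v
  enc j := if h : j < W then t.1 ⟨j, h⟩ else fun _ => false
  re j := if h : j < W then t.2 ⟨j, h⟩ else fun _ => false

/-- The distribution of the coins of an instruction. -/
noncomputable def coinLaw (W ec rc : ℕ) (i : Instr) : PMF (Coin ec rc) :=
  (unif (Fin (i.bound + 1) × Blk W ec rc)).map fun t => Coin.ofBlk t.1 t.2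

/-- A random run of the plaintext machine. -/
noncomputable def lrun {C : Type} {ec : ℕ} (rc : ℕ) (P : Party) (W : ℕ)
    (mk : Party → Bool → Bits ec → C) : Program → LState C → PMF (LState C)
  | [], a => PMF.pure a
  | i :: is, a => (coinLaw W ec rc i).bind fun y => lrun rc P W mk is (lstep P W mk i y a)

theorem lrun_map {C C' : Type} {ec rc : ℕ} (P : Party) (W : ℕ) (mk : Party → Bool → Bits ec → C)
    (φ : C → C') (pr : Program) (a : LState C) :
    (lrun rc P W mk pr a).map (LState.map φ) =
      lrun rc P W (fun K b r => φ (mk K b r)) pr (a.map φ) := by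
  induction pr generalizing a with
  | nil => simp [lrun, PMF.pure_map]
  | cons i is ih => simp [lrun, PMF.map_bind, ih, lstep_map]

theorem lstep_ok {C : Type} {ec rc : ℕ} {P : Party} {W : ℕ} {mk : Party → Bool → Bits ec → C}
    {i : Instr} {y : Coin ec rc} {a : LState C} (h : (lstep P W mk i y a).ok) : a.ok := by
  cases i <;> simp only [lstep] at h <;> try split at h
  all_goals first | exact h | exact h.1

/-- Conditions are only ever added, so legality of all final states implies legality of the present
one. -/
theorem lrun_ok {C : Type} {ec rc : ℕ} {P : Party} {W : ℕ} {mk : Party → Bool → Bits ec → C}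
    {pr : Program} {a : LState C} (h : ∀ a' ∈ (lrun rc P W mk pr a).support, a'.ok) : a.ok := by
  induction pr generalizing a with
  | nil => exact h a (by simp [lrun])
  | cons i is ih =>
    obtain ⟨y, hy⟩ := (coinLaw W ec rc i).support_nonempty
    refine lstep_ok (ih (a := lstep P W mk i y a) fun a' ha' => h a' ?_)
    simp only [lrun, PMF.mem_support_bind_iff]
    exact ⟨y, hy, ha'⟩

/-! ### Executions and the plaintext machine -/

/-- Instructions that use random coins. -/
def Instr.IsRandom : Instr → Prop
  | .coin .. | .enc .. | .reenc .. => True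
  | _ => False

section Relation

variable (E : BitCrypto) (l : ℕ) (g : Party → Bits (E.genCoins l))

/-- The effect of an instruction without random coins. -/
def Instr.det : Instr → State (Bits (E.ctLen l)) → State (Bits (E.ctLen l))
  | .const P d v, st => st.setVal P d v
  | .sub P w d s t, st =>
      st.setVal P d (((st.mem P s).val + 2 ^ w - (st.mem P t).val % 2 ^ w) % 2 ^ w)
  | .move P d s, st => st.put P d (st.mem P s)
  | .load P d arr i, st =>
      match arr[(st.mem P i).val]? with
      | some r => st.put P d (st.mem P r)
      | none => st
  | .store P arr i s, st =>
      match arr[(st.mem P i).val]? with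
      | some r => st.put P r (st.mem P s)
      | none => st
  | .dec P d s, st =>
      st.setVal P d (ofBits ((st.mem P s).ct.map (E.dec l (E.genSk l (g P)))))
  | .hom P K o d s t, st =>
      st.setCt P d
        (o.eval (E.xor l (E.genPk l (g K))) (E.and l (E.genPk l (g K)))
          (st.mem P s).ct (st.mem P t).ct)
  | .mux P K d c s t, st =>
      st.setCt P d
        (muxBits (E.xor l (E.genPk l (g K))) (E.and l (E.genPk l (g K)))
          (st.mem P c).ct (st.mem P s).ct (st.mem P t).ct)
  | .sendCt P d s, st =>
      (st.setCt P.other d (st.mem P s).ct).see P.other (flat (st.mem P s).ct)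
  | .sendVal P w d s, st =>
      (st.setVal P.other d ((st.mem P s).val % 2 ^ w)).see P.other (natBits w (st.mem P s).val)
  | _, st => st

theorem exec_eq_pure {i : Instr} (h : ¬ i.IsRandom) (st : State (Bits (E.ctLen l))) :
    i.exec E l g st = PMF.pure (i.det E l g st) := by
  cases i <;> first | rfl | exact absurd trivial h

theorem exec_coin (P : Party) (d : Reg) (b : ℕ) (st : State (Bits (E.ctLen l))) :
    (Instr.coin P d b).exec E l g st = (unif (Fin (b + 1))).map fun v : Fin (b + 1) =>
      (st.setVal P d v).see P (natBits b.size v) := by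
  simp only [Instr.exec]
  -- In `Instr.exec` the random number is first regarded as a natural number; the two maps are
  -- merged.
  change PMF.map _ ((unif (Fin (b + 1))).bind (PMF.pure ∘ fun a : Fin (b + 1) => (a : ℕ))) = _
  rw [PMF.bind_pure_comp, PMF.map_comp]
  rfl

variable {C : Type} (T : Bits (E.ctLen l) → C → Prop)

/-- A ciphertext and a bit of the plaintext machine correspond to each other. -/
def RelBit (c : Bits (E.ctLen l)) (x : LBit C) : Prop :=
  (∀ K, x.key = some K → E.IsCt l (E.genPk l (g K)) x.bit c) ∧ ∀ t, x.tag = some t → T c t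

def RelCell (x : Cell (Bits (E.ctLen l))) (z : Cell (LBit C)) : Prop :=
  x.val = z.val ∧ List.Forall₂ (RelBit E l g T) x.ct z.ct

/-- The memories of an execution and of the plaintext machine correspond to each other. -/
def Rel (st : State (Bits (E.ctLen l))) (a : LState C) : Prop :=
  ∀ Q r, RelCell E l g T (st.mem Q r) (a.mem Q r)

variable {E l g T} {st : State (Bits (E.ctLen l))} {a : LState C}

theorem Rel.put (h : Rel E l g T st a) {x z} (hx : RelCell E l g T x z) (Q : Party) (d : Reg) :
    Rel E l g T (st.put Q d x) (a.put Q d z) := by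
  intro Q' r
  simp only [State.put, LState.put]
  by_cases hQ : Q' = Q
  · subst hQ
    by_cases hr : r = d
    · subst hr; simpa using hx
    · simpa [hr] using h Q' r
  · simpa [hQ] using h Q' r

theorem Rel.setVal (h : Rel E l g T st a) {v w : ℕ} (hv : v = w) (Q : Party) (d : Reg) :
    Rel E l g T (st.setVal Q d v) (a.setVal Q d w) := h.put (x := ⟨v, _⟩) (z := ⟨w, _⟩) ⟨hv, (h Q d).2⟩ Q d

theorem Rel.setCt (h : Rel E l g T st a) {c z} (hv : List.Forall₂ (RelBit E l g T) c z) (Q : Party)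
    (d : Reg) : Rel E l g T (st.setCt Q d c) (a.setCt Q d z) := 
  h.put (x := ⟨_, c⟩) (z := ⟨_, z⟩) ⟨(h Q d).1, hv⟩ Q d

theorem Rel.see (h : Rel E l g T st a) (P Q Q' : Party) (u v) :
    Rel E l g T (st.see Q' u) (a.see P Q v) := h

theorem Rel.assume (h : Rel E l g T st a) (p : Prop) : Rel E l g T st (a.assume p) := h

/-- A bit without a key makes no claim about its ciphertext, so operations on operands under
different keys need no separate argument. -/
theorem relBit_op {f : Bool → Bool → Bool} {op : Bits (E.ctLen l) → Bits (E.ctLen l) →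
    Bits (E.ctLen l)} {K : Party}
    (hop : ∀ {b b' c c'}, E.IsCt l (E.genPk l (g K)) b c → E.IsCt l (E.genPk l (g K)) b' c' →
      E.IsCt l (E.genPk l (g K)) (f b b') (op c c'))
    {c x c' x'} (h : RelBit E l g T c x) (h' : RelBit E l g T c' x') :
    RelBit E l g T (op c c') (LBit.op f K x x') := by
  refine ⟨fun K' hK => ?_, fun t ht => by simp [LBit.op] at ht⟩
  simp only [LBit.op] at hK ⊢
  split at hK
  · rename_i hk
    obtain rfl : K = K' := by simpa using hK
    exact hop (h.1 _ hk.1) (h'.1 _ hk.2)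
  · simp at hK

/-- This is the one point where correctness of decryption enters. The condition on the keys is what
a legal decryption guarantees. -/
theorem Rel.dec (hE : E.Correct) (h : Rel E l g T st a) {Q : Party} {s : Reg}
    (hk : ∀ x ∈ (a.mem Q s).ct, x.key = some Q) :
    (st.mem Q s).ct.map (E.dec l (E.genSk l (g Q))) = (a.mem Q s).ct.map LBit.bit := by
  have := (h Q s).2
  generalize (st.mem Q s).ct = cs at this
  generalize (a.mem Q s).ct = xs at this hk
  induction this with
  | nil => rfl
  | cons hx _ ih =>
    rw [List.map_cons, List.map_cons, ih fun x hx => hk x (by simp [hx])]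
    rw [hE l (g Q) _ _ (hx.1 Q (hk _ (by simp)))]

/-- Decryption agrees by legality and correctness, homomorphic operations by parametricity and the
closure properties of `IsCt`; all other instructions only move cells around. -/
theorem Rel.step (hE : E.Correct) (h : Rel E l g T st a) {i : Instr} (hi : ¬ i.IsRandom)
    {P : Party} {W : ℕ} {mk : Party → Bool → Bits (E.encCoins l) → C}
    {y : Coin (E.encCoins l) (E.reCoins l)} (hok : (lstep P W mk i y a).ok) :
    Rel E l g T (i.det E l g st) (lstep P W mk i y a) := by
  cases i with
  | const Q d v => exact h.setVal rfl Q d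
  | sub Q w d s t => exact h.setVal (by rw [(h Q s).1, (h Q t).1]) Q d
  | move Q d s => exact h.put (h Q s) Q d
  | load Q d arr i =>
    simp only [Instr.det, lstep, (h Q i).1]
    cases arr[(a.mem Q i).val]? with
    | none => exact h
    | some r => exact h.put (h Q r) Q d
  | store Q arr i s =>
    simp only [Instr.det, lstep, (h Q i).1]
    cases arr[(a.mem Q i).val]? with
    | none => exact h
    | some r => exact h.put (h Q s) Q r
  | coin => exact absurd trivial hi
  | enc => exact absurd trivial hi
  | dec Q d s =>
    refine (h.setVal ?_ Q d).assume _
    rw [h.dec hE]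
    exact hok.2
  | hom Q K o d s t =>
    exact h.setCt (forall₂_homOp (relBit_op .xor) (relBit_op .and) o (h Q s).2 (h Q t).2) Q d
  | mux Q K d c s t =>
    exact h.setCt (forall₂_muxBits (relBit_op .xor) (relBit_op .and) (h Q c).2 (h Q s).2 (h Q t).2) Q d
  | reenc => exact absurd trivial hi
  | sendCt Q d s => exact ((h.setCt (h Q s).2 Q.other d).see _ _ _ _ _).assume _
  | sendVal Q w d s => exact (h.setVal (by rw [(h Q s).1]) Q.other d).see _ _ _ _ _

theorem Rel.coin (h : Rel E l g T st a) (Q : Party) (d : Reg) (b : ℕ)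
    {P : Party} {W : ℕ} {mk : Party → Bool → Bits (E.encCoins l) → C}
    (y : Coin (E.encCoins l) (E.reCoins l)) (u) :
    Rel E l g T ((st.setVal Q d y.int).see Q u) (lstep P W mk (.coin Q d b) y a) :=
  (h.setVal rfl Q d).see _ _ _ _ _

theorem forall₂_retag {cs : List (Bits (E.ctLen l))} {xs : List (LBit C)} (tag : ℕ → Option C)
    (hl : cs.length = xs.length)
    (hk : ∀ j (h : j < cs.length) (h' : j < xs.length), ∀ K, xs[j].key = some K →
      E.IsCt l (E.genPk l (g K)) xs[j].bit cs[j])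
    (ht : ∀ j (h : j < cs.length), ∀ t, tag j = some t → T cs[j] t) :
    List.Forall₂ (RelBit E l g T) cs (retag tag xs) := by
  rw [List.forall₂_iff_get]
  refine ⟨by simpa [retag] using hl, fun j h h' => ⟨fun K hK => ?_, fun t h't => ?_⟩⟩
  · simp only [retag, List.get_eq_getElem, List.getElem_mapIdx] at hK ⊢
    exact hk j h (by simpa [retag] using h') K hK
  · simp only [retag, List.get_eq_getElem, List.getElem_mapIdx] at h't ⊢
    exact ht j h t h't

theorem retag_congr {tag tag' : ℕ → Option C} {xs : List (LBit C)}
    (h : ∀ j < xs.length, tag j = tag' j) : retag tag xs = retag tag' xs := by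
  refine List.ext_getElem (by simp [retag]) fun j h1 h2 => ?_
  simp only [retag, List.length_mapIdx] at h1
  simp [retag, h j h1]

theorem Rel.enc (h : Rel E l g T st a) (Q K : Party) (w : ℕ) (d s : Reg) {P : Party} {W : ℕ}
    {mk : Party → Bool → Bits (E.encCoins l) → C}
    (hT : ∀ b r, T (E.enc l (E.genPk l (g K)) b r) (mk K b r))
    (y : Coin (E.encCoins l) (E.reCoins l)) (u) :
    Rel E l g T ((st.setCt Q d (List.ofFn fun j : Fin w =>
          E.enc l (E.genPk l (g K)) ((st.mem Q s).val.testBit j) (y.enc j))).see Q u)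
      (lstep P W mk (.enc Q K w d s) y a) := by
  refine ((h.setCt ?_ Q d).see _ _ _ _ _).assume _
  refine forall₂_retag _ (by simp [encBits]) (fun j h1 h2 K' hK => ?_) fun j h1 t ht => ?_
  · simp only [encBits, List.getElem_map, List.getElem_range, Option.some.injEq] at hK ⊢
    subst hK
    simp only [List.getElem_ofFn, (h Q s).1]
    exact .enc _ _
  · simp only [freshTags] at ht
    split at ht
    · simp at ht
    · simp only [List.length_ofFn] at h1
      simp only [encBits, List.getElem?_map, List.getElem?_range h1, Option.map_some,
        Option.some.injEq] at ht
      subst ht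
      simp only [List.getElem_ofFn, (h Q s).1]
      exact hT _ _

/-- The tags are left open. They may be absent, they may be the actual re-encryptions when `T` is
equality, or they may be arbitrary when `T` is trivial. -/
theorem Rel.reenc_ct (h : Rel E l g T st a) (Q K : Party) (d : Reg) (r : ℕ → Bits (E.reCoins l))
    (tag : ℕ → Option C)
    (ht : ∀ j (hj : j < (st.mem Q d).ct.length), ∀ t, tag j = some t →
      T (E.reenc l (E.genPk l (g K)) (st.mem Q d).ct[j] (r j)) t) :
    List.Forall₂ (RelBit E l g T)
      (List.ofFn fun j : Fin (st.mem Q d).ct.length =>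
          E.reenc l (E.genPk l (g K)) ((st.mem Q d).ct.get j) (r j))
      (retag tag (recode K (a.mem Q d).ct)) := by
  have hl := (h Q d).2.length_eq
  refine forall₂_retag _ (by simpa [recode] using hl) (fun j h1 h2 K' hK => ?_) fun j h1 t h't => ?_
  · simp only [recode, List.getElem_map] at hK ⊢
    split at hK
    · rename_i hk
      obtain rfl : K = K' := by simpa using hK
      simp only [List.getElem_ofFn]
      refine .reenc _ ?_
      have := List.forall₂_iff_get.1 (h Q d).2
      exact (this.2 j (by simpa using h1) (by simpa [recode] using h2)).1 K hk
    · simp at hK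
  · simp only [List.getElem_ofFn]
    exact ht j (by simpa using h1) t h't

end Relation

/-! #### Every execution corresponds to a run of the plaintext machine -/

theorem mem_support_coinLaw {W ec rc : ℕ} (i : Instr) (v : Fin (i.bound + 1)) (t : Blk W ec rc) :
    Coin.ofBlk v t ∈ (coinLaw W ec rc i).support := by
  simp only [coinLaw, PMF.mem_support_map_iff]
  exact ⟨(v, t), by simp [PMF.support_uniformOfFintype], rfl⟩

/-- The coins of the execution are extended to coins of the machine. Trivial tags suffice, since
only the plaintexts of the final state are of interest. -/
theorem exists_lrun_of_mem_support {E : BitCrypto} (hE : E.Correct) {l : ℕ}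
    {g : Party → Bits (E.genCoins l)} {P : Party} {W : ℕ} (pr : Program)
    {st : State (Bits (E.ctLen l))} {a : LState Unit} (h : Rel E l g (fun _ _ => True) st a)
    (hok : ∀ a' ∈ (lrun (E.reCoins l) P W (fun _ _ (_ : Bits (E.encCoins l)) => ()) pr a).support,
      a'.ok) {st' : State (Bits (E.ctLen l))} (hst : st' ∈ (runProgram E l g pr st).support) :
    ∃ a' ∈ (lrun (E.reCoins l) P W (fun _ _ (_ : Bits (E.encCoins l)) => ()) pr a).support,
      Rel E l g (fun _ _ => True) st' a' := by
  induction pr generalizing st a with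
  | nil =>
    simp only [runProgram, PMF.mem_support_pure_iff] at hst
    exact ⟨a, by simp [lrun], hst ▸ h⟩
  | cons i is ih =>
    simp only [runProgram, PMF.mem_support_bind_iff] at hst
    obtain ⟨st₁, h1, h2⟩ := hst
    suffices hs : ∃ y ∈ (coinLaw W (E.encCoins l) (E.reCoins l) i).support,
        (lstep P W (fun _ _ _ => ()) i y a).ok → 
        Rel E l g (fun _ _ => True) st₁ (lstep P W (fun _ _ _ => ()) i y a) by
      obtain ⟨y, hy, hr⟩ := hs
      have hok' : ∀ a' ∈ (lrun (E.reCoins l) P W (fun _ _ (_ : Bits (E.encCoins l)) => ()) is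
          (lstep P W (fun _ _ _ => ()) i y a)).support, a'.ok := fun a' ha' => hok a' (by
        simp only [lrun, PMF.mem_support_bind_iff]; exact ⟨y, hy, ha'⟩)
      obtain ⟨a', ha', hr'⟩ := ih (hr (lrun_ok hok')) hok' h2
      refine ⟨a', ?_, hr'⟩
      simp only [lrun, PMF.mem_support_bind_iff]
      exact ⟨y, hy, ha'⟩
    by_cases hi : i.IsRandom
    · have hok1 : ∀ y ∈ (coinLaw W (E.encCoins l) (E.reCoins l) i).support,
          (lstep P W (fun _ _ _ => ()) i y a).ok := fun y hy => lrun_ok fun a' ha' => hok a' (by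
        simp only [lrun, PMF.mem_support_bind_iff]; exact ⟨y, hy, ha'⟩)
      cases i with
      | coin Q d b =>
        simp only [exec_coin, PMF.mem_support_map_iff] at h1
        obtain ⟨v, -, rfl⟩ := h1
        exact ⟨_, mem_support_coinLaw (.coin Q d b) v (fun _ _ => false, fun _ _ => false),
          fun _ => h.coin Q d b (Coin.ofBlk v _) _⟩
      | enc Q K w d s =>
        simp only [Instr.exec, PMF.mem_support_map_iff] at h1
        obtain ⟨r, -, rfl⟩ := h1
        -- The machine draws coins for `W` bits. Those beyond the first `w` are not read, and here
        -- they are zero.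
        refine ⟨_, mem_support_coinLaw (.enc Q K w d s) 0
          (fun j => if h : j < w then r ⟨j, h⟩ else fun _ => false, fun _ _ => false), fun hw => ?_⟩
        have hw : w ≤ W := hw.2
        have := h.enc Q K w d s (P := P) (W := W) (mk := fun _ _ _ => ()) (fun _ _ => trivial)
          (Coin.ofBlk (W := W) 0 (fun j => if h : j < w then r ⟨j, h⟩ else fun _ => false,
            fun _ _ => false)) (flat (List.ofFn r))
        convert this using 6
        rotate_left
        · rfl
        rename_i j
        simp [Coin.ofBlk, j.2, lt_of_lt_of_le j.2 hw]
      | reenc Q K d =>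
        simp only [Instr.exec, PMF.mem_support_map_iff] at h1
        obtain ⟨r, -, rfl⟩ := h1
        refine ⟨_, mem_support_coinLaw (.reenc Q K d) 0
          (fun _ _ => false, fun j => if h : j < (st.mem Q d).ct.length then r ⟨j, h⟩ else
            fun _ => false), fun hw => ?_⟩
        refine ((h.setCt ?_ Q d).see _ _ _ _ _).assume _
        have := h.reenc_ct Q K d
          (fun j => if h : j < (st.mem Q d).ct.length then r ⟨j, h⟩ else fun _ => false)
          (freshTags (ec := E.encCoins l) (fun _ _ _ => ()) P Q K (recode K (a.mem Q d).ct)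
            fun _ => fun _ => false)
          (fun _ _ _ _ => trivial)
        simpa [Coin.ofBlk] using this
      | _ => exact absurd hi id
    · rw [exec_eq_pure E l g hi, PMF.mem_support_pure_iff] at h1
      obtain ⟨y, hy⟩ := (coinLaw W (E.encCoins l) (E.reCoins l) i).support_nonempty
      exact ⟨y, hy, fun hok => h1 ▸ h.step hE hi hok⟩

/-! ### Hybrid arguments -/

/-- The bit string of a view. -/
def realize {n : ℕ} (v : List (Bool ⊕ Bits n)) : List Bool :=
  v.flatMap (Sum.elim (fun b => [b]) List.ofFn)

theorem realize_append {n : ℕ} (u v : List (Bool ⊕ Bits n)) :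
    realize (u ++ v) = realize u ++ realize v := by simp [realize]

theorem realize_inl {n : ℕ} (u : List Bool) : realize (u.map .inl : List (Bool ⊕ Bits n)) = u := by
  induction u with
  | nil => rfl
  | cons b u ih => simpa [realize] using ih

theorem realize_coinStr {n c : ℕ} (w : ℕ) (r : ℕ → Bits c) :
    realize (coinStr w r : List (Bool ⊕ Bits n)) = flat (List.ofFn fun j : Fin w => r j) := by
  have : (coinStr w r : List (Bool ⊕ Bits n)) =
      ((List.range w).flatMap fun j => List.ofFn (r j)).map .inl := by
    simp [coinStr, List.map_flatMap]
  rw [this, realize_inl, flat, List.ofFn_eq_map, List.flatMap_map, ← List.map_coe_finRange_eq_range,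
    List.flatMap_map]

theorem LState.see_of_ne {C : Type} {P Q : Party} (h : Q ≠ P) (a : LState C)
    (v : List (Bool ⊕ C)) : a.see P Q v = a := by simp [LState.see, h]

/-- Put a symbol in the place of the unknown one. -/
def fill {C : Type} (c : C) (v : List (Bool ⊕ Option C)) : List (Bool ⊕ C) :=
  v.map (Sum.map id fun o => o.getD c)

/-- The machine treats the symbols for ciphertexts as black boxes. -/
theorem exists_view_law {C : Type} {ec : ℕ} (rc : ℕ) (P : Party) (W : ℕ)
    (mk : Party → Bool → Bits ec → C) (pr : Program) (a : LState C) (Q : Party) (d : Reg)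
    (tag : ℕ → C) (xs : List (LBit C)) (t : ℕ) (p : Prop) :
    ∃ μ : PMF (List (Bool ⊕ Option C)), ∀ c,
      (lrun rc P W mk pr ((a.setCt Q d (retag (fun j => some (Function.update tag t c j)) xs)).assume
        p)).map LState.view = μ.map (fill c) := by
  -- The run is carried out with one more symbol, `none`, in position `t`. By naturality, filling in
  -- `c` afterwards is the same as having started with `c`; so the law of the unfilled view is the
  -- required `μ`.
  let a0 : LState (Option C) := ((a.map some).setCt Q d
    (retag (fun j => some (if j = t then none else some (tag j))) (xs.map (LBit.map some)))).assume p
  refine ⟨(lrun rc P W (fun K b r => some (mk K b r)) pr a0).map LState.view, fun c => ?_⟩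
  have hid : ∀ x : LBit C, LBit.map (fun o : Option C => o.getD c) (LBit.map some x) = x := by
    intro x
    obtain ⟨k, b, t⟩ := x
    cases t <;> rfl
  have hmap : a0.map (fun o => o.getD c) =
      (a.setCt Q d (retag (fun j => some (Function.update tag t c j)) xs)).assume p := by
    simp only [a0, LState.map_assume, LState.map_setCt, map_retag, List.map_map]
    congr 1
    congr 1
    · simp only [LState.map, Cell.map, List.map_map]
      obtain ⟨mem, view, ok⟩ := a
      simp only [LState.mk.injEq, and_true]
      constructor
      · funext P r
        have : (LBit.map (fun o : Option C => o.getD c) ∘ LBit.map some) = id := funext hid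
        rw [this]
        simp
      · have : (Sum.map id (fun o : Option C => o.getD c) ∘ Sum.map (id : Bool → Bool) some) = id := by
          funext x; cases x <;> rfl
        rw [this]
        simp
    · congr 1
      · funext j
        by_cases h : j = t <;> simp [h]
      · have : (LBit.map (fun o : Option C => o.getD c) ∘ LBit.map some) = id := funext hid
        rw [this]
        simp
  rw [← hmap, PMF.map_comp]
  have := lrun_map (rc := rc) P W (fun K b r => some (mk K b r)) (fun o : Option C => o.getD c) pr a0
  simp only [Option.getD_some] at this
  rw [← this, PMF.map_comp]
  rfl

/-- The encryption coins are drawn innermost, because they are what the hybrid arguments exchange.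
-/
theorem expect_coinLaw {W ec rc : ℕ} (i : Instr) (F : Coin ec rc → ENNReal) :
    expect (coinLaw W ec rc i) F = expect (unif (Fin (i.bound + 1))) fun v =>
      expect (unif (Fin W → Bits rc)) fun r => expect (unif (Fin W → Bits ec)) fun e =>
        F (Coin.ofBlk v (e, r)) := by
  rw [coinLaw, expect_map, expect_unif_prod]
  refine expect_congr _ fun v _ => ?_
  rw [expect_unif_prod, expect_comm]

theorem expect_restrict {R : Type} [Fintype R] [Nonempty R] {n W : ℕ} (h : n ≤ W)
    (F : (Fin n → R) → ENNReal) :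
    expect (unif (Fin n → R)) F =
      expect (unif (Fin W → R)) fun r => F fun j => r (Fin.castLE h j) :=
  (expect_unif_comp (Fin.castLE h) (Fin.castLE_injective h) F).symm

section Reencryption

variable {E : BitCrypto} {l : ℕ} {g : Party → Bits (E.genCoins l)} {P : Party} {W : ℕ}

/-- Encryption, as a way to produce symbols for ciphertexts. -/
def encWith (E : BitCrypto) (l : ℕ) (g : Party → Bits (E.genCoins l)) (K : Party) (b : Bool)
    (r : Bits (E.encCoins l)) : Bits (E.ctLen l) := E.enc l (E.genPk l (g K)) b r

/-- Here tags are equal to the ciphertexts. A message to `P` is legal only if all its bits are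
tagged, so the recorded symbols are exactly the message. -/
theorem Rel.view_step {st : State (Bits (E.ctLen l))}
    {a : LState (Bits (E.ctLen l))}
    (h : Rel E l g Eq st a) (hv : st.view P = realize a.view) {i : Instr} (hi : ¬ i.IsRandom)
    {mk : Party → Bool → Bits (E.encCoins l) → Bits (E.ctLen l)}
    {y : Coin (E.encCoins l) (E.reCoins l)} (hok : (lstep P W mk i y a).ok) :
    (i.det E l g st).view P = realize (lstep P W mk i y a).view := by
  have hsee : ∀ (v : List (Bool ⊕ Bits (E.ctLen l))) Q u, u = realize v →
      Function.update st.view Q (st.view Q ++ u) P =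
        realize (if Q = P then a.view ++ v else a.view) := by
    intro v Q u hu
    by_cases hQ : Q = P
    · subst hQ; simp [hv, hu, realize_append]
    · simp [hQ, Ne.symm hQ, hv]
  cases i with
  | load Q d arr i =>
    simp only [Instr.det, lstep, (h Q i).1]
    cases arr[(a.mem Q i).val]? <;> exact hv
  | store Q arr i s =>
    simp only [Instr.det, lstep, (h Q i).1]
    cases arr[(a.mem Q i).val]? <;> exact hv
  | coin => exact absurd trivial hi
  | enc => exact absurd trivial hi
  | reenc => exact absurd trivial hi
  | sendCt Q d s =>
    by_cases hQ : Q.other = P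
    · refine hsee _ _ _ ?_
      have h1 := hok.2 hQ
      have h2 := (h Q s).2
      generalize (st.mem Q s).ct = cs at h2
      generalize (a.mem Q s).ct = xs at h1 h2
      induction h2 with
      | nil => rfl
      | @cons c x cs xs hx _ ih =>
        obtain ⟨t, ht⟩ := Option.isSome_iff_exists.1 (h1 x (by simp))
        have := hx.2 t ht
        subst this
        have ih := ih fun y hy => h1 y (by simp [hy])
        simp only [flat, List.flatMap_cons] at ih ⊢
        rw [ih]
        simp [realize, ht]
    · simp [Instr.det, lstep, LState.assume, LState.see, hQ, State.see, Ne.symm hQ, LState.setCt,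
        State.setCt, State.put, LState.put, hv]
  | sendVal Q w d s =>
    refine hsee _ _ _ ?_
    rw [realize_inl, (h Q s).1]
  | _ => exact hv

/-- Execution and machine are coupled through common coins. They differ only where the other party
re-encrypts: the machine then records a fresh encryption. At most `W` ciphertexts are exchanged at
each instruction, each at the cost `ε`, and the future view depends on the exchanged ciphertext only
through its occurrences in the view. -/
theorem near_real_lrun (hE : E.Correct) (D : List Bool → Bool) {ε : ENNReal}
    (hε : ∀ K b c, E.IsCt l (E.genPk l (g K)) b c → ∀ v : List (Bool ⊕ Option (Bits (E.ctLen l))),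
      Near (expect (unif (Bits (E.reCoins l))) fun r =>
          ind (D (realize (fill (E.reenc l (E.genPk l (g K)) c r) v))))
        (expect (unif (Bits (E.encCoins l))) fun r => ind (D (realize (fill (encWith E l g K b r) v))))
        ε)
    (pr : Program) {st : State (Bits (E.ctLen l))} {a : LState (Bits (E.ctLen l))}
    (h : Rel E l g Eq st a) (hv : st.view P = realize a.view)
    (hok : ∀ a' ∈ (lrun (E.reCoins l) P W (fun _ _ (_ : Bits (E.encCoins l)) => ()) pr
      (a.map fun _ => ())).support, a'.ok) :
    Near (expect (runProgram E l g pr st) fun s => ind (D (s.view P)))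
      (expect (lrun (E.reCoins l) P W (encWith E l g) pr a) fun b => ind (D (realize b.view)))
      (pr.length * (W * ε)) := by
  induction pr generalizing st a with
  | nil =>
    simp only [runProgram, lrun, expect_pure, hv]
    exact Near.of_eq rfl _
  | cons i is ih =>
    have hok1 : ∀ y ∈ (coinLaw W (E.encCoins l) (E.reCoins l) i).support,
        ∀ a' ∈ (lrun (E.reCoins l) P W (fun _ _ (_ : Bits (E.encCoins l)) => ()) is
          ((lstep P W (encWith E l g) i y a).map fun _ => ())).support, a'.ok := by
      intro y hy a' ha'
      refine hok a' ?_
      rw [lstep_map] at ha'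
      simp only [lrun, PMF.mem_support_bind_iff]
      exact ⟨y, hy, ha'⟩
    have hok2 : ∀ y ∈ (coinLaw W (E.encCoins l) (E.reCoins l) i).support,
        (lstep P W (encWith E l g) i y a).ok := fun y hy => by
      have := lrun_ok (hok1 y hy)
      exact this
    have hadd : (is.length : ENNReal) * (W * ε) + W * ε = ((i :: is).length : ℕ) * (W * ε) := by
      push_cast [List.length_cons]; ring
    rw [← hadd]
    simp only [runProgram, lrun, expect_bind]
    by_cases hi : i.IsRandom
    · cases i with
      | coin Q d b =>
        rw [exec_coin, expect_map, expect_coinLaw]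
        refine (Near.expect _ fun v _ => ?_).mono le_self_add
        rw [expect_comm]
        have : ∀ x : ENNReal, x = expect (unif (Fin W → Bits (E.encCoins l))) fun _ =>
          expect (unif (Fin W → Bits (E.reCoins l))) fun _ => x := fun x => by
          simp only [expect_const]
        rw [this (expect (runProgram E l g is _) _)]
        refine Near.expect _ fun e _ => Near.expect _ fun r _ => ?_
        refine ih (h.coin Q d b (Coin.ofBlk v (e, r)) _) ?_
          (hok1 _ (mem_support_coinLaw (.coin Q d b) v (e, r)))
        by_cases hQ : Q = P
        · subst hQ
          simp [State.see, State.setVal, State.put, lstep, LState.see, LState.setVal, LState.put,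
            realize_append, realize_inl, hv, Coin.ofBlk]
        · simp [State.see, State.setVal, State.put, lstep, LState.see, LState.setVal, LState.put,
            hv, hQ, Ne.symm hQ]
      | enc Q K w d s =>
        have hw : w ≤ W := (hok2 _ (mem_support_coinLaw (.enc Q K w d s) 0
          (fun _ _ => false, fun _ _ => false))).2
        simp only [Instr.exec]
        rw [expect_map, expect_coinLaw, expect_restrict hw]
        have : ∀ x : ENNReal, x = expect (unif (Fin ((Instr.enc Q K w d s).bound + 1))) fun _ =>
          expect (unif (Fin W → Bits (E.reCoins l))) fun _ => x := fun x => by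
          simp only [expect_const]
        rw [this (expect (unif _) _)]
        refine Near.expect _ fun v _ => Near.expect _ fun r _ => ?_
        refine (Near.expect _ fun e _ => ?_).mono le_self_add
        have hj : ∀ j : Fin w, (Coin.ofBlk v (e, r)).enc j = e (Fin.castLE hw j) := by
          intro j
          simp [Coin.ofBlk, lt_of_lt_of_le j.2 hw]
          rfl
        have hr := h.enc Q K w d s (P := P) (W := W) (mk := encWith E l g) (fun _ _ => rfl)
          (Coin.ofBlk v (e, r)) (flat (List.ofFn fun j => e (Fin.castLE hw j)))
        simp only [hj] at hr
        refine ih hr ?_ (hok1 _ (mem_support_coinLaw (.enc Q K w d s) v (e, r)))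
        by_cases hQ : Q = P
        · subst hQ
          simp only [State.see, State.setCt, State.put, lstep, LState.see, LState.setCt, LState.put,
            realize_append, realize_coinStr, hv, hj, LState.assume, if_true, Function.update_self]
        · simp [State.see, State.setCt, State.put, lstep, LState.see, LState.setCt, LState.put,
            hv, hQ, Ne.symm hQ, LState.assume]
      | reenc Q K d =>
        obtain ⟨hw, hk⟩ := (hok2 _ (mem_support_coinLaw (.reenc Q K d) 0
          (fun _ _ => false, fun _ _ => false))).2
        have hl : (st.mem Q d).ct.length = (a.mem Q d).ct.length := (h Q d).2.length_eq
        have hw' : (st.mem Q d).ct.length ≤ W := hl.trans_le hw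
        simp only [Instr.exec]
        rw [expect_map, expect_coinLaw]
        have : ∀ x : ENNReal, x = expect (unif (Fin ((Instr.reenc Q K d).bound + 1))) fun _ => x :=
          fun x => by simp only [expect_const]
        rw [this (expect (unif _) _)]
        refine Near.expect _ fun v _ => ?_
        -- A re-encryption by `P` shows its coins, which are matched literally and without error. A
        -- re-encryption by the other party is where the laws differ.
        by_cases hQ : Q = P
        · subst hQ
          rw [expect_restrict hw']
          refine (Near.expect _ fun r _ => ?_).mono le_self_add
          rw [← expect_const (unif (Fin W → Bits (E.encCoins l))) (expect (runProgram E l g is _) _)]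
          refine Near.expect _ fun e _ => ?_
          have hj : ∀ j : Fin (st.mem Q d).ct.length,
              (Coin.ofBlk v (e, r)).re j = r (Fin.castLE hw' j) := by
            intro j
            simp [Coin.ofBlk, lt_of_lt_of_le j.2 hw']
            rfl
          have hr := h.reenc_ct Q K d (Coin.ofBlk v (e, r)).re
            (freshTags (encWith E l g) Q Q K (recode K (a.mem Q d).ct) (Coin.ofBlk v (e, r)).enc)
            (by intro j _ t ht; simp [freshTags] at ht)
          simp only [hj] at hr
          refine ih (((h.setCt hr Q d).see _ _ _ _ _).assume _) ?_
            (hok1 _ (mem_support_coinLaw (.reenc Q K d) v (e, r)))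
          have hcs : realize (coinStr (a.mem Q d).ct.length (Coin.ofBlk v (e, r)).re :
              List (Bool ⊕ Bits (E.ctLen l))) = flat (List.ofFn fun j => r (Fin.castLE hw' j)) := by
            rw [← hl, realize_coinStr]; simp only [hj]
          simp only [State.see, State.setCt, State.put, lstep, LState.see, LState.setCt, LState.put,
            realize_append, hcs, hv, LState.assume, if_true, Function.update_self]
        · have hP : ∀ (s : State (Bits (E.ctLen l))) u, (s.see Q u).view P = s.view P := by
            intro s u; simp [State.see, Ne.symm hQ]
          let n := (st.mem Q d).ct.length
          let xs : List (LBit (Bits (E.ctLen l))) := recode K (a.mem Q d).ct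
          have hxs : xs.length = n := by simp [xs, recode, n, hl]
          let p : Prop := (a.mem Q d).ct.length ≤ W ∧ ∀ x ∈ (a.mem Q d).ct, x.key = some K
          let Y : (ℕ → Bits (E.ctLen l)) → ENNReal := fun tag =>
            expect (lrun (E.reCoins l) P W (encWith E l g) is
              ((a.setCt Q d (retag (fun j => some (tag j)) xs)).assume p))
                fun b => ind (D (realize b.view))
          let f : ℕ → Bits (E.reCoins l) → Bits (E.ctLen l) := fun t r =>
            E.reenc l (E.genPk l (g K)) ((st.mem Q d).ct.getD t fun _ => false) r
          let f' : ℕ → Bits (E.encCoins l) → Bits (E.ctLen l) := fun t r =>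
            encWith E l g K ((xs[t]?.map LBit.bit).getD false) r
          let z : ℕ → Bits (E.ctLen l) := fun _ _ => false
          -- The induction hypothesis compares the remaining execution with a run whose tags are the
          -- actual re-encryptions.
          have step1 : Near
              (expect (unif (Fin n → Bits (E.reCoins l))) fun r => expect (runProgram E l g is
                ((st.setCt Q d (List.ofFn fun j => E.reenc l (E.genPk l (g K))
                  ((st.mem Q d).ct.get j) (r j))).see Q (flat (List.ofFn r))))
                    fun s => ind (D (s.view P)))
              (expect (unif (Fin n → Bits (E.reCoins l))) fun r =>
                Y fun t => if ht : t < n then f t (r ⟨t, ht⟩) else z t)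
              (is.length * (W * ε)) := by
            refine Near.expect _ fun r _ => ?_
            have hr := h.reenc_ct Q K d (fun j => if hj : j < n then r ⟨j, hj⟩ else fun _ => false)
              (fun j => some (if ht : j < n then f j (r ⟨j, ht⟩) else z j)) (by
                intro j hj t ht
                simp only [Option.some.injEq] at ht
                subst ht
                simp [n, hj, f])
            simp only [n, Fin.is_lt, dif_pos, Fin.eta] at hr
            refine ih (((h.setCt hr Q d).see P P Q _ []).assume p) ?_ ?_
            · rw [hP]
              exact hv
            · have := hok1 _ (mem_support_coinLaw (.reenc Q K d) 0
                (fun _ _ => false, fun _ _ => false))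
              have heq : ((a.setCt Q d (retag (fun j => some (if ht : j < n then
                    f j (r ⟨j, ht⟩) else z j)) xs)).assume p).map (fun _ => ()) =
                  (lstep P W (encWith E l g) (.reenc Q K d) (Coin.ofBlk (W := W) (rc := E.reCoins l) 0
                    (fun _ _ => false, fun _ _ => false)) a).map fun _ => () := by
                simp only [lstep, LState.see_of_ne hQ, LState.map_assume, LState.map_setCt,
                  map_retag]
                refine congrArg (fun c => LState.assume (LState.setCt _ Q d c) p)
                  (retag_congr fun j hj => ?_)
                rw [List.length_map] at hj
                have : xs[j]? = some xs[j] := List.getElem?_eq_getElem hj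
                simp only [freshTags, hQ, if_false]
                change _ = Option.map _ (Option.map _ xs[j]?)
                rw [this]; rfl
              rw [heq]; exact this
          -- The tags are exchanged for fresh encryptions of the same bits, one position after the
          -- other. For a single position, `exists_view_law` reduces the comparison to a fixed view
          -- with holes, where `hε` applies.
          have step2 : Near
              (expect (unif (Fin n → Bits (E.reCoins l))) fun r =>
                Y fun t => if ht : t < n then f t (r ⟨t, ht⟩) else z t)
              (expect (unif (Fin n → Bits (E.encCoins l))) fun r =>
                Y fun t => if ht : t < n then f' t (r ⟨t, ht⟩) else z t)
              (n * ε) := by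
            refine near_vector f f' Y ε n (fun t ht tag => ?_) z
            obtain ⟨μ, hμ⟩ := exists_view_law (E.reCoins l) P W (encWith E l g) is a Q d tag xs t p
            have hY : ∀ c, Y (Function.update tag t c) =
                expect μ fun v => ind (D (realize (fill c v))) := by
              intro c
              rw [← expect_map μ (fill c) fun v => ind (D (realize v)), ← hμ c, expect_map]
            simp only [hY]
            rw [expect_comm, expect_comm (unif (Bits (E.encCoins l)))]
            refine Near.expect _ fun v _ => ?_
            have htx : t < xs.length := hxs ▸ ht
            have hta : t < (a.mem Q d).ct.length := hl ▸ ht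
            have hb : (xs[t]?.map LBit.bit).getD false = ((a.mem Q d).ct[t]).bit := by
              rw [List.getElem?_eq_getElem htx]
              simp [xs, recode]
            have hc : (st.mem Q d).ct.getD t (fun _ => false) = (st.mem Q d).ct[t] := by
              simp [List.getD, List.getElem?_eq_getElem (show t < (st.mem Q d).ct.length from ht)]
            simp only [f, f', hb, hc]
            exact hε K _ _ (((List.forall₂_iff_get.1 (h Q d).2).2 t ht hta).1 K
              (hk _ (List.getElem_mem hta))) v
          -- This is the law that the machine itself uses: the coins for re-encryption and those
          -- beyond the first `n` bits play no role.
          have step3 : (expect (unif (Fin W → Bits (E.reCoins l))) fun r =>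
                expect (unif (Fin W → Bits (E.encCoins l))) fun e =>
                expect (lrun (E.reCoins l) P W (encWith E l g) is
                  (lstep P W (encWith E l g) (.reenc Q K d) (Coin.ofBlk v (e, r)) a))
                    fun b => ind (D (realize b.view))) =
              expect (unif (Fin n → Bits (E.encCoins l))) fun r =>
                Y fun t => if ht : t < n then f' t (r ⟨t, ht⟩) else z t := by
            rw [← expect_const (unif (Fin W → Bits (E.reCoins l)))
              (expect (unif (Fin n → Bits (E.encCoins l))) _)]
            refine expect_congr _ fun r _ => ?_
            rw [expect_restrict (show n ≤ W from hw')]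
            refine expect_congr _ fun e _ => ?_
            refine congrArg (fun s => expect (lrun (E.reCoins l) P W (encWith E l g) is s) _) ?_
            simp only [lstep, LState.see_of_ne hQ]
            refine congrArg (fun c => LState.assume (LState.setCt _ Q d c) p)
              (retag_congr fun j hj => ?_)
            have hj' : j < n := by
              have : (recode K (a.mem Q d).ct).length = n := hxs
              rwa [this] at hj
            simp only [freshTags, hQ, if_false, hj', dif_pos, f', xs,
              List.getElem?_eq_getElem hj, Option.map_some, Option.getD_some]
            simp [Coin.ofBlk, lt_of_lt_of_le hj' hw', Fin.castLE]
          rw [step3]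
          refine (step1.trans step2).mono ?_
          gcongr
      | _ => exact absurd hi id
    · rw [exec_eq_pure E l g hi, expect_pure,
        ← expect_const (coinLaw W (E.encCoins l) (E.reCoins l) i)
          (expect (runProgram E l g is (i.det E l g st)) _)]
      refine (Near.expect _ fun y hy => ?_).mono le_self_add
      exact ih (h.step hE hi (hok2 y hy)) (h.view_step hv hi (hok2 y hy)) (hok1 y hy)

end Reencryption

/-- A symbol for an encryption: the key, the plaintext and the coins. -/
abbrev SymCt (ec : ℕ) : Type := Party × Bool × Bits ec

def symCt {ec : ℕ} (K : Party) (b : Bool) (r : Bits ec) : SymCt ec := (K, b, r)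

/-- Encryptions with the key of the other party are replaced by encryptions of `0`. -/
def hideCt {ec : ℕ} (P K : Party) (b : Bool) (r : Bits ec) : SymCt ec :=
  (K, if K = P then b else false, r)

theorem Party.eq_other_of_ne {K P : Party} (h : K ≠ P) : K = P.other := by
  cases K <;> cases P <;> simp_all [Party.other]

/-- The two symbols coincide unless the bit is `1` and the key is that of the other party. In that
case the position is treated as a hole in the view and `hε` applies. -/
theorem near_hide_step {ec rc W : ℕ} {P : Party} {G : List (Bool ⊕ SymCt ec) → ENNReal}
    {ε : ENNReal}
    (hε : ∀ v, Near (expect (unif (Bits ec)) fun r => G (fill (P.other, true, r) v))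
      (expect (unif (Bits ec)) fun r => G (fill (P.other, false, r) v)) ε)
    (pr : Program) (a : LState (SymCt ec)) (Q K : Party) (hQ : Q ≠ P) (d : Reg)
    (xs : List (LBit (SymCt ec))) (p : Prop) (hl : xs.length ≤ W) (v : ℕ) (s : Fin W → Bits rc) :
    Near
      (expect (unif (Fin W → Bits ec)) fun e => expect (lrun rc P W (hideCt P) pr
        ((a.setCt Q d (retag (freshTags symCt P Q K xs (Coin.ofBlk v (e, s)).enc) xs)).assume p))
          fun b => G b.view)
      (expect (unif (Fin W → Bits ec)) fun e => expect (lrun rc P W (hideCt P) pr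
        ((a.setCt Q d (retag (freshTags (hideCt P) P Q K xs (Coin.ofBlk v (e, s)).enc) xs)).assume p))
          fun b => G b.view) (W * ε) := by
  let Y : (ℕ → SymCt ec) → ENNReal := fun tag => expect (lrun rc P W (hideCt P) pr
    ((a.setCt Q d (retag (fun j => some (tag j)) xs)).assume p)) fun b => G b.view
  let bit : ℕ → Bool := fun t => (xs[t]?.map LBit.bit).getD false
  have key : ∀ mk : Party → Bool → Bits ec → SymCt ec,
      (expect (unif (Fin W → Bits ec)) fun e => expect (lrun rc P W (hideCt P) pr
        ((a.setCt Q d (retag (freshTags mk P Q K xs (Coin.ofBlk v (e, s)).enc) xs)).assume p))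
          fun b => G b.view) =
      expect (unif (Fin W → Bits ec)) fun e =>
        Y fun t => if ht : t < W then mk K (bit t) (e ⟨t, ht⟩) else (K, false, fun _ => false) := by
    intro mk
    refine expect_congr _ fun e _ => ?_
    refine congrArg (fun c => expect (lrun rc P W (hideCt P) pr ((a.setCt Q d c).assume p)) _) ?_
    refine retag_congr fun j hj => ?_
    have hj' : j < W := by omega
    simp [freshTags, hQ, hj', bit, List.getElem?_eq_getElem hj, Coin.ofBlk]
  rw [key, key]
  refine near_vector (fun t => symCt K (bit t)) (fun t => hideCt P K (bit t)) Y ε W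
    (fun t _ tag => ?_) _
  by_cases hb : hideCt (ec := ec) P K (bit t) = symCt K (bit t)
  · exact Near.of_eq (by rw [hb]) _
  · have hK : K ≠ P := by rintro rfl; exact hb (by funext r; simp [hideCt, symCt])
    have hbt : bit t = true := by
      by_contra h
      exact hb (by funext r; simp only [Bool.not_eq_true] at h; simp [hideCt, symCt, h])
    obtain ⟨μ, hμ⟩ := exists_view_law rc P W (hideCt P) pr a Q d tag xs t p
    have hY : ∀ c, Y (Function.update tag t c) = expect μ fun v => G (fill c v) := by
      intro c
      rw [← expect_map μ (fill c) fun v => G v, ← hμ c, expect_map]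
    simp only [hY]
    rw [expect_comm, expect_comm (unif (Bits ec))]
    refine Near.expect _ fun v _ => ?_
    have := hε v
    rw [← Party.eq_other_of_ne hK] at this
    simpa [symCt, hideCt, hbt, hK] using this

/-- Symbols contain the coins but not the keys, so the whole run is independent of the keys. The
test `G` may therefore include the generation of the other party's keys, as the definition of
ciphertext indistinguishability requires. -/
theorem near_lrun_hide {ec rc W : ℕ} {P : Party} {G : List (Bool ⊕ SymCt ec) → ENNReal}
    {ε : ENNReal}
    (hε : ∀ v, Near (expect (unif (Bits ec)) fun r => G (fill (P.other, true, r) v))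
      (expect (unif (Bits ec)) fun r => G (fill (P.other, false, r) v)) ε)
    (pr : Program) (a : LState (SymCt ec))
    (hok : ∀ a' ∈ (lrun rc P W (fun _ _ (_ : Bits ec) => ()) pr (a.map fun _ => ())).support,
      a'.ok) :
    Near (expect (lrun rc P W symCt pr a) fun b => G b.view)
      (expect (lrun rc P W (hideCt P) pr a) fun b => G b.view) (pr.length * (W * ε)) := by
  induction pr generalizing a with
  | nil => exact Near.of_eq rfl _
  | cons i is ih =>
    have hok1 : ∀ y ∈ (coinLaw W ec rc i).support,
        ∀ a' ∈ (lrun rc P W (fun _ _ (_ : Bits ec) => ()) is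
          ((lstep P W symCt i y a).map fun _ => ())).support, a'.ok := by
      intro y hy a' ha'
      refine hok a' ?_
      rw [lstep_map] at ha'
      simp only [lrun, PMF.mem_support_bind_iff]
      exact ⟨y, hy, ha'⟩
    have hok2 : ∀ y ∈ (coinLaw W ec rc i).support, (lstep P W symCt i y a).ok := fun y hy => by
      have := lrun_ok (hok1 y hy)
      exact this
    have hadd : (is.length : ENNReal) * (W * ε) + W * ε = ((i :: is).length : ℕ) * (W * ε) := by
      push_cast [List.length_cons]; ring
    rw [← hadd]
    simp only [lrun, expect_bind]
    refine (Near.expect _ fun y hy => ih _ (hok1 y hy)).trans ?_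
    rw [expect_coinLaw, expect_coinLaw]
    refine Near.expect _ fun v _ => Near.expect _ fun s _ => ?_
    cases i with
    | enc Q K w d s =>
      by_cases hQ : Q = P
      · refine Near.of_eq (expect_congr _ fun e _ => ?_) _
        congr 2
        simp only [lstep]
        congr 4
        funext j
        simp [freshTags, hQ]
      · have hw := (hok2 _ (mem_support_coinLaw (.enc Q K w d s) 0
          (fun _ _ => false, fun _ _ => false))).2
        simp only [lstep, LState.see_of_ne hQ]
        exact near_hide_step hε is a Q K hQ d _ _ (by simpa [encBits] using hw) v _
    | reenc Q K d =>
      by_cases hQ : Q = P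
      · refine Near.of_eq (expect_congr _ fun e _ => ?_) _
        congr 2
        simp only [lstep]
        congr 4
        funext j
        simp [freshTags, hQ]
      · have hw := (hok2 _ (mem_support_coinLaw (.reenc Q K d) 0
          (fun _ _ => false, fun _ _ => false))).2.1
        simp only [lstep, LState.see_of_ne hQ]
        exact near_hide_step hε is a Q K hQ d _ _ (by simpa [recode] using hw) v _
    | _ => exact Near.of_eq rfl _

/-! ### Labelled programs and tapes -/

/-- Labels of instructions: number of the phase, indices of the loops, line. -/
abbrev Label : Type := ℕ × ℕ × ℕ × ℕ

abbrev LProg : Type := List (Label × Instr)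

/-- A block of instructions, labelled by their lines. -/
def blk (c i h : ℕ) (body : Program) : LProg :=
  body.zipIdx.map fun x => ((c, i, h, x.2), x.1)

/-- A piece of program without random coins. -/
def quiet (body : Program) : LProg := body.map fun x => ((0, 0, 0, 0), x)

section Run

variable {C : Type} {ec rc : ℕ} (P : Party) (W : ℕ) (mk : Party → Bool → Bits ec → C)
  (τ : Label → Coin ec rc)

/-- The run with given coins. -/
def drun (lp : LProg) (a : LState C) : LState C :=
  lp.foldl (fun a x => lstep P W mk x.2 (τ x.1) a) a

theorem drun_append (p q : LProg) (a : LState C) :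
    drun P W mk τ (p ++ q) a = drun P W mk τ q (drun P W mk τ p a) := by
  simp [drun]

/-- A run of a block, from a given line on. -/
def brun (c i h : ℕ) : ℕ → Program → LState C → LState C
  | _, [], a => a
  | n, x :: xs, a => brun c i h (n + 1) xs (lstep P W mk x (τ (c, i, h, n)) a)

theorem drun_blk (c i h : ℕ) (body : Program) (a : LState C) :
    drun P W mk τ (blk c i h body) a = brun P W mk τ c i h 0 body a := by
  have : ∀ n (a : LState C), List.foldl (fun a (x : Label × Instr) => lstep P W mk x.2 (τ x.1) a) a
      ((body.zipIdx n).map fun x => ((c, i, h, x.2), x.1)) = brun P W mk τ c i h n body a := by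
    induction body with
    | nil => intro n a; rfl
    | cons x xs ih => intro n a; simp [brun, ih]
  exact this 0 a

/-- A run of a program without random coins. -/
def qrun : Program → LState C → LState C
  | [], a => a
  | x :: xs, a => qrun xs (lstep P W mk x (τ (0, 0, 0, 0)) a)

theorem drun_quiet (body : Program) (a : LState C) :
    drun P W mk τ (quiet body) a = qrun P W mk τ body a := by
  induction body generalizing a with
  | nil => rfl
  | cons x xs ih => exact ih _

/-- `Triple lp Pre Post v`: from legal states with `Pre`, the run of `lp` is legal, leads to a state
with `Post`, and adds `v` to the view. -/
def Triple (lp : LProg) (Pre Post : LState C → Prop) (v : List (Bool ⊕ C)) : Prop :=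
  ∀ a, a.ok → Pre a → (drun P W mk τ lp a).ok ∧ Post (drun P W mk τ lp a) ∧
    (drun P W mk τ lp a).view = a.view ++ v

variable {P W mk τ}

theorem Triple.append {p q : LProg} {Pre Mid Post : LState C → Prop} {u v : List (Bool ⊕ C)}
    (hp : Triple P W mk τ p Pre Mid u) (hq : Triple P W mk τ q Mid Post v) :
    Triple P W mk τ (p ++ q) Pre Post (u ++ v) := by
  intro a ha h
  obtain ⟨h1, h2, h3⟩ := hp a ha h
  obtain ⟨k1, k2, k3⟩ := hq _ h1 h2
  rw [drun_append]
  exact ⟨k1, k2, by rw [k3, h3, List.append_assoc]⟩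

theorem Triple.nil {Pre : LState C → Prop} : Triple P W mk τ [] Pre Pre [] :=
  fun _ ha h => ⟨ha, h, (List.append_nil _).symm⟩

theorem Triple.weaken {p : LProg} {Pre Pre' Post Post' : LState C → Prop} {v : List (Bool ⊕ C)}
    (hp : Triple P W mk τ p Pre Post v) (h : ∀ a, Pre' a → Pre a) (h' : ∀ a, Post a → Post' a) :
    Triple P W mk τ p Pre' Post' v := by
  intro a ha hP
  obtain ⟨h1, h2, h3⟩ := hp a ha (h a hP)
  exact ⟨h1, h' _ h2, h3⟩

theorem Triple.view_eq {p : LProg} {Pre Post : LState C → Prop} {u v : List (Bool ⊕ C)}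
    (hp : Triple P W mk τ p Pre Post u) (h : u = v) : Triple P W mk τ p Pre Post v := h ▸ hp

theorem Triple.loop {n : ℕ} {body : ℕ → LProg} {Inv : ℕ → LState C → Prop}
    {v : ℕ → List (Bool ⊕ C)}
    (h : ∀ i < n, Triple P W mk τ (body i) (Inv i) (Inv (i + 1)) (v i)) :
    Triple P W mk τ ((List.range n).flatMap body) (Inv 0) (Inv n) ((List.range n).flatMap v) := by
  induction n with
  | zero => exact .nil
  | succ n ih =>
    simp only [List.range_succ, List.flatMap_append, List.flatMap_singleton]
    exact (ih fun i hi => h i (by omega)).append (h n (by omega))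

theorem Triple.loop₂ {k n : ℕ} {body : ℕ → ℕ → LProg} {Inv : ℕ → ℕ → LState C → Prop}
    {v : ℕ → ℕ → List (Bool ⊕ C)} (hc : ∀ i < k, ∀ a, Inv i n a → Inv (i + 1) 0 a)
    (h : ∀ i < k, ∀ j < n, Triple P W mk τ (body i j) (Inv i j) (Inv i (j + 1)) (v i j)) :
    Triple P W mk τ ((List.range k).flatMap fun i => (List.range n).flatMap (body i))
      (Inv 0 0) (Inv k 0) ((List.range k).flatMap fun i => (List.range n).flatMap (v i)) :=
  Triple.loop (Inv := fun i => Inv i 0) fun i hi =>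
    (Triple.loop (Inv := Inv i) fun j hj => h i hi j hj).weaken (fun _ => id) (hc i hi)

theorem reverse_range_succ (n : ℕ) : (List.range (n + 1)).reverse = n :: (List.range n).reverse := by
  simp [List.range_succ]

/-- A loop that counts down; `Inv i` holds when the steps from `i` on have been made. -/
theorem Triple.loopDown {n : ℕ} {body : ℕ → LProg} {Inv : ℕ → LState C → Prop}
    {v : ℕ → List (Bool ⊕ C)}
    (h : ∀ i < n, Triple P W mk τ (body i) (Inv (i + 1)) (Inv i) (v i)) :
    Triple P W mk τ ((List.range n).reverse.flatMap body) (Inv n) (Inv 0)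
      ((List.range n).reverse.flatMap v) := by
  induction n with
  | zero => exact .nil
  | succ n ih =>
    simp only [reverse_range_succ, List.flatMap_cons]
    exact (h n (by omega)).append (ih fun i hi => h i (by omega))

end Run

/-! ### Encrypted integers in the plaintext machine -/

/-- `xs` is an encryption of the `w` lowest bits of `v` with the key of `K`. -/
def IsEnc {C : Type} (K : Party) (w v : ℕ) (xs : List (LBit C)) : Prop :=
  List.Forall₂ (fun x b => x.key = some K ∧ x.bit = b) xs (natBits w v)

namespace IsEnc

variable {C : Type} {K : Party} {w w' u v : ℕ} {xs ys zs : List (LBit C)}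

theorem length (h : IsEnc K w v xs) : xs.length = w := by
  have := List.Forall₂.length_eq h
  simpa using this

theorem key (h : IsEnc K w v xs) : ∀ x ∈ xs, x.key = some K := by
  unfold IsEnc at h
  generalize natBits w v = bs at h
  induction h with
  | nil => simp
  | cons hx _ ih =>
    intro y hy
    rcases List.mem_cons.1 hy with rfl | hy
    · exact hx.1
    · exact ih y hy

theorem bits (h : IsEnc K w v xs) : xs.map LBit.bit = natBits w v := by
  unfold IsEnc at h
  generalize natBits w v = bs at h
  induction h with
  | nil => rfl
  | cons hx _ ih => rw [List.map_cons, ih, hx.2]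

theorem ofBits (h : IsEnc K w v xs) : ofBits (xs.map LBit.bit) = v % 2 ^ w := by
  rw [h.bits, ofBits_natBits]

theorem congr (h : IsEnc K w u xs) (huv : u % 2 ^ w = v % 2 ^ w) : IsEnc K w v xs := by
  unfold IsEnc at h ⊢
  rwa [← natBits_mod, ← huv, natBits_mod]

theorem of_forall₂ {bs : List Bool}
    (h : List.Forall₂ (fun x b => x.key = some K ∧ x.bit = b) xs bs) :
    IsEnc K bs.length (SecureCWC.ofBits bs) xs := by
  unfold IsEnc; rwa [natBits_ofBits]

theorem homOp (o : HomOp) (hx : IsEnc K w u xs) (hy : IsEnc K w' v ys) :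
    List.Forall₂ (fun x b => x.key = some K ∧ x.bit = b)
      (o.eval (LBit.op Bool.xor K) (LBit.op Bool.and K) xs ys)
      (o.eval Bool.xor Bool.and (natBits w u) (natBits w' v)) :=
  forall₂_homOp (by rintro x _ y _ ⟨h, rfl⟩ ⟨k, rfl⟩; simp [LBit.op, h, k])
    (by rintro x _ y _ ⟨h, rfl⟩ ⟨k, rfl⟩; simp [LBit.op, h, k]) o hx hy

/-- The width is that of the first summand. The second one may be shorter, as when a bit is added to
a weight. -/
theorem add (hx : IsEnc K w u xs) (hy : IsEnc K w' v ys) :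
    IsEnc K w (u + v % 2 ^ w') (HomOp.add.eval (LBit.op Bool.xor K) (LBit.op Bool.and K) xs ys) := by
  have := of_forall₂ (hx.homOp .add hy)
  simp only [HomOp.eval, length_addBits, length_natBits, ofBits_addBits, ofBits_natBits] at this
  exact this.congr (by simp [Nat.add_mod])

theorem add_same (hx : IsEnc K w u xs) (hy : IsEnc K w v ys) :
    IsEnc K w (u + v) (HomOp.add.eval (LBit.op Bool.xor K) (LBit.op Bool.and K) xs ys) :=
  (hx.add hy).congr (by simp [Nat.add_mod])

theorem bit_op {o : HomOp} {f : Bool → Bool → Bool} {b c : Bool} (hx : IsEnc K 1 b.toNat xs)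
    (hy : IsEnc K 1 c.toNat ys)
    (ho : ∀ b c : Bool, o.eval Bool.xor Bool.and [b] [c] = [f b c]) :
    IsEnc K 1 (f b c).toNat (o.eval (LBit.op Bool.xor K) (LBit.op Bool.and K) xs ys) := by
  have hb : ∀ b : Bool, natBits 1 b.toNat = [b] := by intro b; cases b <;> rfl
  have := hx.homOp o hy
  rwa [hb, hb, ho, ← hb] at this

theorem xor {b c : Bool} (hx : IsEnc K 1 b.toNat xs) (hy : IsEnc K 1 c.toNat ys) :
    IsEnc K 1 (Bool.xor b c).toNat
      (HomOp.xor.eval (LBit.op Bool.xor K) (LBit.op Bool.and K) xs ys) :=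
  hx.bit_op hy fun _ _ => rfl

theorem and {b c : Bool} (hx : IsEnc K 1 b.toNat xs) (hy : IsEnc K 1 c.toNat ys) :
    IsEnc K 1 (b && c).toNat
      (HomOp.and.eval (LBit.op Bool.xor K) (LBit.op Bool.and K) xs ys) :=
  hx.bit_op hy fun _ _ => rfl

theorem or {b c : Bool} (hx : IsEnc K 1 b.toNat xs) (hy : IsEnc K 1 c.toNat ys) :
    IsEnc K 1 (b || c).toNat
      (HomOp.or.eval (LBit.op Bool.xor K) (LBit.op Bool.and K) xs ys) :=
  hx.bit_op hy fun b c => by cases b <;> cases c <;> rfl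

/-- Positive width is needed because comparing empty lists yields no bit at all. -/
theorem lt (hx : IsEnc K w u xs) (hy : IsEnc K w v ys) (hw : 0 < w) (hu : u < 2 ^ w)
    (hv : v < 2 ^ w) :
    IsEnc K 1 (decide (u < v)).toNat
      (HomOp.lt.eval (LBit.op Bool.xor K) (LBit.op Bool.and K) xs ys) := by
  have := hx.homOp .lt hy
  simp only [HomOp.eval] at this ⊢
  rw [ltBits_eq _ _ (by simp) (by rw [← List.length_pos_iff]; simpa using hw), ofBits_natBits,
    ofBits_natBits, Nat.mod_eq_of_lt hu, Nat.mod_eq_of_lt hv] at this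
  have hb : ∀ b : Bool, natBits 1 b.toNat = [b] := by intro b; cases b <;> rfl
  rwa [IsEnc, hb]

/-- Concatenation makes the second component more significant. Comparison of such integers is
comparison by the second component and then by the first. -/
theorem cat (hx : IsEnc K w u xs) (hy : IsEnc K w' v ys) (hu : u < 2 ^ w) :
    IsEnc K (w + w') (u + 2 ^ w * v)
      (HomOp.cat.eval (LBit.op Bool.xor K) (LBit.op Bool.and K) xs ys) := by
  have := of_forall₂ (hx.homOp .cat hy)
  simp only [HomOp.eval, List.length_append, length_natBits, ofBits_append, ofBits_natBits,
    Nat.mod_eq_of_lt hu] at this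
  refine this.congr ?_
  rw [pow_add, Nat.add_mod, Nat.mul_mod_mul_left, Nat.mod_mod, ← Nat.mul_mod_mul_left,
    ← Nat.add_mod]

theorem mux {c : Bool} (hc : IsEnc K 1 c.toNat zs) (hx : IsEnc K w u xs) (hy : IsEnc K w v ys) :
    IsEnc K w (if c then u else v)
      (muxBits (LBit.op Bool.xor K) (LBit.op Bool.and K) zs xs ys) := by
  have hb : ∀ b : Bool, natBits 1 b.toNat = [b] := by intro b; cases b <;> rfl
  have := forall₂_muxBits (R := fun (x : LBit C) b => x.key = some K ∧ x.bit = b)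
    (xor := LBit.op Bool.xor K) (and := LBit.op Bool.and K) (xor' := Bool.xor) (and' := Bool.and)
    (by rintro x _ y _ ⟨h, rfl⟩ ⟨k, rfl⟩; simp [LBit.op, h, k])
    (by rintro x _ y _ ⟨h, rfl⟩ ⟨k, rfl⟩; simp [LBit.op, h, k]) hc hx hy
  rw [hb, muxBits_eq _ _ _ (by simp)] at this
  cases c <;> exact this

end IsEnc

/-! ### Freshly encrypted and re-encrypted integers. -/

section Sealed

variable {C : Type} {ec : ℕ} (mk : Party → Bool → Bits ec → C)

/-- The ciphertext of an integer, freshly encrypted or re-encrypted by `Q`. -/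
def sealedCt (P Q K : Party) (w v : ℕ) (e : ℕ → Bits ec) : List (LBit C) :=
  retag (freshTags mk P Q K (encBits K w v) e) (encBits K w v)

/-- What a party sees of the ciphertext of an integer. -/
def ctView (K : Party) (w v : ℕ) (e : ℕ → Bits ec) : List (Bool ⊕ C) :=
  (List.range w).map fun j => .inr (mk K (v.testBit j) (e j))

theorem isEnc_encBits (K : Party) (w v : ℕ) : IsEnc K w v (encBits K w v : List (LBit C)) := by
  simp [IsEnc, encBits, natBits, List.forall₂_map_left_iff, List.forall₂_map_right_iff,
    List.forall₂_same]

theorem isEnc_retag {K : Party} {w v : ℕ} {xs : List (LBit C)} (h : IsEnc K w v xs)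
    (tag : ℕ → Option C) : IsEnc K w v (retag tag xs) := by
  unfold IsEnc at h ⊢
  rw [List.forall₂_iff_get] at h ⊢
  refine ⟨by simpa [retag] using h.1, fun j h1 h2 => ?_⟩
  have := h.2 j (by simpa [retag] using h1) h2
  simpa [retag] using this

variable {mk}

theorem isEnc_sealedCt (P Q K : Party) (w v : ℕ) (e : ℕ → Bits ec) :
    IsEnc K w v (sealedCt mk P Q K w v e) := isEnc_retag (isEnc_encBits K w v) _

/-- Apart from its tags, a re-encrypted integer depends on its key, width and value only, not on how
it was computed. -/
theorem recode_eq {K : Party} {w v : ℕ} {xs : List (LBit C)} (h : IsEnc K w v xs) :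
    recode K xs = encBits K w v := by
  refine List.ext_getElem (by simp [recode, encBits, h.length]) fun j h1 h2 => ?_
  unfold IsEnc at h
  rw [List.forall₂_iff_get] at h
  have := h.2 j (by simpa [recode] using h1) (by simpa [encBits] using h2)
  simp only [List.get_eq_getElem] at this
  simp only [recode, encBits, List.getElem_map, List.getElem_range, this.1, this.2]
  simp [natBits]

theorem sealedCt_eq {P Q : Party} (h : Q ≠ P) (K : Party) (w v : ℕ) (e : ℕ → Bits ec) :
    sealedCt mk P Q K w v e =
      (List.range w).map fun j => ⟨some K, v.testBit j, some (mk K (v.testBit j) (e j))⟩ := by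
  refine List.ext_getElem (by simp [sealedCt, retag, encBits]) fun j h1 h2 => ?_
  have hj : j < w := by simpa using h2
  simp [sealedCt, retag, freshTags, encBits, h, hj]

theorem filterMap_sealedCt {P Q : Party} (h : Q ≠ P) (K : Party) (w v : ℕ) (e : ℕ → Bits ec) :
    (sealedCt mk P Q K w v e).filterMap (fun x => x.tag.map (.inr : C → Bool ⊕ C)) =
      ctView mk K w v e := by
  rw [sealedCt_eq h, List.filterMap_map, ctView]
  simp [List.filterMap_eq_map']

theorem isSome_tag_sealedCt {P Q : Party} (h : Q ≠ P) {K : Party} {w v : ℕ} {e : ℕ → Bits ec} :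
    ∀ x ∈ sealedCt mk P Q K w v e, x.tag.isSome := by
  rw [sealedCt_eq h]; simp

end Sealed

theorem Party.other_ne (P : Party) : P.other ≠ P := by cases P <;> simp [Party.other]

/-! ### Reading registers after a step -/

/-- What a party `P` sees of something that `Q` sees. -/
def vis {C : Type} (P Q : Party) (v : List (Bool ⊕ C)) : List (Bool ⊕ C) := if Q = P then v else []

section Steps

variable {C : Type} {ec rc : ℕ} {P : Party} {W : ℕ} {mk : Party → Bool → Bits ec → C}
  {y : Coin ec rc} {a : LState C}

/-- All instructions that write one register are instances. The resulting rules, used as rewriting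
rules, execute a straight block symbolically. -/
theorem mem_put (Q : Party) (d : Reg) (x : Cell (LBit C)) (Q' : Party) (r : Reg) :
    (a.put Q d x).mem Q' r = if Q' = Q ∧ r = d then x else a.mem Q' r := by
  by_cases hQ : Q' = Q
  · subst hQ
    by_cases hr : r = d <;> simp [LState.put, hr]
  · simp [LState.put, hQ]

theorem view_see (Q : Party) (v : List (Bool ⊕ C)) : (a.see P Q v).view = a.view ++ vis P Q v := by
  by_cases h : Q = P <;> simp [LState.see, vis, h]

theorem mem_const (Q d v Q' r) : (lstep P W mk (.const Q d v) y a).mem Q' r =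
    if Q' = Q ∧ r = d then ⟨v, (a.mem Q d).ct⟩ else a.mem Q' r := mem_put ..

theorem mem_sub (Q w d s t Q' r) : (lstep P W mk (.sub Q w d s t) y a).mem Q' r =
    if Q' = Q ∧ r = d then
      ⟨((a.mem Q s).val + 2 ^ w - (a.mem Q t).val % 2 ^ w) % 2 ^ w, (a.mem Q d).ct⟩
    else a.mem Q' r := mem_put ..

theorem mem_move (Q d s Q' r) : (lstep P W mk (.move Q d s) y a).mem Q' r =
    if Q' = Q ∧ r = d then a.mem Q s else a.mem Q' r := mem_put ..

theorem mem_load {Q d k} {f : ℕ → Reg} {i} (h : (a.mem Q i).val < k) (Q' r) :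
    (lstep P W mk (.load Q d ((List.range k).map f) i) y a).mem Q' r =
      if Q' = Q ∧ r = d then a.mem Q (f (a.mem Q i).val) else a.mem Q' r := by
  simp [lstep, h, mem_put]

theorem mem_store {Q s k} {f : ℕ → Reg} {i} (h : (a.mem Q i).val < k) (Q' r) :
    (lstep P W mk (.store Q ((List.range k).map f) i s) y a).mem Q' r =
      if Q' = Q ∧ r = f (a.mem Q i).val then a.mem Q s else a.mem Q' r := by
  simp [lstep, h, mem_put]

theorem mem_coin (Q d b Q' r) : (lstep P W mk (.coin Q d b) y a).mem Q' r =
    if Q' = Q ∧ r = d then ⟨y.int, (a.mem Q d).ct⟩ else a.mem Q' r := mem_put ..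

theorem mem_enc (Q K w d s Q' r) : (lstep P W mk (.enc Q K w d s) y a).mem Q' r =
    if Q' = Q ∧ r = d then ⟨(a.mem Q d).val, sealedCt mk P Q K w (a.mem Q s).val y.enc⟩
    else a.mem Q' r := mem_put ..

theorem mem_dec (Q d s Q' r) : (lstep P W mk (.dec Q d s) y a).mem Q' r =
    if Q' = Q ∧ r = d then ⟨ofBits ((a.mem Q s).ct.map LBit.bit), (a.mem Q d).ct⟩
    else a.mem Q' r := mem_put ..

theorem mem_hom (Q K o d s t Q' r) : (lstep P W mk (.hom Q K o d s t) y a).mem Q' r =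
    if Q' = Q ∧ r = d then ⟨(a.mem Q d).val, HomOp.eval (LBit.op Bool.xor K) (LBit.op Bool.and K) o
      (a.mem Q s).ct (a.mem Q t).ct⟩
    else a.mem Q' r := mem_put ..

theorem mem_mux (Q K d c s t Q' r) : (lstep P W mk (.mux Q K d c s t) y a).mem Q' r =
    if Q' = Q ∧ r = d then ⟨(a.mem Q d).val, muxBits (LBit.op Bool.xor K) (LBit.op Bool.and K)
      (a.mem Q c).ct (a.mem Q s).ct (a.mem Q t).ct⟩
    else a.mem Q' r := mem_put ..

/-- The effect of a re-encryption. -/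
def reseal (mk : Party → Bool → Bits ec → C) (P Q K : Party) (xs : List (LBit C))
    (e : ℕ → Bits ec) : List (LBit C) :=
  retag (freshTags mk P Q K (recode K xs) e) (recode K xs)

theorem reseal_eq {Q K : Party} {w v : ℕ} {xs : List (LBit C)} (h : IsEnc K w v xs)
    (e : ℕ → Bits ec) : reseal mk P Q K xs e = sealedCt mk P Q K w v e := by
  rw [reseal, recode_eq h, sealedCt]

theorem mem_reenc (Q K d Q' r) : (lstep P W mk (.reenc Q K d) y a).mem Q' r =
    if Q' = Q ∧ r = d then ⟨(a.mem Q d).val, reseal mk P Q K (a.mem Q d).ct y.enc⟩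
    else a.mem Q' r := mem_put ..

theorem mem_sendCt (Q d s Q' r) : (lstep P W mk (.sendCt Q d s) y a).mem Q' r =
    if Q' = Q.other ∧ r = d then ⟨(a.mem Q.other d).val, (a.mem Q s).ct⟩ else a.mem Q' r :=
  mem_put ..

theorem mem_sendVal (Q w d s Q' r) : (lstep P W mk (.sendVal Q w d s) y a).mem Q' r =
    if Q' = Q.other ∧ r = d then ⟨(a.mem Q s).val % 2 ^ w, (a.mem Q.other d).ct⟩
    else a.mem Q' r := mem_put ..

/-- The instructions that do not change the view and are always legal. -/
def Instr.IsSilent : Instr → Prop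
  | .const .. | .sub .. | .move .. | .load .. | .store .. | .hom .. | .mux .. => True
  | _ => False

theorem view_silent {i : Instr} (h : i.IsSilent) : (lstep P W mk i y a).view = a.view := by
  cases i with
  | load Q d arr i => simp only [lstep]; split <;> rfl
  | store Q d arr i => simp only [lstep]; split <;> rfl
  | _ => first | rfl | exact absurd h id

theorem ok_silent {i : Instr} (h : i.IsSilent) : (lstep P W mk i y a).ok = a.ok := by
  cases i with
  | load Q d arr i => simp only [lstep]; split <;> rfl
  | store Q d arr i => simp only [lstep]; split <;> rfl
  | _ => first | rfl | exact absurd h id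

theorem view_const (Q d v) : (lstep P W mk (.const Q d v) y a).view = a.view := rfl
theorem view_sub (Q w d s t) : (lstep P W mk (.sub Q w d s t) y a).view = a.view := rfl
theorem view_move (Q d s) : (lstep P W mk (.move Q d s) y a).view = a.view := rfl
theorem view_load (Q d arr i) : (lstep P W mk (.load Q d arr i) y a).view = a.view :=
  view_silent trivial
theorem view_store (Q arr i s) : (lstep P W mk (.store Q arr i s) y a).view = a.view :=
  view_silent trivial
theorem view_hom (Q K o d s t) : (lstep P W mk (.hom Q K o d s t) y a).view = a.view := rfl
theorem view_mux (Q K d c s t) : (lstep P W mk (.mux Q K d c s t) y a).view = a.view := rfl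
theorem view_dec (Q d s) : (lstep P W mk (.dec Q d s) y a).view = a.view := rfl

theorem view_coin (Q d b) : (lstep P W mk (.coin Q d b) y a).view =
    a.view ++ vis P Q ((natBits b.size y.int).map .inl) := view_see ..

theorem view_enc (Q K w d s) : (lstep P W mk (.enc Q K w d s) y a).view =
    a.view ++ vis P Q (coinStr w y.enc) := view_see ..

theorem view_reenc (Q K d) : (lstep P W mk (.reenc Q K d) y a).view =
    a.view ++ vis P Q (coinStr (a.mem Q d).ct.length y.re) := view_see ..

theorem view_sendCt (Q d s) : (lstep P W mk (.sendCt Q d s) y a).view =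
    a.view ++ vis P Q.other ((a.mem Q s).ct.filterMap fun x => x.tag.map .inr) := view_see ..

theorem view_sendVal (Q w d s) : (lstep P W mk (.sendVal Q w d s) y a).view =
    a.view ++ vis P Q.other ((natBits w (a.mem Q s).val).map .inl) := view_see ..

theorem ok_const (Q d v) : (lstep P W mk (.const Q d v) y a).ok = a.ok := rfl
theorem ok_sub (Q w d s t) : (lstep P W mk (.sub Q w d s t) y a).ok = a.ok := rfl
theorem ok_move (Q d s) : (lstep P W mk (.move Q d s) y a).ok = a.ok := rfl
theorem ok_load (Q d arr i) : (lstep P W mk (.load Q d arr i) y a).ok = a.ok := ok_silent trivial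
theorem ok_store (Q arr i s) : (lstep P W mk (.store Q arr i s) y a).ok = a.ok := ok_silent trivial
theorem ok_hom (Q K o d s t) : (lstep P W mk (.hom Q K o d s t) y a).ok = a.ok := rfl
theorem ok_mux (Q K d c s t) : (lstep P W mk (.mux Q K d c s t) y a).ok = a.ok := rfl
theorem ok_coin (Q d b) : (lstep P W mk (.coin Q d b) y a).ok = a.ok := rfl
theorem ok_sendVal (Q w d s) : (lstep P W mk (.sendVal Q w d s) y a).ok = a.ok := rfl

theorem ok_enc (Q K w d s) : (lstep P W mk (.enc Q K w d s) y a).ok = (a.ok ∧ w ≤ W) := rfl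

theorem ok_dec (Q d s) : (lstep P W mk (.dec Q d s) y a).ok =
    (a.ok ∧ ∀ x ∈ (a.mem Q s).ct, x.key = some Q) := rfl

theorem ok_reenc (Q K d) : (lstep P W mk (.reenc Q K d) y a).ok =
    (a.ok ∧ (a.mem Q d).ct.length ≤ W ∧ ∀ x ∈ (a.mem Q d).ct, x.key = some K) := rfl

theorem ok_sendCt (Q d s) : (lstep P W mk (.sendCt Q d s) y a).ok =
    (a.ok ∧ (Q.other = P → ∀ x ∈ (a.mem Q s).ct, x.tag.isSome)) := rfl

/-- If `P` receives the message, then its sender `Q` is not `P`, and all its bits are tagged.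
Otherwise nothing is seen. -/
theorem vis_sealedCt (Q K : Party) (w v : ℕ) (e : ℕ → Bits ec) :
    vis P Q.other ((sealedCt mk P Q K w v e).filterMap fun x => x.tag.map .inr) =
      vis P Q.other (ctView mk K w v e) := by
  by_cases h : Q.other = P
  · have hQ : Q ≠ P := by rintro rfl; exact Party.other_ne _ h
    rw [filterMap_sealedCt hQ]
  · simp [vis, h]

theorem tags_sealedCt (Q K : Party) (w v : ℕ) (e : ℕ → Bits ec) :
    Q.other = P → ∀ x ∈ sealedCt mk P Q K w v e, x.tag.isSome := by
  intro h
  exact isSome_tag_sealedCt (by rintro rfl; exact Party.other_ne _ h)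

end Steps


/-! ### Registers that a program does not change -/

/-- The registers that an instruction may change. -/
def Instr.Writes : Instr → Party → Reg → Prop
  | .const P d _, Q, r | .sub P _ d _ _, Q, r | .move P d _, Q, r | .load P d _ _, Q, r
  | .coin P d _, Q, r | .enc P _ _ d _, Q, r | .dec P d _, Q, r | .hom P _ _ d _ _, Q, r
  | .mux P _ d _ _ _, Q, r | .reenc P _ d, Q, r => Q = P ∧ r = d
  | .store P arr _ _, Q, r => Q = P ∧ r ∈ arr
  | .sendCt P d _, Q, r | .sendVal P _ d _, Q, r => Q = P.other ∧ r = d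

/-- The register `r` of `Q` is not changed by the program. -/
def Keeps (lp : LProg) (Q : Party) (r : Reg) : Prop := ∀ x ∈ lp, ¬x.2.Writes Q r

section Frame

variable {C : Type} {ec rc : ℕ} {P : Party} {W : ℕ} {mk : Party → Bool → Bits ec → C}
  {τ : Label → Coin ec rc} {Q : Party} {r : Reg}

theorem lstep_mem_of_not_writes {i : Instr} (h : ¬i.Writes Q r) (y : Coin ec rc) (a : LState C) :
    (lstep P W mk i y a).mem Q r = a.mem Q r := by
  cases i <;> simp only [Instr.Writes] at h
  case load Q' d arr i =>
    simp only [lstep]; split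
    · rw [mem_put, if_neg h]
    · rfl
  case store Q' arr i s =>
    simp only [lstep]; split
    · next r' hr =>
      rw [mem_put, if_neg]
      rintro ⟨rfl, rfl⟩
      exact h ⟨rfl, List.mem_of_getElem? hr⟩
    · rfl
  all_goals exact (mem_put ..).trans (if_neg h)

theorem drun_mem {lp : LProg} (h : Keeps lp Q r) (a : LState C) :
    (drun P W mk τ lp a).mem Q r = a.mem Q r := by
  induction lp generalizing a with
  | nil => rfl
  | cons x lp ih =>
    have := ih (fun y hy => h y (List.mem_cons_of_mem _ hy)) (lstep P W mk x.2 (τ x.1) a)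
    rw [lstep_mem_of_not_writes (h x List.mem_cons_self)] at this
    exact this

theorem keeps_append {p q : LProg} : Keeps (p ++ q) Q r ↔ Keeps p Q r ∧ Keeps q Q r := by
  simp only [Keeps, List.mem_append, or_imp, forall_and]

theorem keeps_flatMap {ι : Type} {L : List ι} {f : ι → LProg} :
    Keeps (L.flatMap f) Q r ↔ ∀ x ∈ L, Keeps (f x) Q r := by
  simp only [Keeps, List.mem_flatMap]
  exact ⟨fun h x hx y hy => h y ⟨x, hx, hy⟩, fun h y ⟨x, hx, hy⟩ => h x hx y hy⟩

theorem keeps_quiet {body : Program} : Keeps (quiet body) Q r ↔ ∀ x ∈ body, ¬x.Writes Q r := by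
  simp [Keeps, quiet]

theorem keeps_blk {c i h : ℕ} {body : Program} :
    Keeps (blk c i h body) Q r ↔ ∀ x ∈ body, ¬x.Writes Q r := by
  constructor
  · intro H x hx
    obtain ⟨n, hn, rfl⟩ := List.mem_iff_getElem.1 hx
    exact H ((c, i, h, n), body[n]) (List.mem_map.2 ⟨(body[n], n), by
      simp [List.mem_zipIdx_iff_getElem?], rfl⟩)
  · intro H x hx
    obtain ⟨y, hy, rfl⟩ := List.mem_map.1 hx
    exact H _ ((List.mem_zipIdx' hy).2 ▸ List.getElem_mem _)

/-- A loop whose passes do not disturb each other. -/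
theorem Triple.forAll {ι : Type} {L : List ι} (hL : L.Nodup) {body : ι → LProg}
    {S : LState C → Prop} {p q : ι → LState C → Prop} {v : ι → List (Bool ⊕ C)}
    (h : ∀ x ∈ L, Triple P W mk τ (body x) (fun a => S a ∧ p x a) (fun a => S a ∧ q x a) (v x))
    (hp : ∀ x ∈ L, ∀ y ∈ L, y ≠ x → ∀ a, p y a → p y (drun P W mk τ (body x) a))
    (hq : ∀ x ∈ L, ∀ y ∈ L, y ≠ x → ∀ a, q y a → q y (drun P W mk τ (body x) a)) :
    Triple P W mk τ (L.flatMap body) (fun a => S a ∧ ∀ x ∈ L, p x a)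
      (fun a => S a ∧ ∀ x ∈ L, q x a) (L.flatMap v) := by
  induction L with
  | nil => exact Triple.nil.weaken (fun _ h => ⟨h.1, by simp⟩) fun _ h => h
  | cons x L ih =>
    rw [List.nodup_cons] at hL
    have IH := ih hL.2 (fun y hy => h y (List.mem_cons_of_mem _ hy))
      (fun y hy z hz => hp y (List.mem_cons_of_mem _ hy) z (List.mem_cons_of_mem _ hz))
      (fun y hy z hz => hq y (List.mem_cons_of_mem _ hy) z (List.mem_cons_of_mem _ hz))
    have hne : ∀ y ∈ L, y ≠ x := fun y hy e => hL.1 (e ▸ hy)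
    intro a ha ⟨hS, hpa⟩
    obtain ⟨h1, ⟨h2, h3⟩, h4⟩ := h x List.mem_cons_self a ha ⟨hS, hpa x List.mem_cons_self⟩
    obtain ⟨k1, ⟨k2, k3⟩, k4⟩ := IH _ h1 ⟨h2, fun y hy => hp x List.mem_cons_self y
      (List.mem_cons_of_mem _ hy) (hne y hy) a (hpa y (List.mem_cons_of_mem _ hy))⟩
    rw [List.flatMap_cons, List.flatMap_cons, drun_append]
    refine ⟨k1, ⟨k2, fun y hy => ?_⟩, by rw [k4, h4, List.append_assoc]⟩
    rcases List.mem_cons.1 hy with rfl | hy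
    · clear IH k1 k2 k3 k4 hpa
      -- What the pass `x` has established must survive all later passes; this is where `hq` is used
      -- with `y = x`.
      suffices ∀ M : List ι, (∀ z ∈ M, z ∈ L) → ∀ b : LState C, q y b →
          q y (drun P W mk τ (M.flatMap body) b) from this L (fun _ => id) _ h3
      intro M
      induction M with
      | nil => exact fun _ _ hb => hb
      | cons z M ihM =>
        intro hM b hb
        rw [List.flatMap_cons, drun_append]
        have hz := hM z List.mem_cons_self
        exact ihM (fun z' hz' => hM z' (List.mem_cons_of_mem _ hz')) _
          (hq z (List.mem_cons_of_mem _ hz) y List.mem_cons_self (hne z hz).symm b hb)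
    · exact k3 y hy

end Frame

/-- Pairs of indices. -/
def grid (k n : ℕ) : List (ℕ × ℕ) := (List.range k).flatMap fun i => (List.range n).map fun j => (i, j)

theorem mem_grid {k n : ℕ} {x : ℕ × ℕ} : x ∈ grid k n ↔ x.1 < k ∧ x.2 < n := by
  simp only [grid, List.mem_flatMap, List.mem_range, List.mem_map]
  exact ⟨by rintro ⟨i, hi, j, hj, rfl⟩; exact ⟨hi, hj⟩, fun h => ⟨x.1, h.1, x.2, h.2, rfl⟩⟩

theorem flatMap_grid {α : Type} (k n : ℕ) (f : ℕ × ℕ → List α) :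
    (grid k n).flatMap f =
      (List.range k).flatMap fun i => (List.range n).flatMap fun j => f (i, j) := by
  simp [grid, List.flatMap_assoc, List.flatMap_map]

theorem nodup_grid (k n : ℕ) : (grid k n).Nodup := by
  rw [grid, List.nodup_flatMap]
  refine ⟨fun i _ => List.nodup_range.map fun a b h => (Prod.ext_iff.1 h).2,
    List.nodup_range.imp fun {i j} hij => ?_⟩
  simp only [Function.onFun, List.disjoint_left, List.mem_map]
  rintro x ⟨_, _, rfl⟩ ⟨_, _, h⟩
  exact hij (Prod.ext_iff.1 h).1.symm

/-! ### The protocol with labels -/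

/-- The components of a tuple by their number. -/
def fld : ℕ → Field
  | 0 => .name
  | 1 => .weight
  | h + 2 => .bit h

theorem fld_injective : Function.Injective fld := by
  intro i j h
  match i, j with
  | 0, 0 => rfl
  | 1, 1 => rfl
  | i + 2, j + 2 => simpa [fld] using h
  | 0, 1 => simp [fld] at h
  | 0, j + 2 => simp [fld] at h
  | 1, 0 => simp [fld] at h
  | 1, j + 2 => simp [fld] at h
  | i + 2, 0 => simp [fld] at h
  | i + 2, 1 => simp [fld] at h

@[simp] theorem fld_inj {i j : ℕ} : fld i = fld j ↔ i = j := fld_injective.eq_iff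

namespace Sizes

variable (s : Sizes)

/-- The number of components of a tuple. -/
def arity : ℕ := s.n * s.m + 2

/-- The bit length of a component of a tuple. -/
def fw (h : ℕ) : ℕ := if h < 2 then s.width else 1

theorem fieldWidth_fld (h : ℕ) : Protocol.fieldWidth s (fld h) = s.fw h := by
  match h with
  | 0 => rfl
  | 1 => rfl
  | h + 2 => simp [fld, Protocol.fieldWidth, fw]

theorem fields_eq : Protocol.fields s = (List.range s.arity).map fld := by
  simp only [Protocol.fields, arity, List.range_succ_eq_map, List.map_cons, List.map_map]
  rfl

theorem fw_le (h : ℕ) : s.fw h ≤ s.width + 1 := by unfold fw; split <;> omega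

end Sizes

namespace Labelled

open Party Reg Instr

variable (s : Sizes)

def posA : LProg := (grid (s.npos A) s.k).flatMap fun x =>
  blk 1 x.1 x.2 [enc A B 1 (pos x.1 x.2) (pos x.1 x.2)]

def negA : LProg := (grid (s.nneg A) s.k).flatMap fun x =>
  blk 2 x.1 x.2 [enc A B 1 (neg x.1 x.2) (neg x.1 x.2)]

def posB : LProg := (grid (s.npos B) s.k).flatMap fun x =>
  blk 3 x.1 x.2 [enc B B 1 (pos (s.posStart B + x.1) x.2) (pos (s.posStart B + x.1) x.2),
    sendCt B (pos (s.posStart B + x.1) x.2) (pos (s.posStart B + x.1) x.2)]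

def negB : LProg := (grid (s.nneg B) s.k).flatMap fun x =>
  blk 4 x.1 x.2 [enc B B 1 (neg (s.negStart B + x.1) x.2) (neg (s.negStart B + x.1) x.2),
    sendCt B (neg (s.negStart B + x.1) x.2) (neg (s.negStart B + x.1) x.2)]

def items : LProg := (List.range s.k).flatMap fun i =>
  blk 5 i 0 [const A (tmp 0) i, enc A B s.width (item i .name) (tmp 0),
     const A (tmp 0) 0, enc A B s.width (item i .weight) (tmp 0)] ++
  (grid s.n s.m).flatMap fun x => quiet
    [hom A B .xor (item i (.bit (s.m * x.1 + x.2))) (pos x.1 i) (neg x.2 i),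
       hom A B .add (item i .weight) (item i .weight) (item i (.bit (s.m * x.1 + x.2)))]

def mix : LProg := (grid s.k s.arity).flatMap fun x => blk 6 x.1 x.2
  [coin A (mask x.1 (fld x.2)) (2 ^ s.fw x.2 - 1),
   enc A A (s.fw x.2) (mask x.1 (fld x.2)) (mask x.1 (fld x.2)),
   enc A B (s.fw x.2) (tmp 0) (mask x.1 (fld x.2)),
   hom A B .add (tmp 0) (item x.1 (fld x.2)) (tmp 0),
   reenc A B (tmp 0),
   sendCt A (item x.1 (fld x.2)) (tmp 0),
   sendCt A (mask x.1 (fld x.2)) (mask x.1 (fld x.2))]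

def fyInit : LProg := (List.range s.k).flatMap fun i => quiet [const B (perm i) i]

def fy : LProg := (List.range s.k).reverse.flatMap fun i => blk 7 i 0
    [coin B (tmp 0) i,
     load B (tmp 1) ((List.range s.k).map perm) (tmp 0),
     move B (tmp 2) (perm i),
     move B (perm i) (tmp 1),
     store B ((List.range s.k).map perm) (tmp 0) (tmp 2)]

def reply : LProg := (grid s.k s.arity).flatMap fun x => blk 8 x.1 x.2
    [coin B (noise x.1 (fld x.2)) (2 ^ s.fw x.2 - 1),
     enc B B (s.fw x.2) (tmp 0) (noise x.1 (fld x.2)),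
     hom B B .add (item x.1 (fld x.2)) (item x.1 (fld x.2)) (tmp 0),
     reenc B B (item x.1 (fld x.2)),
     enc B A (s.fw x.2) (tmp 0) (noise x.1 (fld x.2)),
     hom B A .add (mask x.1 (fld x.2)) (mask x.1 (fld x.2)) (tmp 0),
     reenc B A (mask x.1 (fld x.2))]

def send : LProg := (grid s.k s.arity).flatMap fun x => quiet
    [load B (tmp 0) ((List.range s.k).map fun i => item i (fld x.2)) (perm x.1),
     sendCt B (item x.1 (fld x.2)) (tmp 0),
     load B (tmp 0) ((List.range s.k).map fun i => mask i (fld x.2)) (perm x.1),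
     sendCt B (mask x.1 (fld x.2)) (tmp 0)]

def unmask : LProg := (grid s.k s.arity).flatMap fun x => blk 10 x.1 x.2
    [dec A (mask x.1 (fld x.2)) (mask x.1 (fld x.2)),
     sub A (s.fw x.2) (tmp 0) (tmp 1) (mask x.1 (fld x.2)),
     enc A B (s.fw x.2) (tmp 0) (tmp 0),
     hom A B .add (item x.1 (fld x.2)) (item x.1 (fld x.2)) (tmp 0)]

def keys : LProg := (List.range s.k).flatMap fun j => blk 11 j 0
    [hom A B .cat (key j) (item j .name) (item j .weight),
     const A (tmp 0) j, enc A B s.width (label j) (tmp 0)]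

def net : LProg := (sortNetwork s.k).flatMap fun c => quiet (Protocol.compareExchange c.1 c.2)

def sendRanks : LProg := (List.range s.k).flatMap fun j => blk 12 j 0
    [coin A (Reg.pad j) (2 ^ s.width - 1),
     enc A B s.width (tmp 0) (Reg.pad j),
     hom A B .add (tmp 0) (label j) (tmp 0),
     reenc A B (tmp 0),
     sendCt A (masked j) (tmp 0)]

def openRanks : LProg := (List.range s.k).flatMap fun j => quiet
  [dec B (masked j) (masked j), sendVal B s.width (masked j) (masked j)]

def ranks : LProg := (List.range s.k).flatMap fun j => quiet
  [sub A s.width (rank j) (masked j) (Reg.pad j)]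

def moveStrings : LProg := (grid s.k (s.n * s.m)).flatMap fun x => quiet
  [load A (srt x.1 x.2) ((List.range s.k).map fun i => item i (fld (x.2 + 2))) (rank x.1)]

def constants : LProg := blk 14 0 0
  [const A (tmp 0) 0, enc A B 1 (tmp 0) (tmp 0), const A (tmp 1) 1, enc A B 1 (tmp 1) (tmp 1)]

def selInit : LProg := (List.range (s.n * s.m)).flatMap fun h => quiet
  [move A (z s.k h) (tmp 0), move A (cum h) (tmp 0)]

def suffixes : LProg := (List.range s.k).reverse.flatMap fun i =>
  (List.range (s.n * s.m)).flatMap fun h => quiet [hom A B .or (z i h) (z (i + 1) h) (srt i h)]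

def select : LProg := (List.range s.k).flatMap fun i =>
  quiet [move A (keep i) (tmp 1)] ++
  ((List.range (s.n * s.m)).flatMap (fun h => quiet
      [hom A B .or (tmp 2) (z (i + 1) h) (cum h), hom A B .and (keep i) (keep i) (tmp 2)]) ++
  (quiet [hom A B .xor (keep i) (keep i) (tmp 1)] ++
  (List.range (s.n * s.m)).flatMap fun h => quiet
      [hom A B .and (tmp 2) (keep i) (srt i h), hom A B .or (cum h) (cum h) (tmp 2)]))

def storeSel : LProg := (List.range s.k).flatMap fun j => quiet
  [store A ((List.range s.k).map sel) (rank j) (keep j)]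

def sendSel : LProg := (List.range s.k).flatMap fun j => blk 15 j 0
  [reenc A B (sel j), sendCt A (sel j) (sel j)]

def openSel : LProg := (List.range s.k).flatMap fun j => quiet
  [dec B (sel j) (sel j), store B ((List.range s.k).map out) (perm j) (sel j)]

def share : LProg := (List.range s.k).flatMap fun i => quiet [sendVal B 1 (out i) (out i)]

/-- The protocol with labels. -/
def protocol : LProg :=
  posA s ++ negA s ++ posB s ++ negB s ++ items s ++ mix s ++ fyInit s ++ fy s ++ reply s ++ send s ++
  quiet [const A (tmp 1) 0] ++ unmask s ++ keys s ++ net s ++ sendRanks s ++ openRanks s ++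
  ranks s ++ moveStrings s ++ constants ++ selInit s ++ suffixes s ++ select s ++ storeSel s ++
  sendSel s ++ openSel s ++ share s

theorem map_snd_blk (c i h : ℕ) (body : Program) : (blk c i h body).map Prod.snd = body := by
  simp only [blk, List.map_map]
  exact (List.zipIdx_map_fst 0 body)

theorem map_snd_quiet (body : Program) : (quiet body).map Prod.snd = body := by
  simp [quiet, Function.comp_def]

section

open Protocol

theorem map_snd_share_data :
    ((posA s ++ negA s ++ posB s ++ negB s).map Prod.snd) = shareData s := by
  simp only [posA, negA, posB, negB, List.map_append, List.map_flatMap, map_snd_blk, flatMap_grid,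
    shareData, loop]

theorem map_snd_items : (items s).map Prod.snd = computeItems s := by
  simp only [items, List.map_append, List.map_flatMap, map_snd_blk, map_snd_quiet, flatMap_grid,
    computeItems, loop]

theorem map_snd_mix : (mix s).map Prod.snd = mixSend s := by
  simp only [mix, List.map_flatMap, map_snd_blk, flatMap_grid, mixSend, forItems, loop, s.fields_eq,
    s.fieldWidth_fld, List.flatMap_map]

theorem map_snd_fy : (fyInit s ++ fy s).map Prod.snd = drawPerm s := by
  simp only [fyInit, fy, List.map_append, List.map_flatMap, map_snd_blk, map_snd_quiet, drawPerm, loop]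

theorem map_snd_reply : (reply s ++ send s).map Prod.snd = mixReply s := by
  simp only [reply, send, List.map_append, List.map_flatMap, map_snd_blk, map_snd_quiet,
    flatMap_grid, mixReply, forItems, loop, s.fields_eq, s.fieldWidth_fld, List.flatMap_map]

theorem map_snd_unmask :
    (quiet [const A (tmp 1) 0] ++ unmask s).map Prod.snd = mixEnd s := by
  simp only [unmask, List.map_append, List.map_flatMap, map_snd_blk, map_snd_quiet,
    flatMap_grid, mixEnd, forItems, loop, s.fields_eq, s.fieldWidth_fld, List.flatMap_map]
  rfl

theorem map_snd_sort : (keys s ++ net s).map Prod.snd = sortItems s := by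
  simp only [keys, net, List.map_append, List.map_flatMap, map_snd_blk, map_snd_quiet, sortItems, loop]

theorem map_snd_ranks : (sendRanks s ++ openRanks s ++ ranks s).map Prod.snd =
    Protocol.openRanks s := by
  simp only [sendRanks, openRanks, ranks, List.map_append, List.map_flatMap, map_snd_blk,
    map_snd_quiet, Protocol.openRanks, loop]

theorem map_snd_strings : (moveStrings s).map Prod.snd = Protocol.moveStrings s := by
  simp only [moveStrings, List.map_flatMap, map_snd_quiet, flatMap_grid, Protocol.moveStrings, loop,
    fld]

theorem map_snd_select : (constants ++ selInit s ++ suffixes s ++ select s).map Prod.snd =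
    selectFeatures s := by
  have h1 : constants.map Prod.snd = _ := map_snd_blk ..
  have h2 : (selInit s).map Prod.snd = _ := List.map_flatMap
  have h3 : (suffixes s).map Prod.snd = _ := List.map_flatMap
  have h4 : (select s).map Prod.snd = _ := List.map_flatMap
  simp only [List.map_append, List.map_flatMap, map_snd_quiet] at h1 h2 h3 h4
  rw [List.map_append, List.map_append, List.map_append, h1, h2, h3, h4, selectFeatures]
  simp only [loop, List.append_assoc, List.cons_append, List.nil_append]

theorem map_snd_result : (storeSel s ++ sendSel s ++ openSel s ++ share s).map Prod.snd =
    openResult s := by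
  simp only [storeSel, sendSel, openSel, share, List.map_append, List.map_flatMap, map_snd_blk,
    map_snd_quiet, openResult, loop]

/-- Labels serve only to address coins; without them the labelled program is the protocol itself. -/
theorem map_snd_protocol : (protocol s).map Prod.snd = improvedCWC s := by
  have h1 := map_snd_share_data s
  have h2 := map_snd_items s
  have h3 := map_snd_mix s
  have h4 := map_snd_fy s
  have h5 := map_snd_reply s
  have h6 := map_snd_unmask s
  have h7 := map_snd_sort s
  have h8 := map_snd_ranks s
  have h9 := map_snd_strings s
  have h10 := map_snd_select s
  have h11 := map_snd_result s
  unfold improvedCWC protocol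
  rw [← h1, ← h2, ← h3, ← h4, ← h5, ← h6, ← h7, ← h8, ← h9, ← h10]
  rw [← h11]
  clear h1 h2 h3 h4 h5 h6 h7 h8 h9 h10 h11
  generalize posA s = x1, negA s = x2, posB s = x3, negB s = x4, items s = x5, mix s = x6,
    fyInit s = x7, fy s = x8, reply s = x9, send s = x10, unmask s = x11, keys s = x12, net s = x13,
    sendRanks s = x14, openRanks s = x15, ranks s = x16, moveStrings s = x17, constants = x18,
    selInit s = x19, suffixes s = x20, select s = x21, storeSel s = x22, sendSel s = x23,
    openSel s = x24, share s = x25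
  simp only [List.map_append, List.append_assoc]

end

end Labelled

/-! ### The data -/

/-- The bits of the joint data. -/
structure Table where
  x : ℕ → ℕ → Bool
  y : ℕ → ℕ → Bool

namespace Table

variable (D : Table) (s : Sizes)

/-- Bit `t` of the string of feature `i`. -/
def bit (i t : ℕ) : Bool := Bool.xor (D.x (t / s.m) i) (D.y (t % s.m) i)

def weight (i : ℕ) : ℕ := ∑ t ∈ Finset.range (s.n * s.m), (D.bit s i t).toNat

/-- The components of the tuple of feature `i`. -/
def comp (i : ℕ) : ℕ → ℕ
  | 0 => i
  | 1 => D.weight s i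
  | t + 2 => (D.bit s i t).toNat

end Table

/-! ### Execution of the phases -/

section Exec

variable {C : Type} {ec rc : ℕ} {P : Party} {W : ℕ} {mk : Party → Bool → Bits ec → C}
  {τ : Label → Coin ec rc} {s : Sizes}

open Party Reg Labelled

attribute [local simp] mem_const mem_sub mem_move mem_load mem_store mem_coin mem_enc mem_dec mem_hom
  mem_mux mem_reenc mem_sendCt mem_sendVal view_const view_sub view_move view_load view_store view_hom
  view_mux view_dec view_coin view_enc view_reenc view_sendCt view_sendVal ok_const ok_sub ok_move
  ok_load ok_store ok_hom ok_mux ok_coin ok_sendVal ok_enc ok_dec ok_reenc ok_sendCt tags_sealedCt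
  drun_blk drun_quiet brun qrun Party.other mem_grid isEnc_sealedCt
  Instr.Writes keeps_blk keeps_append keeps_quiet keeps_flatMap

theorem vis_A_sealedCt (K : Party) (w v : ℕ) (e : ℕ → Bits ec) :
    vis P B ((sealedCt mk P A K w v e).filterMap fun x => x.tag.map .inr) =
      vis P B (ctView mk K w v e) := vis_sealedCt A K w v e

theorem vis_B_sealedCt (K : Party) (w v : ℕ) (e : ℕ → Bits ec) :
    vis P A ((sealedCt mk P B K w v e).filterMap fun x => x.tag.map .inr) =
      vis P A (ctView mk K w v e) := vis_sealedCt B K w v e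

theorem tags_A_sealedCt (K : Party) (w v : ℕ) (e : ℕ → Bits ec) :
    B = P → ∀ x ∈ sealedCt mk P A K w v e, x.tag.isSome = true := tags_sealedCt A K w v e

theorem tags_B_sealedCt (K : Party) (w v : ℕ) (e : ℕ → Bits ec) :
    A = P → ∀ x ∈ sealedCt mk P B K w v e, x.tag.isSome = true := tags_sealedCt B K w v e

theorem posA_triple (hW : 1 ≤ W) (u : ℕ → ℕ → ℕ) :
    Triple P W mk τ (posA s)
      (fun a => True ∧ ∀ x ∈ grid (s.npos A) s.k, (a.mem A (pos x.1 x.2)).val = u x.1 x.2)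
      (fun a => True ∧ ∀ x ∈ grid (s.npos A) s.k, IsEnc B 1 (u x.1 x.2) (a.mem A (pos x.1 x.2)).ct)
      ((grid (s.npos A) s.k).flatMap fun x => vis P A (coinStr 1 (τ (1, x.1, x.2, 0)).enc)) := by
  refine Triple.forAll (nodup_grid _ _) (fun x hx a ha h => ?_) (fun x hx y hy hne a h => ?_)
    (fun x hx y hy hne a h => ?_)
  · simp [ha, h.2, hW]
  · rwa [drun_mem]
    simpa [Prod.ext_iff] using hne
  · rwa [drun_mem]
    simpa [Prod.ext_iff] using hne

theorem negA_triple (hW : 1 ≤ W) (u : ℕ → ℕ → ℕ) :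
    Triple P W mk τ (negA s)
      (fun a => True ∧ ∀ x ∈ grid (s.nneg A) s.k, (a.mem A (neg x.1 x.2)).val = u x.1 x.2)
      (fun a => True ∧ ∀ x ∈ grid (s.nneg A) s.k, IsEnc B 1 (u x.1 x.2) (a.mem A (neg x.1 x.2)).ct)
      ((grid (s.nneg A) s.k).flatMap fun x => vis P A (coinStr 1 (τ (2, x.1, x.2, 0)).enc)) := by
  refine Triple.forAll (nodup_grid _ _) (fun x hx a ha h => ?_) (fun x hx y hy hne a h => ?_)
    (fun x hx y hy hne a h => ?_)
  · simp [ha, h.2, hW]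
  · rwa [drun_mem]
    simpa [Prod.ext_iff] using hne
  · rwa [drun_mem]
    simpa [Prod.ext_iff] using hne

theorem posB_triple (hW : 1 ≤ W) (u : ℕ → ℕ → ℕ) :
    Triple P W mk τ (posB s)
      (fun a => True ∧ ∀ x ∈ grid (s.npos B) s.k,
        (a.mem B (pos (s.posStart B + x.1) x.2)).val = u x.1 x.2)
      (fun a => True ∧ ∀ x ∈ grid (s.npos B) s.k,
        IsEnc B 1 (u x.1 x.2) (a.mem A (pos (s.posStart B + x.1) x.2)).ct)
      ((grid (s.npos B) s.k).flatMap fun x => vis P B (coinStr 1 (τ (3, x.1, x.2, 0)).enc) ++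
        vis P A (ctView mk B 1 (u x.1 x.2) (τ (3, x.1, x.2, 0)).enc)) := by
  refine Triple.forAll (nodup_grid _ _) (fun x hx a ha h => ?_) (fun x hx y hy hne a h => ?_)
    (fun x hx y hy hne a h => ?_)
  · simp [ha, h.2, hW, vis_B_sealedCt]
    exact tags_B_sealedCt _ _ _ _
  · rwa [drun_mem]
    simpa [Prod.ext_iff] using hne
  · rwa [drun_mem]
    simpa [Prod.ext_iff] using hne

theorem negB_triple (hW : 1 ≤ W) (u : ℕ → ℕ → ℕ) :
    Triple P W mk τ (negB s)
      (fun a => True ∧ ∀ x ∈ grid (s.nneg B) s.k,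
        (a.mem B (neg (s.negStart B + x.1) x.2)).val = u x.1 x.2)
      (fun a => True ∧ ∀ x ∈ grid (s.nneg B) s.k,
        IsEnc B 1 (u x.1 x.2) (a.mem A (neg (s.negStart B + x.1) x.2)).ct)
      ((grid (s.nneg B) s.k).flatMap fun x => vis P B (coinStr 1 (τ (4, x.1, x.2, 0)).enc) ++
        vis P A (ctView mk B 1 (u x.1 x.2) (τ (4, x.1, x.2, 0)).enc)) := by
  refine Triple.forAll (nodup_grid _ _) (fun x hx a ha h => ?_) (fun x hx y hy hne a h => ?_)
    (fun x hx y hy hne a h => ?_)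
  · simp [ha, h.2, hW, vis_B_sealedCt]
    exact tags_B_sealedCt _ _ _ _
  · rwa [drun_mem]
    simpa [Prod.ext_iff] using hne
  · rwa [drun_mem]
    simpa [Prod.ext_iff] using hne

/-- The sum is determined only modulo `2 ^ s.fw`, which is all that `IsEnc` records. The ciphertext
seen by `B` is re-encrypted, so its symbol depends on the masked value and on the coins of line `4`
only. -/
theorem mix_triple (hW : s.width + 1 ≤ W) (v : ℕ → ℕ → ℕ) :
    Triple P W mk τ (mix s)
      (fun a => True ∧ ∀ x ∈ grid s.k s.arity,
        IsEnc B (s.fw x.2) (v x.1 x.2) (a.mem A (item x.1 (fld x.2))).ct)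
      (fun a => True ∧ ∀ x ∈ grid s.k s.arity,
        IsEnc B (s.fw x.2) (v x.1 x.2 + (τ (6, x.1, x.2, 0)).int) (a.mem B (item x.1 (fld x.2))).ct ∧
        IsEnc A (s.fw x.2) (τ (6, x.1, x.2, 0)).int (a.mem B (mask x.1 (fld x.2))).ct)
      ((grid s.k s.arity).flatMap fun x =>
        vis P A ((natBits (2 ^ s.fw x.2 - 1).size (τ (6, x.1, x.2, 0)).int).map .inl) ++
        (vis P A (coinStr (s.fw x.2) (τ (6, x.1, x.2, 1)).enc) ++
        (vis P A (coinStr (s.fw x.2) (τ (6, x.1, x.2, 2)).enc) ++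
        (vis P A (coinStr (s.fw x.2) (τ (6, x.1, x.2, 4)).re) ++
        (vis P B (ctView mk B (s.fw x.2) (v x.1 x.2 + (τ (6, x.1, x.2, 0)).int)
          (τ (6, x.1, x.2, 4)).enc) ++
        vis P B (ctView mk A (s.fw x.2) (τ (6, x.1, x.2, 0)).int (τ (6, x.1, x.2, 1)).enc)))))) := by
  refine Triple.forAll (nodup_grid _ _) (fun x hx a ha h => ?_) (fun x hx y hy hne a h => ?_)
    (fun x hx y hy hne a h => ?_)
  · have hw := (s.fw_le x.2).trans hW
    have e1 := h.2.add_same (isEnc_sealedCt (mk := mk) P A B (s.fw x.2) (τ (6, x.1, x.2, 0)).int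
      (τ (6, x.1, x.2, 2)).enc)
    simp [ha, hw, reseal_eq e1, e1.length, vis_A_sealedCt]
    exact ⟨⟨e1.key, tags_A_sealedCt _ _ _ _⟩, tags_A_sealedCt _ _ _ _⟩
  · rwa [drun_mem]
    simp
  · rwa [drun_mem, drun_mem] <;> simpa [Prod.ext_iff] using hne

/-- The weight is accumulated along with the bits. The data registers are part of the invariant
since every feature reads columns of all data. -/
theorem items_triple (D : Table) (hW : s.width + 1 ≤ W) :
    Triple P W mk τ (items s)
      (fun a => ((∀ x ∈ grid s.n s.k, IsEnc B 1 (D.x x.1 x.2).toNat (a.mem A (pos x.1 x.2)).ct) ∧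
        ∀ x ∈ grid s.m s.k, IsEnc B 1 (D.y x.1 x.2).toNat (a.mem A (neg x.1 x.2)).ct) ∧
        ∀ i ∈ List.range s.k, True)
      (fun a => ((∀ x ∈ grid s.n s.k, IsEnc B 1 (D.x x.1 x.2).toNat (a.mem A (pos x.1 x.2)).ct) ∧
        ∀ x ∈ grid s.m s.k, IsEnc B 1 (D.y x.1 x.2).toNat (a.mem A (neg x.1 x.2)).ct) ∧
        ∀ i ∈ List.range s.k, ∀ h < s.arity,
          IsEnc B (s.fw h) (D.comp s i h) (a.mem A (item i (fld h))).ct)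
      ((List.range s.k).flatMap fun i => vis P A (coinStr s.width (τ (5, i, 0, 1)).enc) ++
        vis P A (coinStr s.width (τ (5, i, 0, 3)).enc)) := by
  refine Triple.forAll List.nodup_range (fun i hi => ?_) (fun x hx y hy hne a h => trivial)
    (fun i hi j hj hne a H h hh => ?_)
  · have hi : i < s.k := List.mem_range.1 hi
    -- After the passes before `(p, q)`, exactly the first `s.m * p + q` bits are present and
    -- summed.
    let Inv : ℕ → ℕ → LState C → Prop := fun p q a =>
      ((∀ x ∈ grid s.n s.k, IsEnc B 1 (D.x x.1 x.2).toNat (a.mem A (pos x.1 x.2)).ct) ∧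
        ∀ x ∈ grid s.m s.k, IsEnc B 1 (D.y x.1 x.2).toNat (a.mem A (neg x.1 x.2)).ct) ∧
      IsEnc B s.width i (a.mem A (item i .name)).ct ∧
      IsEnc B s.width (∑ t ∈ Finset.range (s.m * p + q), (D.bit s i t).toNat)
        (a.mem A (item i .weight)).ct ∧
      ∀ t < s.m * p + q, IsEnc B 1 (D.bit s i t).toNat (a.mem A (item i (.bit t))).ct
    refine Triple.view_eq (Triple.append (Mid := Inv 0 0) (u := vis P A (coinStr s.width
      (τ (5, i, 0, 1)).enc) ++ vis P A (coinStr s.width (τ (5, i, 0, 3)).enc)) (v := [])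
      (fun a ha h => ?_) ?_) (by simp)
    · have hw : s.width ≤ W := by omega
      have := h.1
      simp [ha, hw, Inv]
      simpa using this
    · rw [flatMap_grid]
      refine (Triple.loop₂ (Inv := Inv) (v := fun _ _ => []) (fun p hp a h => ?_)
        (fun p hp q hq a ha h => ?_)).view_eq (by simp) |>.weaken (fun _ h => h) (fun a h => ?_)
      · simpa only [Inv, mul_add, mul_one, add_zero] using h
      · obtain ⟨⟨h1, h2⟩, h3, h4, h5⟩ := h
        have e1 := (h1 (p, i) (mem_grid.2 ⟨hp, hi⟩)).xor (h2 (q, i) (mem_grid.2 ⟨hq, hi⟩))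
        -- Division by `s.m` with remainder recovers `p` and `q` from the number of the bit.
        have hb : D.bit s i (s.m * p + q) = (D.x p i ^^ D.y q i) := by
          rw [Table.bit, Nat.mul_add_div (by omega), Nat.div_eq_of_lt hq, Nat.mul_add_mod,
            Nat.mod_eq_of_lt hq, add_zero]
        rw [← hb] at e1
        have e2 := (h4.add e1).congr (v := ∑ t ∈ Finset.range (s.m * p + q + 1), (D.bit s i t).toNat)
          (by rw [Finset.sum_range_succ]; congr 2; cases D.bit s i (s.m * p + q) <;> rfl)
        simp [ha, Inv, h3, ← add_assoc] at h1 h2 ⊢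
        refine ⟨⟨h1, h2⟩, e2, fun t ht => ?_⟩
        split
        · next h => rw [h]; exact e1
        · exact h5 t (by omega)
      · obtain ⟨h1, h3, h4, h5⟩ := h
        refine ⟨h1, fun h hh => ?_⟩
        match h with
        | 0 => exact h3
        | 1 => 
          rw [add_zero, mul_comm] at h4
          exact h4
        | h + 2 => 
          rw [add_zero, mul_comm] at h5
          exact h5 h (by simpa [Sizes.arity] using hh)
  · have := H h hh
    rwa [drun_mem]
    rcases h with _ | _ | h <;> simp [fld, hne]

end Exec

/-- The permutation that is drawn by Fisher and Yates with the coins `v`. -/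
def fyPerm (v : ℕ → ℕ) : ℕ → Equiv.Perm ℕ
  | 0 => 1
  | k + 1 => Equiv.swap k (v k) * fyPerm v k

theorem fyPerm_of_le {v : ℕ → ℕ} {k : ℕ} (hv : ∀ i < k, v i ≤ i) {j : ℕ} (hj : k ≤ j) :
    fyPerm v k j = j := by
  induction k with
  | zero => rfl
  | succ k ih =>
    have := hv k (by omega)
    rw [fyPerm, Equiv.Perm.mul_apply, ih (fun i hi => hv i (by omega)) (by omega)]
    exact Equiv.swap_apply_of_ne_of_ne (by omega) (by omega)

theorem fyPerm_lt {v : ℕ → ℕ} {k : ℕ} (hv : ∀ i < k, v i ≤ i) {j : ℕ} (hj : j < k) :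
    fyPerm v k j < k := by
  by_contra h
  have := fyPerm_of_le hv (not_lt.1 h)
  have := (fyPerm v k).injective this
  omega

/-- A comparator acting on pairs (key, label). -/
def exchange (f : ℕ → ℕ × ℕ) (c : ℕ × ℕ) : ℕ → ℕ × ℕ :=
  if (f c.2).1 < (f c.1).1 then f ∘ Equiv.swap c.1 c.2 else f

/-! ### The shuffle, the removal of masks, and the sorting network. -/

section Exec

variable {C : Type} {ec rc : ℕ} {P : Party} {W : ℕ} {mk : Party → Bool → Bits ec → C}
  {τ : Label → Coin ec rc} {s : Sizes}

open Party Reg Labelled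

attribute [local simp] mem_const mem_sub mem_move mem_load mem_store mem_coin mem_enc mem_dec mem_hom
  mem_mux mem_reenc mem_sendCt mem_sendVal view_const view_sub view_move view_load view_store view_hom
  view_mux view_dec view_coin view_enc view_reenc view_sendCt view_sendVal ok_const ok_sub ok_move
  ok_load ok_store ok_hom ok_mux ok_coin ok_sendVal ok_enc ok_dec ok_reenc ok_sendCt tags_sealedCt
  drun_blk drun_quiet brun qrun Party.other mem_grid isEnc_sealedCt
  Instr.Writes keeps_blk keeps_append keeps_quiet keeps_flatMap

theorem fyInit_triple : Triple P W mk τ (fyInit s) (fun _ => True ∧ ∀ i ∈ List.range s.k, True)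
    (fun a => True ∧ ∀ i ∈ List.range s.k, (a.mem B (perm i)).val = i) [] := by
  refine (Triple.forAll List.nodup_range (p := fun _ _ => True) (v := fun _ => [])
    (fun i hi a ha h => ?_) (fun x hx y hy hne a h => trivial) (fun x hx y hy hne a h => ?_)).view_eq
    (by simp)
  · simp [ha]
  · rwa [drun_mem]
    simpa using hne

/-- The loop counts down. When the steps from `i` on are done, the registers hold `fyPerm v k *
(fyPerm v i)⁻¹`, the product of the transpositions made so far. Exchanging the entries `i` and `v i`
multiplies by the next transposition on the right. -/
theorem fy_triple (hv : ∀ i < s.k, (τ (7, i, 0, 0)).int ≤ i) :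
    Triple P W mk τ (fy s) (fun a => ∀ i < s.k, (a.mem B (perm i)).val = i)
      (fun a => ∀ i < s.k, (a.mem B (perm i)).val = fyPerm (fun i => (τ (7, i, 0, 0)).int) s.k i)
      ((List.range s.k).reverse.flatMap fun i =>
        vis P B ((natBits i.size (τ (7, i, 0, 0)).int).map .inl)) := by
  set v : ℕ → ℕ := fun i => (τ (7, i, 0, 0)).int with hvdef
  have := Triple.loopDown (P := P) (W := W) (mk := mk) (τ := τ) (n := s.k)
    (body := fun i => blk 7 i 0
      [.coin B (tmp 0) i,
       .load B (tmp 1) ((List.range s.k).map perm) (tmp 0),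
       .move B (tmp 2) (perm i),
       .move B (perm i) (tmp 1),
       .store B ((List.range s.k).map perm) (tmp 0) (tmp 2)])
    (Inv := fun i a => ∀ j < s.k, (a.mem B (perm j)).val = (fyPerm v s.k * (fyPerm v i)⁻¹) j)
    (v := fun i => vis P B ((natBits i.size (τ (7, i, 0, 0)).int).map .inl))
    (fun i hi a ha h => ?_)
  · exact this.weaken (fun a h j hj => by simpa using h j hj) fun a h j hj => by
      simpa [fyPerm] using h j hj
  · have h0 := hv i hi
    have h1 : (τ (7, i, 0, 0)).int < s.k := by omega
    simp [ha, h1]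
    intro j hj
    have e : fyPerm v s.k * (fyPerm v i)⁻¹ =
        fyPerm v s.k * (fyPerm v (i + 1))⁻¹ * Equiv.swap i (v i) := by
      simp [fyPerm, mul_assoc]
    have e' : (fyPerm v s.k) (Equiv.symm (fyPerm v i) j) = (fyPerm v s.k * (fyPerm v i)⁻¹) j := rfl
    rw [e', e, Equiv.Perm.mul_apply]
    by_cases hjv : j = (τ (7, i, 0, 0)).int
    · rw [if_pos hjv, hjv, Equiv.swap_apply_right]
      exact h i hi
    · rw [if_neg hjv]
      by_cases hji : j = i
      · rw [if_pos hji, hji, Equiv.swap_apply_left]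
        exact h _ h1
      · rw [if_neg hji, Equiv.swap_apply_of_ne_of_ne hji hjv]
        exact h j hj

/-- The same noise is added to the value and to the mask, so the mask still fits. Afterwards all
ciphertexts are sealed, hence can be shown to `A`. -/
theorem reply_triple (hW : s.width + 1 ≤ W) (u r : ℕ → ℕ → ℕ) :
    Triple P W mk τ (reply s)
      (fun a => True ∧ ∀ x ∈ grid s.k s.arity,
        IsEnc B (s.fw x.2) (u x.1 x.2) (a.mem B (item x.1 (fld x.2))).ct ∧
        IsEnc A (s.fw x.2) (r x.1 x.2) (a.mem B (mask x.1 (fld x.2))).ct)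
      (fun a => True ∧ ∀ x ∈ grid s.k s.arity,
        (a.mem B (item x.1 (fld x.2))).ct = sealedCt mk P B B (s.fw x.2)
          (u x.1 x.2 + (τ (8, x.1, x.2, 0)).int) (τ (8, x.1, x.2, 3)).enc ∧
        (a.mem B (mask x.1 (fld x.2))).ct = sealedCt mk P B A (s.fw x.2)
          (r x.1 x.2 + (τ (8, x.1, x.2, 0)).int) (τ (8, x.1, x.2, 6)).enc)
      ((grid s.k s.arity).flatMap fun x =>
        vis P B ((natBits (2 ^ s.fw x.2 - 1).size (τ (8, x.1, x.2, 0)).int).map .inl) ++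
        (vis P B (coinStr (s.fw x.2) (τ (8, x.1, x.2, 1)).enc) ++
        (vis P B (coinStr (s.fw x.2) (τ (8, x.1, x.2, 3)).re) ++
        (vis P B (coinStr (s.fw x.2) (τ (8, x.1, x.2, 4)).enc) ++
        vis P B (coinStr (s.fw x.2) (τ (8, x.1, x.2, 6)).re))))) := by
  refine Triple.forAll (nodup_grid _ _) (fun x hx a ha h => ?_) (fun x hx y hy hne a h => ?_)
    (fun x hx y hy hne a h => ?_)
  · have hw := (s.fw_le x.2).trans hW
    have e1 := h.2.1.add_same (isEnc_sealedCt (mk := mk) P B B (s.fw x.2) (τ (8, x.1, x.2, 0)).int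
      (τ (8, x.1, x.2, 1)).enc)
    have e2 := h.2.2.add_same (isEnc_sealedCt (mk := mk) P B A (s.fw x.2) (τ (8, x.1, x.2, 0)).int
      (τ (8, x.1, x.2, 4)).enc)
    simp [ha, hw, reseal_eq e1, e1.length, reseal_eq e2, e2.length]
    exact ⟨e1.key, e2.key⟩
  · rwa [drun_mem, drun_mem] <;> simpa [Prod.ext_iff] using hne
  · rwa [drun_mem, drun_mem] <;> simpa [Prod.ext_iff] using hne

/-- Position `j` receives the tuple number `π j`, with its coins. The two different encryption keys
stay with the two kinds of components. -/
theorem send_triple (π : ℕ → ℕ) (hπ : ∀ j < s.k, π j < s.k) (u r : ℕ → ℕ → ℕ)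
    (e e' : ℕ → ℕ → ℕ → Bits ec) :
    Triple P W mk τ (send s)
      (fun a => ((∀ j < s.k, (a.mem B (perm j)).val = π j) ∧ ∀ i < s.k, ∀ h < s.arity,
        (a.mem B (item i (fld h))).ct = sealedCt mk P B B (s.fw h) (u i h) (e i h) ∧
        (a.mem B (mask i (fld h))).ct = sealedCt mk P B A (s.fw h) (r i h) (e' i h)) ∧
        ∀ x ∈ grid s.k s.arity, True)
      (fun a => ((∀ j < s.k, (a.mem B (perm j)).val = π j) ∧ ∀ i < s.k, ∀ h < s.arity,
        (a.mem B (item i (fld h))).ct = sealedCt mk P B B (s.fw h) (u i h) (e i h) ∧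
        (a.mem B (mask i (fld h))).ct = sealedCt mk P B A (s.fw h) (r i h) (e' i h)) ∧
        ∀ x ∈ grid s.k s.arity,
          IsEnc B (s.fw x.2) (u (π x.1) x.2) (a.mem A (item x.1 (fld x.2))).ct ∧
          IsEnc A (s.fw x.2) (r (π x.1) x.2) (a.mem A (mask x.1 (fld x.2))).ct)
      ((grid s.k s.arity).flatMap fun x =>
        vis P A (ctView mk B (s.fw x.2) (u (π x.1) x.2) (e (π x.1) x.2)) ++
        vis P A (ctView mk A (s.fw x.2) (r (π x.1) x.2) (e' (π x.1) x.2))) := by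
  refine Triple.forAll (nodup_grid _ _) (fun x hx a ha h => ?_) (fun x hx y hy hne a h => trivial)
    (fun x hx y hy hne a h => ?_)
  · obtain ⟨⟨h1, h2⟩, -⟩ := h
    obtain ⟨hx1, hx2⟩ := mem_grid.1 hx
    have h3 := h2 _ (hπ _ hx1) _ hx2
    simp [ha, h1 _ hx1, hπ _ hx1, h3, vis_B_sealedCt]
    refine ⟨⟨tags_B_sealedCt _ _ _ _, tags_B_sealedCt _ _ _ _⟩, h1, h2⟩
  · rwa [drun_mem, drun_mem] <;> simpa [Prod.ext_iff] using hne

/-- The register `tmp 1` holds zero, so the subtraction computes the negative of the mask, which is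
encrypted and added. -/
theorem unmask_triple (hW : s.width + 1 ≤ W) (v c : ℕ → ℕ → ℕ) :
    Triple P W mk τ (unmask s)
      (fun a => (a.mem A (tmp 1)).val = 0 ∧ ∀ x ∈ grid s.k s.arity,
        IsEnc B (s.fw x.2) (v x.1 x.2 + c x.1 x.2) (a.mem A (item x.1 (fld x.2))).ct ∧
        IsEnc A (s.fw x.2) (c x.1 x.2) (a.mem A (mask x.1 (fld x.2))).ct)
      (fun a => (a.mem A (tmp 1)).val = 0 ∧ ∀ x ∈ grid s.k s.arity,
        IsEnc B (s.fw x.2) (v x.1 x.2) (a.mem A (item x.1 (fld x.2))).ct)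
      ((grid s.k s.arity).flatMap fun x => vis P A (coinStr (s.fw x.2) (τ (10, x.1, x.2, 2)).enc)) := by
  refine Triple.forAll (nodup_grid _ _) (fun x hx a ha h => ?_) (fun x hx y hy hne a h => ?_)
    (fun x hx y hy hne a h => ?_)
  · have hw := (s.fw_le x.2).trans hW
    obtain ⟨h0, h1, h2⟩ := h
    simp [ha, hw, h0, h2.ofBits]
    refine ⟨h2.key, (h1.add_same (isEnc_sealedCt ..)).congr ?_⟩
    have : c x.1 x.2 % 2 ^ s.fw x.2 < 2 ^ s.fw x.2 := Nat.mod_lt _ (by positivity)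
    -- Decryption yields only the residue `z` of the mask. Adding `2 ^ w - z` leaves the value plus
    -- a multiple of `2 ^ w`.
    rw [← Nat.div_add_mod (c x.1 x.2) (2 ^ s.fw x.2)]
    generalize c x.1 x.2 % 2 ^ s.fw x.2 = z at this
    simp only [Nat.add_mod_mod, Nat.mul_add_mod, Nat.mod_eq_of_lt this]
    rw [show v x.1 x.2 + (2 ^ s.fw x.2 * (c x.1 x.2 / 2 ^ s.fw x.2) + z) + (2 ^ s.fw x.2 - z) =
      v x.1 x.2 + 2 ^ s.fw x.2 * (c x.1 x.2 / 2 ^ s.fw x.2 + 1) by rw [mul_add]; omega]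
    simp
  · rwa [drun_mem, drun_mem] <;> simpa [Prod.ext_iff] using hne
  · rwa [drun_mem]
    simpa [Prod.ext_iff] using hne

theorem keys_triple (hW : s.width + 1 ≤ W) (u v : ℕ → ℕ) (hu : ∀ i < s.k, u i < 2 ^ s.width) :
    Triple P W mk τ (keys s)
      (fun a => True ∧ ∀ j ∈ List.range s.k, IsEnc B s.width (u j) (a.mem A (item j .name)).ct ∧
        IsEnc B s.width (v j) (a.mem A (item j .weight)).ct)
      (fun a => True ∧ ∀ j ∈ List.range s.k,
        IsEnc B (s.width + s.width) (u j + 2 ^ s.width * v j) (a.mem A (key j)).ct ∧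
        IsEnc B s.width j (a.mem A (label j)).ct)
      ((List.range s.k).flatMap fun j => vis P A (coinStr s.width (τ (11, j, 0, 2)).enc)) := by
  refine Triple.forAll List.nodup_range (fun j hj a ha h => ?_) (fun x hx y hy hne a h => ?_)
    (fun x hx y hy hne a h => ?_)
  · have hw : s.width ≤ W := by omega
    simp [ha, hw]
    exact h.2.1.cat h.2.2 (hu j (List.mem_range.1 hj))
  · rwa [drun_mem, drun_mem] <;> simp
  · rwa [drun_mem, drun_mem] <;> simpa using hne

/-- The pair `f j` lists key and label on wire `j`. The bound `N` guarantees that the encrypted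
comparison agrees with the comparison of integers; exchanges preserve it. -/
theorem net_triple (k w : ℕ) (hw : 0 < w) (N : ℕ) (hN : N ≤ 2 ^ w) (w' : ℕ) (L : List (ℕ × ℕ))
    (hL : ∀ c ∈ L, c.1 < k ∧ c.2 < k ∧ c.1 ≠ c.2) (f : ℕ → ℕ × ℕ) :
    Triple P W mk τ (L.flatMap fun c => quiet (Protocol.compareExchange c.1 c.2))
      (fun a => ∀ j < k, (f j).1 < N ∧ IsEnc B w (f j).1 (a.mem A (key j)).ct ∧
        IsEnc B w' (f j).2 (a.mem A (label j)).ct)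
      (fun a => ∀ j < k, (L.foldl exchange f j).1 < N ∧
        IsEnc B w (L.foldl exchange f j).1 (a.mem A (key j)).ct ∧
        IsEnc B w' (L.foldl exchange f j).2 (a.mem A (label j)).ct) [] := by
  induction L generalizing f with
  | nil => exact .nil
  | cons c L ih =>
    rw [List.flatMap_cons, List.foldl_cons]
    refine Triple.append (u := []) (fun a ha h => ?_)
      (ih (fun c hc => hL c (List.mem_cons_of_mem _ hc)) (exchange f c))
    obtain ⟨i, j⟩ := c
    obtain ⟨hi, hj, hij⟩ := hL (i, j) List.mem_cons_self
    simp only at hi hj hij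
    obtain ⟨b1, k1, l1⟩ := h i hi
    obtain ⟨b2, k2, l2⟩ := h j hj
    have c0 := k2.lt k1 hw (b2.trans_le hN) (b1.trans_le hN)
    have m1 := c0.mux k2 k1
    have m2 := c0.mux k1 k2
    have m3 := c0.mux l2 l1
    have m4 := c0.mux l1 l2
    simp [Protocol.compareExchange, ha]
    intro t ht
    by_cases hlt : (f j).1 < (f i).1
    · simp only [hlt, decide_true, if_true] at m1 m2 m3 m4
      simp only [exchange, hlt, if_true, Function.comp]
      by_cases h1 : t = i
      · subst h1
        simp [b2, m1, m3]
      · by_cases h2 : t = j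
        · subst h2
          simp [h1, b1, m2, m4]
        · rw [Equiv.swap_apply_of_ne_of_ne h1 h2]
          simp [h1, h2, h t ht]
    · simp only [hlt, decide_false, Bool.false_eq_true, if_false] at m1 m2 m3 m4
      simp only [exchange, hlt, if_false]
      by_cases h1 : t = i
      · subst h1
        simp [b1, m1, m3]
      · by_cases h2 : t = j
        · subst h2
          simp [h1, b2, m2, m4]
        · simp [h1, h2, h t ht]

end Exec

/-! ### Opening of the ranks, deletion loop, and output. -/

section Exec

variable {C : Type} {ec rc : ℕ} {P : Party} {W : ℕ} {mk : Party → Bool → Bits ec → C}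
  {τ : Label → Coin ec rc} {s : Sizes}

open Party Reg Labelled

attribute [local simp] mem_const mem_sub mem_move mem_load mem_store mem_coin mem_enc mem_dec mem_hom
  mem_mux mem_reenc mem_sendCt mem_sendVal view_const view_sub view_move view_load view_store view_hom
  view_mux view_dec view_coin view_enc view_reenc view_sendCt view_sendVal ok_const ok_sub ok_move
  ok_load ok_store ok_hom ok_mux ok_coin ok_sendVal ok_enc ok_dec ok_reenc ok_sendCt tags_sealedCt
  drun_blk drun_quiet brun qrun Party.other mem_grid isEnc_sealedCt
  Instr.Writes keeps_blk keeps_append keeps_quiet keeps_flatMap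

theorem sendRanks_triple (hW : s.width + 1 ≤ W) (ρ : ℕ → ℕ) :
    Triple P W mk τ (sendRanks s)
      (fun a => True ∧ ∀ j ∈ List.range s.k, IsEnc B s.width (ρ j) (a.mem A (label j)).ct)
      (fun a => True ∧ ∀ j ∈ List.range s.k,
        IsEnc B s.width (ρ j + (τ (12, j, 0, 0)).int) (a.mem B (masked j)).ct ∧
        (a.mem A (Reg.pad j)).val = (τ (12, j, 0, 0)).int)
      ((List.range s.k).flatMap fun j =>
        vis P A ((natBits (2 ^ s.width - 1).size (τ (12, j, 0, 0)).int).map .inl) ++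
        (vis P A (coinStr s.width (τ (12, j, 0, 1)).enc) ++
        (vis P A (coinStr s.width (τ (12, j, 0, 3)).re) ++
        vis P B (ctView mk B s.width (ρ j + (τ (12, j, 0, 0)).int) (τ (12, j, 0, 3)).enc)))) := by
  refine Triple.forAll List.nodup_range (fun j hj a ha h => ?_) (fun x hx y hy hne a h => ?_)
    (fun x hx y hy hne a h => ?_)
  · have hw : s.width ≤ W := by omega
    have e1 := h.2.add_same (isEnc_sealedCt (mk := mk) P A B s.width (τ (12, j, 0, 0)).int
      (τ (12, j, 0, 1)).enc)
    simp [ha, hw, reseal_eq e1, e1.length, vis_A_sealedCt]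
    exact ⟨e1.key, tags_A_sealedCt _ _ _ _⟩
  · rwa [drun_mem]
    simp
  · rwa [drun_mem, drun_mem] <;> simpa using hne

theorem openRanks_triple (c : ℕ → ℕ) :
    Triple P W mk τ (openRanks s)
      (fun a => True ∧ ∀ j ∈ List.range s.k, IsEnc B s.width (c j) (a.mem B (masked j)).ct)
      (fun a => True ∧ ∀ j ∈ List.range s.k, (a.mem A (masked j)).val = c j % 2 ^ s.width)
      ((List.range s.k).flatMap fun j => vis P A ((natBits s.width (c j)).map .inl)) := by
  refine Triple.forAll List.nodup_range (fun j hj a ha h => ?_) (fun x hx y hy hne a h => ?_)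
    (fun x hx y hy hne a h => ?_)
  · simp [ha, h.2.ofBits, natBits_mod]
    exact h.2.key
  · rwa [drun_mem]
    simpa using hne
  · rwa [drun_mem]
    simpa using hne

/-- Subtraction modulo `2 ^ s.width` removes the noise, and a rank is smaller than the modulus, so
it is recovered exactly. -/
theorem ranks_triple (ρ c : ℕ → ℕ) (hρ : ∀ j < s.k, ρ j < 2 ^ s.width) :
    Triple P W mk τ (ranks s)
      (fun a => True ∧ ∀ j ∈ List.range s.k, (a.mem A (masked j)).val = (ρ j + c j) % 2 ^ s.width ∧
        (a.mem A (Reg.pad j)).val = c j)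
      (fun a => True ∧ ∀ j ∈ List.range s.k, (a.mem A (rank j)).val = ρ j) [] := by
  refine (Triple.forAll List.nodup_range (v := fun _ => []) (fun j hj a ha h => ?_)
    (fun x hx y hy hne a h => ?_) (fun x hx y hy hne a h => ?_)).view_eq (by simp)
  · simp [ha, h.2.1, h.2.2]
    have hj := hρ j (List.mem_range.1 hj)
    have : c j % 2 ^ s.width < 2 ^ s.width := Nat.mod_lt _ (by positivity)
    rw [Nat.add_mod (ρ j), Nat.mod_eq_of_lt hj]
    generalize c j % 2 ^ s.width = z at this
    generalize 2 ^ s.width = M at *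
    -- The two cases are whether the masked value has wrapped around.
    rcases lt_or_ge (ρ j + z) M with h | h
    · rw [Nat.mod_eq_of_lt h, show ρ j + z + M - z = ρ j + M by omega, Nat.add_mod_right,
        Nat.mod_eq_of_lt hj]
    · rw [Nat.mod_eq_sub_mod h, Nat.mod_eq_of_lt (by omega : ρ j + z - M < M),
        show ρ j + z - M + M - z = ρ j by omega, Nat.mod_eq_of_lt hj]
  · rwa [drun_mem, drun_mem] <;> simp
  · rwa [drun_mem]
    simpa using hne

theorem moveStrings_triple (ρ : ℕ → ℕ) (hρ : ∀ j < s.k, ρ j < s.k) (b : ℕ → ℕ → Bool) :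
    Triple P W mk τ (moveStrings s)
      (fun a => ((∀ j < s.k, (a.mem A (rank j)).val = ρ j) ∧ ∀ i < s.k, ∀ h < s.n * s.m,
        IsEnc B 1 (b i h).toNat (a.mem A (item i (fld (h + 2)))).ct) ∧
        ∀ x ∈ grid s.k (s.n * s.m), True)
      (fun a => ((∀ j < s.k, (a.mem A (rank j)).val = ρ j) ∧ ∀ i < s.k, ∀ h < s.n * s.m,
        IsEnc B 1 (b i h).toNat (a.mem A (item i (fld (h + 2)))).ct) ∧
        ∀ x ∈ grid s.k (s.n * s.m), IsEnc B 1 (b (ρ x.1) x.2).toNat (a.mem A (srt x.1 x.2)).ct)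
      [] := by
  refine (Triple.forAll (nodup_grid _ _) (v := fun _ => []) (fun x hx a ha h => ?_)
    (fun x hx y hy hne a h => trivial) (fun x hx y hy hne a h => ?_)).view_eq (by simp)
  · obtain ⟨⟨h1, h2⟩, -⟩ := h
    obtain ⟨hx1, hx2⟩ := mem_grid.1 hx
    simp [ha, h1 _ hx1, hρ _ hx1, h2 _ (hρ _ hx1) _ hx2]
    exact ⟨h1, h2⟩
  · rwa [drun_mem]
    simpa [Prod.ext_iff] using hne

theorem constants_triple (hW : 1 ≤ W) :
    Triple P W mk τ constants (fun _ => True)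
      (fun a => IsEnc B 1 false.toNat (a.mem A (tmp 0)).ct ∧
        IsEnc B 1 true.toNat (a.mem A (tmp 1)).ct)
      (vis P A (coinStr 1 (τ (14, 0, 0, 1)).enc) ++ vis P A (coinStr 1 (τ (14, 0, 0, 3)).enc)) := by
  intro a ha _
  simp [constants, ha, hW]

theorem selInit_triple :
    Triple P W mk τ (selInit s)
      (fun a => (IsEnc B 1 false.toNat (a.mem A (tmp 0)).ct ∧
        IsEnc B 1 true.toNat (a.mem A (tmp 1)).ct) ∧ ∀ h ∈ List.range (s.n * s.m), True)
      (fun a => (IsEnc B 1 false.toNat (a.mem A (tmp 0)).ct ∧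
        IsEnc B 1 true.toNat (a.mem A (tmp 1)).ct) ∧ ∀ h ∈ List.range (s.n * s.m),
        IsEnc B 1 false.toNat (a.mem A (z s.k h)).ct ∧
        IsEnc B 1 false.toNat (a.mem A (cum h)).ct) [] := by
  refine (Triple.forAll List.nodup_range (v := fun _ => []) (fun x hx a ha h => ?_)
    (fun x hx y hy hne a h => trivial) (fun x hx y hy hne a h => ?_)).view_eq (by simp)
  · have := h.1
    simp [ha]
    simp at this
    exact ⟨this, this.1⟩
  · rwa [drun_mem, drun_mem] <;> simpa using hne

/-- The recursion for `zs` descends, as the loop does. Row `i` is computed from row `i + 1`, which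
starts with zeros in row `s.k`. -/
theorem suffixes_triple (b zs : ℕ → ℕ → Bool) (h0 : ∀ h, zs s.k h = false)
    (h1 : ∀ i < s.k, ∀ h, zs i h = (zs (i + 1) h || b i h)) :
    Triple P W mk τ (suffixes s)
      (fun a => (∀ i < s.k, ∀ h < s.n * s.m, IsEnc B 1 (b i h).toNat (a.mem A (srt i h)).ct) ∧
        ∀ h < s.n * s.m, IsEnc B 1 false.toNat (a.mem A (z s.k h)).ct)
      (fun a => ∀ i ≤ s.k, ∀ h < s.n * s.m, IsEnc B 1 (zs i h).toNat (a.mem A (z i h)).ct) [] := by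
  let S : LState C → Prop := fun a =>
    ∀ i < s.k, ∀ h < s.n * s.m, IsEnc B 1 (b i h).toNat (a.mem A (srt i h)).ct
  refine (Triple.loopDown (Inv := fun i a => S a ∧ ∀ j, i ≤ j → j ≤ s.k → ∀ h < s.n * s.m,
    IsEnc B 1 (zs j h).toNat (a.mem A (z j h)).ct) (v := fun _ => []) (fun i hi => ?_)).weaken
    (fun a h => ⟨h.1, fun j hj hj' t ht => ?_⟩) (fun a h i hi => h.2 i (by omega) hi) |>.view_eq
    (by simp)
  · have := Triple.forAll (P := P) (W := W) (mk := mk) (τ := τ) (L := List.range (s.n * s.m))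
      List.nodup_range
      (body := fun h => quiet [.hom A B .or (z i h) (z (i + 1) h) (srt i h)])
      (S := fun a => S a ∧ ∀ j, i + 1 ≤ j → j ≤ s.k → ∀ h < s.n * s.m,
        IsEnc B 1 (zs j h).toNat (a.mem A (z j h)).ct)
      (p := fun _ _ => True) (q := fun h a => IsEnc B 1 (zs i h).toNat (a.mem A (z i h)).ct)
      (v := fun _ => []) (fun h hh a ha H => ?_) (fun x hx y hy hne a h => trivial)
      (fun x hx y hy hne a h => ?_)
    · refine (this.weaken (fun a h => ⟨h, fun _ _ => trivial⟩) fun a h => ⟨h.1.1, ?_⟩).view_eq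
        (by simp)
      intro j hj hj' t ht
      rcases hj.eq_or_lt with rfl | hj
      · exact h.2 t (List.mem_range.2 ht)
      · exact h.1.2 j hj hj' t ht
    · obtain ⟨⟨H1, H2⟩, -⟩ := H
      have hh := List.mem_range.1 hh
      have e := (H2 (i + 1) le_rfl hi h hh).or (H1 i hi h hh)
      rw [← h1 i hi] at e
      simp [ha, S, e]
      refine ⟨H1, fun j hj hj' t ht => ?_⟩
      rw [if_neg (by omega)]
      exact H2 j hj hj' t ht
    · rwa [drun_mem]
      simpa using hne
  · obtain rfl : j = s.k := le_antisymm hj' hj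
    rw [h0]
    exact h.2 t ht

/-- The hypotheses are the recursions that the loop realizes. During pass `i` the register `keep i`
first collects whether every position is covered without string `i`; its negation is the decision,
which then updates the disjunction of selected strings. -/
theorem select_triple (b zs cs : ℕ → ℕ → Bool) (ks : ℕ → Bool) (h0 : ∀ h, cs 0 h = false)
    (h1 : ∀ i, ks i = !(List.range (s.n * s.m)).all fun h => zs (i + 1) h || cs i h)
    (h2 : ∀ i h, cs (i + 1) h = (cs i h || (ks i && b i h))) :
    Triple P W mk τ (select s)
      (fun a => IsEnc B 1 true.toNat (a.mem A (tmp 1)).ct ∧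
        (∀ i < s.k, ∀ h < s.n * s.m, IsEnc B 1 (b i h).toNat (a.mem A (srt i h)).ct) ∧
        (∀ i ≤ s.k, ∀ h < s.n * s.m, IsEnc B 1 (zs i h).toNat (a.mem A (z i h)).ct) ∧
        ∀ h < s.n * s.m, IsEnc B 1 false.toNat (a.mem A (cum h)).ct)
      (fun a => ∀ i < s.k, IsEnc B 1 (ks i).toNat (a.mem A (keep i)).ct) [] := by
  let S : LState C → Prop := fun a => IsEnc B 1 true.toNat (a.mem A (tmp 1)).ct ∧
    (∀ i < s.k, ∀ h < s.n * s.m, IsEnc B 1 (b i h).toNat (a.mem A (srt i h)).ct) ∧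
    (∀ i ≤ s.k, ∀ h < s.n * s.m, IsEnc B 1 (zs i h).toNat (a.mem A (z i h)).ct)
  let Cum : ℕ → LState C → Prop := fun i a =>
    ∀ h < s.n * s.m, IsEnc B 1 (cs i h).toNat (a.mem A (cum h)).ct
  let K : ℕ → LState C → Prop := fun i a => ∀ j < i, IsEnc B 1 (ks j).toNat (a.mem A (keep j)).ct
  refine (Triple.loop (Inv := fun i a => S a ∧ Cum i a ∧ K i a) (v := fun _ => [])
    (fun i hi => ?_)).weaken (fun a h => ⟨⟨h.1, h.2.1, h.2.2.1⟩, fun t ht => by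
      rw [h0]; exact h.2.2.2 t ht, by intro j hj; omega⟩) (fun a h => h.2.2) |>.view_eq (by simp)
  -- In `F n` the first `n` positions have been checked.
  let F : ℕ → LState C → Prop := fun n a => S a ∧ Cum i a ∧ K i a ∧
    IsEnc B 1 ((List.range n).all fun h => zs (i + 1) h || cs i h).toNat (a.mem A (keep i)).ct
  have t1 : Triple P W mk τ (quiet [.move A (keep i) (tmp 1)]) (fun a => S a ∧ Cum i a ∧ K i a)
      (F 0) [] := by
    rintro a ha ⟨H1, H2, H3⟩
    simp only [F, S, Cum, K] at H1 H2 H3 ⊢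
    simp [ha]
    simp at H1
    refine ⟨H1, H2, fun j hj => ?_, H1.1⟩
    rw [if_neg (by omega)]
    exact H3 j hj
  have t2 : Triple P W mk τ ((List.range (s.n * s.m)).flatMap fun h => quiet
      [.hom A B .or (tmp 2) (z (i + 1) h) (cum h), .hom A B .and (keep i) (keep i) (tmp 2)])
      (F 0) (F (s.n * s.m)) [] := by
    refine (Triple.loop (v := fun _ => []) fun h hh a ha H => ?_).view_eq (by simp)
    obtain ⟨H1, H2, H3, H4⟩ := H
    have e1 := (H1.2.2 (i + 1) hi h hh).or (H2 h hh)
    have e2 := H4.and e1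
    simp only [F, S, Cum, K] at H1 H2 H3 ⊢
    simp [ha, List.range_succ]
    simp at H1 e2
    refine ⟨H1, H2, fun j hj => ?_, e2⟩
    rw [if_neg (by omega)]
    exact H3 j hj
  have t3 : Triple P W mk τ (quiet [.hom A B .xor (keep i) (keep i) (tmp 1)]) (F (s.n * s.m))
      (fun a => S a ∧ Cum i a ∧ K (i + 1) a) [] := by
    rintro a ha ⟨H1, H2, H3, H4⟩
    have e1 := H4.xor H1.1
    rw [Bool.xor_true, ← h1] at e1
    simp only [S, Cum, K] at H1 H2 H3 ⊢
    simp [ha]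
    simp at H1
    refine ⟨H1, H2, fun j hj => ?_⟩
    split
    · next h => rw [h]; exact e1
    · exact H3 j (by omega)
  have t4 : Triple P W mk τ ((List.range (s.n * s.m)).flatMap fun h => quiet
      [.hom A B .and (tmp 2) (keep i) (srt i h), .hom A B .or (cum h) (cum h) (tmp 2)])
      (fun a => S a ∧ Cum i a ∧ K (i + 1) a) (fun a => S a ∧ Cum (i + 1) a ∧ K (i + 1) a) [] := by
    -- In `G n` the first `n` positions already include the decision on string `i`.
    let G : ℕ → LState C → Prop := fun n a => S a ∧ (∀ h < s.n * s.m,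
      IsEnc B 1 (if h < n then cs (i + 1) h else cs i h).toNat (a.mem A (cum h)).ct) ∧ K (i + 1) a
    refine (Triple.loop (Inv := G) (v := fun _ => []) fun h hh a ha H => ?_).weaken
      (fun a h => by simpa [G] using h) (fun a h => ⟨h.1, fun t ht => by
        simpa [ht] using h.2.1 t ht, h.2.2⟩) |>.view_eq (by simp)
    obtain ⟨H1, H2, H3⟩ := H
    have e1 := (H3 i (by omega)).and (H1.2.1 i hi h hh)
    have e2 := H2 h hh
    rw [if_neg (by omega)] at e2
    have e3 := e2.or e1
    rw [← h2] at e3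
    simp only [G, S, K] at H1 H2 H3 ⊢
    simp [ha]
    simp at H1
    refine ⟨H1, fun t ht => ?_, fun j hj => H3 j (by omega)⟩
    by_cases htn : t = h
    · subst htn
      simpa using e3
    · have := H2 t ht
      rw [if_neg htn]
      rwa [if_congr (show t ≤ h ↔ t < h by omega) rfl rfl]
  exact (t1.append (t2.append (t3.append t4))).view_eq (by simp)

/-- Different positions have different ranks, so no stored bit is overwritten later. -/
theorem storeSel_triple (ρ : ℕ → ℕ) (hρ : ∀ j < s.k, ρ j < s.k)
    (hinj : ∀ i < s.k, ∀ j < s.k, ρ i = ρ j → i = j) (c : ℕ → ℕ) :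
    Triple P W mk τ (storeSel s)
      (fun a => (∀ j < s.k, (a.mem A (rank j)).val = ρ j) ∧
        ∀ j < s.k, IsEnc B 1 (c j) (a.mem A (keep j)).ct)
      (fun a => ∀ j < s.k, IsEnc B 1 (c j) (a.mem A (sel (ρ j))).ct) [] := by
  refine (Triple.loop (Inv := fun i a => ((∀ j < s.k, (a.mem A (rank j)).val = ρ j) ∧
    ∀ j < s.k, IsEnc B 1 (c j) (a.mem A (keep j)).ct) ∧
    ∀ j < i, IsEnc B 1 (c j) (a.mem A (sel (ρ j))).ct) (v := fun _ => [])
    (fun i hi a ha h => ?_)).weaken (fun a h => ⟨h, by intro j hj; omega⟩) (fun a h => h.2) |>.view_eq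
    (by simp)
  obtain ⟨⟨H1, H2⟩, H3⟩ := h
  simp [ha, H1 i hi, hρ i hi]
  refine ⟨⟨H1, H2⟩, fun j hj => ?_⟩
  split
  · next h => rw [hinj j (by omega) i hi h]; exact H2 i hi
  · next h => exact H3 j (lt_of_le_of_ne (by omega) fun e => h (by rw [e]))

theorem sendSel_triple (hW : 1 ≤ W) (c : ℕ → ℕ) :
    Triple P W mk τ (sendSel s)
      (fun a => True ∧ ∀ j ∈ List.range s.k, IsEnc B 1 (c j) (a.mem A (sel j)).ct)
      (fun a => True ∧ ∀ j ∈ List.range s.k, IsEnc B 1 (c j) (a.mem B (sel j)).ct)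
      ((List.range s.k).flatMap fun j => vis P A (coinStr 1 (τ (15, j, 0, 0)).re) ++
        vis P B (ctView mk B 1 (c j) (τ (15, j, 0, 0)).enc)) := by
  refine Triple.forAll List.nodup_range (fun j hj a ha h => ?_) (fun x hx y hy hne a h => ?_)
    (fun x hx y hy hne a h => ?_)
  · simp [ha, hW, reseal_eq h.2, h.2.length, vis_A_sealedCt]
    exact ⟨h.2.key, tags_A_sealedCt _ _ _ _⟩
  · rwa [drun_mem]
    simpa using hne
  · rwa [drun_mem]
    simpa using hne

/-- `B` knows `π` and writes the bit of position `j` to the feature `π j`. Injectivity again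
prevents overwriting, and a value below `2` is recovered from one encrypted bit. -/
theorem openSel_triple (π : ℕ → ℕ) (hπ : ∀ j < s.k, π j < s.k)
    (hinj : ∀ i < s.k, ∀ j < s.k, π i = π j → i = j) (c : ℕ → ℕ) (hc : ∀ j < s.k, c j < 2) :
    Triple P W mk τ (openSel s)
      (fun a => (∀ j < s.k, (a.mem B (perm j)).val = π j) ∧
        ∀ j < s.k, IsEnc B 1 (c j) (a.mem B (sel j)).ct)
      (fun a => ∀ j < s.k, (a.mem B (out (π j))).val = c j) [] := by
  refine (Triple.loop (Inv := fun i a => ((∀ j < s.k, (a.mem B (perm j)).val = π j) ∧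
    ∀ j < s.k, IsEnc B 1 (c j) (a.mem B (sel j)).ct) ∧
    ∀ j < i, (a.mem B (out (π j))).val = c j) (v := fun _ => [])
    (fun i hi a ha h => ?_)).weaken (fun a h => ⟨h, by intro j hj; omega⟩) (fun a h => h.2) |>.view_eq
    (by simp)
  obtain ⟨⟨H1, H2⟩, H3⟩ := h
  have H4 := (H2 i hi).ofBits
  rw [pow_one, Nat.mod_eq_of_lt (hc i hi)] at H4
  simp [ha, H1 i hi, hπ i hi, H4]
  refine ⟨(H2 i hi).key, ⟨H1, fun j hj => ?_⟩, fun j hj => ?_⟩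
  · split
    · next h => rw [h]; exact H2 i hi
    · exact H2 j hj
  split
  · next h => rw [hinj j (by omega) i hi h]
  · next h => exact H3 j (lt_of_le_of_ne (by omega) fun e => h (by rw [e]))

theorem share_triple (o : ℕ → ℕ) :
    Triple P W mk τ (share s)
      (fun a => True ∧ ∀ i ∈ List.range s.k, (a.mem B (out i)).val = o i)
      (fun a => True ∧ ∀ i ∈ List.range s.k, (a.mem B (out i)).val = o i ∧
        (a.mem A (out i)).val = o i % 2)
      ((List.range s.k).flatMap fun i => vis P A ((natBits 1 (o i)).map .inl)) := by
  refine Triple.forAll List.nodup_range (fun j hj a ha h => ?_) (fun x hx y hy hne a h => ?_)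
    (fun x hx y hy hne a h => ?_)
  · simp [ha, h.2]
  · rwa [drun_mem]
    simp
  · rwa [drun_mem, drun_mem] <;> simp [hne]

end Exec

/-! ### Batcher's network sorts -/

/-- A comparator on bits. -/
def bexchange (b : ℕ → Bool) (c : ℕ × ℕ) : ℕ → Bool := fun j =>
  if j = c.1 then b c.1 && b c.2 else if j = c.2 then b c.1 || b c.2 else b j

theorem foldl_bexchange_of_notMem {N : List (ℕ × ℕ)} {j : ℕ} (b : ℕ → Bool)
    (h : ∀ c ∈ N, j ≠ c.1 ∧ j ≠ c.2) : N.foldl bexchange b j = b j := by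
  induction N generalizing b with
  | nil => rfl
  | cons c N ih =>
    rw [List.foldl_cons, ih _ fun c hc => h c (List.mem_cons_of_mem _ hc)]
    have := h c List.mem_cons_self
    simp [bexchange, this]

/-- The result of a network on given wires depends on these wires only. -/
theorem mem_oddEvenMerge {t lo r : ℕ} {c : ℕ × ℕ} (h : c ∈ oddEvenMerge t lo r) :
    ∃ i j, i < j ∧ j < 2 ^ t ∧ c = (lo + r * i, lo + r * j) := by
  induction t using Nat.strong_induction_on generalizing lo r with
  | _ t ih =>
    match t with
    | 0 => simp [oddEvenMerge] at h
    | 1 =>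
      simp only [oddEvenMerge, List.mem_singleton] at h
      exact ⟨0, 1, by simp, by simp, by simp [h]⟩
    | t + 2 =>
      simp only [oddEvenMerge, List.mem_append, List.mem_map, List.mem_range] at h
      rcases h with (h | h) | ⟨i, hi, rfl⟩
      · obtain ⟨i, j, h1, h2, rfl⟩ := ih _ (by omega) h
        exact ⟨2 * i, 2 * j, by omega, by rw [pow_succ]; omega, by
          rw [show 2 * r * i = r * (2 * i) by ring, show 2 * r * j = r * (2 * j) by ring]⟩
      · obtain ⟨i, j, h1, h2, rfl⟩ := ih _ (by omega) h
        exact ⟨2 * i + 1, 2 * j + 1, by omega, by rw [pow_succ]; omega, by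
          rw [show lo + r + 2 * r * i = lo + r * (2 * i + 1) by ring,
            show lo + r + 2 * r * j = lo + r * (2 * j + 1) by ring]⟩
      · exact ⟨2 * i + 1, 2 * i + 2, by omega, by rw [pow_succ]; omega, rfl⟩

/-- The comparators act on disjoint pairs of wires, so each acts on the original values. -/
theorem foldl_bexchange_adjacent {lo r : ℕ} (hr : 0 < r) (n : ℕ) (b : ℕ → Bool) :
    let b' := ((List.range n).map fun i => (lo + r * (2 * i + 1), lo + r * (2 * i + 2))).foldl
      bexchange b
    ∀ i < n, b' (lo + r * (2 * i + 1)) = (b (lo + r * (2 * i + 1)) && b (lo + r * (2 * i + 2))) ∧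
      b' (lo + r * (2 * i + 2)) = (b (lo + r * (2 * i + 1)) || b (lo + r * (2 * i + 2))) := by
  induction n with
  | zero => intro b' i hi; omega
  | succ n ih =>
    intro b' i hi
    have hinj : ∀ {x y : ℕ}, lo + r * x = lo + r * y ↔ x = y := by
      intro x y; rw [add_right_inj, Nat.mul_right_inj hr.ne']
    simp only [b', List.range_succ, List.map_append, List.foldl_append, List.map_singleton,
      List.foldl_cons, List.foldl_nil]
    rcases Nat.lt_succ_iff_lt_or_eq.1 hi with h | rfl
    · have := ih i h
      simp only [bexchange, hinj]
      rw [if_neg (by omega), if_neg (by omega), if_neg (by omega), if_neg (by omega)]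
      exact this
    · have h1 : ∀ x, 2 * i < x → (((List.range i).map fun i =>
          (lo + r * (2 * i + 1), lo + r * (2 * i + 2))).foldl bexchange b) (lo + r * x) =
          b (lo + r * x) := by
        intro x hx
        refine foldl_bexchange_of_notMem b fun c hc => ?_
        obtain ⟨j, hj, rfl⟩ := List.mem_map.1 hc
        have := List.mem_range.1 hj
        simp only [ne_eq, hinj]
        omega
      simp only [bexchange, hinj, h1 _ (Nat.lt_succ_self _), h1 (2 * i + 2) (by omega)]
      simp

/-- The sorted halves begin with `p` and `q` zeros. The merged even wires then have `⌈p/2⌉ + ⌈q/2⌉`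
zeros and the merged odd wires `⌊p/2⌋ + ⌊q/2⌋`. These numbers differ by at most two, so at most one
adjacent pair is out of order, and the last row of comparators repairs it. -/
theorem merge_sorts {t lo r : ℕ} (hr : 0 < r) {p q : ℕ} {b : ℕ → Bool} (hp : p ≤ 2 ^ t)
    (hq : q ≤ 2 ^ t) (h1 : ∀ i < 2 ^ t, b (lo + r * i) = decide (p ≤ i))
    (h2 : ∀ i < 2 ^ t, b (lo + r * (2 ^ t + i)) = decide (q ≤ i)) :
    ∀ i < 2 ^ (t + 1), (oddEvenMerge (t + 1) lo r).foldl bexchange b (lo + r * i) =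
      decide (p + q ≤ i) := by
  induction t generalizing lo r p q b with
  | zero =>
    simp only [pow_zero, Nat.lt_one_iff, forall_eq, mul_zero, add_zero, mul_one] at h1 h2 hp hq
    intro i hi
    have : i = 0 ∨ i = 1 := by simp at hi; omega
    have hr' : r ≠ 0 := hr.ne'
    rcases this with rfl | rfl
    · simp [oddEvenMerge, bexchange, h1, h2]
    · simp [oddEvenMerge, bexchange, h1, h2, hr']
      rw [← Bool.decide_or, decide_eq_decide]
      omega
  | succ t ih =>
    intro i hi
    have hM : 2 ^ (t + 1) = 2 * 2 ^ t := by ring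
    have hM2 : 2 ^ (t + 1 + 1) = 4 * 2 ^ t := by ring
    have hinj : ∀ {x y : ℕ}, lo + r * x = lo + r * y ↔ x = y := by
      intro x y; rw [add_right_inj, Nat.mul_right_inj hr.ne']
    simp only [oddEvenMerge, List.foldl_append]
    set be := (oddEvenMerge (t + 1) lo (2 * r)).foldl bexchange b with hbe
    set bo := (oddEvenMerge (t + 1) (lo + r) (2 * r)).foldl bexchange be with hbo
    -- The even wires of the two halves are again sorted, with rounded-up numbers of zeros; they
    -- form a merging problem with doubled stride.
    have e1 : ∀ i < 2 ^ (t + 1), be (lo + r * (2 * i)) = decide ((p + 1) / 2 + (q + 1) / 2 ≤ i) := by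
      intro i hi
      rw [show r * (2 * i) = 2 * r * i by ring]
      refine ih (by omega) (by omega) (by omega) (fun i hi => ?_) (fun i hi => ?_) i hi
      · rw [show 2 * r * i = r * (2 * i) by ring, h1 _ (by omega), decide_eq_decide]; omega
      · rw [show 2 * r * (2 ^ t + i) = r * (2 ^ (t + 1) + 2 * i) by ring, h2 _ (by omega),
          decide_eq_decide]
        omega
    have e2 : ∀ i, be (lo + r * (2 * i + 1)) = b (lo + r * (2 * i + 1)) := by
      intro i
      refine foldl_bexchange_of_notMem b fun c hc => ?_
      obtain ⟨x, y, -, -, rfl⟩ := mem_oddEvenMerge hc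
      simp only [ne_eq, show 2 * r * x = r * (2 * x) by ring, show 2 * r * y = r * (2 * y) by ring,
        hinj]
      omega
    -- The odd wires were not touched by the even merge, and their numbers of zeros are rounded
    -- down.
    have o1 : ∀ i < 2 ^ (t + 1), bo (lo + r * (2 * i + 1)) = decide (p / 2 + q / 2 ≤ i) := by
      intro i hi
      rw [show lo + r * (2 * i + 1) = lo + r + 2 * r * i by ring]
      refine ih (by omega) (by omega) (by omega) (fun i hi => ?_) (fun i hi => ?_) i hi
      · rw [show lo + r + 2 * r * i = lo + r * (2 * i + 1) by ring, e2, h1 _ (by omega),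
          decide_eq_decide]
        omega
      · rw [show lo + r + 2 * r * (2 ^ t + i) = lo + r * (2 * (2 ^ t + i) + 1) by ring, e2,
          show 2 * (2 ^ t + i) + 1 = 2 ^ (t + 1) + (2 * i + 1) by ring, h2 _ (by omega),
          decide_eq_decide]
        omega
    have o2 : ∀ i, bo (lo + r * (2 * i)) = be (lo + r * (2 * i)) := by
      intro i
      refine foldl_bexchange_of_notMem be fun c hc => ?_
      obtain ⟨x, y, -, -, rfl⟩ := mem_oddEvenMerge hc
      simp only [ne_eq, show lo + r + 2 * r * x = lo + r * (2 * x + 1) by ring,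
        show lo + r + 2 * r * y = lo + r * (2 * y + 1) by ring, hinj]
      omega
    have A := foldl_bexchange_adjacent (lo := lo) hr (2 ^ (t + 1) - 1) bo
    simp only at A
    -- The last row compares wire `2 * j + 1` with wire `2 * j + 2`. The lowest and the highest wire
    -- take no part in it and are treated separately.
    obtain ⟨j, rfl | rfl⟩ : ∃ j, i = 2 * j + 1 ∨ i = 2 * j := ⟨i / 2, by omega⟩
    · by_cases hj : j < 2 ^ (t + 1) - 1
      · rw [(A j hj).1, o1 j (by omega), show 2 * j + 2 = 2 * (j + 1) by ring, o2,
          e1 (j + 1) (by omega), ← Bool.decide_and, decide_eq_decide]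
        omega
      · rw [foldl_bexchange_of_notMem, o1 j (by omega), decide_eq_decide]
        · omega
        · intro c hc
          obtain ⟨x, hx, rfl⟩ := List.mem_map.1 hc
          have := List.mem_range.1 hx
          simp only [ne_eq, hinj]
          omega
    · rcases j with _ | j
      · rw [foldl_bexchange_of_notMem, o2, e1 0 (by omega), decide_eq_decide]
        · omega
        · intro c hc
          obtain ⟨x, hx, rfl⟩ := List.mem_map.1 hc
          simp only [ne_eq, hinj]
          omega
      · rw [show 2 * (j + 1) = 2 * j + 2 by ring, (A j (by omega)).2, o1 j (by omega),
          show 2 * j + 2 = 2 * (j + 1) by ring, o2, e1 (j + 1) (by omega), ← Bool.decide_or,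
          decide_eq_decide]
        omega

theorem mem_oddEvenSort {t lo : ℕ} {c : ℕ × ℕ} (h : c ∈ oddEvenSort t lo) :
    lo ≤ c.1 ∧ c.1 < c.2 ∧ c.2 < lo + 2 ^ t := by
  induction t generalizing lo with
  | zero => simp [oddEvenSort] at h
  | succ t ih =>
    simp only [oddEvenSort, List.mem_append] at h
    have : 2 ^ (t + 1) = 2 * 2 ^ t := by ring
    rcases h with (h | h) | h
    · have := ih h; omega
    · have := ih h; omega
    · obtain ⟨i, j, h1, h2, rfl⟩ := mem_oddEvenMerge h
      simp only
      omega

/-- A sorted sequence of bits is described by its number of zeros, and these numbers add up under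
merging. Sorting the upper half leaves the lower half as it is. -/
theorem oddEvenSort_sorts (t lo : ℕ) (b : ℕ → Bool) :
    ∃ p ≤ 2 ^ t, ∀ i < 2 ^ t, (oddEvenSort t lo).foldl bexchange b (lo + i) = decide (p ≤ i) := by
  induction t generalizing lo b with
  | zero =>
    cases h : b lo
    · exact ⟨1, by simp, by intro i hi; obtain rfl : i = 0 := by simpa using hi
                            simpa [oddEvenSort] using h⟩
    · exact ⟨0, by simp, by intro i hi; obtain rfl : i = 0 := by simpa using hi
                            simpa [oddEvenSort] using h⟩
  | succ t ih =>
    simp only [oddEvenSort, List.foldl_append]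
    obtain ⟨p, hp, h1⟩ := ih lo b
    obtain ⟨q, hq, h2⟩ := ih (lo + 2 ^ t) ((oddEvenSort t lo).foldl bexchange b)
    refine ⟨p + q, by rw [pow_succ]; omega, fun i hi => ?_⟩
    have := merge_sorts (lo := lo) one_pos hp hq (b := (oddEvenSort t (lo + 2 ^ t)).foldl bexchange
      ((oddEvenSort t lo).foldl bexchange b)) (fun i hi => ?_) (fun i hi => ?_) i hi
    · simpa using this
    · rw [one_mul, ← h1 i hi]
      refine foldl_bexchange_of_notMem _ fun c hc => ?_
      have := mem_oddEvenSort hc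
      omega
    · rw [one_mul, ← add_assoc]
      exact h2 i hi

theorem mem_sortNetwork {k : ℕ} {c : ℕ × ℕ} (h : c ∈ sortNetwork k) : c.1 < c.2 ∧ c.2 < k := by
  simp only [sortNetwork, List.mem_filter, decide_eq_true_eq] at h
  exact ⟨(mem_oddEvenSort h.1).2.1, h.2⟩

/-- Wires that carry the largest value may be omitted. -/
theorem foldl_bexchange_filter {N : List (ℕ × ℕ)} (hN : ∀ c ∈ N, c.1 < c.2) {k : ℕ} {b : ℕ → Bool}
    (hb : ∀ j, k ≤ j → b j = true) :
    (N.filter fun c => decide (c.2 < k)).foldl bexchange b = N.foldl bexchange b := by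
  induction N generalizing b with
  | nil => rfl
  | cons c N ih =>
    have hc := hN c List.mem_cons_self
    have ih := fun b hb => @ih (fun c hc => hN c (List.mem_cons_of_mem _ hc)) b hb
    by_cases h : c.2 < k
    · rw [List.filter_cons_of_pos (by simpa using h), List.foldl_cons, List.foldl_cons]
      refine ih _ fun j hj => ?_
      rw [bexchange, if_neg (by omega), if_neg (by omega), hb j hj]
    · rw [List.filter_cons_of_neg (by simpa using h), List.foldl_cons]
      have : bexchange b c = b := by
        funext j
        simp only [bexchange, hb c.2 (by omega), Bool.and_true, Bool.or_true]
        split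
        · next h => rw [h]
        · split
          · next h => rw [h, hb c.2 (by omega)]
          · rfl
      rw [this]
      exact ih _ hb

/-- The bits that say which keys of the first `k` wires are at least `θ`. -/
def threshold (k θ : ℕ) (f : ℕ → ℕ × ℕ) (j : ℕ) : Bool := decide (j < k → θ ≤ (f j).1)

/-- Comparison with `θ` is monotone, hence commutes with taking minimum and maximum. This is the
step behind the 0-1 principle; labels play no role in it. -/
theorem threshold_exchange {k θ : ℕ} {f : ℕ → ℕ × ℕ} {c : ℕ × ℕ} (hc : c.1 < c.2 ∧ c.2 < k) :
    threshold k θ (exchange f c) = bexchange (threshold k θ f) c := by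
  funext j
  obtain ⟨x, y⟩ := c
  obtain ⟨hxy, hy⟩ := hc
  simp only at hxy hy
  have hx : x < k := by omega
  by_cases h : (f y).1 < (f x).1
  · simp only [exchange, h, if_true, threshold, bexchange, hx, hy, forall_const, Function.comp]
    by_cases h1 : j = x
    · subst h1
      simp only [Equiv.swap_apply_left, if_true, hx, forall_const, ← Bool.decide_and,
        decide_eq_decide]
      omega
    · by_cases h2 : j = y
      · subst h2
        simp only [Equiv.swap_apply_right, if_true, hy, h1, if_false, forall_const,
          ← Bool.decide_or, decide_eq_decide]
        omega
      · simp only [Equiv.swap_apply_of_ne_of_ne h1 h2, h1, h2, if_false]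
  · simp only [exchange, h, if_false, threshold, bexchange, hx, hy, forall_const]
    by_cases h1 : j = x
    · subst h1
      simp only [if_true, hx, forall_const, ← Bool.decide_and, decide_eq_decide]
      omega
    · by_cases h2 : j = y
      · subst h2
        simp only [if_true, hy, h1, if_false, forall_const, ← Bool.decide_or, decide_eq_decide]
        omega
      · simp only [h1, h2, if_false]

theorem threshold_foldl {k θ : ℕ} {f : ℕ → ℕ × ℕ} {N : List (ℕ × ℕ)}
    (hN : ∀ c ∈ N, c.1 < c.2 ∧ c.2 < k) :
    threshold k θ (N.foldl exchange f) = N.foldl bexchange (threshold k θ f) := by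
  induction N generalizing f with
  | nil => rfl
  | cons c N ih =>
    rw [List.foldl_cons, List.foldl_cons, ih fun c hc => hN c (List.mem_cons_of_mem _ hc),
      threshold_exchange (hN c List.mem_cons_self)]

/-- The 0-1 principle, with the key that ends on wire `i` as threshold: the bit on wire `i` is one
and the bits are sorted, so the bit on wire `j` is one too. The missing wires up to a power of two
read as ones, and comparators reaching them are idle. -/
theorem sortNetwork_sorts (k : ℕ) (f : ℕ → ℕ × ℕ) {i j : ℕ} (hij : i ≤ j) (hj : j < k) :
    ((sortNetwork k).foldl exchange f i).1 ≤ ((sortNetwork k).foldl exchange f j).1 := by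
  set g := (sortNetwork k).foldl exchange f with hg
  have h := threshold_foldl (θ := (g i).1) (f := f) fun c hc => mem_sortNetwork (k := k) hc
  have h' : (sortNetwork k).foldl bexchange (threshold k (g i).1 f) =
      (oddEvenSort (Nat.clog 2 k) 0).foldl bexchange (threshold k (g i).1 f) :=
    foldl_bexchange_filter (fun c hc => (mem_oddEvenSort hc).2.1) fun j hj => by
      simp [threshold, not_lt.2 hj]
  obtain ⟨p, hp, H⟩ := oddEvenSort_sorts (Nat.clog 2 k) 0 (threshold k (g i).1 f)
  have hk : k ≤ 2 ^ Nat.clog 2 k := Nat.le_pow_clog (by norm_num) _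
  rw [← h', ← h, ← hg] at H
  have hi := H i (by omega)
  have hj' := H j (by omega)
  simp only [threshold, zero_add, decide_eq_decide, hj, show i < k by omega, forall_const] at hi hj'
  rw [hj']
  exact (hi.1 le_rfl).trans hij

/-- A network permutes the wires. -/
theorem exists_perm_foldl_exchange (k : ℕ) (N : List (ℕ × ℕ)) (hN : ∀ c ∈ N, c.1 < c.2 ∧ c.2 < k)
    (f : ℕ → ℕ × ℕ) :
    ∃ σ : Equiv.Perm ℕ, (∀ j, k ≤ j → σ j = j) ∧ N.foldl exchange f = f ∘ σ := by
  induction N generalizing f with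
  | nil => exact ⟨1, fun _ _ => rfl, rfl⟩
  | cons c N ih =>
    obtain ⟨σ, h1, h2⟩ := ih (fun c hc => hN c (List.mem_cons_of_mem _ hc)) (exchange f c)
    have hc := hN c List.mem_cons_self
    rw [List.foldl_cons, h2]
    by_cases h : (f c.2).1 < (f c.1).1
    · refine ⟨Equiv.swap c.1 c.2 * σ, fun j hj => ?_, ?_⟩
      · rw [Equiv.Perm.mul_apply, h1 j hj, Equiv.swap_apply_of_ne_of_ne (by omega) (by omega)]
      · rw [exchange, if_pos h]; rfl
    · exact ⟨σ, h1, by rw [exchange, if_neg h]⟩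

/-! ### The deletion loop -/

/-- Does a bit number `h` of the strings `i, …, k-1` equal one? -/
def sufOr (k : ℕ) (b : ℕ → ℕ → Bool) (i h : ℕ) : Bool :=
  (List.range k).any fun t => decide (i ≤ t) && b t h

theorem sufOr_self (k : ℕ) (b : ℕ → ℕ → Bool) (h : ℕ) : sufOr k b k h = false := by
  simp only [sufOr, List.any_eq_false, List.mem_range]
  intro t ht
  simp [ht]

theorem sufOr_eq {k : ℕ} (b : ℕ → ℕ → Bool) {i : ℕ} (hi : i < k) (h : ℕ) :
    sufOr k b i h = (sufOr k b (i + 1) h || b i h) := by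
  rw [Bool.eq_iff_iff]
  simp only [sufOr, List.any_eq_true, List.mem_range, Bool.and_eq_true, decide_eq_true_eq,
    Bool.or_eq_true]
  constructor
  · rintro ⟨t, h1, h2, h3⟩
    rcases h2.eq_or_lt with rfl | h2
    · exact .inr h3
    · exact .inl ⟨t, h1, h2, h3⟩
  · rintro (⟨t, h1, h2, h3⟩ | h3)
    · exact ⟨t, h1, by omega, h3⟩
    · exact ⟨i, hi, le_rfl, h3⟩

/-- Is string `i` selected, given the disjunction `c` of the selected strings before it? -/
def selBit (k N : ℕ) (b : ℕ → ℕ → Bool) (c : ℕ → Bool) (i : ℕ) : Bool :=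
  !(List.range N).all fun h => sufOr k b (i + 1) h || c h

/-- The disjunction of the selected strings among the first `i`. -/
def cumBits (k N : ℕ) (b : ℕ → ℕ → Bool) : ℕ → ℕ → Bool
  | 0 => fun _ => false
  | i + 1 => fun h => cumBits k N b i h || (selBit k N b (cumBits k N b i) i && b i h)

/-- The selected strings. -/
def selected (k N : ℕ) (b : ℕ → ℕ → Bool) (i : ℕ) : Bool := selBit k N b (cumBits k N b i) i

/-- The recursion unfolded: it identifies the second half of the covering condition with the
selected features before `i`. -/
theorem cumBits_eq_true {k N : ℕ} {b : ℕ → ℕ → Bool} {i h : ℕ} :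
    cumBits k N b i h = true ↔ ∃ j < i, selected k N b j = true ∧ b j h = true := by
  induction i with
  | zero => simp [cumBits]
  | succ i ih =>
    simp only [cumBits, Bool.or_eq_true, ih, Bool.and_eq_true]
    constructor
    · rintro (⟨j, h1, h2⟩ | h2)
      · exact ⟨j, by omega, h2⟩
      · exact ⟨i, by omega, h2⟩
    · rintro ⟨j, h1, h2⟩
      rcases Nat.lt_succ_iff_lt_or_eq.1 h1 with h1 | rfl
      · exact .inl ⟨j, h1, h2⟩
      · exact .inr h2

/-! ### The sorted order of the features and the output of CWC. -/

section Plain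

variable {k : ℕ} (pos neg : List (Fin k → Bool))

/-- The rank of a feature: by weight, then by index. -/
def rankKey (w : ℕ) (weight : Fin k → ℕ) (i : Fin k) : ℕ := i + 2 ^ w * weight i

/-- Indices are below `2 ^ w`, so the integers `i + 2 ^ w * weight i` are ordered lexicographically,
the weight first. -/
theorem rankKey_lt {w : ℕ} (hw : k ≤ 2 ^ w) {weight : Fin k → ℕ} {i j : Fin k} :
    rankKey w weight i < rankKey w weight j ↔
      weight i < weight j ∨ weight i = weight j ∧ i < j := by
  have hi : (i : ℕ) < 2 ^ w := i.2.trans_le hw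
  have hj : (j : ℕ) < 2 ^ w := j.2.trans_le hw
  rw [rankKey, rankKey, Fin.lt_def]
  rcases lt_trichotomy (weight i) (weight j) with h | h | h
  · have : 2 ^ w * (weight i + 1) ≤ 2 ^ w * weight j := Nat.mul_le_mul_left _ h
    rw [mul_add] at this
    simp only [h, true_or, iff_true]
    omega
  · rw [h]; simp
  · have : 2 ^ w * (weight j + 1) ≤ 2 ^ w * weight i := Nat.mul_le_mul_left _ h
    rw [mul_add] at this
    constructor
    · intro; omega
    · intro; omega

/-- Sorting orders the weights weakly. Features of equal weight keep their order by stability: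
otherwise they would appear in the output both in increasing and in decreasing order of the indices.
-/
theorem pairwise_sortedFeatures {w : ℕ} (hw : k ≤ 2 ^ w) : (sortedFeatures pos neg).Pairwise
    fun i j => rankKey w (bitWeight pos neg) i < rankKey w (bitWeight pos neg) j := by
  have hperm : (sortedFeatures pos neg).Perm (List.finRange k) := List.mergeSort_perm _ _
  have hnd : (sortedFeatures pos neg).Nodup := hperm.nodup_iff.2 (List.nodup_finRange k)
  have htr : ∀ a b c : Fin k, decide (bitWeight pos neg a ≤ bitWeight pos neg b) = true →
      decide (bitWeight pos neg b ≤ bitWeight pos neg c) = true →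
      decide (bitWeight pos neg a ≤ bitWeight pos neg c) = true := by
    intro a b c; simp only [decide_eq_true_eq]; exact le_trans
  have htot : ∀ a b : Fin k, (decide (bitWeight pos neg a ≤ bitWeight pos neg b) ||
      decide (bitWeight pos neg b ≤ bitWeight pos neg a)) = true := by
    intro a b; simp only [Bool.or_eq_true, decide_eq_true_eq]; exact le_total _ _
  have hs := List.pairwise_mergeSort htr htot (List.finRange k)
  change (sortedFeatures pos neg).Pairwise _ at hs
  rw [List.pairwise_iff_getElem] at hs ⊢
  intro i j hi hj hij
  have h1 := hs i j hi hj hij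
  simp only [decide_eq_true_eq] at h1
  rw [rankKey_lt hw]
  rcases h1.lt_or_eq with h1 | h1
  · exact .inl h1
  refine .inr ⟨h1, ?_⟩
  by_contra hlt
  have hne : (sortedFeatures pos neg)[i] ≠ (sortedFeatures pos neg)[j] := fun e =>
    hij.ne ((hnd.getElem_inj_iff).1 e)
  have hlt' : (sortedFeatures pos neg)[j] < (sortedFeatures pos neg)[i] :=
    lt_of_le_of_ne (not_lt.1 hlt) hne.symm
  -- The pair, arranged by increasing index, is a sublist of the list that is sorted.
  have hsub : [(sortedFeatures pos neg)[j], (sortedFeatures pos neg)[i]].Sublist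
      (List.finRange k) := by
    generalize (sortedFeatures pos neg)[j] = x at hlt'
    generalize (sortedFeatures pos neg)[i] = y at hlt'
    refine List.sublist_of_subperm_of_sortedLE
      (List.subperm_of_subset (by simp [hlt'.ne]) fun _ _ => List.mem_finRange _) ?_ ?_
    · simpa [List.sortedLE_iff_pairwise] using hlt'.le
    · rw [List.sortedLE_iff_pairwise]
      exact (List.pairwise_lt_finRange k).imp le_of_lt
  have hsub' := List.pair_sublist_mergeSort htr htot (by simpa using h1.ge) hsub
  change List.Sublist _ (sortedFeatures pos neg) at hsub'
  -- In a list without repetitions, the order within a sublist is the order of positions; this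
  -- contradicts `i < j`.
  have hp := List.pairwise_iff_forall_sublist.1 (show (sortedFeatures pos neg).Pairwise
    (fun a b => (sortedFeatures pos neg).idxOf a < (sortedFeatures pos neg).idxOf b) from by
      rw [List.pairwise_iff_getElem]
      intro a b ha hb hab
      rwa [hnd.idxOf_getElem, hnd.idxOf_getElem]) hsub'
  rw [hnd.idxOf_getElem, hnd.idxOf_getElem] at hp
  omega

/-- Rank keys of different features differ, so a weakly increasing arrangement is strictly
increasing, and there is only one strictly increasing arrangement of all features. -/
theorem sortedFeatures_eq {w : ℕ} (hw : k ≤ 2 ^ w) (G : Equiv.Perm (Fin k))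
    (hG : ∀ i j, i ≤ j → rankKey w (bitWeight pos neg) (G i) ≤ rankKey w (bitWeight pos neg) (G j)) :
    sortedFeatures pos neg = (List.finRange k).map G := by
  have hperm : (sortedFeatures pos neg).Perm ((List.finRange k).map G) :=
    (List.mergeSort_perm _ _).trans (Equiv.Perm.map_finRange_perm G).symm
  refine hperm.eq_of_pairwise (le := fun i j =>
    rankKey w (bitWeight pos neg) i < rankKey w (bitWeight pos neg) j) ?_
    (pairwise_sortedFeatures pos neg hw) ?_
  · intro a b _ _ h1 h2; omega
  · rw [List.pairwise_map]
    refine (List.pairwise_lt_finRange k).imp fun {i j} hij => lt_of_le_of_ne (hG i j hij.le) ?_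
    intro e
    have h1 := (rankKey_lt (weight := bitWeight pos neg) hw (i := G i) (j := G j)).not.1 (by omega)
    have h2 := (rankKey_lt (weight := bitWeight pos neg) hw (i := G j) (j := G i)).not.1 (by omega)
    push Not at h1 h2
    have h3 : bitWeight pos neg (G i) = bitWeight pos neg (G j) := by omega
    exact hij.ne (G.injective (le_antisymm (h2.2 h3.symm) (h1.2 h3)))

/-- Before step `i` the current set consists of all features from position `i` on and the selected
ones before. Without feature `i` it covers a position iff the suffix or the cumulated disjunction
does. -/
theorem mem_cwc {N : ℕ} (hN : pos.length * neg.length = N) (G : Equiv.Perm (Fin k))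
    (hG : sortedFeatures pos neg = (List.finRange k).map G) (b : ℕ → ℕ → Bool)
    (hb : ∀ (j : Fin k), ∀ h < N, (bitString pos neg (G j)).getD h false = b j h) (j : Fin k) :
    G j ∈ cwc pos neg ↔ selected k N b j = true := by
  have key : ∀ i ≤ k, ∀ j : Fin k, G j ∈ (((List.finRange k).map G).take i).foldl
      (fun S i => if Consistent pos neg (S.erase i) then S.erase i else S) Finset.univ ↔
      (i ≤ j ∨ selected k N b j = true) := by
    intro i
    induction i with
    | zero => intro _ j; simp
    | succ i ih =>
      intro hi
      have ih := ih (by omega)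
      have hlen : i < ((List.finRange k).map G).length := by simp; omega
      rw [← List.take_append_getElem hlen, List.foldl_append, List.foldl_cons, List.foldl_nil]
      set S := (((List.finRange k).map G).take i).foldl
        (fun S i => if Consistent pos neg (S.erase i) then S.erase i else S) Finset.univ
      have hget : ((List.finRange k).map G)[i] = G ⟨i, hi⟩ := by simp
      rw [hget]
      have hmem : ∀ j : Fin k, G j ∈ S.erase (G ⟨i, hi⟩) ↔
          (i < j.1 ∨ (j.1 < i ∧ selected k N b j = true)) := by
        intro j
        rw [Finset.mem_erase, ih j, ne_eq, G.injective.eq_iff, Fin.ext_iff]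
        constructor
        · rintro ⟨h1, h2 | h2⟩
          · exact .inl (lt_of_le_of_ne h2 (Ne.symm h1))
          · rcases lt_or_gt_of_ne h1 with h | h
            · exact .inr ⟨h, h2⟩
            · exact .inl h
        · rintro (h | ⟨h, h2⟩)
          · exact ⟨h.ne', .inl h.le⟩
          · exact ⟨h.ne, .inr h2⟩
      -- Membership in the reduced set splits into later features, which give `sufOr`, and earlier
      -- selected ones, which give `cumBits`.
      have hcons : Consistent pos neg (S.erase (G ⟨i, hi⟩)) ↔ selected k N b i = false := by
        rw [selected, selBit, Bool.not_eq_false', List.all_eq_true]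
        simp only [Consistent, hN]
        refine forall₂_congr fun h hh => ?_
        have hh := List.mem_range.1 hh
        rw [Bool.or_eq_true, cumBits_eq_true]
        simp only [sufOr, List.any_eq_true, List.mem_range, Bool.and_eq_true, decide_eq_true_eq]
        constructor
        · rintro ⟨x, hx, hx'⟩
          obtain ⟨j, rfl⟩ := G.surjective x
          rw [hb j h hh] at hx'
          rcases (hmem j).1 hx with h1 | ⟨h1, h2⟩
          · exact .inl ⟨j, j.2, h1, hx'⟩
          · exact .inr ⟨j, h1, h2, hx'⟩
        · rintro (⟨j, h1, h2, h3⟩ | ⟨j, h1, h2, h3⟩)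
          · exact ⟨G ⟨j, h1⟩, (hmem _).2 (.inl h2), by rw [hb _ h hh]; exact h3⟩
          · exact ⟨G ⟨j, by omega⟩, (hmem _).2 (.inr ⟨h1, h2⟩), by rw [hb _ h hh]; exact h3⟩
      intro j
      split
      · next h =>
        rw [hmem j]
        have := hcons.1 h
        constructor
        · rintro (h | h)
          · exact .inl h
          · exact .inr h.2
        · rintro (h | h)
          · exact .inl h
          · rcases lt_trichotomy j.1 i with h' | h' | h'
            · exact .inr ⟨h', h⟩
            · rw [h', this] at h; cases h
            · exact .inl h'
      · next h =>
        rw [ih j]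
        have : selected k N b i = true := by
          rw [← Bool.not_eq_false]; exact fun e => h (hcons.2 e)
        constructor
        · rintro (h | h)
          · rcases h.eq_or_lt with h | h
            · right; rw [← h]; exact this
            · exact .inl h
          · exact .inr h
        · rintro (h | h)
          · exact .inl (by omega)
          · exact .inr h
  have := key k le_rfl j
  rw [List.take_of_length_le (by simp)] at this
  rw [cwc, hG, this]
  simp [not_le.2 j.2]

/-- The pairs in lexicographic order are numbered by `m * p + q`; quotient and remainder invert this
numbering. -/
theorem flatMap_range_map {α : Type} (n m : ℕ) (f : ℕ → ℕ → α) :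
    ((List.range n).flatMap fun p => (List.range m).map (f p)) =
      (List.range (n * m)).map fun t => f (t / m) (t % m) := by
  rcases Nat.eq_zero_or_pos m with rfl | hm
  · simp
  induction n with
  | zero => simp
  | succ n ih =>
    rw [List.range_succ, List.flatMap_append, ih, add_mul, one_mul, List.range_add, List.map_append]
    simp only [List.flatMap_singleton, List.map_map, List.append_cancel_left_eq]
    refine List.map_congr_left fun q hq => ?_
    have hq := List.mem_range.1 hq
    simp only [Function.comp]
    rw [mul_comm n m, Nat.mul_add_div hm, Nat.div_eq_of_lt hq, Nat.mul_add_mod, Nat.mod_eq_of_lt hq,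
      add_zero]

theorem bitString_eq {X Y : ℕ → Fin k → Bool} {n m : ℕ} (hX : pos = (List.range n).map X)
    (hY : neg = (List.range m).map Y) (i : Fin k) :
    bitString pos neg i =
      (List.range (n * m)).map fun t => Bool.xor (X (t / m) i) (Y (t % m) i) := by
  rw [← flatMap_range_map n m fun p q => Bool.xor (X p i) (Y q i), bitString, hX, hY,
    List.flatMap_map]
  simp [Function.comp_def]

end Plain

theorem count_true_map (N : ℕ) (f : ℕ → Bool) :
    ((List.range N).map f).count true = ∑ t ∈ Finset.range N, (f t).toNat := by
  induction N with
  | zero => rfl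
  | succ N ih =>
    rw [List.range_succ, List.map_append, List.count_append, ih, Finset.sum_range_succ]
    cases h : f N <;> simp [h]

/-! ### The joint data as a table -/

section Data

variable {s : Sizes} (d : Inputs s)

/-- The joint data. -/
def table : Table where
  x p i := decide (rowEntry (d .A).pos (s.posStart .A) p i + rowEntry (d .B).pos (s.posStart .B) p i = 1)
  y q i := decide (rowEntry (d .A).neg (s.negStart .A) q i + rowEntry (d .B).neg (s.negStart .B) q i = 1)

theorem rowEntry_eq {k n : ℕ} (rows : Fin n → Fin k → Bool) {start p i : ℕ} (hp : p < n) (hi : i < k) :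
    rowEntry rows start (start + p) i = (rows ⟨p, hp⟩ ⟨i, hi⟩).toNat := by
  simp [rowEntry, hp, hi]

theorem rowEntry_of_lt {k n : ℕ} (rows : Fin n → Fin k → Bool) {start p i : ℕ} (hp : p < start) :
    rowEntry rows start p i = 0 := by
  simp [rowEntry, not_le.2 hp]

theorem rowEntry_of_le {k n : ℕ} (rows : Fin n → Fin k → Bool) {start p i : ℕ} (hp : start + n ≤ p) :
    rowEntry rows start p i = 0 := by
  rw [rowEntry, dif_neg (by omega)]

theorem decide_toNat (b : Bool) : decide (b.toNat = 1) = b := by cases b <;> rfl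

/-- Data numbers of the two parties do not overlap, so one of the two summands in `table` vanishes.
-/
theorem table_x_A {p i : ℕ} (hp : p < s.npos .A) (hi : i < s.k) :
    (table d).x p i = (d .A).pos ⟨p, hp⟩ ⟨i, hi⟩ := by
  have h := rowEntry_eq (d .A).pos (start := 0) hp hi
  rw [zero_add] at h
  rw [table]
  simp only [Sizes.posStart, h, rowEntry_of_lt (d .B).pos hp, add_zero, decide_toNat]

theorem table_x_B {p i : ℕ} (hp : p < s.npos .B) (hi : i < s.k) :
    (table d).x (s.npos .A + p) i = (d .B).pos ⟨p, hp⟩ ⟨i, hi⟩ := by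
  have h := rowEntry_eq (d .B).pos (start := s.npos .A) hp hi
  rw [table]
  simp only [Sizes.posStart, h, rowEntry_of_le (d .A).pos (show 0 + s.npos .A ≤ s.npos .A + p by omega),
    zero_add, decide_toNat]

theorem table_y_A {p i : ℕ} (hp : p < s.nneg .A) (hi : i < s.k) :
    (table d).y p i = (d .A).neg ⟨p, hp⟩ ⟨i, hi⟩ := by
  have h := rowEntry_eq (d .A).neg (start := 0) hp hi
  rw [zero_add] at h
  rw [table]
  simp only [Sizes.negStart, h, rowEntry_of_lt (d .B).neg hp, add_zero, decide_toNat]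

theorem table_y_B {p i : ℕ} (hp : p < s.nneg .B) (hi : i < s.k) :
    (table d).y (s.nneg .A + p) i = (d .B).neg ⟨p, hp⟩ ⟨i, hi⟩ := by
  have h := rowEntry_eq (d .B).neg (start := s.nneg .A) hp hi
  rw [table]
  simp only [Sizes.negStart, h, rowEntry_of_le (d .A).neg (show 0 + s.nneg .A ≤ s.nneg .A + p by omega),
    zero_add, decide_toNat]

theorem joint_eq {k a b : ℕ} (f : Fin a → Fin k → Bool) (g : Fin b → Fin k → Bool)
    (X : ℕ → ℕ → Bool) (hf : ∀ p (hp : p < a) i (hi : i < k), X p i = f ⟨p, hp⟩ ⟨i, hi⟩)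
    (hg : ∀ p (hp : p < b) i (hi : i < k), X (a + p) i = g ⟨p, hp⟩ ⟨i, hi⟩) :
    List.ofFn f ++ List.ofFn g = (List.range (a + b)).map fun p (i : Fin k) => X p i := by
  rw [List.range_add, List.map_append]
  congr 1
  · refine List.ext_getElem (by simp) fun p h1 h2 => ?_
    simp only [List.getElem_ofFn, List.getElem_map, List.getElem_range]
    funext i
    exact (hf p (by simpa using h1) i i.2).symm
  · refine List.ext_getElem (by simp) fun p h1 h2 => ?_
    simp only [List.getElem_ofFn, List.getElem_map, List.getElem_range]
    funext i
    exact (hg p (by simpa using h1) i i.2).symm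

/-- The joint positive data. -/
def jointPos : List (Fin s.k → Bool) := List.ofFn (d .A).pos ++ List.ofFn (d .B).pos

/-- The joint negative data. -/
def jointNeg : List (Fin s.k → Bool) := List.ofFn (d .A).neg ++ List.ofFn (d .B).neg

theorem bitString_joint (i : Fin s.k) : bitString (jointPos d) (jointNeg d) i =
    (List.range (s.n * s.m)).map ((table d).bit s i) := by
  rw [bitString_eq (jointPos d) (jointNeg d) (n := s.n) (m := s.m)
    (joint_eq _ _ (table d).x (fun p hp i hi => table_x_A d hp hi) fun p hp i hi => table_x_B d hp hi)
    (joint_eq _ _ (table d).y (fun p hp i hi => table_y_A d hp hi) fun p hp i hi => table_y_B d hp hi)]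
  rfl

theorem bitWeight_joint (i : Fin s.k) :
    bitWeight (jointPos d) (jointNeg d) i = (table d).weight s i := by
  rw [bitWeight, bitString_joint, count_true_map, Table.weight]

theorem length_joint : (jointPos d).length * (jointNeg d).length = s.n * s.m := by
  simp [jointPos, jointNeg, Sizes.n, Sizes.m]

/-- The output of CWC, for arbitrary indices. -/
def resVal (i : ℕ) : ℕ := if h : i < s.k then (decide (⟨i, h⟩ ∈ result d)).toNat else 0

theorem Sizes.k_lt (s : Sizes) : s.k < 2 ^ s.width :=
  (Nat.le_add_right _ _).trans_lt (Nat.lt_size_self _)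

theorem Table.weight_lt (D : Table) (i : ℕ) : D.weight s i < 2 ^ s.width := by
  have : D.weight s i ≤ s.n * s.m := by
    refine (Finset.sum_le_card_nsmul _ _ 1 fun t _ => ?_).trans (by simp)
    cases D.bit s i t <;> simp
  exact (this.trans (Nat.le_add_left _ _)).trans_lt (Nat.lt_size_self _)

/-- The keys by which the shuffled features are sorted. -/
def sortKey (π : ℕ → ℕ) (j : ℕ) : ℕ := π j + 2 ^ s.width * (table d).weight s (π j)

/-- The new names of the shuffled features in sorted order. -/
def sortedName (π : ℕ → ℕ) (j : ℕ) : ℕ :=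
  ((sortNetwork s.k).foldl exchange (fun j => (sortKey d π j, j)) j).2

variable {d}

theorem exists_perm_sortedName (π : ℕ → ℕ) :
    ∃ σ : Equiv.Perm ℕ, (∀ j, s.k ≤ j → σ j = j) ∧ ∀ j, σ j = sortedName d π j := by
  obtain ⟨σ, h1, h2⟩ := exists_perm_foldl_exchange s.k (sortNetwork s.k)
    (fun c hc => mem_sortNetwork hc) fun j => (sortKey d π j, j)
  exact ⟨σ, h1, fun j => by rw [sortedName, h2]; rfl⟩

theorem perm_lt {k : ℕ} {σ : Equiv.Perm ℕ} (h : ∀ j, k ≤ j → σ j = j) {j : ℕ} (hj : j < k) :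
    σ j < k := by
  by_contra hk
  have := σ.injective (h _ (not_lt.1 hk))
  omega

theorem exists_of_perm {k : ℕ} {σ : Equiv.Perm ℕ} (h : ∀ j, k ≤ j → σ j = j) {j : ℕ} (hj : j < k) :
    ∃ i < k, σ i = j := by
  refine ⟨σ.symm j, ?_, by simp⟩
  by_contra hk
  have := h _ (not_lt.1 hk)
  rw [Equiv.apply_symm_apply] at this
  omega

/-- The sorting permutation, and the renaming by a permutation `π`. -/
theorem exists_sortedFeatures_eq (π : Equiv.Perm ℕ) (hπ : ∀ j, s.k ≤ j → π j = j) :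
    ∃ G : Equiv.Perm (Fin s.k), (∀ j : Fin s.k, (G j : ℕ) = π (sortedName d π j)) ∧
      sortedFeatures (jointPos d) (jointNeg d) = (List.finRange s.k).map G := by
  obtain ⟨σ, h1, h2⟩ := exists_perm_sortedName (d := d) π
  obtain ⟨σ', h1', h2'⟩ := exists_perm_foldl_exchange s.k (sortNetwork s.k)
    (fun c hc => mem_sortNetwork hc) fun j => (sortKey d π j, j)
  have hlt : ∀ j < s.k, π (sortedName d π j) < s.k := fun j hj => by
    rw [← h2]; exact perm_lt hπ (perm_lt h1 hj)
  let g : Fin s.k → Fin s.k := fun j => ⟨π (sortedName d π j), hlt j j.2⟩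
  have hg : Function.Injective g := fun i j h => by
    have h := congrArg Fin.val h
    simp only [g, ← h2] at h
    exact Fin.ext (σ.injective (π.injective h))
  let G := Equiv.ofBijective g (Finite.injective_iff_bijective.1 hg)
  refine ⟨G, fun j => rfl, sortedFeatures_eq _ _ (w := s.width) s.k_lt.le G fun i j hij => ?_⟩
  have := sortNetwork_sorts s.k (fun j => (sortKey d π j, j)) hij j.2
  rw [h2'] at this
  -- The key on wire `i` after sorting is the rank key of the feature whose new name is on this
  -- wire.
  have e : ∀ i : Fin s.k, rankKey s.width (bitWeight (jointPos d) (jointNeg d)) (G i) =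
      sortKey d π (σ' i) := by
    intro i
    rw [rankKey, bitWeight_joint]
    change π (sortedName d π i) + 2 ^ s.width * (table d).weight s (π (sortedName d π i)) = _
    rw [sortedName, h2']
    rfl
  rw [e, e]
  exact this

/-- The shuffle followed along the sorted names is the sorted order of the features, which does not
depend on the shuffle. So for fixed data the names determine the shuffle. This is why the sorting
permutation that `A` learns carries no information about the data. -/
theorem perm_eq_of_sortedName_eq {π π' : Equiv.Perm ℕ} (hπ : ∀ j, s.k ≤ j → π j = j)
    (hπ' : ∀ j, s.k ≤ j → π' j = j) (h : ∀ j < s.k, sortedName d π j = sortedName d π' j) :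
    π = π' := by
  obtain ⟨G, hG, e⟩ := exists_sortedFeatures_eq (d := d) π hπ
  obtain ⟨G', hG', e'⟩ := exists_sortedFeatures_eq (d := d) π' hπ'
  have hGG : ∀ j, G j = G' j := fun j =>
    List.map_inj_left.1 (e.symm.trans e') j (List.mem_finRange j)
  obtain ⟨σ, h1, h2⟩ := exists_perm_sortedName (d := d) π
  ext j
  by_cases hj : j < s.k
  · obtain ⟨i, hi, rfl⟩ := exists_of_perm h1 hj
    have := hG ⟨i, hi⟩
    rw [hGG, hG'] at this
    simp only [← h i hi, ← h2] at this
    exact this.symm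
  · rw [hπ j (not_lt.1 hj), hπ' j (not_lt.1 hj)]

/-- The deletion loop on the sorted strings computes the output of CWC. -/
theorem selected_eq (π : Equiv.Perm ℕ) (hπ : ∀ j, s.k ≤ j → π j = j) {j : ℕ} (hj : j < s.k) :
    (selected s.k (s.n * s.m) (fun j h => (table d).bit s (π (sortedName d π j)) h) j).toNat =
      resVal d (π (sortedName d π j)) := by
  obtain ⟨G, hG, hsort⟩ := exists_sortedFeatures_eq (d := d) π hπ
  have := mem_cwc (jointPos d) (jointNeg d) (length_joint d) G hsort
    (fun j h => (table d).bit s (π (sortedName d π j)) h) (fun j h hh => by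
      rw [bitString_joint]
      simp [hh, hG]) ⟨j, hj⟩
  have e := hG ⟨j, hj⟩
  simp only at e
  rw [resVal, dif_pos (e ▸ (G ⟨j, hj⟩).2)]
  congr 1
  rw [Bool.eq_iff_iff, decide_eq_true_eq, ← this]
  exact iff_of_eq (congrArg (· ∈ _) (Fin.ext e))

end Data

/-! ### The whole execution -/

/-- The plaintexts and the encryption coins of the ciphertexts that are seen in an execution, and
the plaintexts that are received. -/
structure Script (ec : ℕ) where
  pos : ℕ → ℕ → ℕ
  neg : ℕ → ℕ → ℕ
  item : ℕ → ℕ → ℕ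
  shuffled : ℕ → ℕ → ℕ
  shuffledCoins : ℕ → ℕ → ℕ → Bits ec
  mask : ℕ → ℕ → ℕ
  maskCoins : ℕ → ℕ → ℕ → Bits ec
  rank : ℕ → ℕ
  sel : ℕ → ℕ
  out : ℕ → ℕ

section

variable {C : Type} {ec rc : ℕ} (P : Party) (mk : Party → Bool → Bits ec → C) (s : Sizes)
  (τ : Label → Coin ec rc)

open Party

/-- What is seen in the execution that is described by a script. -/
def Script.view (K : Script ec) : List (Bool ⊕ C) :=
  ((grid (s.npos A) s.k).flatMap fun x => vis P A (coinStr 1 (τ (1, x.1, x.2, 0)).enc)) ++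
  (((grid (s.nneg A) s.k).flatMap fun x => vis P A (coinStr 1 (τ (2, x.1, x.2, 0)).enc)) ++
  (((grid (s.npos B) s.k).flatMap fun x => vis P B (coinStr 1 (τ (3, x.1, x.2, 0)).enc) ++
    vis P A (ctView mk B 1 (K.pos x.1 x.2) (τ (3, x.1, x.2, 0)).enc)) ++
  (((grid (s.nneg B) s.k).flatMap fun x => vis P B (coinStr 1 (τ (4, x.1, x.2, 0)).enc) ++
    vis P A (ctView mk B 1 (K.neg x.1 x.2) (τ (4, x.1, x.2, 0)).enc)) ++
  (((List.range s.k).flatMap fun i => vis P A (coinStr s.width (τ (5, i, 0, 1)).enc) ++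
    vis P A (coinStr s.width (τ (5, i, 0, 3)).enc)) ++
  (((grid s.k s.arity).flatMap fun x =>
    vis P A ((natBits (2 ^ s.fw x.2 - 1).size (τ (6, x.1, x.2, 0)).int).map .inl) ++
    (vis P A (coinStr (s.fw x.2) (τ (6, x.1, x.2, 1)).enc) ++
    (vis P A (coinStr (s.fw x.2) (τ (6, x.1, x.2, 2)).enc) ++
    (vis P A (coinStr (s.fw x.2) (τ (6, x.1, x.2, 4)).re) ++
    (vis P B (ctView mk B (s.fw x.2) (K.item x.1 x.2) (τ (6, x.1, x.2, 4)).enc) ++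
    vis P B (ctView mk A (s.fw x.2) (τ (6, x.1, x.2, 0)).int (τ (6, x.1, x.2, 1)).enc)))))) ++
  (((List.range s.k).reverse.flatMap fun i =>
    vis P B ((natBits i.size (τ (7, i, 0, 0)).int).map .inl)) ++
  (((grid s.k s.arity).flatMap fun x =>
    vis P B ((natBits (2 ^ s.fw x.2 - 1).size (τ (8, x.1, x.2, 0)).int).map .inl) ++
    (vis P B (coinStr (s.fw x.2) (τ (8, x.1, x.2, 1)).enc) ++
    (vis P B (coinStr (s.fw x.2) (τ (8, x.1, x.2, 3)).re) ++
    (vis P B (coinStr (s.fw x.2) (τ (8, x.1, x.2, 4)).enc) ++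
    vis P B (coinStr (s.fw x.2) (τ (8, x.1, x.2, 6)).re))))) ++
  (((grid s.k s.arity).flatMap fun x =>
    vis P A (ctView mk B (s.fw x.2) (K.shuffled x.1 x.2) (K.shuffledCoins x.1 x.2)) ++
    vis P A (ctView mk A (s.fw x.2) (K.mask x.1 x.2) (K.maskCoins x.1 x.2))) ++
  (((grid s.k s.arity).flatMap fun x => vis P A (coinStr (s.fw x.2) (τ (10, x.1, x.2, 2)).enc)) ++
  (((List.range s.k).flatMap fun j => vis P A (coinStr s.width (τ (11, j, 0, 2)).enc)) ++
  (((List.range s.k).flatMap fun j =>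
    vis P A ((natBits (2 ^ s.width - 1).size (τ (12, j, 0, 0)).int).map .inl) ++
    (vis P A (coinStr s.width (τ (12, j, 0, 1)).enc) ++
    (vis P A (coinStr s.width (τ (12, j, 0, 3)).re) ++
    vis P B (ctView mk B s.width (K.rank j) (τ (12, j, 0, 3)).enc)))) ++
  (((List.range s.k).flatMap fun j => vis P A ((natBits s.width (K.rank j)).map .inl)) ++
  ((vis P A (coinStr 1 (τ (14, 0, 0, 1)).enc) ++ vis P A (coinStr 1 (τ (14, 0, 0, 3)).enc)) ++
  (((List.range s.k).flatMap fun j => vis P A (coinStr 1 (τ (15, j, 0, 0)).re) ++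
    vis P B (ctView mk B 1 (K.sel j) (τ (15, j, 0, 0)).enc)) ++
  ((List.range s.k).flatMap fun i => vis P A ((natBits 1 (K.out i)).map .inl))))))))))))))))

variable {s}

/-- The permutation of the features that is drawn by `B`. -/
def drawn : Equiv.Perm ℕ := fyPerm (fun i => (τ (7, i, 0, 0)).int) s.k

/-- The script of the execution on given data. -/
def realScript (d : Inputs s) : Script ec where
  pos p i := ((table d).x (s.posStart B + p) i).toNat
  neg q i := ((table d).y (s.negStart B + q) i).toNat
  item i h := (table d).comp s i h + (τ (6, i, h, 0)).int
  shuffled j h := (table d).comp s (drawn (s := s) τ j) h + (τ (6, drawn (s := s) τ j, h, 0)).int +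
    (τ (8, drawn (s := s) τ j, h, 0)).int
  shuffledCoins j h := (τ (8, drawn (s := s) τ j, h, 3)).enc
  mask j h := (τ (6, drawn (s := s) τ j, h, 0)).int + (τ (8, drawn (s := s) τ j, h, 0)).int
  maskCoins j h := (τ (8, drawn (s := s) τ j, h, 6)).enc
  rank j := sortedName d (drawn (s := s) τ) j + (τ (12, j, 0, 0)).int
  sel j := resVal d (drawn (s := s) τ j)
  out i := resVal d i

/-- The state before the execution. -/
def startState (d : Inputs s) (v : List (Bool ⊕ C)) : LState C where
  mem P r :=
    match r with
    | .pos p i => ⟨rowEntry (d P).pos (s.posStart P) p i, []⟩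
    | .neg q i => ⟨rowEntry (d P).neg (s.negStart P) q i, []⟩
    | _ => ⟨0, []⟩
  view := v
  ok := True

theorem resVal_lt (d : Inputs s) (i : ℕ) : resVal d i < 2 := by
  unfold resVal
  split
  · exact Bool.toNat_lt _
  · norm_num

end

/-! ### Composition of the phases. -/

section Exec

variable {C : Type} {ec rc : ℕ} {P : Party} {W : ℕ} {mk : Party → Bool → Bits ec → C}
  {τ : Label → Coin ec rc} {s : Sizes}

open Party Reg

section

open Labelled

attribute [local simp] Instr.Writes keeps_blk keeps_append keeps_quiet keeps_flatMap mem_grid Party.other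
  posA negA posB negB items mix fyInit fy reply send unmask keys net sendRanks openRanks ranks
  moveStrings constants selInit suffixes select storeSel sendSel openSel share
  Protocol.compareExchange

/-- The triples of the phases are chained. A fact about registers that is needed later is carried
across the phases in between by `Keeps`. The views of the phases concatenate to the view of the
script. -/
theorem protocol_exec (hW : s.width + 1 ≤ W) (hv : ∀ i < s.k, (τ (7, i, 0, 0)).int ≤ i)
    (d : Inputs s) (v : List (Bool ⊕ C)) :
    (drun P W mk τ (protocol s) (startState d v)).ok ∧
      (∀ Q, ∀ i < s.k, ((drun P W mk τ (protocol s) (startState d v)).mem Q (out i)).val =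
        resVal d i) ∧
      (drun P W mk τ (protocol s) (startState d v)).view = v ++ (realScript τ d).view P mk s τ := by
  have hW1 : 1 ≤ W := by omega
  set π := drawn (s := s) τ with hπdef
  have hπ : ∀ j, s.k ≤ j → π j = j := fun j hj => fyPerm_of_le hv hj
  have hπlt : ∀ j < s.k, π j < s.k := fun j hj => perm_lt hπ hj
  obtain ⟨σ, hσ, hσρ⟩ := exists_perm_sortedName (d := d) π
  set ρ := sortedName d π with hρdef
  have hρlt : ∀ j < s.k, ρ j < s.k := fun j hj => by rw [← hσρ]; exact perm_lt hσ hj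
  have hρinj : ∀ i < s.k, ∀ j < s.k, ρ i = ρ j → i = j := fun i _ j _ h => by
    rw [← hσρ, ← hσρ] at h
    exact σ.injective h
  unfold protocol
  simp only [drun_append]
  set a₀ : LState C := startState d v with ha₀
  have ok₀ : a₀.ok := trivial
  have hview : a₀.view = v := rfl
  -- the data of `A`
  obtain ⟨ok₁, ⟨-, p₁⟩, w₁⟩ := posA_triple (P := P) (mk := mk) (τ := τ) hW1
    (fun p i => ((table d).x p i).toNat) a₀ ok₀ ⟨trivial, fun x hx => by
      obtain ⟨h1, h2⟩ := mem_grid.1 hx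
      rw [table_x_A d h1 h2, ← rowEntry_eq (start := 0), zero_add]
      rfl⟩
  -- The frame property of the phase; such a fact is recorded for each phase that has to be skipped
  -- later, before its final state is abstracted.
  have f₁ : ∀ Q r, Keeps (posA s) Q r → _ := fun Q r h => drun_mem (P := P) (W := W) (mk := mk)
    (τ := τ) h a₀
  generalize drun P W mk τ (posA s) a₀ = a₁ at *
  obtain ⟨ok₂, ⟨-, p₂⟩, w₂⟩ := negA_triple (P := P) (mk := mk) (τ := τ) hW1
    (fun p i => ((table d).y p i).toNat) a₁ ok₁ ⟨trivial, fun x hx => by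
      obtain ⟨h1, h2⟩ := mem_grid.1 hx
      rw [table_y_A d h1 h2, ← rowEntry_eq (start := 0), zero_add, f₁ _ _ (by simp)]
      rfl⟩
  have f₂ : ∀ Q r, Keeps (negA s) Q r → _ := fun Q r h => drun_mem (P := P) (W := W) (mk := mk)
    (τ := τ) h a₁
  generalize drun P W mk τ (negA s) a₁ = a₂ at *
  obtain ⟨ok₃, ⟨-, p₃⟩, w₃⟩ := posB_triple (P := P) (mk := mk) (τ := τ) hW1
    (fun p i => ((table d).x (s.posStart B + p) i).toNat) a₂ ok₂ ⟨trivial, fun x hx => by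
      obtain ⟨h1, h2⟩ := mem_grid.1 hx
      rw [Sizes.posStart, table_x_B d h1 h2, ← rowEntry_eq (start := s.npos A), f₂ _ _ (by simp),
        f₁ _ _ (by simp)]
      rfl⟩
  have f₃ : ∀ Q r, Keeps (posB s) Q r → _ := fun Q r h => drun_mem (P := P) (W := W) (mk := mk)
    (τ := τ) h a₂
  generalize drun P W mk τ (posB s) a₂ = a₃ at *
  obtain ⟨ok₄, ⟨-, p₄⟩, w₄⟩ := negB_triple (P := P) (mk := mk) (τ := τ) hW1
    (fun p i => ((table d).y (s.negStart B + p) i).toNat) a₃ ok₃ ⟨trivial, fun x hx => by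
      obtain ⟨h1, h2⟩ := mem_grid.1 hx
      rw [Sizes.negStart, table_y_B d h1 h2, ← rowEntry_eq (start := s.nneg A), f₃ _ _ (by simp),
        f₂ _ _ (by simp), f₁ _ _ (by simp)]
      rfl⟩
  have f₄ : ∀ Q r, Keeps (negB s) Q r → _ := fun Q r h => drun_mem (P := P) (W := W) (mk := mk)
    (τ := τ) h a₃
  generalize drun P W mk τ (negB s) a₃ = a₄ at *
  -- the tuples
  obtain ⟨ok₅, ⟨-, p₅⟩, w₅⟩ := items_triple (P := P) (mk := mk) (τ := τ) (table d) hW a₄ ok₄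
    ⟨⟨fun x hx => by
      obtain ⟨h1, h2⟩ := mem_grid.1 hx
      rcases lt_or_ge x.1 (s.npos A) with h | h
      -- A datum of the joint list belongs to `A` or to `B`, and its encryption was produced in the
      -- corresponding phase.
      · rw [f₄ _ _ (by simp), f₃ _ _ (by simp [Sizes.posStart]; omega), f₂ _ _ (by simp)]
        exact p₁ x (mem_grid.2 ⟨h, h2⟩)
      · have := p₃ (x.1 - s.npos A, x.2) (mem_grid.2 ⟨by simp [Sizes.n] at h1; simp; omega, h2⟩)
        simp only [Sizes.posStart, Nat.add_sub_cancel' h] at this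
        rwa [f₄ _ _ (by simp)], fun x hx => by
      obtain ⟨h1, h2⟩ := mem_grid.1 hx
      rcases lt_or_ge x.1 (s.nneg A) with h | h
      · rw [f₄ _ _ (by simp [Sizes.negStart]; omega), f₃ _ _ (by simp)]
        exact p₂ x (mem_grid.2 ⟨h, h2⟩)
      · have := p₄ (x.1 - s.nneg A, x.2) (mem_grid.2 ⟨by simp [Sizes.m] at h1; simp; omega, h2⟩)
        simp only [Sizes.negStart, Nat.add_sub_cancel' h] at this
        exact this⟩, fun _ _ => trivial⟩
  clear p₁ p₂ p₃ p₄ f₁ f₂ f₃ f₄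
  generalize drun P W mk τ (items s) a₄ = a₅ at *
  -- the mix network
  obtain ⟨ok₆, ⟨-, p₆⟩, w₆⟩ := mix_triple (P := P) (mk := mk) (τ := τ) hW ((table d).comp s) a₅ ok₅
    ⟨trivial, fun x hx => p₅ x.1 (List.mem_range.2 (mem_grid.1 hx).1) x.2 (mem_grid.1 hx).2⟩
  generalize drun P W mk τ (mix s) a₅ = a₆ at *
  obtain ⟨ok₇, ⟨-, p₇⟩, w₇⟩ := fyInit_triple (P := P) (W := W) (mk := mk) (τ := τ) (s := s) a₆ ok₆
    ⟨trivial, fun _ _ => trivial⟩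
  have f₇ : ∀ Q r, Keeps (fyInit s) Q r → _ := fun Q r h => drun_mem (P := P) (W := W) (mk := mk)
    (τ := τ) h a₆
  generalize drun P W mk τ (fyInit s) a₆ = a₇ at *
  obtain ⟨ok₈, p₈, w₈⟩ := fy_triple (P := P) (W := W) (mk := mk) hv a₇ ok₇
    fun i hi => p₇ i (List.mem_range.2 hi)
  have f₈ : ∀ Q r, Keeps (fy s) Q r → _ := fun Q r h => drun_mem (P := P) (W := W) (mk := mk)
    (τ := τ) h a₇
  generalize drun P W mk τ (fy s) a₇ = a₈ at *
  obtain ⟨ok₉, ⟨-, p₉⟩, w₉⟩ := reply_triple (P := P) (mk := mk) (τ := τ) hW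
    (fun i h => (table d).comp s i h + (τ (6, i, h, 0)).int) (fun i h => (τ (6, i, h, 0)).int) a₈ ok₈
    ⟨trivial, fun x hx => by
      rw [f₈ _ _ (by simp), f₇ _ _ (by simp), f₈ _ _ (by simp), f₇ _ _ (by simp)]
      exact p₆ x hx⟩
  have f₉ : ∀ Q r, Keeps (reply s) Q r → _ := fun Q r h => drun_mem (P := P) (W := W) (mk := mk)
    (τ := τ) h a₈
  generalize drun P W mk τ (reply s) a₈ = a₉ at *
  obtain ⟨okA, ⟨⟨qA, -⟩, pA⟩, wA⟩ := send_triple (P := P) (W := W) (τ := τ) π hπlt _ _ _ _ a₉ ok₉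
    ⟨⟨fun j hj => by rw [f₉ _ _ (by simp)]; exact p₈ j hj,
      fun i hi h hh => p₉ (i, h) (mem_grid.2 ⟨hi, hh⟩)⟩, fun _ _ => trivial⟩
  clear p₅ p₆ p₇ p₈ p₉ f₇ f₈ f₉
  generalize drun P W mk τ (send s) a₉ = aA at *
  have hB : drun P W mk τ (quiet [.const A (tmp 1) 0]) aA =
    lstep P W mk (.const A (tmp 1) 0) (τ (0, 0, 0, 0)) aA := rfl
  have okB : (drun P W mk τ (quiet [.const A (tmp 1) 0]) aA).ok := okA
  have wB : (drun P W mk τ (quiet [.const A (tmp 1) 0]) aA).view = aA.view := rfl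
  have fB : ∀ Q r, Keeps (quiet [.const A (tmp 1) 0]) Q r → _ := fun Q r h =>
    drun_mem (P := P) (W := W) (mk := mk) (τ := τ) h aA
  have pB : ((drun P W mk τ (quiet [.const A (tmp 1) 0]) aA).mem A (tmp 1)).val = 0 := by
    rw [hB, mem_const]; simp
  clear hB
  generalize drun P W mk τ (quiet [.const A (tmp 1) 0]) aA = aB at *
  obtain ⟨okC, ⟨-, pC⟩, wC⟩ := unmask_triple (P := P) (mk := mk) (τ := τ) hW
    (fun j h => (table d).comp s (π j) h)
    (fun j h => (τ (6, π j, h, 0)).int + (τ (8, π j, h, 0)).int) aB okB ⟨pB, fun x hx => by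
      rw [fB _ _ (by simp), fB _ _ (by simp), ← add_assoc]
      exact pA x hx⟩
  have fC : ∀ Q r, Keeps (unmask s) Q r → _ := fun Q r h => drun_mem (P := P) (W := W) (mk := mk)
    (τ := τ) h aB
  generalize drun P W mk τ (unmask s) aB = aC at *
  -- sorting
  obtain ⟨okD, ⟨-, pD⟩, wD⟩ := keys_triple (P := P) (mk := mk) (τ := τ) hW π
    (fun j => (table d).weight s (π j)) (fun j hj => (hπlt j hj).trans s.k_lt) aC okC
    ⟨trivial, fun j hj => ⟨pC (j, 0) (mem_grid.2 ⟨List.mem_range.1 hj, by simp [Sizes.arity]⟩),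
      pC (j, 1) (mem_grid.2 ⟨List.mem_range.1 hj, by simp [Sizes.arity]⟩)⟩⟩
  have fD : ∀ Q r, Keeps (keys s) Q r → _ := fun Q r h => drun_mem (P := P) (W := W) (mk := mk)
    (τ := τ) h aC
  generalize drun P W mk τ (keys s) aC = aD at *
  -- Index and weight both fit into `s.width` bits, so the pair fits into twice as many.
  have hkey : ∀ j < s.k, sortKey d π j < 2 ^ (s.width + s.width) := by
    intro j hj
    have h1 : 2 ^ s.width * ((table d).weight s (π j) + 1) ≤ 2 ^ s.width * 2 ^ s.width :=
      Nat.mul_le_mul_left _ ((table d).weight_lt (π j))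
    have h2 := (hπlt j hj).trans s.k_lt
    rw [mul_add, ← pow_add] at h1
    rw [sortKey]
    omega
  obtain ⟨okE, pE, wE⟩ : (drun P W mk τ (net s) aD).ok ∧ (∀ j < s.k, IsEnc B s.width (ρ j)
      ((drun P W mk τ (net s) aD).mem A (label j)).ct) ∧
      (drun P W mk τ (net s) aD).view = aD.view := by
    -- Without features the width may be zero and comparison would be meaningless, but then the
    -- network is empty.
    rcases Nat.eq_zero_or_pos s.k with hk | hk
    · have : net s = [] := by
        rw [net, sortNetwork, hk]
        simp
      rw [this]
      exact ⟨okD, by intro j hj; omega, rfl⟩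
    · have hw : 0 < s.width + s.width := by
        have : 0 < s.width := Nat.size_pos.2 (by omega)
        omega
      obtain ⟨h1, h2, h3⟩ := net_triple (P := P) (W := W) (mk := mk) (τ := τ) s.k (s.width + s.width)
        hw _ le_rfl s.width (sortNetwork s.k) (fun c hc => by
          have := mem_sortNetwork hc; omega) (fun j => (sortKey d π j, j)) aD okD
        fun j hj => ⟨hkey j hj, pD j (List.mem_range.2 hj)⟩
      rw [List.append_nil] at h3
      exact ⟨h1, fun j hj => (h2 j hj).2.2, h3⟩
  have fE : ∀ Q r, Keeps (net s) Q r → _ := fun Q r h => drun_mem (P := P) (W := W) (mk := mk)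
    (τ := τ) h aD
  generalize drun P W mk τ (net s) aD = aE at *
  -- opening the ranks
  obtain ⟨okF, ⟨-, pF⟩, wF⟩ := sendRanks_triple (P := P) (mk := mk) (τ := τ) hW ρ aE okE
    ⟨trivial, fun j hj => pE j (List.mem_range.1 hj)⟩
  have fF : ∀ Q r, Keeps (sendRanks s) Q r → _ := fun Q r h => drun_mem (P := P) (W := W) (mk := mk)
    (τ := τ) h aE
  generalize drun P W mk τ (sendRanks s) aE = aF at *
  obtain ⟨okG, ⟨-, pG⟩, wG⟩ := openRanks_triple (P := P) (W := W) (mk := mk) (τ := τ) (s := s)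
    (fun j => ρ j + (τ (12, j, 0, 0)).int) aF okF ⟨trivial, fun j hj => (pF j hj).1⟩
  have fG : ∀ Q r, Keeps (Labelled.openRanks s) Q r → _ := fun Q r h =>
    drun_mem (P := P) (W := W) (mk := mk) (τ := τ) h aF
  generalize drun P W mk τ (Labelled.openRanks s) aF = aG at *
  obtain ⟨okH, ⟨-, pH⟩, wH⟩ := ranks_triple (P := P) (W := W) (mk := mk) (τ := τ) (s := s) ρ
    (fun j => (τ (12, j, 0, 0)).int) (fun j hj => (hρlt j hj).trans s.k_lt) aG okG
    ⟨trivial, fun j hj => ⟨pG j hj, by rw [fG _ _ (by simp)]; exact (pF j hj).2⟩⟩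
  have fH : ∀ Q r, Keeps (ranks s) Q r → _ := fun Q r h => drun_mem (P := P) (W := W) (mk := mk)
    (τ := τ) h aG
  generalize drun P W mk τ (ranks s) aG = aH at *
  -- the deletion loop
  obtain ⟨okI, ⟨⟨qI, -⟩, pI⟩, wI⟩ := moveStrings_triple (P := P) (W := W) (mk := mk) (τ := τ) ρ hρlt
    (fun j h => (table d).bit s (π j) h) aH okH ⟨⟨fun j hj => pH j (List.mem_range.2 hj),
      fun i hi h hh => by
        rw [fH _ _ (by simp), fG _ _ (by simp), fF _ _ (by simp), fE _ _ (by simp),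
          fD _ _ (by simp)]
        exact pC (i, h + 2) (mem_grid.2 ⟨hi, by simpa [Sizes.arity] using hh⟩)⟩, fun _ _ => trivial⟩
  have fI : ∀ Q r, Keeps (moveStrings s) Q r → _ := fun Q r h =>
    drun_mem (P := P) (W := W) (mk := mk) (τ := τ) h aH
  generalize drun P W mk τ (moveStrings s) aH = aI at *
  obtain ⟨okJ, pJ, wJ⟩ := constants_triple (P := P) (mk := mk) (τ := τ) hW1 aI okI trivial
  have fJ : ∀ Q r, Keeps constants Q r → _ := fun Q r h =>
    drun_mem (P := P) (W := W) (mk := mk) (τ := τ) h aI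
  generalize drun P W mk τ constants aI = aJ at *
  obtain ⟨okK, ⟨qK, pK⟩, wK⟩ := selInit_triple (P := P) (W := W) (mk := mk) (τ := τ) (s := s) aJ okJ
    ⟨pJ, fun _ _ => trivial⟩
  have fK : ∀ Q r, Keeps (selInit s) Q r → _ := fun Q r h =>
    drun_mem (P := P) (W := W) (mk := mk) (τ := τ) h aJ
  generalize drun P W mk τ (selInit s) aJ = aK at *
  have hsrt : ∀ i < s.k, ∀ h < s.n * s.m,
      IsEnc B 1 ((table d).bit s (π (ρ i)) h).toNat (aK.mem A (srt i h)).ct := fun i hi h hh => by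
    rw [fK _ _ (by simp), fJ _ _ (by simp)]
    exact pI (i, h) (mem_grid.2 ⟨hi, hh⟩)
  set b : ℕ → ℕ → Bool := fun j h => (table d).bit s (π (ρ j)) h with hb
  obtain ⟨okL, pL, wL⟩ := suffixes_triple (P := P) (W := W) (mk := mk) (τ := τ) (s := s) b
    (sufOr s.k b) (sufOr_self s.k b) (fun i hi h => sufOr_eq b hi h) aK okK
    ⟨hsrt, fun h hh => (pK h (List.mem_range.2 hh)).1⟩
  have fL : ∀ Q r, Keeps (suffixes s) Q r → _ := fun Q r h =>
    drun_mem (P := P) (W := W) (mk := mk) (τ := τ) h aK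
  generalize drun P W mk τ (suffixes s) aK = aL at *
  obtain ⟨okM, pM, wM⟩ := select_triple (P := P) (W := W) (mk := mk) (τ := τ) (s := s) b
    (sufOr s.k b) (cumBits s.k (s.n * s.m) b) (selected s.k (s.n * s.m) b) (fun _ => rfl)
    (fun _ => rfl) (fun _ _ => rfl) aL okL
    ⟨by rw [fL _ _ (by simp)]; exact qK.2, fun i hi h hh => by
      rw [fL _ _ (by simp)]; exact hsrt i hi h hh, pL, fun h hh => by
      rw [fL _ _ (by simp)]; exact (pK h (List.mem_range.2 hh)).2⟩
  have fM : ∀ Q r, Keeps (select s) Q r → _ := fun Q r h =>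
    drun_mem (P := P) (W := W) (mk := mk) (τ := τ) h aL
  generalize drun P W mk τ (select s) aL = aM at *
  -- opening the result
  obtain ⟨okN, pN, wN⟩ := storeSel_triple (P := P) (W := W) (mk := mk) (τ := τ) (s := s) ρ hρlt hρinj
    (fun j => resVal d (π (ρ j))) aM okM ⟨fun j hj => by
      rw [fM _ _ (by simp), fL _ _ (by simp), fK _ _ (by simp), fJ _ _ (by simp)]
      exact qI j hj, fun j hj => by
      rw [← selected_eq π hπ hj]
      exact pM j hj⟩
  have fN : ∀ Q r, Keeps (storeSel s) Q r → _ := fun Q r h =>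
    drun_mem (P := P) (W := W) (mk := mk) (τ := τ) h aM
  generalize drun P W mk τ (storeSel s) aM = aN at *
  obtain ⟨okO, ⟨-, pO⟩, wO⟩ := sendSel_triple (P := P) (mk := mk) (τ := τ) (s := s) hW1
    (fun j => resVal d (π j)) aN okN ⟨trivial, fun j hj => by
      -- Bits were stored by rank; every new name is the rank of some position, since the ranks form
      -- a permutation.
      obtain ⟨i, hi, rfl⟩ := exists_of_perm hσ (List.mem_range.1 hj)
      rw [hσρ]
      exact pN i hi⟩
  have fO : ∀ Q r, Keeps (sendSel s) Q r → _ := fun Q r h =>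
    drun_mem (P := P) (W := W) (mk := mk) (τ := τ) h aN
  generalize drun P W mk τ (sendSel s) aN = aO at *
  obtain ⟨okP, pP, wP⟩ := openSel_triple (P := P) (W := W) (mk := mk) (τ := τ) (s := s) π hπlt
    (fun i _ j _ h => π.injective h) (fun j => resVal d (π j)) (fun j _ => resVal_lt d _) aO okO
    ⟨fun j hj => by
      rw [fO _ _ (by simp), fN _ _ (by simp), fM _ _ (by simp), fL _ _ (by simp), fK _ _ (by simp),
        fJ _ _ (by simp), fI _ _ (by simp), fH _ _ (by simp), fG _ _ (by simp), fF _ _ (by simp),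
        fE _ _ (by simp), fD _ _ (by simp), fC _ _ (by simp), fB _ _ (by simp)]
      exact qA j hj, fun j hj => pO j (List.mem_range.2 hj)⟩
  generalize drun P W mk τ (openSel s) aO = aP at *
  obtain ⟨okQ, ⟨-, pQ⟩, wQ⟩ := share_triple (P := P) (W := W) (mk := mk) (τ := τ) (s := s) (resVal d)
    aP okP ⟨trivial, fun j hj => by
      obtain ⟨i, hi, rfl⟩ := exists_of_perm hπ (List.mem_range.1 hj)
      exact pP i hi⟩
  refine ⟨okQ, fun Q i hi => ?_, ?_⟩
  · have := pQ i (List.mem_range.2 hi)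
    rw [Nat.mod_eq_of_lt (resVal_lt d i)] at this
    cases Q
    · exact this.2
    · exact this.1
  · rw [wQ, wP, wO, wN, wM, wL, wK, wJ, wI, wH, wG, wF, wE, wD, wC, wB, wA, w₉, w₈, w₇, w₆, w₅, w₄, w₃,
      w₂, w₁, hview]
    simp only [List.append_assoc, List.append_nil, Script.view, realScript]
    rfl

end

end Exec

/-! ### The coins of an execution -/

namespace Sizes

variable (s : Sizes)

/-- A bound for all indices. -/
def span : ℕ := s.k + s.arity + s.n + s.m

/-- The largest value of the random integer with a given label. -/
def intBound : Label → ℕ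
  | (c, i, h, l) =>
    if l = 0 then
      if c = 6 ∨ c = 8 then 2 ^ s.fw h - 1 else if c = 7 then i else
        if c = 12 then 2 ^ s.width - 1 else 0
    else 0

end Sizes

/-- The labels of a protocol with indices less than `D`. -/
abbrev Box (D : ℕ) : Type := Fin 16 × Fin D × Fin D × Fin 8

def Box.label {D : ℕ} (q : Box D) : Label := (q.1, q.2.1, q.2.2.1, q.2.2.2)

/-- All coins of an execution. -/
abbrev Tape (s : Sizes) (W ec rc : ℕ) : Type :=
  ∀ q : Box s.span, Fin (s.intBound q.label + 1) × Blk W ec rc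

section Tape

variable {s : Sizes} {W ec rc : ℕ}

/-- The label, if it is one of the protocol. -/
def toBox (D : ℕ) (x : Label) : Option (Box D) :=
  if h : x.1 < 16 ∧ x.2.1 < D ∧ x.2.2.1 < D ∧ x.2.2.2 < 8 then
    some (⟨x.1, h.1⟩, ⟨x.2.1, h.2.1⟩, ⟨x.2.2.1, h.2.2.1⟩, ⟨x.2.2.2, h.2.2.2⟩) else none

theorem toBox_label {D : ℕ} (q : Box D) : toBox D q.label = some q := by
  rw [toBox, dif_pos ⟨q.1.2, q.2.1.2, q.2.2.1.2, q.2.2.2.2⟩]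
  rfl

theorem label_of_toBox {D : ℕ} {x : Label} {q : Box D} (h : toBox D x = some q) : q.label = x := by
  unfold toBox at h
  split at h
  · rw [← Option.some.inj h]; rfl
  · cases h

theorem exists_label {D : ℕ} {x : Label}
    (h : x.1 < 16 ∧ x.2.1 < D ∧ x.2.2.1 < D ∧ x.2.2.2 < 8) : ∃ q : Box D, q.label = x :=
  ⟨_, label_of_toBox (dif_pos h)⟩

/-- The coins with a given label. -/
def tape (t : Tape s W ec rc) (x : Label) : Coin ec rc :=
  match toBox s.span x with
  | some q => Coin.ofBlk (t q).1 (t q).2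
  | none => ⟨0, fun _ _ => false, fun _ _ => false⟩

theorem tape_label (t : Tape s W ec rc) (q : Box s.span) :
    tape t q.label = Coin.ofBlk (t q).1 (t q).2 := by
  rw [tape, toBox_label]

theorem tape_update_of_ne (t : Tape s W ec rc) {q : Box s.span} (z) {x : Label} (hx : x ≠ q.label) :
    tape (Function.update t q z) x = tape t x := by
  unfold tape
  split
  · next q' h =>
    rw [Function.update_of_ne]
    rintro rfl
    exact hx (label_of_toBox h).symm
  · rfl

theorem tape_int_le (t : Tape s W ec rc) (x : Label) : (tape t x).int ≤ s.intBound x := by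
  unfold tape
  split
  · next q h =>
    rw [← label_of_toBox h]
    exact Nat.lt_succ_iff.1 (t q).1.2
  · exact Nat.zero_le _

variable (s)

/-- The random instructions have different labels, with the right bounds, and with the number of
the phase in a given interval. -/
structure WellLabelled (lo hi : ℕ) (lp : LProg) : Prop where
  distinct : lp.Pairwise fun x y => x.2.IsRandom → y.2.IsRandom → x.1 ≠ y.1
  site : ∀ x ∈ lp, x.2.IsRandom → lo ≤ x.1.1 ∧ x.1.1 < hi
  label : ∀ x ∈ lp, x.2.IsRandom → (∃ q : Box s.span, q.label = x.1) ∧ s.intBound x.1 = x.2.bound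

variable {s}

theorem WellLabelled.append {lo mid hi : ℕ} {p q : LProg} (hp : WellLabelled s lo mid p)
    (hq : WellLabelled s mid hi q) (h1 : lo ≤ mid) (h2 : mid ≤ hi) :
    WellLabelled s lo hi (p ++ q) where
  distinct := List.pairwise_append.2 ⟨hp.distinct, hq.distinct, fun x hx y hy rx ry e => by
    have h1 := hp.site x hx rx
    have h2 := hq.site y hy ry
    rw [e] at h1
    omega⟩
  site x hx rx := by
    rcases List.mem_append.1 hx with hx | hx
    · have := hp.site x hx rx; omega
    · have := hq.site x hx rx; omega
  label x hx rx := by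
    rcases List.mem_append.1 hx with hx | hx
    · exact hp.label x hx rx
    · exact hq.label x hx rx

theorem WellLabelled.of_quiet {lo hi : ℕ} {lp : LProg} (h : ∀ x ∈ lp, ¬x.2.IsRandom) :
    WellLabelled s lo hi lp where
  distinct := List.pairwise_iff_forall_sublist.2 fun {x _} hs rx =>
    absurd rx (h x (hs.subset List.mem_cons_self))
  site x hx rx := absurd rx (h x hx)
  label x hx rx := absurd rx (h x hx)

/-- Passes of a loop are told apart by the indices in their labels, hence the injectivity of `idx`.
-/
theorem WellLabelled.flatMap {ι : Type} {c : ℕ} {L : List ι} (hL : L.Nodup) {body : ι → LProg}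
    (idx : ι → ℕ × ℕ) (hidx : Function.Injective idx)
    (h : ∀ x ∈ L, WellLabelled s c (c + 1) (body x) ∧ ∀ y ∈ body x, y.2.IsRandom →
      (y.1.2.1, y.1.2.2.1) = idx x) :
    WellLabelled s c (c + 1) (L.flatMap body) where
  distinct := by
    rw [List.pairwise_flatMap]
    refine ⟨fun x hx => (h x hx).1.distinct, hL.imp_of_mem fun {x _} hx hy hne => ?_⟩
    intro u hu v hv ru rv e
    have h1 := (h x hx).2 u hu ru
    have h2 := (h _ hy).2 v hv rv
    rw [e, h2] at h1
    exact hne (hidx h1.symm)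
  site x hx rx := by
    obtain ⟨y, hy, hx⟩ := List.mem_flatMap.1 hx
    exact (h y hy).1.site x hx rx
  label x hx rx := by
    obtain ⟨y, hy, hx⟩ := List.mem_flatMap.1 hx
    exact (h y hy).1.label x hx rx

theorem wellLabelled_blk {c i h : ℕ} {body : Program} (hc : c < 16) (hi : i < s.span)
    (hh : h < s.span) (hl : body.length ≤ 8)
    (H : ∀ x ∈ body.zipIdx, x.1.IsRandom → s.intBound (c, i, h, x.2) = x.1.bound) :
    WellLabelled s c (c + 1) (blk c i h body) ∧ ∀ y ∈ blk c i h body, y.2.IsRandom →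
      (y.1.2.1, y.1.2.2.1) = (i, h) := by
  refine ⟨⟨?_, ?_, ?_⟩, ?_⟩
  · rw [blk, List.pairwise_map, List.pairwise_iff_getElem]
    intro a b ha hb hab _ _
    simp
    omega
  · intro x hx _
    obtain ⟨y, -, rfl⟩ := List.mem_map.1 hx
    simp
  · intro x hx rx
    obtain ⟨y, hy, rfl⟩ := List.mem_map.1 hx
    refine ⟨exists_label ⟨hc, hi, hh, ?_⟩, H y hy rx⟩
    have := List.snd_lt_of_mem_zipIdx hy
    simp only
    omega
  · intro x hx _
    obtain ⟨y, -, rfl⟩ := List.mem_map.1 hx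
    rfl

theorem lstep_of_not_isRandom {C : Type} {P : Party} {mk : Party → Bool → Bits ec → C} {i : Instr}
    (h : ¬i.IsRandom) (y y' : Coin ec rc) (a : LState C) :
    lstep P W mk i y a = lstep P W mk i y' a := by
  cases i <;> first | rfl | exact absurd trivial h

theorem drun_congr {C : Type} {P : Party} {mk : Party → Bool → Bits ec → C} {lp : LProg}
    {τ τ' : Label → Coin ec rc} (h : ∀ u ∈ lp, u.2.IsRandom → τ u.1 = τ' u.1) (a : LState C) :
    drun P W mk τ lp a = drun P W mk τ' lp a := by
  induction lp generalizing a with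
  | nil => rfl
  | cons u lp ih =>
    have e : lstep P W mk u.2 (τ u.1) a = lstep P W mk u.2 (τ' u.1) a := by
      by_cases hu : u.2.IsRandom
      · rw [h u List.mem_cons_self hu]
      · exact lstep_of_not_isRandom hu ..
    have ih := ih (fun u hu => h u (List.mem_cons_of_mem _ hu)) (lstep P W mk u.2 (τ' u.1) a)
    simp only [drun, List.foldl_cons, e] at ih ⊢
    exact ih

/-- A random run is a run with random coins. -/
theorem lrun_eq_map_tape {C : Type} {P : Party} {mk : Party → Bool → Bits ec → C} {lo hi : ℕ}
    {lp : LProg} (h : WellLabelled s lo hi lp) (a : LState C) :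
    lrun rc P W mk (lp.map Prod.snd) a =
      (unif (Tape s W ec rc)).map fun t => drun P W mk (tape t) lp a := by
  -- Equality of all expectations gives equality of the laws, by testing with indicators of points.
  suffices H : ∀ F : LState C → ENNReal, expect (lrun rc P W mk (lp.map Prod.snd) a) F =
      expect (unif (Tape s W ec rc)) fun t => F (drun P W mk (tape t) lp a) by
    classical
    ext b
    have := (H fun x => if x = b then 1 else 0).trans
      (expect_map (unif (Tape s W ec rc)) (fun t => drun P W mk (tape t) lp a)
        fun x => if x = b then 1 else 0).symm
    simpa [expect] using this
  intro F
  induction lp generalizing a with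
  | nil => simp only [List.map_nil, lrun, expect_pure, drun, List.foldl_nil, expect_const]
  | cons x lp ih =>
    have hd := List.pairwise_cons.1 h.distinct
    have ih := ih ⟨hd.2, fun y hy => h.site y (List.mem_cons_of_mem _ hy),
      fun y hy => h.label y (List.mem_cons_of_mem _ hy)⟩
    rw [List.map_cons, lrun, expect_bind]
    simp only [ih]
    by_cases hx : x.2.IsRandom
    · obtain ⟨⟨q, hq⟩, hb⟩ := h.label x List.mem_cons_self hx
      have e : ∀ t : Tape s W ec rc, drun P W mk (tape t) (x :: lp) a =
          drun P W mk (tape t) lp (lstep P W mk x.2 (Coin.ofBlk (t q).1 (t q).2) a) := by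
        intro t
        rw [← tape_label, hq]
        rfl
      simp only [e]
      -- The label of the first instruction does not recur among the later random instructions, so
      -- its coins are independent of what happens afterwards.
      have := expect_unif_pi_split q (fun (y : Fin (s.intBound q.label + 1) × Blk W ec rc)
        (t : Tape s W ec rc) =>
          F (drun P W mk (tape t) lp (lstep P W mk x.2 (Coin.ofBlk y.1 y.2) a))) ?_
      · rw [this, coinLaw, expect_map]
        rw [hq, hb]
      · intro y t z
        congr 1
        have hne : ∀ u ∈ lp, u.2.IsRandom → u.1 ≠ q.label := fun u hu ru => by
          rw [hq]
          exact (hd.1 u hu hx ru).symm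
        refine drun_congr (fun u hu ru => tape_update_of_ne t z (hne u hu ru)) _
    · obtain ⟨y0⟩ : Nonempty (Coin ec rc) := ⟨⟨0, fun _ _ => false, fun _ _ => false⟩⟩
      have e1 : ∀ y, lstep P W mk x.2 y a = lstep P W mk x.2 y0 a := fun y =>
        lstep_of_not_isRandom hx ..
      simp only [e1, expect_const]
      refine expect_congr _ fun t _ => ?_
      rw [← e1 (tape t x.1)]
      rfl

end Tape

section

variable {s : Sizes}

open Labelled

/-- Each random phase has its own number, and within it the loop indices and the line separate the
coins. Phases without coins fit into empty intervals of numbers. -/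
theorem wellLabelled_protocol : WellLabelled s 0 16 (protocol s) := by
  have hk : s.k ≤ s.span := by unfold Sizes.span; omega
  have ha : s.arity ≤ s.span := by unfold Sizes.span; omega
  have h0 : 0 < s.span := by unfold Sizes.span Sizes.arity; omega
  have hn : ∀ P, s.npos P ≤ s.span := fun P => by
    cases P <;> unfold Sizes.span Sizes.n <;> omega
  have hm : ∀ P, s.nneg P ≤ s.span := fun P => by
    cases P <;> unfold Sizes.span Sizes.m <;> omega
  have hq : ∀ {ι : Type} {lo : ℕ} {L : List ι} {body : ι → LProg},
      (∀ x ∈ L, ∀ y ∈ body x, ¬y.2.IsRandom) → WellLabelled s lo lo (L.flatMap body) :=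
    fun h => .of_quiet fun _ hy => by
      obtain ⟨x, hx, hy⟩ := List.mem_flatMap.1 hy
      exact h x hx _ hy
  have w1 : WellLabelled s 1 (1 + 1) (posA s) := .flatMap (nodup_grid _ _) id Function.injective_id
    fun x hx => wellLabelled_blk (by omega) ((mem_grid.1 hx).1.trans_le (hn _))
      ((mem_grid.1 hx).2.trans_le hk) (by simp)
      (by simp [List.zipIdx, Instr.IsRandom, Instr.bound, Sizes.intBound])
  have w2 : WellLabelled s 2 (2 + 1) (negA s) := .flatMap (nodup_grid _ _) id Function.injective_id
    fun x hx => wellLabelled_blk (by omega) ((mem_grid.1 hx).1.trans_le (hm _))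
      ((mem_grid.1 hx).2.trans_le hk) (by simp)
      (by simp [List.zipIdx, Instr.IsRandom, Instr.bound, Sizes.intBound])
  have w3 : WellLabelled s 3 (3 + 1) (posB s) := .flatMap (nodup_grid _ _) id Function.injective_id
    fun x hx => wellLabelled_blk (by omega) ((mem_grid.1 hx).1.trans_le (hn _))
      ((mem_grid.1 hx).2.trans_le hk) (by simp)
      (by simp [List.zipIdx, Instr.IsRandom, Instr.bound, Sizes.intBound])
  have w4 : WellLabelled s 4 (4 + 1) (negB s) := .flatMap (nodup_grid _ _) id Function.injective_id
    fun x hx => wellLabelled_blk (by omega) ((mem_grid.1 hx).1.trans_le (hm _))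
      ((mem_grid.1 hx).2.trans_le hk) (by simp)
      (by simp [List.zipIdx, Instr.IsRandom, Instr.bound, Sizes.intBound])
  have w5 : WellLabelled s 5 (5 + 1) (items s) := by
    refine .flatMap List.nodup_range (fun i => (i, 0)) (fun i j h => (Prod.ext_iff.1 h).1)
      fun i hi => ?_
    have hb := wellLabelled_blk (s := s) (c := 5) (i := i) (h := 0) (body := [.const .A (.tmp 0) i,
      .enc .A .B s.width (.item i .name) (.tmp 0), .const .A (.tmp 0) 0,
      .enc .A .B s.width (.item i .weight) (.tmp 0)]) (by omega)
      ((List.mem_range.1 hi).trans_le hk) h0 (by simp)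
      (by simp [List.zipIdx, Instr.IsRandom, Instr.bound, Sizes.intBound])
    have hr : ∀ y ∈ (grid s.n s.m).flatMap fun x => quiet
        [.hom .A .B .xor (.item i (.bit (s.m * x.1 + x.2))) (.pos x.1 i) (.neg x.2 i),
          .hom .A .B .add (.item i .weight) (.item i .weight) (.item i (.bit (s.m * x.1 + x.2)))],
        ¬y.2.IsRandom := by
      intro y hy
      obtain ⟨x, -, hy⟩ := List.mem_flatMap.1 hy
      simp only [quiet, List.map_cons, List.map_nil, List.mem_cons, List.not_mem_nil, or_false] at hy
      rcases hy with rfl | rfl <;> simp [Instr.IsRandom]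
    refine ⟨hb.1.append (.of_quiet hr) (by omega) (by omega), fun y hy ry => ?_⟩
    rcases List.mem_append.1 hy with hy | hy
    · exact hb.2 y hy ry
    · exact absurd ry (hr y hy)
  have w6 : WellLabelled s 6 (6 + 1) (mix s) := .flatMap (nodup_grid _ _) id Function.injective_id
    fun x hx => wellLabelled_blk (by omega) ((mem_grid.1 hx).1.trans_le hk)
      ((mem_grid.1 hx).2.trans_le ha) (by simp)
      (by simp [List.zipIdx, Instr.IsRandom, Instr.bound, Sizes.intBound])
  have w7 : WellLabelled s 7 (7 + 1) (fy s) := .flatMap (List.nodup_reverse.2 List.nodup_range)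
    (fun i => (i, 0)) (fun i j h => (Prod.ext_iff.1 h).1)
    fun x hx => wellLabelled_blk (by omega)
      ((List.mem_range.1 (List.mem_reverse.1 hx)).trans_le hk) h0 (by simp)
      (by simp [List.zipIdx, Instr.IsRandom, Instr.bound, Sizes.intBound])
  have w8 : WellLabelled s 8 (8 + 1) (reply s) := .flatMap (nodup_grid _ _) id
    Function.injective_id fun x hx => wellLabelled_blk (by omega) ((mem_grid.1 hx).1.trans_le hk)
      ((mem_grid.1 hx).2.trans_le ha) (by simp)
      (by simp [List.zipIdx, Instr.IsRandom, Instr.bound, Sizes.intBound])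
  have w10 : WellLabelled s 10 (10 + 1) (unmask s) := .flatMap (nodup_grid _ _) id
    Function.injective_id fun x hx => wellLabelled_blk (by omega) ((mem_grid.1 hx).1.trans_le hk)
      ((mem_grid.1 hx).2.trans_le ha) (by simp)
      (by simp [List.zipIdx, Instr.IsRandom, Instr.bound, Sizes.intBound])
  have w11 : WellLabelled s 11 (11 + 1) (keys s) := .flatMap List.nodup_range
    (fun i => (i, 0)) (fun i j h => (Prod.ext_iff.1 h).1)
    fun x hx => wellLabelled_blk (by omega) ((List.mem_range.1 hx).trans_le hk) h0 (by simp)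
      (by simp [List.zipIdx, Instr.IsRandom, Instr.bound, Sizes.intBound])
  have w12 : WellLabelled s 12 (12 + 1) (sendRanks s) := .flatMap List.nodup_range
    (fun i => (i, 0)) (fun i j h => (Prod.ext_iff.1 h).1)
    fun x hx => wellLabelled_blk (by omega) ((List.mem_range.1 hx).trans_le hk) h0 (by simp)
      (by simp [List.zipIdx, Instr.IsRandom, Instr.bound, Sizes.intBound])
  have w14 : WellLabelled s 14 (14 + 1) constants := (wellLabelled_blk (by omega) h0 h0 (by simp)
      (by simp [List.zipIdx, Instr.IsRandom, Instr.bound, Sizes.intBound])).1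
  have w15 : WellLabelled s 15 (15 + 1) (sendSel s) := .flatMap List.nodup_range
    (fun i => (i, 0)) (fun i j h => (Prod.ext_iff.1 h).1)
    fun x hx => wellLabelled_blk (by omega) ((List.mem_range.1 hx).trans_le hk) h0 (by simp)
      (by simp [List.zipIdx, Instr.IsRandom, Instr.bound, Sizes.intBound])
  have q1 : WellLabelled s 7 7 (fyInit s) := hq (by simp [quiet, Instr.IsRandom])
  have q2 : WellLabelled s 9 9 (send s) := hq (by simp [quiet, Instr.IsRandom])
  have q3 : WellLabelled s 9 9 (quiet [.const .A (.tmp 1) 0]) :=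
    .of_quiet (by simp [quiet, Instr.IsRandom])
  have q4 : WellLabelled s 12 12 (net s) := hq (by
    simp [quiet, Instr.IsRandom, Protocol.compareExchange])
  have q5 : WellLabelled s 13 13 (Labelled.openRanks s) := hq (by simp [quiet, Instr.IsRandom])
  have q6 : WellLabelled s 13 13 (ranks s) := hq (by simp [quiet, Instr.IsRandom])
  have q7 : WellLabelled s 13 13 (moveStrings s) := hq (by simp [quiet, Instr.IsRandom])
  have q8 : WellLabelled s 15 15 (selInit s) := hq (by simp [quiet, Instr.IsRandom])
  have q9 : WellLabelled s 15 15 (suffixes s) := hq fun i _ y hy => by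
    simp only [quiet, List.map_cons, List.map_nil, List.mem_flatMap, List.mem_cons,
      List.not_mem_nil, or_false] at hy
    obtain ⟨h, -, rfl⟩ := hy
    simp [Instr.IsRandom]
  have q10 : WellLabelled s 15 15 (select s) := hq fun i _ y hy => by
    simp only [quiet, List.map_cons, List.map_nil, List.mem_append, List.mem_flatMap,
      List.mem_cons, List.not_mem_nil, or_false] at hy
    rcases hy with rfl | ⟨h, -, rfl | rfl⟩ | rfl | ⟨h, -, rfl | rfl⟩ <;> simp [Instr.IsRandom]
  have q11 : WellLabelled s 15 15 (storeSel s) := hq (by simp [quiet, Instr.IsRandom])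
  have q12 : WellLabelled s 16 16 (openSel s) := hq (by simp [quiet, Instr.IsRandom])
  have q13 : WellLabelled s 16 16 (share s) := hq (by simp [quiet, Instr.IsRandom])
  -- Empty programs bridge the numbers that no phase with coins uses.
  have e : WellLabelled s 0 1 [] := .of_quiet (by simp)
  have e9 : WellLabelled s 9 10 [] := .of_quiet (by simp)
  have e13 : WellLabelled s 13 14 [] := .of_quiet (by simp)
  have R := (e.append w1 (by omega) (by omega)).append w2 (by omega) (by omega) |>.append w3
    (by omega) (by omega) |>.append w4 (by omega) (by omega) |>.append w5 (by omega) (by omega)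
    |>.append w6 (by omega) (by omega) |>.append q1 (by omega) (by omega)
    |>.append w7 (by omega) (by omega) |>.append w8 (by omega) (by omega)
    |>.append q2 (by omega) (by omega) |>.append q3 (by omega) (by omega)
    |>.append e9 (by omega) (by omega) |>.append w10 (by omega) (by omega)
    |>.append w11 (by omega) (by omega) |>.append q4 (by omega) (by omega)
    |>.append w12 (by omega) (by omega) |>.append q5 (by omega) (by omega)
    |>.append q6 (by omega) (by omega) |>.append q7 (by omega) (by omega)
    |>.append e13 (by omega) (by omega) |>.append w14 (by omega) (by omega)
    |>.append q8 (by omega) (by omega) |>.append q9 (by omega) (by omega)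
    |>.append q10 (by omega) (by omega) |>.append q11 (by omega) (by omega)
    |>.append w15 (by omega) (by omega) |>.append q12 (by omega) (by omega)
    |>.append q13 (by omega) (by omega)
  unfold protocol
  simpa only [List.nil_append, List.append_nil] using R

end

/-! ### Correctness of the protocol -/

section

variable {C : Type} {ec rc : ℕ} {P : Party} {W : ℕ} {mk : Party → Bool → Bits ec → C} {s : Sizes}

theorem tape_fy_le (t : Tape s W ec rc) (i : ℕ) : (tape t (7, i, 0, 0)).int ≤ i := by
  simpa [Sizes.intBound] using tape_int_le t (7, i, 0, 0)

theorem lrun_improvedCWC (a : LState C) : lrun rc P W mk (improvedCWC s) a =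
    (unif (Tape s W ec rc)).map fun t => drun P W mk (tape t) (Labelled.protocol s) a := by
  rw [← Labelled.map_snd_protocol]
  exact lrun_eq_map_tape wellLabelled_protocol a

/-- The law of the views of the plaintext machine. -/
theorem expect_lrun_protocol (hW : s.width + 1 ≤ W) (d : Inputs s) (v : List (Bool ⊕ C))
    (G : List (Bool ⊕ C) → ENNReal) :
    (expect (lrun rc P W mk (improvedCWC s) (startState d v)) fun a => G a.view) =
      expect (unif (Tape s W ec rc)) fun t =>
        G (v ++ (realScript (tape t) d).view P mk s (tape t)) := by
  rw [lrun_improvedCWC, expect_map]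
  refine expect_congr _ fun t _ => ?_
  rw [(protocol_exec hW (fun i _ => tape_fy_le t i) d v).2.2]

theorem exists_tape_of_mem_support {a a' : LState C}
    (ha : a' ∈ (lrun rc P W mk (improvedCWC s) a).support) :
    ∃ t : Tape s W ec rc, drun P W mk (tape t) (Labelled.protocol s) a = a' := by
  rw [lrun_improvedCWC, PMF.mem_support_map_iff] at ha
  obtain ⟨t, -, h⟩ := ha
  exact ⟨t, h⟩

theorem lrun_protocol (hW : s.width + 1 ≤ W) (d : Inputs s) (v : List (Bool ⊕ C)) (a : LState C)
    (ha : a ∈ (lrun rc P W mk (improvedCWC s) (startState d v)).support) : a.ok ∧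
      ∀ Q, ∀ i < s.k, (a.mem Q (.out i)).val = resVal d i := by
  obtain ⟨t, h⟩ := exists_tape_of_mem_support ha
  have := protocol_exec (P := P) (mk := mk) hW (fun i _ => tape_fy_le t i) d v
  rw [h] at this
  exact ⟨this.1, this.2.1⟩

/-- The initial memory holds no ciphertexts, so a change of symbols affects only the recorded view.
-/
theorem startState_map {C' : Type} (φ : C → C') (d : Inputs s) (v : List (Bool ⊕ C)) :
    (startState d v).map φ = startState d (v.map (Sum.map id φ)) := by
  simp only [startState, LState.map, LState.mk.injEq, and_true]
  funext P r
  cases r <;> rfl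

theorem rel_initState (E : BitCrypto) (l : ℕ) (g : Party → Bits (E.genCoins l))
    (T : Bits (E.ctLen l) → C → Prop) (d : Inputs s) (v : List (Bool ⊕ C)) :
    Rel E l g T (initState E l s d g) (startState d v) := by
  intro Q r
  cases r <;> exact ⟨rfl, .nil⟩

end

/-- The keys of both parties. -/
def keyPair {α : Type} (gA gB : α) : Party → α
  | .A => gA
  | .B => gB

theorem execution_eq (E : BitCrypto) (l : ℕ) (s : Sizes) (d : Inputs s) :
    execution E l s d = (unif (Bits (E.genCoins l))).bind fun gA =>
      (unif (Bits (E.genCoins l))).bind fun gB =>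
        runProgram E l (keyPair gA gB) (improvedCWC s) (initState E l s d (keyPair gA gB)) := by
  have e : ∀ g g' : Party → Bits (E.genCoins l), g = g' →
      runProgram E l g (improvedCWC s) (initState E l s d g) =
        runProgram E l g' (improvedCWC s) (initState E l s d g') := by
    rintro g _ rfl
    rfl
  exact congrArg (PMF.bind _) (funext fun gA => congrArg (PMF.bind _) (funext fun gB =>
    e _ _ (funext fun P => by cases P <;> rfl)))

/-- The final state of an execution corresponds to that of a run, whose output registers are known
for all coins. -/
theorem simulates (E : BitCrypto) (hE : E.Correct) : Simulates E := by
  intro l s d st hst P i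
  rw [execution_eq] at hst
  simp only [PMF.mem_support_bind_iff] at hst
  obtain ⟨gA, -, gB, -, hst⟩ := hst
  obtain ⟨a, ha, hr⟩ := exists_lrun_of_mem_support hE (P := .A) (W := s.width + 1) (improvedCWC s)
    (rel_initState E l _ (fun _ _ => True) d []) (fun a ha => (lrun_protocol le_rfl d [] a ha).1) hst
  rw [(hr P (.out i)).1, (lrun_protocol le_rfl d [] a ha).2 P i i.2, resVal, dif_pos i.2]
  by_cases h : i ∈ result d <;> simp [h]

/-! ### Views without the secrets -/

theorem fyPerm_congr {v v' : ℕ → ℕ} {k : ℕ} (h : ∀ i < k, v i = v' i) : fyPerm v k = fyPerm v' k := by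
  induction k with
  | zero => rfl
  | succ k ih => rw [fyPerm, fyPerm, h k (by omega), ih fun i hi => h i (by omega)]

/-- The last transposition is read off from the image of `k`; cancelling it reduces `k`. Together
with `exists_fyPerm` the admissible coins correspond one to one to the permutations of the first `k`
numbers. -/
theorem fyPerm_injective {v v' : ℕ → ℕ} {k : ℕ} (hv : ∀ i < k, v i ≤ i) (hv' : ∀ i < k, v' i ≤ i)
    (h : fyPerm v k = fyPerm v' k) : ∀ i < k, v i = v' i := by
  induction k with
  | zero => intro i hi; omega
  | succ k ih =>
    have e : v k = v' k := by
      have := congrArg (fun σ => σ k) h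
      simpa [fyPerm, fyPerm_of_le (fun i hi => hv i (Nat.lt_succ_of_lt hi)) le_rfl,
        fyPerm_of_le (fun i hi => hv' i (Nat.lt_succ_of_lt hi)) le_rfl] using this
    rw [fyPerm, fyPerm, e] at h
    intro i hi
    rcases Nat.lt_succ_iff_lt_or_eq.1 hi with hi | rfl
    · exact ih (fun i hi => hv i (by omega)) (fun i hi => hv' i (by omega)) (mul_left_cancel h) i hi
    · exact e

theorem exists_fyPerm {k : ℕ} {σ : Equiv.Perm ℕ} (hσ : ∀ j, k ≤ j → σ j = j) :
    ∃ v : ℕ → ℕ, (∀ i, v i ≤ i) ∧ fyPerm v k = σ := by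
  induction k generalizing σ with
  | zero => exact ⟨fun _ => 0, fun i => Nat.zero_le i, Equiv.ext fun j => (hσ j (Nat.zero_le j)).symm⟩
  | succ k ih =>
    have hk : σ k < k + 1 := perm_lt hσ (by omega)
    -- Composition with the transposition of `k` and `σ k` makes `k` a fixed point.
    obtain ⟨v, hv, e⟩ := ih (σ := Equiv.swap k (σ k) * σ) fun j hj => by
      rcases hj.eq_or_lt with rfl | hj
      · simp
      · rw [Equiv.Perm.mul_apply, hσ j hj]
        exact Equiv.swap_apply_of_ne_of_ne (by omega) (by omega)
    refine ⟨Function.update v k (σ k), fun i => ?_, ?_⟩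
    · by_cases hi : i = k
      · subst hi; simpa using Nat.lt_succ_iff.1 hk
      · simpa [hi] using hv i
    · rw [fyPerm, fyPerm_congr (v' := v) fun i hi => Function.update_of_ne hi.ne _ _, e]
      simp [← mul_assoc]

section Tape

variable {s : Sizes} {W ec rc : ℕ}

theorem tape_injective : Function.Injective (tape (s := s) (W := W) (ec := ec) (rc := rc)) := by
  intro t t' h
  funext q
  have e := congrFun h q.label
  rw [tape_label, tape_label] at e
  have h1 : (t q).1 = (t' q).1 := Fin.ext (congrArg Coin.int e)
  have h2 : (t q).2.1 = (t' q).2.1 := by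
    funext j
    simpa [Coin.ofBlk] using congrFun (congrArg Coin.enc e) j
  have h3 : (t q).2.2 = (t' q).2.2 := by
    funext j
    simpa [Coin.ofBlk] using congrFun (congrArg Coin.re e) j
  exact Prod.ext h1 (Prod.ext h2 h3)

def Coin.withInt (y : Coin ec rc) (n : ℕ) : Coin ec rc := ⟨n, y.enc, y.re⟩

/-- Relabel the coins and replace the integers. -/
theorem exists_tape_eq (t : Tape s W ec rc) (φ : Label → Label) (f : Label → ℕ)
    (hf : ∀ x, f x ≤ s.intBound x)
    (hout : ∀ x, toBox s.span x = none → toBox s.span (φ x) = none ∧ f x = 0) :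
    ∃ t' : Tape s W ec rc, tape t' = fun x => (tape t (φ x)).withInt (f x) := by
  refine ⟨fun q => (⟨f q.label, Nat.lt_succ_of_le (hf _)⟩,
    (fun j => (tape t (φ q.label)).enc j, fun j => (tape t (φ q.label)).re j)), funext fun x => ?_⟩
  rw [tape]
  split
  · next q h =>
    rw [label_of_toBox h, tape]
    split
    · next q' h' =>
      simp only [Coin.withInt, Coin.ofBlk, Coin.mk.injEq, true_and]
      constructor <;> (funext j; split <;> rfl)
    · simp only [Coin.withInt, Coin.ofBlk, Coin.mk.injEq, true_and]
      constructor <;> (funext j; split <;> rfl)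
  · next h =>
    obtain ⟨h1, h2⟩ := hout x h
    rw [tape, h1, h2]
    rfl

/-- A change of the coins that can be undone does not change their law. -/
theorem expect_tape_twist (T : (Label → Coin ec rc) → Label → Coin ec rc)
    (hT : ∀ t : Tape s W ec rc, ∃ t' : Tape s W ec rc, tape t' = T (tape t))
    (hinj : ∀ t t' : Tape s W ec rc, T (tape t) = T (tape t') → tape t = tape t')
    (F : (Label → Coin ec rc) → ENNReal) :
    (expect (unif (Tape s W ec rc)) fun t => F (T (tape t))) =
      expect (unif (Tape s W ec rc)) fun t => F (tape t) := by
  choose Φ hΦ using hT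
  have hΦi : Function.Injective Φ := fun t t' h =>
    tape_injective (hinj t t' ((hΦ t).symm.trans ((congrArg tape h).trans (hΦ t'))))
  simp only [← hΦ]
  exact (expect_unif_equiv (Equiv.ofBijective Φ (Finite.injective_iff_bijective.1 hΦi))
    fun t => F (tape t)).symm

end Tape

/-! ### Bijections of the coins that remove the data from the views. -/

section Ideal

variable {C : Type} {ec rc : ℕ} {mk : Party → Bool → Bits ec → C} {s : Sizes}
  {τ τ' : Label → Coin ec rc}

open Party

theorem ctView_congr {K : Party} {w u v : ℕ} {e e' : ℕ → Bits ec} (h : u % 2 ^ w = v % 2 ^ w)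
    (he : e = e') : ctView mk K w u e = ctView mk K w v e' := by
  subst he
  refine List.map_congr_left fun j hj => ?_
  rw [List.mem_range] at hj
  have := congrArg (fun n => n.testBit j) h
  simp only [Nat.testBit_mod_two_pow, hj, decide_true, Bool.true_and] at this
  rw [this]

/-- If `mk` ignores plaintexts under the key `K`, only the coins of such ciphertexts matter. -/
theorem ctView_hidden {K : Party} (h : ∀ b r, mk K b r = mk K false r) {w u v : ℕ}
    {e e' : ℕ → Bits ec} (he : e = e') : ctView mk K w u e = ctView mk K w v e' := by
  subst he
  refine List.map_congr_left fun j _ => ?_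
  rw [h, h (v.testBit j)]

theorem natBits_congr {w u v : ℕ} (h : u % 2 ^ w = v % 2 ^ w) : natBits w u = natBits w v := by
  rw [← natBits_mod, h, natBits_mod]

/-- Phases `7` and `8` use coins of `B`. `A` notices them only through the coins of received
ciphertexts, the sums of masks, and the opened ranks. Plaintexts count modulo the power of two given
by their width. -/
theorem Script.view_congr_A {K K' : Script ec} (hmk : ∀ b r, mk B b r = mk B false r)
    (h : ∀ c i h l, c ≠ 7 → c ≠ 8 → τ (c, i, h, l) = τ' (c, i, h, l))
    (h1 : ∀ j h, j < s.k → h < s.arity → K.shuffledCoins j h = K'.shuffledCoins j h)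
    (h2 : ∀ j h, j < s.k → h < s.arity → K.mask j h % 2 ^ s.fw h = K'.mask j h % 2 ^ s.fw h)
    (h3 : ∀ j h, j < s.k → h < s.arity → K.maskCoins j h = K'.maskCoins j h)
    (h4 : ∀ j < s.k, K.rank j % 2 ^ s.width = K'.rank j % 2 ^ s.width)
    (h5 : ∀ j < s.k, K.out j = K'.out j) : K.view A mk s τ = K'.view A mk s τ' := by
  simp only [Script.view, vis, reduceCtorEq, if_true, if_false, List.append_nil, List.nil_append,
    ne_eq, Nat.reduceEqDiff, not_false_eq_true, h, OfNat.one_ne_ofNat,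
    List.append_cancel_left_eq]
  have e3 : ∀ p i, ctView mk B 1 (K.pos p i) (τ' (3, p, i, 0)).enc =
      ctView mk B 1 (K'.pos p i) (τ' (3, p, i, 0)).enc := fun p i => ctView_hidden hmk rfl
  have e4 : ∀ p i, ctView mk B 1 (K.neg p i) (τ' (4, p, i, 0)).enc =
      ctView mk B 1 (K'.neg p i) (τ' (4, p, i, 0)).enc := fun p i => ctView_hidden hmk rfl
  have e9 : (grid s.k s.arity).flatMap (fun x =>
      ctView mk B (s.fw x.2) (K.shuffled x.1 x.2) (K.shuffledCoins x.1 x.2) ++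
        ctView mk A (s.fw x.2) (K.mask x.1 x.2) (K.maskCoins x.1 x.2)) =
      (grid s.k s.arity).flatMap (fun x =>
      ctView mk B (s.fw x.2) (K'.shuffled x.1 x.2) (K'.shuffledCoins x.1 x.2) ++
        ctView mk A (s.fw x.2) (K'.mask x.1 x.2) (K'.maskCoins x.1 x.2)) :=
    List.flatMap_congr fun x hx => by
      obtain ⟨hx1, hx2⟩ := mem_grid.1 hx
      rw [ctView_hidden hmk (h1 _ _ hx1 hx2), ctView_congr (h2 _ _ hx1 hx2) (h3 _ _ hx1 hx2)]
  have e13 : (List.range s.k).flatMap (fun j =>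
      ((natBits s.width (K.rank j)).map .inl : List (Bool ⊕ C))) =
      (List.range s.k).flatMap fun j => (natBits s.width (K'.rank j)).map .inl :=
    List.flatMap_congr fun j hj => by rw [natBits_congr (h4 j (List.mem_range.1 hj))]
  have e16 : (List.range s.k).flatMap (fun j => ((natBits 1 (K.out j)).map .inl : List (Bool ⊕ C))) =
      (List.range s.k).flatMap fun j => (natBits 1 (K'.out j)).map .inl :=
    List.flatMap_congr fun j hj => by rw [h5 j (List.mem_range.1 hj)]
  simp only [e3, e4, e9, e13, e16]

/-- The masks of phase `6` and the noise of phase `12` are drawn by `A`. `B` sees them only inside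
masked values, which it can decrypt, and in ciphertexts under the key of `A`, which are hidden. -/
theorem Script.view_congr_B {K K' : Script ec} (hmk : ∀ b r, mk A b r = mk A false r)
    (h : ∀ c i h l, (c = 6 ∧ l = 0 → False) → c ≠ 12 → τ (c, i, h, l) = τ' (c, i, h, l))
    (h0 : ∀ i h l, (τ (12, i, h, l)).enc = (τ' (12, i, h, l)).enc)
    (h2 : ∀ j h, j < s.k → h < s.arity → K.item j h % 2 ^ s.fw h = K'.item j h % 2 ^ s.fw h)
    (h4 : ∀ j < s.k, K.rank j % 2 ^ s.width = K'.rank j % 2 ^ s.width)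
    (h5 : ∀ j < s.k, K.sel j = K'.sel j) : K.view B mk s τ = K'.view B mk s τ' := by
  simp only [Script.view, vis, reduceCtorEq, if_true, if_false, List.append_nil, List.nil_append,
    ne_eq, Nat.reduceEqDiff, not_false_eq_true, h, h0, OfNat.one_ne_ofNat,
    false_and, and_false, OfNat.ofNat_ne_zero, one_ne_zero, imp_false, List.append_cancel_left_eq]
  have e9 : (grid s.k s.arity).flatMap (fun x =>
      ctView mk B (s.fw x.2) (K.item x.1 x.2) (τ' (6, x.1, x.2, 4)).enc ++
        ctView mk A (s.fw x.2) (τ (6, x.1, x.2, 0)).int (τ' (6, x.1, x.2, 1)).enc) =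
      (grid s.k s.arity).flatMap (fun x =>
      ctView mk B (s.fw x.2) (K'.item x.1 x.2) (τ' (6, x.1, x.2, 4)).enc ++
        ctView mk A (s.fw x.2) (τ' (6, x.1, x.2, 0)).int (τ' (6, x.1, x.2, 1)).enc) :=
    List.flatMap_congr fun x hx => by
      obtain ⟨hx1, hx2⟩ := mem_grid.1 hx
      rw [ctView_congr (h2 _ _ hx1 hx2) rfl,
        ctView_hidden (u := (τ (6, x.1, x.2, 0)).int) (v := (τ' (6, x.1, x.2, 0)).int) hmk rfl]
  have e13 : (List.range s.k).flatMap (fun j => ctView mk B s.width (K.rank j) (τ' (12, j, 0, 3)).enc) =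
      (List.range s.k).flatMap fun j => ctView mk B s.width (K'.rank j) (τ' (12, j, 0, 3)).enc :=
    List.flatMap_congr fun j hj => ctView_congr (h4 j (List.mem_range.1 hj)) rfl
  have e16 : (List.range s.k).flatMap (fun j => ctView mk B 1 (K.sel j) (τ' (15, j, 0, 0)).enc) =
      (List.range s.k).flatMap fun j => ctView mk B 1 (K'.sel j) (τ' (15, j, 0, 0)).enc :=
    List.flatMap_congr fun j hj => by rw [h5 j (List.mem_range.1 hj)]
  simp only [e9, e13, e16]

variable (P : Party)

/-- The script of a simulated execution, for the view of `P`; `o` is the output. -/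
def idealScript (τ : Label → Coin ec rc) (o : ℕ → ℕ) : Script ec where
  pos _ _ := 0
  neg _ _ := 0
  item i h := (τ (6, i, h, 0)).int
  shuffled _ _ := 0
  shuffledCoins j h := (τ (8, j, h, 3)).enc
  mask j h := (τ (8, j, h, 0)).int
  maskCoins j h := (τ (8, j, h, 6)).enc
  rank j := (if P = A then drawn (s := s) τ j else 0) + (τ (12, j, 0, 0)).int
  sel j := o (drawn (s := s) τ j)
  out := o

variable {P} (d : Inputs s)

/-- The coins of a permutation that sorts the features which are shuffled by `π`. -/
noncomputable def fyCode (π : Equiv.Perm ℕ) : ℕ → ℕ :=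
  (exists_fyPerm (exists_perm_sortedName (d := d) π).choose_spec.1).choose

theorem fyCode_le (π : Equiv.Perm ℕ) (i : ℕ) : fyCode d π i ≤ i :=
  (exists_fyPerm (exists_perm_sortedName (d := d) π).choose_spec.1).choose_spec.1 i

theorem fyPerm_fyCode (π : Equiv.Perm ℕ) (j : ℕ) : fyPerm (fyCode d π) s.k j = sortedName d π j := by
  rw [fyCode, (exists_fyPerm (exists_perm_sortedName (d := d) π).choose_spec.1).choose_spec.2]
  exact (exists_perm_sortedName (d := d) π).choose_spec.2 j

/-- The coins that produce the same view of `A` in a simulated execution. -/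
noncomputable def twistA (τ : Label → Coin ec rc) : Label → Coin ec rc := fun x =>
  (τ (if x.1 = 8 ∧ x.2.1 < s.k ∧ x.2.2.1 < s.arity then
    (8, drawn (s := s) τ x.2.1, x.2.2.1, x.2.2.2) else x)).withInt
  (if x.1 = 8 ∧ x.2.1 < s.k ∧ x.2.2.1 < s.arity then
    (if x.2.2.2 = 0 then ((τ (6, drawn (s := s) τ x.2.1, x.2.2.1, 0)).int +
      (τ (8, drawn (s := s) τ x.2.1, x.2.2.1, 0)).int) % 2 ^ s.fw x.2.2.1 else 0) else
    if x.1 = 7 ∧ x.2.1 < s.k ∧ x.2.2.1 = 0 ∧ x.2.2.2 = 0 then fyCode d (drawn (s := s) τ) x.2.1 else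
    (τ x).int)

/-- The coins that produce the same view of `B` in a simulated execution. -/
def twistB (τ : Label → Coin ec rc) : Label → Coin ec rc := fun x => (τ x).withInt
  (if x.1 = 6 ∧ x.2.1 < s.k ∧ x.2.2.1 < s.arity ∧ x.2.2.2 = 0 then
    ((table d).comp s x.2.1 x.2.2.1 + (τ x).int) % 2 ^ s.fw x.2.2.1 else
  if x.1 = 12 ∧ x.2.1 < s.k ∧ x.2.2.1 = 0 ∧ x.2.2.2 = 0 then
    (sortedName d (drawn (s := s) τ) x.2.1 + (τ x).int) % 2 ^ s.width else (τ x).int)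

theorem drawn_twistA (j : ℕ) : drawn (s := s) (twistA d τ) j = sortedName d (drawn (s := s) τ) j := by
  rw [← fyPerm_fyCode]
  refine congrArg (fun σ : Equiv.Perm ℕ => σ j) (fyPerm_congr fun i hi => ?_)
  simp [twistA, Coin.withInt, hi]

theorem drawn_twistB : drawn (s := s) (twistB d τ) = drawn (s := s) τ :=
  fyPerm_congr fun i _ => by simp [twistB, Coin.withInt]

/-- In the twisted coins the noise at position `j` is the sum of the masks of the tuple moved there,
the encryption coins are those of that tuple, and the drawn permutation is the list of sorted names.
These are just the values that `A` sees. -/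
theorem view_twistA (hmk : ∀ b r, mk B b r = mk B false r) (o : ℕ → ℕ)
    (ho : ∀ i < s.k, o i = resVal d i) :
    (realScript τ d).view A mk s τ = (idealScript A (s := s) (twistA d τ) o).view A mk s (twistA d τ) := by
  refine Script.view_congr_A hmk (fun c i h l h7 h8 => ?_) (fun j h hj hh => ?_)
    (fun j h hj hh => ?_) (fun j h hj hh => ?_) (fun j hj => ?_) fun j hj => (ho j hj).symm
  · simp [twistA, Coin.withInt, h7, h8]
  · simp [realScript, idealScript, twistA, Coin.withInt, hj, hh]
  · simp [realScript, idealScript, twistA, Coin.withInt, hj, hh]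
  · simp [realScript, idealScript, twistA, Coin.withInt, hj, hh]
  · simp only [realScript, idealScript, drawn_twistA, if_true]
    simp [twistA, Coin.withInt]

/-- Translating a mask by the component it hides, and the noise by the rank, makes the masked values
equal to the coins themselves. The permutation is unchanged, so the selection bits are the output in
an order known to `B`. -/
theorem view_twistB (hmk : ∀ b r, mk A b r = mk A false r) (hv : ∀ i < s.k, (τ (7, i, 0, 0)).int ≤ i)
    (o : ℕ → ℕ) (ho : ∀ i < s.k, o i = resVal d i) :
    (realScript τ d).view B mk s τ = (idealScript B (s := s) (twistB d τ) o).view B mk s (twistB d τ) := by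
  refine Script.view_congr_B hmk (fun c i h l h6 h12 => ?_) (fun i h l => rfl) (fun j h hj hh => ?_)
    (fun j hj => ?_) (fun j hj => ?_)
  · have : ¬ (c = 6 ∧ i < s.k ∧ h < s.arity ∧ l = 0) := fun h => h6 ⟨h.1, h.2.2.2⟩
    simp [twistB, Coin.withInt, h12, this]
  · simp [realScript, idealScript, twistB, Coin.withInt, hj, hh]
  · simp [realScript, idealScript, twistB, Coin.withInt, hj]
  · simp only [realScript, idealScript, drawn_twistB]
    exact (ho _ (fyPerm_lt hv hj)).symm

theorem lt_of_le_pred {a w : ℕ} (h : a ≤ 2 ^ w - 1) : a < 2 ^ w := by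
  have := Nat.two_pow_pos w
  omega

theorem add_mod_cancel {a b c N : ℕ} (hb : b < N) (hc : c < N) (h : (a + b) % N = (a + c) % N) :
    b = c := by
  have := Nat.ModEq.add_left_cancel' a (show a + b ≡ a + c [MOD N] from h)
  rwa [Nat.ModEq, Nat.mod_eq_of_lt hb, Nat.mod_eq_of_lt hc] at this

variable {W : ℕ}

theorem toBox_eq_none {D : ℕ} {x : Label} :
    toBox D x = none ↔ ¬(x.1 < 16 ∧ x.2.1 < D ∧ x.2.2.1 < D ∧ x.2.2.2 < 8) := by
  unfold toBox
  split <;> simp_all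

theorem tape_int_of_none {t : Tape s W ec rc} {x : Label} (h : toBox s.span x = none) :
    (tape t x).int = 0 := by
  rw [tape, h]

/-- The new integers respect their bounds: sums of masks are reduced, and the code of a permutation
consists of admissible coins. Outside the box everything keeps its default value. -/
theorem exists_tape_twistA (t : Tape s W ec rc) : ∃ t' : Tape s W ec rc, tape t' = twistA d (tape t) := by
  refine exists_tape_eq t _ _ (fun x => ?_) fun x hx => ?_
  · obtain ⟨c, i, h, l⟩ := x
    dsimp only
    split_ifs with h1 h2 h3
    · obtain ⟨rfl, -, -⟩ := h1
      subst h2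
      simp only [Sizes.intBound, or_true, if_true]
      exact Nat.le_sub_one_of_lt (Nat.mod_lt _ (Nat.two_pow_pos _))
    · exact Nat.zero_le _
    · obtain ⟨rfl, -, rfl, rfl⟩ := h3
      simpa [Sizes.intBound] using fyCode_le d _ i
    · exact tape_int_le t _
  · obtain ⟨c, i, h, l⟩ := x
    rw [toBox_eq_none] at hx
    dsimp only at hx ⊢
    have hk : ∀ j, j < s.k → j < s.span := fun j hj => by unfold Sizes.span; omega
    have ha : ∀ j, j < s.arity → j < s.span := fun j hj => by unfold Sizes.span; omega
    split_ifs with h1 h2 h3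
    · exact absurd ⟨by omega, hk _ h1.2.1, ha _ h1.2.2, by omega⟩ hx
    · refine ⟨toBox_eq_none.2 fun h' => hx ⟨by omega, hk _ h1.2.1, ha _ h1.2.2, h'.2.2.2⟩, rfl⟩
    · exact absurd ⟨by omega, hk _ h3.2.1, by have := hk _ h3.2.1; omega, by omega⟩ hx
    · exact ⟨toBox_eq_none.2 hx, tape_int_of_none (toBox_eq_none.2 hx)⟩

theorem exists_tape_twistB (t : Tape s W ec rc) : ∃ t' : Tape s W ec rc, tape t' = twistB d (tape t) := by
  refine exists_tape_eq t id _ (fun x => ?_) fun x hx => ?_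
  · obtain ⟨c, i, h, l⟩ := x
    dsimp only
    split_ifs with h1 h2
    · obtain ⟨rfl, -, -, rfl⟩ := h1
      simp only [Sizes.intBound, true_or, if_true]
      exact Nat.le_sub_one_of_lt (Nat.mod_lt _ (Nat.two_pow_pos _))
    · obtain ⟨rfl, -, rfl, rfl⟩ := h2
      simp only [Sizes.intBound, Nat.reduceEqDiff, or_self, if_true, if_false]
      exact Nat.le_sub_one_of_lt (Nat.mod_lt _ (Nat.two_pow_pos _))
    · exact tape_int_le t _
  · refine ⟨hx, ?_⟩
    obtain ⟨c, i, h, l⟩ := x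
    have hx' := toBox_eq_none.1 hx
    dsimp only at hx' ⊢
    have hk : ∀ j, j < s.k → j < s.span := fun j hj => by unfold Sizes.span; omega
    have ha : ∀ j, j < s.arity → j < s.span := fun j hj => by unfold Sizes.span; omega
    split_ifs with h1 h2
    · exact absurd ⟨by omega, hk _ h1.2.1, ha _ h1.2.2.1, by omega⟩ hx'
    · exact absurd ⟨by omega, hk _ h2.2.1, by have := hk _ h2.2.1; omega, by omega⟩ hx'
    · exact tape_int_of_none hx

/-- The twisted permutation lists the sorted names, which determine the original shuffle and hence
its coins. Knowing the shuffle, the relabelling of phase `8` can be undone; the masks of phase `6`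
are unchanged, so they can be subtracted from the sums. -/
theorem twistA_injective (t t' : Tape s W ec rc) (h : twistA d (tape t) = twistA d (tape t')) :
    tape t = tape t' := by
  have hd : drawn (s := s) (tape t) = drawn (s := s) (tape t') :=
    perm_eq_of_sortedName_eq (d := d) (fun j hj => fyPerm_of_le (fun i _ => tape_fy_le t i) hj)
      (fun j hj => fyPerm_of_le (fun i _ => tape_fy_le t' i) hj) fun j _ => by
        rw [← drawn_twistA, ← drawn_twistA, h]
  have h7 := fyPerm_injective (fun i _ => tape_fy_le t i) (fun i _ => tape_fy_le t' i) hd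
  funext ⟨c, i, f, l⟩
  by_cases h8 : c = 8 ∧ i < s.k ∧ f < s.arity
  · obtain ⟨rfl, hi, hf⟩ := h8
    -- The coins at tuple `i` reappear at the position `j` to which the shuffle sends this tuple.
    obtain ⟨j, hj, rfl⟩ := exists_of_perm (fun j hj => fyPerm_of_le (fun i _ => tape_fy_le t i) hj) hi
    change tape t (8, drawn (s := s) (tape t) j, f, l) = tape t' (8, drawn (s := s) (tape t) j, f, l)
    have e := congrFun h (8, j, f, l)
    have e6 := congrArg Coin.int (congrFun h (6, drawn (s := s) (tape t) j, f, 0))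
    simp only [twistA, Coin.withInt, hd, hj, hf, and_self, if_true, Coin.mk.injEq] at e
    simp only [twistA, Coin.withInt, Nat.reduceEqDiff, false_and, if_false, hd] at e6
    rw [hd]
    refine Coin.ext ?_ e.2.1 e.2.2
    by_cases hl : l = 0
    · subst hl
      have e1 := e.1
      rw [if_pos rfl, if_pos rfl, e6] at e1
      refine add_mod_cancel (lt_of_le_pred ?_) (lt_of_le_pred ?_) e1
      · simpa [Sizes.intBound] using tape_int_le t (8, drawn (s := s) (tape t') j, f, 0)
      · simpa [Sizes.intBound] using tape_int_le t' (8, drawn (s := s) (tape t') j, f, 0)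
    -- On the other lines no integer is drawn; the bound is zero.
    · have b := tape_int_le t (8, drawn (s := s) (tape t') j, f, l)
      have b' := tape_int_le t' (8, drawn (s := s) (tape t') j, f, l)
      simp only [Sizes.intBound, hl, if_false] at b b'
      omega
  · have e := congrFun h (c, i, f, l)
    simp only [twistA, Coin.withInt, h8, if_false, Coin.mk.injEq] at e
    refine Coin.ext ?_ e.2.1 e.2.2
    by_cases h7' : c = 7 ∧ i < s.k ∧ f = 0 ∧ l = 0
    · obtain ⟨rfl, hi, rfl, rfl⟩ := h7'
      exact h7 i hi
    · simpa only [h7', if_false] using e.1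

/-- The shuffle is unchanged, so the translations are the same for both tapes and cancel modulo the
powers of two. -/
theorem twistB_injective (t t' : Tape s W ec rc) (h : twistB d (tape t) = twistB d (tape t')) :
    tape t = tape t' := by
  have hd : drawn (s := s) (tape t) = drawn (s := s) (tape t') := by
    rw [← drawn_twistB d, h, drawn_twistB]
  funext ⟨c, i, f, l⟩
  have e := congrFun h (c, i, f, l)
  simp only [twistB, Coin.withInt, hd, Coin.mk.injEq] at e
  refine Coin.ext ?_ e.2.1 e.2.2
  have e1 := e.1
  split_ifs at e1 with h1 h2
  · obtain ⟨rfl, -, -, rfl⟩ := h1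
    refine add_mod_cancel (lt_of_le_pred ?_) (lt_of_le_pred ?_) e1
    · simpa [Sizes.intBound] using tape_int_le t (6, i, f, 0)
    · simpa [Sizes.intBound] using tape_int_le t' (6, i, f, 0)
  · obtain ⟨rfl, -, rfl, rfl⟩ := h2
    refine add_mod_cancel (lt_of_le_pred ?_) (lt_of_le_pred ?_) e1
    · simpa [Sizes.intBound] using tape_int_le t (12, i, 0, 0)
    · simpa [Sizes.intBound] using tape_int_le t' (12, i, 0, 0)
  · exact e1

/-- If the ciphertexts for the other party contain nothing, the view of a party is determined by
its coins and the output. -/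
theorem expect_lrun_ideal (hW : s.width + 1 ≤ W) (hmk : ∀ b r, mk P.other b r = mk P.other false r)
    (o : ℕ → ℕ) (ho : ∀ i < s.k, o i = resVal d i) (v : List (Bool ⊕ C))
    (G : List (Bool ⊕ C) → ENNReal) :
    (expect (lrun rc P W mk (improvedCWC s) (startState d v)) fun a => G a.view) =
      expect (unif (Tape s W ec rc)) fun t =>
        G (v ++ (idealScript P (s := s) (tape t) o).view P mk s (tape t)) := by
  rw [expect_lrun_protocol hW]
  cases P with
  | A =>
    simp only [view_twistA d hmk o ho]
    exact expect_tape_twist (twistA d) (exists_tape_twistA d) (twistA_injective d)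
      fun τ => G (v ++ (idealScript A (s := s) τ o).view A mk s τ)
  | B =>
    have (t : Tape s W ec rc) := view_twistB (mk := mk) d hmk (fun i _ => tape_fy_le t i) o ho
    simp only [this]
    exact expect_tape_twist (twistB d) (exists_tape_twistB d) (twistB_injective d)
      fun τ => G (v ++ (idealScript B (s := s) τ o).view B mk s τ)

end Ideal

/-! ### Circuits for views -/

section

variable {ι : Type}

/-- `g` takes values less than `b`, and its values are recognized by circuits with `s` wires. -/
def NatSize (g : (ι → Bool) → ℕ) (b s : ℕ) : Prop :=
  (∀ x, g x < b) ∧ ∀ v, BitSize (fun x => decide (g x = v)) s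

/-- A circuit distinguishes all `b` values of `g`. This is affordable because every integer in a
simulated view ranges over polynomially many values. -/
theorem NatSize.elim {g : (ι → Bool) → ℕ} {b s t : ℕ} (h : NatSize g b s)
    (F : ℕ → (ι → Bool) → Bool) (hF : ∀ v < b, BitSize (F v) t) :
    BitSize (fun x => F (g x) x) (b * (s + t + 5) + 1) := by
  have e : (fun x => F (g x) x) = fun x => (List.range b).any fun v => decide (g x = v) && F v x := by
    funext x
    rw [Bool.eq_iff_iff]
    simp [h.1 x]
  rw [e]
  have := BitSizeOver.any .nil (List.range b) (fun v x => decide (g x = v) && F v x) fun v hv =>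
    (h.2 v).and (hF v (List.mem_range.1 hv))
  exact this.mono (by rw [List.length_range])

theorem NatSize.pred {g : (ι → Bool) → ℕ} {b s : ℕ} (h : NatSize g b s) (f : ℕ → Bool) :
    BitSize (fun x => f (g x)) (b * (s + 6) + 1) :=
  h.elim (fun v _ => f v) fun v _ => BitSizeOver.const .nil (f v)

/-- The Fisher-Yates shuffle as a circuit. -/
theorem vecSize_fyPerm {k s b : ℕ} (v : (ι → Bool) → ℕ → ℕ) (hle : ∀ x i, v x i ≤ i)
    (hv : ∀ i < k, NatSize (fun x => v x i) b s) (i : ℕ) (hi : i ≤ k) {j : ℕ} (hj : j < k) :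
    VecSize k (fun c x => decide (fyPerm (v x) i j = c))
      (k + i * (k * (k * (b * (s + 6) + 6) + 1))) := by
  induction i with
  | zero =>
    obtain ⟨L, h1, h2, h3⟩ := exists_straightLine_of_forall (ι := ι) .nil (List.range k)
      (fun c _ => decide (j = c)) fun c _ => BitSizeOver.const .nil _
    refine ⟨L, by simpa using h1, by simpa using h2, fun c hc => ?_⟩
    have := h3 c (List.mem_range.2 hc)
    rwa [List.append_nil] at this
  | succ i ih =>
    have hlt : ∀ x, fyPerm (v x) i j < k := fun x => by
      by_cases hji : j < i
      · exact (fyPerm_lt (fun i _ => hle x i) hji).trans_le (by omega)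
      · rw [fyPerm_of_le (fun i _ => hle x i) (not_lt.1 hji)]; exact hj
    -- The image of `j` is represented by the vector of its indicator bits, and a transposition acts
    -- on it by a matrix whose entries depend on one coin.
    have := (ih (by omega)).step (fun c q x => decide (Equiv.swap i (v x i) q = c)) fun c _ q _ =>
      (hv i (by omega)).pred fun u => decide (Equiv.swap i u q = c)
    have e : (fun c x => (List.range k).any fun q =>
        decide (Equiv.swap i (v x i) q = c) && decide (fyPerm (v x) i j = q)) =
        fun c x => decide (fyPerm (v x) (i + 1) j = c) := by
      funext c x
      rw [Bool.eq_iff_iff]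
      simp only [List.any_eq_true, List.mem_range, Bool.and_eq_true, decide_eq_true_eq, fyPerm,
        Equiv.Perm.mul_apply]
      exact ⟨by rintro ⟨q, -, h, rfl⟩; exact decide_eq_true h,
        fun h => ⟨_, hlt x, of_decide_eq_true h, rfl⟩⟩
    rw [e] at this
    convert this using 1
    ring

theorem natSize_fyPerm {k s b : ℕ} (v : (ι → Bool) → ℕ → ℕ) (hle : ∀ x i, v x i ≤ i)
    (hv : ∀ i < k, NatSize (fun x => v x i) b s) {j : ℕ} (hj : j < k) :
    NatSize (fun x => fyPerm (v x) k j) k (k + k * (k * (k * (b * (s + 6) + 6) + 1))) := by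
  refine ⟨fun x => fyPerm_lt (fun i _ => hle x i) hj, fun c => ?_⟩
  by_cases hc : c < k
  · exact (vecSize_fyPerm v hle hv k le_rfl hj).bit hc
  · have : (fun x => decide (fyPerm (v x) k j = c)) = fun _ => false := funext fun x => by
      have := fyPerm_lt (fun i _ => hle x i) hj
      exact decide_eq_false (by omega)
    rw [this]
    exact (BitSizeOver.const .nil false).mono (by omega)

/-- `V` produces lists of a fixed length, at most `n`, whose bits are computed by circuits with
`s` wires. -/
def Sized (V : (ι → Bool) → List Bool) (n s : ℕ) : Prop :=
  ∃ m ≤ n, (∀ x, (V x).length = m) ∧ ∀ j, BitSize (fun x => (V x).getD j false) s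

namespace Sized

variable {V V' : (ι → Bool) → List Bool} {n n' s : ℕ}

theorem mono {s' : ℕ} (h : Sized V n s) (hn : n ≤ n') (hs : s ≤ s') : Sized V n' s' := by
  obtain ⟨m, h1, h2, h3⟩ := h
  exact ⟨m, h1.trans hn, h2, fun j => (h3 j).mono hs⟩

theorem nil (hs : 1 ≤ s) (n : ℕ) : Sized (fun _ : ι → Bool => []) n s :=
  ⟨0, Nat.zero_le _, fun _ => rfl, fun j => by
    simpa using (BitSizeOver.const (ι := ι) .nil false).mono hs⟩

/-- Because lengths are fixed, each output position belongs to the same piece for all inputs, and no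
selection circuit is needed. -/
theorem append (h : Sized V n s) (h' : Sized V' n' s) : Sized (fun x => V x ++ V' x) (n + n') s := by
  obtain ⟨m, h1, h2, h3⟩ := h
  obtain ⟨m', k1, k2, k3⟩ := h'
  refine ⟨m + m', by omega, fun x => by rw [List.length_append, h2, k2], fun j => ?_⟩
  by_cases hj : j < m
  · have : (fun x => (V x ++ V' x).getD j false) = fun x => (V x).getD j false :=
      funext fun x => List.getD_append _ _ _ _ (by rw [h2]; exact hj)
    rw [this]; exact h3 j
  · have : (fun x => (V x ++ V' x).getD j false) = fun x => (V' x).getD (j - m) false :=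
      funext fun x => by rw [List.getD_append_right _ _ _ _ (by rw [h2]; omega), h2]
    rw [this]; exact k3 _

theorem flatMap {α : Type} (hs : 1 ≤ s) (l : List α) (F : α → (ι → Bool) → List Bool)
    (hF : ∀ a ∈ l, Sized (F a) n s) : Sized (fun x => l.flatMap fun a => F a x) (l.length * n) s := by
  induction l with
  | nil => exact nil hs _
  | cons a l ih =>
    simp only [List.flatMap_cons, List.length_cons]
    exact ((hF a (by simp)).append (ih fun b hb => hF b (by simp [hb]))).mono (by ring_nf; omega) le_rfl

theorem map {α : Type} (hs : 1 ≤ s) (l : List α) (f : α → (ι → Bool) → Bool)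
    (hf : ∀ a ∈ l, BitSize (f a) s) : Sized (fun x => l.map fun a => f a x) l.length s := by
  have := flatMap hs l (fun a x => [f a x]) (n := 1) fun a ha =>
    ⟨1, le_rfl, fun _ => rfl, fun j => by
      cases j with
      | zero => exact hf a ha
      | succ j => simpa using (BitSizeOver.const (ι := ι) .nil false).mono hs⟩
  simpa only [← List.map_eq_flatMap, mul_one] using this

theorem ofFn (hs : 1 ≤ s) (f : Fin n → (ι → Bool) → Bool) (hf : ∀ i, BitSize (f i) s) :
    Sized (fun x => List.ofFn fun i => f i x) n s := by
  have := map hs (List.finRange n) f fun i _ => hf i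
  simpa [List.ofFn_eq_map] using this

end Sized

/-! #### Views -/

section View

variable {ct : ℕ}

/-- `Sized`, for views. -/
def ViewSized (V : (ι → Bool) → List (Bool ⊕ Bits ct)) (n s : ℕ) : Prop :=
  Sized (fun x => realize (V x)) n s

variable {V V' : (ι → Bool) → List (Bool ⊕ Bits ct)} {n n' s D : ℕ}

theorem ViewSized.mono (h : ViewSized V n s) (hn : n ≤ n') : ViewSized V n' s :=
  Sized.mono h hn le_rfl

theorem ViewSized.append (h : ViewSized V n s) (h' : ViewSized V' n' s) :
    ViewSized (fun x => V x ++ V' x) (n + n') s := by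
  simpa [ViewSized, realize_append] using Sized.append h h'

theorem realize_flatMap {α : Type} (l : List α) (f : α → List (Bool ⊕ Bits ct)) :
    realize (l.flatMap f) = l.flatMap fun a => realize (f a) := by
  simp [realize, List.flatMap_assoc]

theorem ViewSized.flatMap {α : Type} (hs : 1 ≤ s) {l : List α} {c : ℕ} (hl : l.length ≤ c)
    {F : α → (ι → Bool) → List (Bool ⊕ Bits ct)}
    (hF : ∀ a ∈ l, ViewSized (F a) n s) : ViewSized (fun x => l.flatMap fun a => F a x) (c * n) s := by
  have := Sized.flatMap hs l (fun a x => realize (F a x)) hF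
  simp only [ViewSized, realize_flatMap]
  exact this.mono (Nat.mul_le_mul_right _ hl) le_rfl

theorem ViewSized.vis (hs : 1 ≤ s) (P Q : Party) (h : ViewSized V n s) :
    ViewSized (fun x => vis P Q (V x)) n s := by
  by_cases hQ : Q = P
  · simpa [SecureCWC.vis, hQ] using h
  · simp only [SecureCWC.vis, hQ, if_false]
    exact Sized.nil hs n

theorem viewSized_coinStr (hs : 1 ≤ s) {c w : ℕ} (r : (ι → Bool) → ℕ → Bits c)
    (hr : ∀ j i, BitSize (fun x => r x j i) s) (hw : w ≤ D) (hc : c ≤ D) :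
    ViewSized (ct := ct) (fun x => coinStr w (r x)) (D * D) s := by
  simp only [ViewSized, realize_coinStr, flat]
  have : ∀ x, (List.ofFn fun j : Fin w => r x j).flatMap List.ofFn =
      (List.finRange w).flatMap fun j : Fin w => List.ofFn fun i => r x j i := fun x => by
    rw [List.ofFn_eq_map, List.flatMap_map]
  rw [funext this]
  exact (Sized.flatMap hs (List.finRange w) (fun j x => List.ofFn fun i => r x j i)
    fun j _ => Sized.ofFn hs (fun i x => r x j i) (hr j)).mono
    (by simpa using Nat.mul_le_mul hw hc) le_rfl

theorem viewSized_natBits (hs : 1 ≤ s) {w : ℕ} (g : (ι → Bool) → ℕ)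
    (hg : ∀ j, BitSize (fun x => (g x).testBit j) s) (hw : w ≤ D) :
    ViewSized (ct := ct) (fun x => (natBits w (g x)).map .inl) (D * D) s := by
  simp only [ViewSized, realize_inl, natBits]
  exact (Sized.map hs (List.range w) (fun j x => (g x).testBit j) fun j _ => hg j).mono
    (by simpa using hw.trans (Nat.le_mul_self D)) le_rfl

theorem viewSized_ctView (hs : 1 ≤ s) {ec w : ℕ}
    (mk : (ι → Bool) → Party → Bool → Bits ec → Bits ct) (K : Party)
    (g : (ι → Bool) → ℕ) (r : (ι → Bool) → ℕ → Bits ec)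
    (h : ∀ j i, BitSize (fun x => mk x K ((g x).testBit j) (r x j) i) s) (hw : w ≤ D) (hc : ct ≤ D) :
    ViewSized (fun x => ctView (mk x) K w (g x) (r x)) (D * D) s := by
  have : ∀ x, realize (ctView (mk x) K w (g x) (r x)) =
      (List.range w).flatMap fun j => List.ofFn (mk x K ((g x).testBit j) (r x j)) := fun x => by
    rw [realize, ctView, List.flatMap_map]; rfl
  simp only [ViewSized, this]
  exact (Sized.flatMap hs _ _ fun j _ => Sized.ofFn hs (fun i x => mk x K ((g x).testBit j) (r x j) i)
    (h j)).mono (by simpa using Nat.mul_le_mul hw hc) le_rfl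

theorem length_grid (k n : ℕ) : (grid k n).length = k * n := by simp [grid]

theorem size_le_of_lt_two_pow {a w D : ℕ} (h : a < 2 ^ w) (hw : w ≤ D) : a.size ≤ D :=
  (Nat.size_le.2 h).trans hw

-- Plaintexts and coins have circuits of size `t`; ciphertext bits, computed from them, have size
-- `s`. There are a bounded number of kinds of pieces, each occurring at most `D * D` times and with
-- at most `D * D` bits; the constant is generous.
open Party in
theorem viewSized_script (P : Party) {sz : Sizes} {ec rc t : ℕ}
    {mk : (ι → Bool) → Party → Bool → Bits ec → Bits ct} {τ : (ι → Bool) → Label → Coin ec rc}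
    {K : (ι → Bool) → Script ec} (hs : 1 ≤ s) (hst : t ≤ s)
    (hspan : sz.span ≤ D) (hwid : sz.width + 1 ≤ D) (hct : ct ≤ D) (hec : ec ≤ D) (hrc : rc ≤ D)
    (hpos : ∀ Q, sz.npos Q ≤ D) (hneg : ∀ Q, sz.nneg Q ≤ D)
    (hint : ∀ L j, BitSize (fun x => (τ x L).int.testBit j) t)
    (henc : ∀ L j i, BitSize (fun x => (τ x L).enc j i) t)
    (hre : ∀ L j i, BitSize (fun x => (τ x L).re j i) t)
    (hmk : ∀ Q (b : (ι → Bool) → Bool) (r : (ι → Bool) → Bits ec), BitSize b t →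
      (∀ i, BitSize (fun x => r x i) t) → ∀ i, BitSize (fun x => mk x Q (b x) (r x) i) s)
    (hKpos : ∀ i h j, BitSize (fun x => ((K x).pos i h).testBit j) t)
    (hKneg : ∀ i h j, BitSize (fun x => ((K x).neg i h).testBit j) t)
    (hitem : ∀ i h j, BitSize (fun x => ((K x).item i h).testBit j) t)
    (hshuf : ∀ i h j, BitSize (fun x => ((K x).shuffled i h).testBit j) t)
    (hshufC : ∀ i h j b, BitSize (fun x => (K x).shuffledCoins i h j b) t)
    (hmask : ∀ i h j, BitSize (fun x => ((K x).mask i h).testBit j) t)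
    (hmaskC : ∀ i h j b, BitSize (fun x => (K x).maskCoins i h j b) t)
    (hrank : ∀ i < sz.k, ∀ j, BitSize (fun x => ((K x).rank i).testBit j) t)
    (hsel : ∀ i < sz.k, ∀ j, BitSize (fun x => ((K x).sel i).testBit j) t)
    (hout : ∀ i < sz.k, ∀ j, BitSize (fun x => ((K x).out i).testBit j) t) :
    ViewSized (fun x => (K x).view P (mk x) sz (τ x)) (102 * (D * D * (D * D))) s := by
  have h1 : (1 : ℕ) ≤ D := by omega
  have hw : sz.width ≤ D := by omega
  have hk : sz.k ≤ D := by unfold Sizes.span at hspan; omega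
  have ha : sz.arity ≤ D := by unfold Sizes.span at hspan; omega
  have hD : D ≤ D * D := Nat.le_mul_self D
  have hfw : ∀ h, sz.fw h ≤ D := fun h => by
    match h with
    | 0 => exact hw
    | 1 => exact hw
    | h + 2 => exact h1
  have hpred : ∀ w, w ≤ D → (2 ^ w - 1).size ≤ D := fun w hw =>
    size_le_of_lt_two_pow (Nat.sub_lt (Nat.two_pow_pos w) one_pos) hw
  have gr : ∀ a b, a ≤ D → b ≤ D → (grid a b).length ≤ D * D := fun a b ha hb => by
    rw [length_grid]; exact Nat.mul_le_mul ha hb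
  have rg : (List.range sz.k).length ≤ D * D := by rw [List.length_range]; omega
  have vE : ∀ Q L w, w ≤ D → ViewSized (ct := ct) (fun x => vis P Q (coinStr w (τ x L).enc)) (D * D) s :=
    fun Q L w hw => .vis hs P Q (viewSized_coinStr hs (fun x => (τ x L).enc)
      (fun j i => (henc L j i).mono hst) hw hec)
  have vR : ∀ Q L w, w ≤ D → ViewSized (ct := ct) (fun x => vis P Q (coinStr w (τ x L).re)) (D * D) s :=
    fun Q L w hw => .vis hs P Q (viewSized_coinStr hs (fun x => (τ x L).re)
      (fun j i => (hre L j i).mono hst) hw hrc)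
  have vN : ∀ Q w (g : (ι → Bool) → ℕ), (∀ j, BitSize (fun x => (g x).testBit j) t) → w ≤ D →
      ViewSized (ct := ct) (fun x => vis P Q ((natBits w (g x)).map .inl)) (D * D) s :=
    fun Q w g hg hw => .vis hs P Q (viewSized_natBits hs g (fun j => (hg j).mono hst) hw)
  have vC : ∀ Q K w (g : (ι → Bool) → ℕ) (r : (ι → Bool) → ℕ → Bits ec),
      (∀ j, BitSize (fun x => (g x).testBit j) t) → (∀ j i, BitSize (fun x => r x j i) t) → w ≤ D →
      ViewSized (fun x => vis P Q (ctView (mk x) K w (g x) (r x))) (D * D) s :=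
    fun Q K w g r hg hr hw => .vis hs P Q (viewSized_ctView hs mk K g r
      (fun j i => hmk K _ _ (hg j) (hr j) i) hw hct)
  have tot : ∀ c, c ≤ 102 → c * (D * D * (D * D)) ≤ 102 * (D * D * (D * D)) := fun c hc =>
    Nat.mul_le_mul_right _ hc
  simp only [Script.view]
  have ap : ∀ {V V' : (ι → Bool) → List (Bool ⊕ Bits ct)} {n n' : ℕ}, ViewSized V n s →
      ViewSized V' n' s → ViewSized (fun x => V x ++ V' x) (n + n') s := ViewSized.append
  have fm : ∀ {α : Type} {l : List α} {n : ℕ} {F : α → (ι → Bool) → List (Bool ⊕ Bits ct)},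
      l.length ≤ D * D → (∀ a ∈ l, ViewSized (F a) n s) →
      ViewSized (fun x => l.flatMap fun a => F a x) (D * D * n) s := fun hl hF =>
    ViewSized.flatMap hs hl hF
  refine ViewSized.mono (ap (fm (gr _ _ (hpos A) hk) fun x _ => vE _ _ _ h1) <|
    ap (fm (gr _ _ (hneg A) hk) fun x _ => vE _ _ _ h1) <|
    ap (fm (gr _ _ (hpos B) hk) fun x _ =>
      ap (vE _ _ _ h1) (vC _ _ _ _ _ (hKpos _ _) (henc _) h1)) <|
    ap (fm (gr _ _ (hneg B) hk) fun x _ =>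
      ap (vE _ _ _ h1) (vC _ _ _ _ _ (hKneg _ _) (henc _) h1)) <|
    ap (fm rg fun i _ => ap (vE _ _ _ hw) (vE _ _ _ hw)) <|
    ap (fm (gr _ _ hk ha) fun x _ =>
      ap (vN _ _ _ (hint _) (hpred _ (hfw _))) <| ap (vE _ _ _ (hfw _)) <|
      ap (vE _ _ _ (hfw _)) <| ap (vR _ _ _ (hfw _)) <|
      ap (vC _ _ _ _ _ (hitem _ _) (henc _) (hfw _)) (vC _ _ _ _ _ (hint _) (henc _) (hfw _))) <|
    ap (fm (by rw [List.length_reverse]; exact rg) fun i hi =>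
      vN _ _ _ (hint _) (size_le_of_lt_two_pow Nat.lt_two_pow_self
        ((List.mem_range.1 (List.mem_reverse.1 hi)).le.trans hk))) <|
    ap (fm (gr _ _ hk ha) fun x _ =>
      ap (vN _ _ _ (hint _) (hpred _ (hfw _))) <| ap (vE _ _ _ (hfw _)) <|
      ap (vR _ _ _ (hfw _)) <| ap (vE _ _ _ (hfw _)) (vR _ _ _ (hfw _))) <|
    ap (fm (gr _ _ hk ha) fun x _ =>
      ap (vC _ _ _ _ _ (hshuf _ _) (hshufC _ _) (hfw _))
        (vC _ _ _ _ _ (hmask _ _) (hmaskC _ _) (hfw _))) <|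
    ap (fm (gr _ _ hk ha) fun x _ => vE _ _ _ (hfw _)) <|
    ap (fm rg fun i _ => vE _ _ _ hw) <|
    ap (fm rg fun i hi =>
      ap (vN _ _ _ (hint _) (hpred _ hw)) <| ap (vE _ _ _ hw) <|
      ap (vR _ _ _ hw) (vC _ _ _ _ _ (hrank _ (List.mem_range.1 hi)) (henc _) hw)) <|
    ap (fm rg fun i hi => vN _ _ _ (hrank _ (List.mem_range.1 hi)) hw) <|
    ap (ap (vE _ _ _ h1) (vE _ _ _ h1)) <|
    ap (fm rg fun i hi =>
      ap (vR _ _ _ h1) (vC _ _ _ _ _ (hsel _ (List.mem_range.1 hi)) (henc _) h1)) <|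
    fm rg fun i hi => vN _ _ _ (hout _ (List.mem_range.1 hi)) h1) ?_
  have : D * D ≤ D * D * (D * D) := Nat.le_mul_self _
  generalize D * D = N at *
  generalize hM : N * N = M at *
  have e : ∀ c, N * (N * c) = M * c := fun c => by rw [← mul_assoc, hM]
  ring_nf
  simp only [pow_two, hM]
  omega

end View

end

/-! ### Coins of circuits -/

/-- The integer with the given bits, if it is at most `b`. -/
def decodeInt (b : ℕ) (r : ℕ → Bool) : ℕ :=
  if ofBits ((List.range b.size).map r) ≤ b then ofBits ((List.range b.size).map r) else 0

theorem decodeInt_le (b : ℕ) (r : ℕ → Bool) : decodeInt b r ≤ b := by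
  unfold decodeInt
  split
  · assumption
  · exact Nat.zero_le b

theorem ofBits_map_eq_iff {b v : ℕ} (hv : v ≤ b) (r : ℕ → Bool) :
    ofBits ((List.range b.size).map r) = v ↔ ∀ u ∈ List.range b.size, r u = v.testBit u := by
  rw [← List.map_inj_left]
  constructor
  · intro h
    have := natBits_ofBits ((List.range b.size).map r)
    rw [h, List.length_map, List.length_range] at this
    exact this.symm
  · intro h
    rw [h]
    exact (ofBits_natBits _ _).trans (Nat.mod_eq_of_lt (hv.trans_lt (Nat.lt_size_self b)))

theorem decodeInt_natBits {b v : ℕ} (hv : v ≤ b) {r : ℕ → Bool}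
    (hr : ∀ u < b.size, r u = v.testBit u) : decodeInt b r = v := by
  have := (ofBits_map_eq_iff hv r).2 fun u hu => hr u (List.mem_range.1 hu)
  rw [decodeInt, this, if_pos hv]

/-- Size of the circuits that decode an integer. -/
def decodeSize (b : ℕ) : ℕ := b * (4 * b + 4) + 2

theorem natSize_decodeInt {ι : Type} (b : ℕ) (r : ℕ → (ι → Bool) → Bool)
    (hr : ∀ u, BitSize (r u) 1) :
    NatSize (fun x => decodeInt b fun u => r u x) (b + 1) (decodeSize b) := by
  refine ⟨fun x => Nat.lt_succ_of_le (decodeInt_le b _), fun v => ?_⟩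
  have eqn : ∀ v : ℕ, BitSize (fun x => (List.range b.size).all fun u => r u x == v.testBit u)
      (4 * b + 1) := fun v => by
    have := BitSizeOver.all .nil (List.range b.size) (fun u x => r u x == v.testBit u) (s := 2) fun u _ => by
      cases v.testBit u
      · simpa using (hr u).not
      · simpa using (hr u).mono (by norm_num)
    refine this.mono ?_
    have : b.size ≤ b := Nat.size_le.2 Nat.lt_two_pow_self
    rw [List.length_range]
    omega
  have e : ∀ v ≤ b, ∀ x, ((List.range b.size).all fun u => r u x == v.testBit u) = true ↔
      ofBits ((List.range b.size).map fun u => r u x) = v := fun v hv x => by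
    rw [ofBits_map_eq_iff hv, List.all_eq_true]
    simp
  by_cases hv : v ≤ b
  -- Zero is exceptional, because codes of integers beyond `b` are also decoded as zero. It is
  -- recognized as the absence of all other values.
  · by_cases h0 : v = 0
    · have h := (BitSizeOver.any .nil (List.range b) _ fun v _ => eqn (v + 1)).not
      rw [List.length_range] at h
      have : (fun x => decide (decodeInt b (fun u => r u x) = v)) = fun x =>
          !(List.range b).any fun v => (List.range b.size).all fun u => r u x == (v + 1).testBit u := by
        funext x
        rw [Bool.eq_iff_iff, Bool.not_eq_true', ← Bool.not_eq_true, decide_eq_true_eq, List.any_eq_true,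
          h0]
        refine Iff.trans ?_ (not_congr (exists_congr fun w => and_congr_right fun hw =>
          (e (w + 1) (List.mem_range.1 hw) x).symm))
        simp only [List.mem_range, decodeInt]
        generalize ofBits _ = N
        constructor
        · intro h
          rintro ⟨w, hw, rfl⟩
          rw [if_pos (by omega)] at h
          omega
        · intro h
          by_contra h'
          have hN : N ≤ b ∧ N ≠ 0 := by
            split_ifs at h' with hh
            · exact ⟨hh, h'⟩
            · exact absurd rfl h'
          exact h ⟨N - 1, by omega, by omega⟩
      rw [this]
      exact h.mono (by unfold decodeSize; ring_nf; omega)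
    · have : (fun x => decide (decodeInt b (fun u => r u x) = v)) = fun x =>
          (List.range b.size).all fun u => r u x == v.testBit u := by
        funext x
        rw [Bool.eq_iff_iff, e v hv, decide_eq_true_eq, decodeInt]
        split_ifs with hh
        · rfl
        · exact ⟨fun h => absurd h.symm h0, fun h => absurd (h ▸ hv) hh⟩
      rw [this]
      refine (eqn v).mono ?_
      have : 1 * (4 * b + 4) ≤ b * (4 * b + 4) := Nat.mul_le_mul_right _ (by omega)
      unfold decodeSize
      omega
  · have : (fun x => decide (decodeInt b (fun u => r u x) = v)) = fun _ => false := by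
      funext x
      have := decodeInt_le b fun u => r u x
      exact decide_eq_false (by omega)
    rw [this]
    exact (BitSizeOver.const .nil false).mono (by unfold decodeSize; omega)

/-- In a concatenation of lists of prescribed lengths each list begins at a place that depends on
the lengths only. -/
theorem exists_pos {n : ℕ} (c : Fin n → ℕ) : ∃ pos : Fin n → ℕ, ∀ f : Fin n → List Bool,
    (∀ q, (f q).length = c q) → ∀ q, ∀ t < c q,
      (List.ofFn f).flatten.getD (pos q + t) false = (f q).getD t false := by
  induction n with
  | zero => exact ⟨Fin.elim0, fun f _ q => q.elim0⟩
  | succ n ih =>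
    obtain ⟨pos, h⟩ := ih fun q => c q.succ
    refine ⟨Fin.cons 0 fun q => c 0 + pos q, fun f hf q t ht => ?_⟩
    rw [List.ofFn_succ, List.flatten_cons]
    induction q using Fin.cases with
    | zero =>
      rw [Fin.cons_zero, zero_add, List.getD_append _ _ _ _ (by rw [hf]; exact ht)]
    | succ q =>
      rw [Fin.cons_succ, List.getD_append_right _ _ _ _ (by rw [hf]; omega), hf,
        ← h (fun q => f q.succ) (fun q => hf q.succ) q t ht]
      congr 1
      omega

theorem pad_append_left (u r : List Bool) {i : ℕ} (hi : i < u.length) : pad (u ++ r) i = pad u i :=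
  List.getD_append _ _ _ _ hi

theorem pad_append_right (u r : List Bool) (i : ℕ) : pad (u ++ r) (u.length + i) = pad r i := by
  rw [pad, List.getD_append_right _ _ _ _ (by omega), Nat.add_sub_cancel_left, pad]

section Decoder

variable {J : Type} [Fintype J] (b : J → ℕ)

/-- The bounds for a family of random integers, as a list. -/
noncomputable def coinList : List ℕ := List.ofFn fun q => b ((Fintype.equivFin J).symm q)

/-- Independent random integers can be read off the coins of a circuit by small circuits. -/
theorem exists_decoder [DecidableEq J] (a : ℕ) : ∃ dec : (ℕ → Bool) → ∀ j, Fin (b j + 1),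
    (∀ j, NatSize (fun x => (dec x j : ℕ)) (b j + 1) (decodeSize (b j))) ∧
    ∀ u : List Bool, u.length = a →
      (coinBits (coinList b)).map (fun r => dec (pad (u ++ r))) = unif (∀ j, Fin (b j + 1)) := by
  let e := Fintype.equivFin J
  obtain ⟨pos, hpos⟩ := exists_pos fun q => (b (e.symm q)).size
  refine ⟨fun x j => ⟨decodeInt (b j) fun t => x (a + (pos (e j) + t)), Nat.lt_succ_of_le (decodeInt_le _ _)⟩,
    fun j => natSize_decodeInt (b j) (fun t x => x (a + (pos (e j) + t))) fun t => .input .nil _,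
    fun u hu => ?_⟩
  -- Writing the integers in binary and decoding them again is injective between finite sets of the
  -- same size, hence preserves the uniform law.
  let Ψ : (∀ q, Fin (b (e.symm q) + 1)) → ∀ j, Fin (b j + 1) := fun v j =>
    ⟨decodeInt (b j) fun t => pad (u ++ (List.ofFn fun q => natBits (b (e.symm q)).size (v q)).flatten)
      (a + (pos (e j) + t)), Nat.lt_succ_of_le (decodeInt_le _ _)⟩
  have hΨ : ∀ v j, (Ψ v j : ℕ) = v (e j) := fun v j => by
    have hb : b (e.symm (e j)) = b j := by rw [e.symm_apply_apply]
    have hv : (v (e j) : ℕ) ≤ b j := hb ▸ Nat.lt_succ_iff.1 (v (e j)).2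
    refine decodeInt_natBits hv fun t ht => ?_
    rw [← hu, pad_append_right, pad, hpos _ (fun q => length_natBits _ _) _ _ (by simpa using ht)]
    simp [natBits, ht]
  have hinj : Function.Injective Ψ := fun v w h => by
    funext q
    obtain ⟨j, rfl⟩ := e.surjective q
    exact Fin.ext (by rw [← hΨ, ← hΨ, h])
  have hbij : Function.Bijective Ψ := (Fintype.bijective_iff_injective_and_card Ψ).2 ⟨hinj,
    Fintype.card_congr (Equiv.piCongrLeft' (fun j => Fin (b j + 1)) e).symm⟩
  rw [coinList, coinBits_ofFn, PMF.map_comp, ← unif_map_equiv (Equiv.ofBijective Ψ hbij)]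
  rfl

theorem sum_coinList_le {D : ℕ} (h : ∀ j, b j ≤ D) :
    ((coinList b).map fun b => b.size + 1).sum ≤ Fintype.card J * (D + 1) := by
  rw [coinList, List.map_ofFn, List.sum_ofFn]
  refine (Finset.sum_le_card_nsmul _ _ (D + 1) fun q _ => ?_).trans (by simp)
  have := (Nat.size_le.2 Nat.lt_two_pow_self : (b ((Fintype.equivFin J).symm q)).size ≤ _)
  have := h ((Fintype.equivFin J).symm q)
  simp only [Function.comp]
  omega

end Decoder

/-! #### The coins of the simulator -/

abbrev CoinIdx (D W ec rc gc : ℕ) : Type :=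
  Box D ⊕ (Box D × Fin W × Fin ec) ⊕ (Box D × Fin W × Fin rc) ⊕ Fin gc ⊕ Fin gc

abbrev coinBound (s : Sizes) (W ec rc gc : ℕ) : CoinIdx s.span W ec rc gc → ℕ
  | .inl q => s.intBound q.label
  | .inr _ => 1

/-- The coins of both key generations and of an execution. -/
abbrev Sample (s : Sizes) (W ec rc gc : ℕ) : Type := (Bits gc × Bits gc) × Tape s W ec rc

/-- Random integers with bound `1` serve as random bits, so that one kind of coins covers keys,
encryptions and masks. -/
def sampleEquiv (s : Sizes) (W ec rc gc : ℕ) :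
    (∀ j, Fin (coinBound s W ec rc gc j + 1)) ≃ Sample s W ec rc gc where
  toFun v := ((fun i => finTwoEquiv (v (.inr (.inr (.inr (.inl i))))),
      fun i => finTwoEquiv (v (.inr (.inr (.inr (.inr i)))))),
    fun q => (v (.inl q), fun j i => finTwoEquiv (v (.inr (.inl (q, j, i)))),
      fun j i => finTwoEquiv (v (.inr (.inr (.inl (q, j, i)))))))
  invFun z j := match j with
    | .inl q => (z.2 q).1
    | .inr (.inl (q, j, i)) => finTwoEquiv.symm ((z.2 q).2.1 j i)
    | .inr (.inr (.inl (q, j, i))) => finTwoEquiv.symm ((z.2 q).2.2 j i)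
    | .inr (.inr (.inr (.inl i))) => finTwoEquiv.symm (z.1.1 i)
    | .inr (.inr (.inr (.inr i))) => finTwoEquiv.symm (z.1.2 i)
  left_inv v := by
    funext j
    rcases j with q | ⟨q, j, i⟩ | ⟨q, j, i⟩ | i | i
    · rfl
    all_goals exact finTwoEquiv.symm_apply_apply _
  right_inv z := by
    refine Prod.ext (Prod.ext (funext fun i => finTwoEquiv.apply_symm_apply _)
      (funext fun i => finTwoEquiv.apply_symm_apply _)) (funext fun q => Prod.ext rfl (Prod.ext
        (funext fun j => funext fun i => finTwoEquiv.apply_symm_apply _)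
        (funext fun j => funext fun i => finTwoEquiv.apply_symm_apply _)))

theorem card_coinIdx_le {D0 W ec rc gc D : ℕ} (h0 : D0 ≤ D) (hW : W ≤ D) (hec : ec ≤ D) (hrc : rc ≤ D)
    (hgc : gc ≤ D) :
    Fintype.card (CoinIdx D0 W ec rc gc) ≤ 128 * (D * D) * (1 + 2 * (D * D)) + 2 * D := by
  simp only [CoinIdx, Box, Fintype.card_sum, Fintype.card_prod, Fintype.card_fin]
  have h1 : 16 * (D0 * (D0 * 8)) ≤ 128 * (D * D) := by
    have := Nat.mul_le_mul h0 h0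
    nlinarith
  have h2 := Nat.mul_le_mul h1 (Nat.mul_le_mul hW hec)
  have h3 := Nat.mul_le_mul h1 (Nat.mul_le_mul hW hrc)
  calc _ ≤ 128 * (D * D) + (128 * (D * D) * (D * D) + (128 * (D * D) * (D * D) + (D + D))) := by
        gcongr
    _ = _ := by ring

/-! ### The simulator -/

/-- Encryption, where the other party's ciphertexts are encryptions of `0`. -/
def hiddenEnc (E : BitCrypto) (l : ℕ) (g : Party → Bits (E.genCoins l)) (P K : Party) (b : Bool)
    (r : Bits (E.encCoins l)) : Bits (E.ctLen l) := encWith E l g K (if K = P then b else false) r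

/-- The simulated view of `P`, for the data `u` and the output `o`. -/
def simView (E : BitCrypto) (l : ℕ) (s : Sizes) (W : ℕ) (P : Party) (u : List Bool) (o : ℕ → ℕ)
    (z : Sample s W (E.encCoins l) (E.reCoins l) (E.genCoins l)) : List Bool :=
  u ++ List.ofFn (keyPair z.1.1 z.1.2 P) ++ List.ofFn (E.genPk l (keyPair z.1.1 z.1.2 P.other)) ++
    realize ((idealScript P (s := s) (tape z.2) o).view P
      (hiddenEnc E l (keyPair z.1.1 z.1.2) P) s (tape z.2))

theorem length_bits {k a b : ℕ} (d : PrivateData k a b) : d.bits.length = (a + b) * k := by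
  simp only [PrivateData.bits, List.length_flatMap, List.map_append, List.sum_append, List.length_ofFn,
    List.map_const', List.sum_replicate, smul_eq_mul, add_mul]

theorem NatSize.mono {ι : Type} {g : (ι → Bool) → ℕ} {b b' t t' : ℕ} (h : NatSize g b t)
    (hb : b ≤ b') (ht : t ≤ t') : NatSize g b' t' :=
  ⟨fun x => (h.1 x).trans_le hb, fun v => (h.2 v).mono ht⟩

theorem natSize_zero {ι : Type} {b t : ℕ} (hb : 0 < b) (ht : 1 ≤ t) :
    NatSize (fun _ : ι → Bool => 0) b t :=
  ⟨fun _ => hb, fun _ => (BitSizeOver.const .nil _).mono ht⟩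

theorem decodeSize_mono {a b : ℕ} (h : a ≤ b) : decodeSize a ≤ decodeSize b := by
  unfold decodeSize
  gcongr

/-- Size of the circuits for the permutation in a simulated view. -/
def permSize (D : ℕ) : ℕ := D + D * (D * (D * (D * (decodeSize D + 6) + 6) + 1))

/-- Size of the circuits for the plaintexts in a simulated view. -/
def plainSize (D : ℕ) : ℕ := D * (permSize D + (D * (decodeSize D + 6) + 1) + 5) + 1

/-- Size of the circuits for the bits of a simulated view. -/
def viewSize (D : ℕ) : ℕ := D * (D * (plainSize D + 1) + plainSize D + 1) + D * (plainSize D + 1) + plainSize D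

section

variable {E : BitCrypto} {l : ℕ} {s : Sizes} {W D : ℕ}
  {z : (ℕ → Bool) → Sample s W (E.encCoins l) (E.reCoins l) (E.genCoins l)}

/-- The input consists of `a` bits of private data, the `k` output bits, and the coins. The
permutation is handled by case distinction on its values, and ciphertexts by composing key
generation and encryption with the circuits for their arguments. -/
theorem sized_simView (P : Party) (hspan : s.span ≤ D) (hwid : s.width + 1 ≤ D)
    (hct : E.ctLen l ≤ D) (hec : E.encCoins l ≤ D) (hrc : E.reCoins l ≤ D) (hgc : E.genCoins l ≤ D)
    (hpk : E.pkLen l ≤ D)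
    (hpos : ∀ Q, s.npos Q ≤ D) (hneg : ∀ Q, s.nneg Q ≤ D)
    (hgen : CircuitSizeLE (E.genPk l) D)
    (henc : CircuitSizeLE (fun (x : Fin (E.pkLen l) ⊕ Unit ⊕ Fin (E.encCoins l) → Bool) =>
      E.enc l (fun i => x (.inl i)) (x (.inr (.inl ()))) (fun i => x (.inr (.inr i)))) D)
    (zint : ∀ L, NatSize (fun x => (tape (z x).2 L).int) D (decodeSize D))
    (zenc : ∀ L j i, BitSize (fun x => (tape (z x).2 L).enc j i) (plainSize D))
    (zre : ∀ L j i, BitSize (fun x => (tape (z x).2 L).re j i) (plainSize D))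
    (zg : ∀ Q i, BitSize (fun x => keyPair (z x).1.1 (z x).1.2 Q i) (plainSize D)) (a : ℕ)
    (ha : a ≤ D * D) :
    Sized (fun x => simView E l s W P ((List.range a).map x)
        (fun i => if i < s.k then (x (a + i)).toNat else 0) (z x))
      (D * D + D + D + 102 * (D * D * (D * D))) (viewSize D) := by
  have hD : 1 ≤ D := by omega
  have hk : s.k ≤ D := by unfold Sizes.span at hspan; omega
  have hps : plainSize D ≤ viewSize D := by unfold viewSize; omega
  have h1p : 1 ≤ plainSize D := by unfold plainSize; omega
  have hsmall : D * (decodeSize D + 6) + 1 ≤ plainSize D := by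
    have : 1 * (D * (decodeSize D + 6) + 1) ≤ D * (permSize D + (D * (decodeSize D + 6) + 1) + 5) :=
      Nat.mul_le_mul hD (by omega)
    unfold plainSize
    omega
  have h1 : 1 ≤ viewSize D := h1p.trans hps
  have zbit : ∀ L t, BitSize (fun x => (tape (z x).2 L).int.testBit t) (plainSize D) := fun L t =>
    ((zint L).pred fun v => v.testBit t).mono hsmall
  have zero : ∀ t, BitSize (fun _ : ℕ → Bool => Nat.testBit 0 t) (plainSize D) := fun t =>
    (BitSizeOver.const .nil _).mono h1p
  have hbool : ∀ i t, BitSize (fun x : ℕ → Bool => ((x i).toNat).testBit t) 1 := fun i t => by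
    cases t with
    | zero =>
      have : (fun x : ℕ → Bool => ((x i).toNat).testBit 0) = fun x => x i := by
        funext x; cases x i <;> rfl
      rw [this]; exact .input .nil i
    | succ t =>
      have : (fun x : ℕ → Bool => ((x i).toNat).testBit (t + 1)) = fun x => false := by
        funext x; cases x i <;> simp [Nat.testBit_succ]
      rw [this]; exact .const .nil _
  have hout : ∀ i t, BitSize (fun x : ℕ → Bool =>
      (if i < s.k then (x (a + i)).toNat else 0).testBit t) 1 := fun i t => by
    by_cases hi : i < s.k
    · simpa only [hi, if_true] using hbool (a + i) t
    · simpa only [hi, if_false] using BitSizeOver.const .nil _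
  have hdrawn : ∀ j < s.k, NatSize (fun x => drawn (s := s) (tape (z x).2) j) s.k (permSize D) :=
    fun j hj => (natSize_fyPerm (fun x i => (tape (z x).2 (7, i, 0, 0)).int) (fun x i => tape_fy_le _ i)
      (fun i _ => zint _) hj).mono le_rfl (by unfold permSize; gcongr)
  -- Public keys are recomputed from the coins of key generation.
  have hpkb : ∀ Q i, BitSize (fun x => E.genPk l (keyPair (z x).1.1 (z x).1.2 Q) i)
      (D * (plainSize D + 1)) := fun Q i => (hgen.bit i).comp _ (zg Q)
  have hmk : ∀ Q (b : (ℕ → Bool) → Bool) (r : (ℕ → Bool) → Bits (E.encCoins l)),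
      BitSize b (plainSize D) → (∀ i, BitSize (fun x => r x i) (plainSize D)) →
      ∀ i, BitSize (fun x => hiddenEnc E l (keyPair (z x).1.1 (z x).1.2) P Q (b x) (r x) i)
        (viewSize D) := fun Q b r hb hr i => by
    have := (henc.bit i).comp (fun q x => match q with
      | .inl i => E.genPk l (keyPair (z x).1.1 (z x).1.2 Q) i
      | .inr (.inl _) => if Q = P then b x else false
      | .inr (.inr i) => r x i) (s := D * (plainSize D + 1) + plainSize D) (by
        rintro (i | _ | i)
        · exact (hpkb Q i).mono (by omega)
        · by_cases hQ : Q = P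
          · simpa only [hQ, if_true] using hb.mono (by omega)
          · simpa only [hQ, if_false] using (BitSizeOver.const .nil false).mono (by omega)
        · exact (hr i).mono (by omega))
    exact this.mono (by unfold viewSize; omega)
  have hview := viewSized_script (ct := E.ctLen l) P (sz := s)
    (mk := fun x => hiddenEnc E l (keyPair (z x).1.1 (z x).1.2) P) (τ := fun x => tape (z x).2)
    (K := fun x => idealScript P (s := s) (tape (z x).2) fun i =>
      if i < s.k then (x (a + i)).toNat else 0) (D := D) h1 hps hspan hwid hct hec hrc hpos hneg zbit zenc zre hmk (fun _ _ => zero)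
    (fun _ _ => zero) (fun i h => zbit _) (fun _ _ => zero) (fun j h => zenc _) (fun j h => zbit _)
    (fun j h => zenc _) (fun j hj t => by
      simp only [idealScript]
      by_cases hP : P = .A
      · simp only [hP, if_true]
        -- First the drawn name is distinguished, then the noise; every bit of their sum is a
        -- function of the two values.
        refine ((hdrawn j hj).elim (fun v x => (v + (tape (z x).2 (12, j, 0, 0)).int).testBit t)
          fun v _ => (zint _).pred fun u => (v + u).testBit t).mono ?_
        unfold plainSize
        gcongr
      · simp only [hP, if_false, zero_add]
        exact zbit _ t)
    (fun j hj t => by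
      refine ((hdrawn j hj).elim (fun v x => (if v < s.k then (x (a + v)).toNat else 0).testBit t)
        fun v _ => hout v t).mono ?_
      unfold plainSize
      gcongr
      omega)
    (fun j _ t => (hout j t).mono h1p)
  have hu : Sized (fun x : ℕ → Bool => (List.range a).map x) (D * D) (viewSize D) :=
    (Sized.map h1 (List.range a) (fun i x => x i) fun i _ => (BitSizeOver.input .nil i).mono h1).mono
      (by simpa using ha) le_rfl
  have hg : Sized (fun x => List.ofFn (keyPair (z x).1.1 (z x).1.2 P)) D (viewSize D) :=
    (Sized.ofFn h1 (fun i x => keyPair (z x).1.1 (z x).1.2 P i) fun i => (zg P i).mono hps).mono hgc le_rfl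
  have hp : Sized (fun x => List.ofFn (E.genPk l (keyPair (z x).1.1 (z x).1.2 P.other))) D (viewSize D) :=
    (Sized.ofFn h1 (fun i x => E.genPk l (keyPair (z x).1.1 (z x).1.2 P.other) i)
      fun i => (hpkb _ i).mono (by unfold viewSize; omega)).mono hpk le_rfl
  exact ((hu.append hg).append hp).append hview

end

/-- This bounds `2 ^ width` linearly in `k + n * m`, so masks have polynomially many values. -/
theorem two_pow_size_le (a : ℕ) : 2 ^ a.size ≤ 2 * a + 1 := by
  by_cases h : a = 0
  · subst h; simp
  · have h0 : 0 < a.size := Nat.size_pos.2 (by omega)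
    have := Nat.lt_size.1 (Nat.sub_lt h0 one_pos)
    have e : 2 ^ a.size = 2 * 2 ^ (a.size - 1) := by
      rw [← pow_succ']; congr 1; omega
    omega

theorem intBound_lt {s : Sizes} {D : ℕ} (hspan : s.span ≤ D) (hpow : 2 ^ s.width + 2 ≤ D)
    (q : Box s.span) : s.intBound q.label + 1 ≤ D := by
  have hfw : ∀ h, 2 ^ s.fw h ≤ 2 ^ s.width + 2 := fun h => by
    match h with
    | 0 => exact Nat.le_add_right _ _
    | 1 => exact Nat.le_add_right _ _
    | h + 2 => simp [Sizes.fw]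
  have hi : q.label.2.1 < s.span := q.2.1.2
  have h2 := hfw q.label.2.2.1
  have := Nat.two_pow_pos (s.fw q.label.2.2.1)
  have := Nat.two_pow_pos s.width
  generalize q.label = L at *
  obtain ⟨c, i, h, t⟩ := L
  simp only [Sizes.intBound] at *
  split_ifs <;> omega

theorem PolyBounded.comp_poly {D : ℕ → ℕ} (hD : PolyBounded D) :
    PolyBounded (fun l => viewSize (D l)) := by
  unfold viewSize plainSize permSize decodeSize
  repeat' first | exact hD | exact PolyBounded.const _ | apply PolyBounded.add | apply PolyBounded.mul

theorem length_resultBits {s : Sizes} (d : Inputs s) : (resultBits d).length = s.k := by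
  simp [resultBits]

/-- A bound for everything that is polynomially bounded. -/
theorem exists_common_bound {E : BitCrypto} (hE : E.Efficient) {s : ℕ → Sizes}
    (hk : PolyBounded fun l => (s l).k) (hpos : ∀ P, PolyBounded fun l => (s l).npos P)
    (hneg : ∀ P, PolyBounded fun l => (s l).nneg P) :
    ∃ D : ℕ → ℕ, PolyBounded D ∧ ∀ l, (s l).span ≤ D l ∧ 2 ^ (s l).width + 2 ≤ D l ∧
      E.ctLen l ≤ D l ∧ E.encCoins l ≤ D l ∧ E.reCoins l ≤ D l ∧ E.genCoins l ≤ D l ∧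
      E.pkLen l ≤ D l ∧ (∀ Q, (s l).npos Q ≤ D l) ∧ (∀ Q, (s l).nneg Q ≤ D l) ∧
      CircuitSizeLE (E.genPk l) (D l) ∧
      CircuitSizeLE (fun (x : Fin (E.pkLen l) ⊕ Unit ⊕ Fin (E.encCoins l) → Bool) =>
        E.enc l (fun i => x (.inl i)) (x (.inr (.inl ()))) (fun i => x (.inr (.inr i)))) (D l) := by
  obtain ⟨h1, -, h3, h4, h5, h6, ⟨p7, h7⟩, -, ⟨p9, h9⟩, -⟩ := hE
  have hn : PolyBounded fun l => (s l).n := (hpos .A).add (hpos .B)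
  have hm : PolyBounded fun l => (s l).m := (hneg .A).add (hneg .B)
  have hspan : PolyBounded fun l => (s l).span :=
    ((hk.add ((hn.mul hm).add (.const 2))).add hn).add hm
  have hpow : PolyBounded fun l => 2 ^ (s l).width + 2 :=
    PolyBounded.mono ((((PolyBounded.const 2).mul (hk.add (hn.mul hm))).add (.const 1)).add (.const 2))
      fun l => Nat.add_le_add_right (two_pow_size_le _) 2
  have hp7 : PolyBounded fun l => p7.eval l := ⟨p7, fun _ => le_rfl⟩
  have hp9 : PolyBounded fun l => p9.eval l := ⟨p9, fun _ => le_rfl⟩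
  refine ⟨_, ((((((((((hspan.add hpow).add h3).add h4).add h5).add h6).add h1).add hn).add hm).add
    hp7).add hp9), fun l => ?_⟩
  have hmono : ∀ {ι κ : Type} {f : (ι → Bool) → κ → Bool} {a b : ℕ}, CircuitSizeLE f a → a ≤ b →
      CircuitSizeLE f b := fun ⟨L, h1, h2, h3⟩ h => ⟨L, h1, h2.trans h, h3⟩
  have hn' : (s l).n = (s l).npos .A + (s l).npos .B := rfl
  have hm' : (s l).m = (s l).nneg .A + (s l).nneg .B := rfl
  have hp := Nat.two_pow_pos (s l).width
  refine ⟨by omega, by omega, by omega, by omega, by omega, by omega, by omega,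
    fun Q => by cases Q <;> omega, fun Q => by cases Q <;> omega, hmono (h7 l) (by omega),
    hmono (h9 l) (by omega)⟩

/-- The simulator has exactly the law of `simView`, whatever the data: its circuits depend only on
the sizes, and the data enter as input bits. -/
theorem exists_simulator {E : BitCrypto} (hE : E.Efficient) {s : ℕ → Sizes}
    (hk : PolyBounded fun l => (s l).k) (hpos : ∀ P, PolyBounded fun l => (s l).npos P)
    (hneg : ∀ P, PolyBounded fun l => (s l).nneg P) (P : Party) :
    ∃ S : ProbCircuits, S.Efficient ∧ ∀ l (d : Inputs (s l)),
      S.run l ((d P).bits ++ resultBits d) =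
        (unif (Sample (s l) ((s l).width + 1) (E.encCoins l) (E.reCoins l) (E.genCoins l))).map
          (simView E l (s l) _ P (d P).bits (resVal d)) := by
  obtain ⟨D, hD, H⟩ := exists_common_bound hE hk hpos hneg
  let b : ∀ l, CoinIdx (s l).span ((s l).width + 1) (E.encCoins l) (E.reCoins l) (E.genCoins l) → ℕ :=
    fun l => coinBound (s l) _ _ _ _
  let a : ℕ → ℕ := fun l => ((s l).npos P + (s l).nneg P) * (s l).k
  have dec l := exists_decoder (b l) (a l + (s l).k)
  choose dec hsize hlaw using dec
  let z := fun l x => sampleEquiv (s l) _ _ _ _ (dec l x)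
  let V := fun l (x : ℕ → Bool) => simView E l (s l) _ P ((List.range (a l)).map x)
    (fun i => if i < (s l).k then (x (a l + i)).toNat else 0) (z l x)
  have hV : ∀ l, Sized (V l) (D l * D l + D l + D l + 102 * (D l * D l * (D l * D l)))
      (viewSize (D l)) := by
    intro l
    obtain ⟨h1, h2, h3, h4, h5, h6, h7, h8, h9, h10, h11⟩ := H l
    have hp := Nat.two_pow_pos (s l).width
    have hD0 : 0 < D l := by omega
    have hb : ∀ j, b l j + 1 ≤ D l := by
      rintro (q | j)
      · exact intBound_lt h1 h2 q
      · simp only [b, coinBound]; omega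
    have hdec : ∀ j, NatSize (fun x => (dec l x j : ℕ)) (D l) (decodeSize (D l)) := fun j =>
      (hsize l j).mono (hb j) (decodeSize_mono (by have := hb j; omega))
    have hsmall : D l * (decodeSize (D l) + 6) + 1 ≤ plainSize (D l) := by
      have : 1 * (D l * (decodeSize (D l) + 6) + 1) ≤
          D l * (permSize (D l) + (D l * (decodeSize (D l) + 6) + 1) + 5) :=
        Nat.mul_le_mul hD0 (by omega)
      unfold plainSize
      omega
    have hbit : ∀ j, BitSize (fun x => finTwoEquiv (dec l x (.inr j))) (plainSize (D l)) := by
      intro j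
      refine BitSizeOver.mono ?_ hsmall
      have : (fun x => finTwoEquiv (dec l x (.inr j))) = fun x => (dec l x (.inr j) : ℕ) == 1 := by
        funext x
        generalize dec l x (.inr j) = v
        change Fin 2 at v
        fin_cases v <;> rfl
      rw [this]
      exact (hdec _).pred (· == 1)
    have hpl : 1 ≤ plainSize (D l) := by unfold plainSize; omega
    refine sized_simView P h1 ?_ h3 h4 h5 h6 h7 h8 h9 h10 h11 (fun L => ?_) (fun L j i => ?_)
      (fun L j i => ?_) (fun Q i => ?_) (a l) ?_
    · have : (s l).width < 2 ^ (s l).width := Nat.lt_two_pow_self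
      omega
    · unfold tape
      cases toBox (s l).span L with
      | none => exact natSize_zero hD0 (by unfold decodeSize; omega)
      | some q => exact hdec (.inl q)
    · unfold tape
      cases toBox (s l).span L with
      | none => exact (BitSizeOver.const .nil false).mono hpl
      | some q =>
        simp only [Coin.ofBlk]
        by_cases hj : j < (s l).width + 1
        · simp only [hj, dif_pos]
          exact hbit _
        · simp only [hj, dif_neg, not_false_eq_true]
          exact (BitSizeOver.const .nil false).mono hpl
    · unfold tape
      cases toBox (s l).span L with
      | none => exact (BitSizeOver.const .nil false).mono hpl
      | some q =>
        simp only [Coin.ofBlk]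
        by_cases hj : j < (s l).width + 1
        · simp only [hj, dif_pos]
          exact hbit _
        · simp only [hj, dif_neg, not_false_eq_true]
          exact (BitSizeOver.const .nil false).mono hpl
    · cases Q <;> exact hbit _
    · have hkn : (s l).k + ((s l).npos P + (s l).nneg P) ≤ (s l).span := by
        unfold Sizes.span Sizes.n Sizes.m
        cases P <;> omega
      exact Nat.mul_le_mul (by omega) (by omega)
  choose m hm hlen hbits using hV
  refine ⟨⟨fun l => coinList (b l), m, fun l x i => (V l x).getD i false⟩, ⟨?_, ?_, ?_⟩, ?_⟩
  · have : PolyBounded fun l => (128 * (D l * D l) * (1 + 2 * (D l * D l)) + 2 * D l) * (D l + 1) := by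
      repeat' first | exact hD | exact PolyBounded.const _ | apply PolyBounded.add | apply PolyBounded.mul
    refine this.mono fun l => ?_
    obtain ⟨h1, h2, h3, h4, h5, h6, -⟩ := H l
    have hw : (s l).width < 2 ^ (s l).width := Nat.lt_two_pow_self
    refine (sum_coinList_le (b l) (D := D l) ?_).trans
      (Nat.mul_le_mul_right _ (card_coinIdx_le h1 (by omega) h4 h5 h6))
    rintro (q | j)
    · have := intBound_lt h1 h2 q
      simp only [b, coinBound]; omega
    · simp only [b, coinBound]; omega
  · refine PolyBounded.mono ?_ hm
    repeat' first | exact hD | exact PolyBounded.const _ | apply PolyBounded.add | apply PolyBounded.mul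
  · have hpoly : PolyBounded fun l => m l * viewSize (D l) := by
      refine PolyBounded.mul (PolyBounded.mono ?_ hm) hD.comp_poly
      repeat' first | exact hD | exact PolyBounded.const _ | apply PolyBounded.add | apply PolyBounded.mul
    obtain ⟨p, hp⟩ := hpoly
    refine ⟨p, fun l => ?_⟩
    obtain ⟨L, h1, h2, h3⟩ := circuitSizeLE_of_bits (f := fun x (i : Fin (m l)) => (V l x).getD i false)
      fun j => hbits l j
    exact ⟨L, h1, h2.trans (hp l), h3⟩
  · intro l d
    have hu : ((d P).bits ++ resultBits d).length = a l + (s l).k := by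
      rw [List.length_append, length_bits, length_resultBits]
    -- The output length is exact, so reading the bits with a default value loses nothing.
    have e1 : ∀ x, (List.ofFn fun i : Fin (m l) => (V l x).getD i false) = V l x := fun x => by
      refine List.ext_getElem (by rw [List.length_ofFn, hlen]) fun i h1 h2 => ?_
      rw [List.getElem_ofFn, List.getD_eq_getElem _ _ h2]
    have e2 : ∀ r, V l (pad ((d P).bits ++ resultBits d ++ r)) = simView E l (s l) _ P (d P).bits
        (resVal d) (z l (pad ((d P).bits ++ resultBits d ++ r))) := fun r => by
      have h1 : (List.range (a l)).map (pad ((d P).bits ++ resultBits d ++ r)) = (d P).bits := by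
        have ha : (d P).bits.length = a l := length_bits _
        refine List.ext_getElem (by simp [ha]) fun i h1 h2 => ?_
        rw [List.getElem_map, List.getElem_range, List.append_assoc, pad_append_left _ _ h2, pad,
          List.getD_eq_getElem _ _ h2]
      have h2 : (fun i => if i < (s l).k then
          (pad ((d P).bits ++ resultBits d ++ r) (a l + i)).toNat else 0) = resVal d := by
        funext i
        have ha : (d P).bits.length = a l := length_bits _
        by_cases hi : i < (s l).k
        · rw [if_pos hi, List.append_assoc, ← ha, pad_append_right,
            pad_append_left _ _ (by rw [length_resultBits]; exact hi), resVal, dif_pos hi, pad,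
            List.getD_eq_getElem _ _ (by rw [length_resultBits]; exact hi)]
          simp [resultBits]
        · rw [if_neg hi, resVal, dif_neg hi]
      simp only [V, h1, h2]
    have e3 := hlaw l _ hu
    refine (congrArg (fun f => PMF.map f (coinBits (coinList (b l))))
      (funext fun r => (e1 _).trans (e2 r))).trans ?_
    rw [← unif_map_equiv (sampleEquiv (s l) ((s l).width + 1) (E.encCoins l) (E.reCoins l)
      (E.genCoins l)), ← e3, PMF.map_comp, PMF.map_comp]
    rfl

section

/-! ### Reductions to the security of the cryptosystem -/

theorem Sized.circuit {ι : Type} {V : (ι → Bool) → List Bool} {n s t : ℕ}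
    {f : (ℕ → Bool) → Unit → Bool} (hf : CircuitSizeLE f t) (hV : Sized V n s) :
    CircuitSizeLE (fun x (_ : Unit) => f (pad (V x)) ()) (t * (s + 1)) := by
  obtain ⟨m, -, -, h⟩ := hV
  exact circuitSizeLE_of_bit ((hf.bit ()).comp (fun i x => (V x).getD i false) h)

theorem Sized.const {ι : Type} {s : ℕ} (hs : 1 ≤ s) (u : List Bool) :
    Sized (fun _ : ι → Bool => u) u.length s :=
  ⟨_, le_rfl, fun _ => rfl, fun _ => (BitSizeOver.const .nil _).mono hs⟩

theorem abs_prTrue_sub_le (p q : PMF Bool) : |prTrue p - prTrue q| ≤ 1 := by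
  have h : ∀ p : PMF Bool, 0 ≤ prTrue p ∧ prTrue p ≤ 1 := fun p =>
    ⟨ENNReal.toReal_nonneg, ENNReal.toReal_le_of_le_ofReal zero_le_one
      (by rw [ENNReal.ofReal_one]; exact p.coe_le_one _)⟩
  rw [abs_le]
  constructor <;> linarith [(h p).1, (h p).2, (h q).1, (h q).2]

theorem near_of_abs_prTrue {α β : Type} {p : PMF α} {q : PMF β} {f : α → Bool} {g : β → Bool} {ε : ℝ}
    (h : |prTrue (p.map f) - prTrue (q.map g)| ≤ ε) :
    Near (expect p fun x => ind (f x)) (expect q fun x => ind (g x)) (ENNReal.ofReal ε) := by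
  rw [prTrue_map, prTrue_map] at h
  exact near_of_abs_sub_le (expect_ind_le _ _) (expect_ind_le _ _) h

variable {E : BitCrypto} {D : ∀ _ : ℕ, (ℕ → Bool) → Unit → Bool}

/-- A distinguisher of views becomes a distinguisher of single ciphertexts when the rest of the view
is hard-wired. The key, the ciphertext and that rest are all part of the attack, and one negligible
bound serves for all of them. -/
theorem exists_reenc_bound (hE : E.ReencIndist) (hD : PolySize D) :
    ∃ ε : ℕ → ℝ, Negligible ε ∧ ∀ l (g : Bits (E.genCoins l)) b c,
      E.IsCt l (E.genPk l g) b c → ∀ v : List (Bool ⊕ Option (Bits (E.ctLen l))),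
      Near (expect (unif (Bits (E.reCoins l))) fun r =>
          ind (D l (pad (realize (fill (E.reenc l (E.genPk l g) c r) v))) ()))
        (expect (unif (Bits (E.encCoins l))) fun r =>
          ind (D l (pad (realize (fill (E.enc l (E.genPk l g) b r) v))) ())) (ENNReal.ofReal (ε l)) := by
  let X : ℕ → Type := fun l => Bits (E.genCoins l) × Bool × Bits (E.ctLen l) ×
    List (Bool ⊕ Option (Bits (E.ctLen l)))
  let A : ∀ l, List (Bool ⊕ Option (Bits (E.ctLen l))) → (Fin (E.ctLen l) → Bool) → Unit → Bool :=
    fun l v x _ => D l (pad (realize (fill x v))) ()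
  obtain ⟨ε, h1, h2⟩ := exists_negligible_bound (X := X)
    (fun l x => E.IsCt l (E.genPk l x.1) x.2.1 x.2.2.1)
    (fun l x => |prTrue ((unif (Bits (E.reCoins l))).map fun r =>
            A l x.2.2.2 (E.reenc l (E.genPk l x.1) x.2.2.1 r) ()) -
          prTrue ((unif (Bits (E.encCoins l))).map fun r =>
            A l x.2.2.2 (E.enc l (E.genPk l x.1) x.2.1 r) ())|)
    (fun l => ⟨(fun _ => false, false, E.enc l (E.genPk l fun _ => false) false fun _ => false, []), .enc _ _⟩)
    (fun l x => abs_prTrue_sub_le _ _) (fun l x => abs_nonneg _) (fun x hx => by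
      refine hE (fun l => (x l).1) (fun l => (x l).2.1) (fun l => (x l).2.2.1) hx
        (fun l => A l (x l).2.2.2) ?_
      obtain ⟨p, hp⟩ := hD
      -- Every input of the distinguisher becomes a constant or an input wire. The length of the
      -- view is irrelevant for the size.
      refine ⟨p * 2, fun l => ?_⟩
      have : Sized (fun y : Fin (E.ctLen l) → Bool => realize (fill y (x l).2.2.2))
          ((x l).2.2.2.length * (E.ctLen l + 1)) 1 := by
        simp only [realize, fill, List.flatMap_map]
        refine Sized.flatMap le_rfl _ (fun a (y : Fin (E.ctLen l) → Bool) =>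
          Sum.elim (fun b => [b]) List.ofFn (Sum.map id (fun o => Option.getD o y) a)) ?_
        rintro (b | _ | c) -
        · exact (Sized.const le_rfl [b]).mono (by simp) le_rfl
        · exact (Sized.ofFn le_rfl (fun i (y : Fin (E.ctLen l) → Bool) => y i)
            fun i => .input .nil i).mono (by simp) le_rfl
        · exact (Sized.const le_rfl (List.ofFn c)).mono (by simp) le_rfl
      simpa using Sized.circuit (hp l) this)
  exact ⟨ε, h1, fun l g b c hc v => near_of_abs_prTrue (h2 l (g, b, c, v) hc)⟩

/-- The keys, if `P` uses the coins `gP` and the other party uses `gO`. -/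
def keysOf {α : Type} (P : Party) (gP gO : α) (Q : Party) : α := if Q = P then gP else gO

/-- The ciphertext that a symbol stands for. -/
def evalSym (E : BitCrypto) (l : ℕ) (g : Party → Bits (E.genCoins l)) (c : SymCt (E.encCoins l)) :
    Bits (E.ctLen l) := encWith E l g c.1 c.2.1 c.2.2

/-- The part of a view that is known before the execution. -/
def viewPrefix (E : BitCrypto) (l : ℕ) (P : Party) (u : List Bool) (g : Party → Bits (E.genCoins l)) :
    List Bool := u ++ List.ofFn (g P) ++ List.ofFn (E.genPk l (g P.other))

/-- The other party's key pair is part of the challenge, while the keys of `P` are hard-wired. The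
remaining ciphertexts under the challenge key are given by plaintext and coins, so the attack
encrypts them itself with the public key. -/
theorem exists_ct_bound (hE : E.CtIndist) (heff : E.Efficient) (hD : PolySize D) (P : Party) :
    ∃ ε : ℕ → ℝ, Negligible ε ∧ ∀ l (gP : Bits (E.genCoins l)) (u : List Bool)
      (v : List (Bool ⊕ Option (SymCt (E.encCoins l)))),
      Near (expect (unif (Bits (E.encCoins l))) fun r => expect (unif (Bits (E.genCoins l))) fun gO =>
          ind (D l (pad (viewPrefix E l P u (keysOf P gP gO) ++
            realize ((fill (P.other, true, r) v).map (Sum.map id (evalSym E l (keysOf P gP gO)))))) ()))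
        (expect (unif (Bits (E.encCoins l))) fun r => expect (unif (Bits (E.genCoins l))) fun gO =>
          ind (D l (pad (viewPrefix E l P u (keysOf P gP gO) ++
            realize ((fill (P.other, false, r) v).map (Sum.map id (evalSym E l (keysOf P gP gO)))))) ()))
        (ENNReal.ofReal (ε l)) := by
  let X : ℕ → Type := fun l => Bits (E.genCoins l) × List Bool ×
    List (Bool ⊕ Option (SymCt (E.encCoins l)))
  -- The hole receives the challenge ciphertext; all other symbols are evaluated with the hard-wired
  -- or the challenge public key.
  let elt : ∀ l, Bits (E.genCoins l) → (Fin (E.pkLen l) ⊕ Fin (E.ctLen l) → Bool) →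
      Bool ⊕ Option (SymCt (E.encCoins l)) → List Bool := fun l gP y a => match a with
    | .inl b => [b]
    | .inr none => List.ofFn fun i => y (.inr i)
    | .inr (some c) => List.ofFn (E.enc l (if c.1 = P then E.genPk l gP else fun i => y (.inl i)) c.2.1 c.2.2)
  let V : ∀ l, X l → (Fin (E.pkLen l) ⊕ Fin (E.ctLen l) → Bool) → List Bool := fun l x y =>
    x.2.1 ++ List.ofFn x.1 ++ (List.ofFn fun i => y (.inl i)) ++ x.2.2.flatMap (elt l x.1 y)
  have hV : ∀ l (x : X l) b r gO, viewPrefix E l P x.2.1 (keysOf P x.1 gO) ++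
      realize ((fill (P.other, b, r) x.2.2).map (Sum.map id (evalSym E l (keysOf P x.1 gO)))) =
      V l x (Sum.elim (E.genPk l gO) (E.enc l (E.genPk l gO) b r)) := fun l x b r gO => by
    have hne : P.other ≠ P := P.other_ne
    simp only [viewPrefix, V, keysOf, if_true, hne, if_false, Sum.elim_inl, realize, fill, List.map_map,
      List.flatMap_map]
    congr 1
    refine List.flatMap_congr fun a _ => ?_
    rcases a with b' | _ | ⟨K, b', r'⟩
    · rfl
    · simp [evalSym, encWith, elt, keysOf, hne]
    · by_cases hK : K = P
      · simp [evalSym, encWith, elt, keysOf, hK]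
      · simp [evalSym, encWith, elt, keysOf, hK]
  let A : ∀ l, X l → (Fin (E.pkLen l) ⊕ Fin (E.ctLen l) → Bool) → Unit → Bool :=
    fun l x y _ => D l (pad (V l x y)) ()
  let law : ∀ l, X l → Bool → PMF Bool := fun l x b =>
    (unif (Bits (E.genCoins l) × Bits (E.encCoins l))).map fun t =>
      A l x (Sum.elim (E.genPk l t.1) (E.enc l (E.genPk l t.1) b t.2)) ()
  obtain ⟨ε, h1, h2⟩ := exists_negligible_bound (X := X) (fun _ _ => True)
    (fun l x => |prTrue (law l x false) - prTrue (law l x true)|)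
    (fun l => ⟨(fun _ => false, [], []), trivial⟩)
    (fun l x => abs_prTrue_sub_le _ _) (fun l x => abs_nonneg _) (fun x hx => by
      refine hE (fun l => A l (x l)) ?_
      obtain ⟨p, hp⟩ := hD
      obtain ⟨-, -, -, -, -, -, -, -, ⟨q, hq⟩, -⟩ := heff
      refine ⟨p * (q * 2 + 1 + 1), fun l => ?_⟩
      have h1 : 1 ≤ q.eval l * 2 + 1 := by omega
      have hel : Sized (fun y => (x l).2.2.flatMap fun a => elt l (x l).1 y a)
          ((x l).2.2.length * (E.ctLen l + 1)) (q.eval l * 2 + 1) := by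
        refine Sized.flatMap h1 _ (fun a y => elt l (x l).1 y a) ?_
        rintro (b | _ | ⟨K, b, r⟩) -
        · exact (Sized.const h1 [b]).mono (by simp) le_rfl
        · exact (Sized.ofFn h1 (fun i (y : Fin (E.pkLen l) ⊕ Fin (E.ctLen l) → Bool) => y (.inr i))
            fun i => (BitSizeOver.input .nil _).mono h1).mono (by simp) le_rfl
        · refine (Sized.ofFn h1 (fun i (y : Fin (E.pkLen l) ⊕ Fin (E.ctLen l) → Bool) =>
            E.enc l (if K = P then E.genPk l (x l).1 else fun i => y (.inl i)) b r i) fun i => ?_).mono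
              (by simp) le_rfl
          have key := ((hq l).bit i).comp (fun a (y : Fin (E.pkLen l) ⊕ Fin (E.ctLen l) → Bool) =>
            Sum.elim (fun i => if K = P then E.genPk l (x l).1 i else y (.inl i))
              (Sum.elim (fun _ => b) r) a) (s := 1) (by
              rintro (i | _ | i)
              · by_cases hK : K = P
                · simpa only [hK, if_true, Sum.elim_inl] using BitSizeOver.const .nil _
                · simpa only [hK, if_false, Sum.elim_inl] using BitSizeOver.input .nil _
              · exact .const .nil _
              · exact .const .nil _)
          refine BitSizeOver.mono ?_ (Nat.le_succ _)
          convert key using 2 with y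
          by_cases hK : K = P <;> simp [hK]
      have : Sized (V l (x l)) _ (q.eval l * 2 + 1) :=
        (((Sized.const h1 _).append (Sized.const h1 _)).append (Sized.ofFn h1
          (fun i (y : Fin (E.pkLen l) ⊕ Fin (E.ctLen l) → Bool) => y (.inl i))
            fun i => (BitSizeOver.input .nil _).mono h1)).append hel
      simpa using Sized.circuit (hp l) this)
  refine ⟨ε, h1, fun l gP u v => ?_⟩
  have h := h2 l (gP, u, v) trivial
  rw [abs_sub_comm] at h
  have h := near_of_abs_prTrue h
  rw [expect_unif_prod, expect_unif_prod, expect_comm, expect_comm (unif (Bits (E.genCoins l)))] at h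
  have e := fun b r gO => hV l (gP, u, v) b r gO
  simp only [e]
  exact h

end

/-! ### Privacy -/

/-- Keys are drawn independently, so it does not matter whether they are ordered by name or by role.
-/
theorem expect_keys {α : Type} [Fintype α] [Nonempty α] (P : Party) (F : (Party → α) → ENNReal) :
    (expect (unif α) fun gA => expect (unif α) fun gB => F (keyPair gA gB)) =
      expect (unif α) fun gP => expect (unif α) fun gO => F (keysOf P gP gO) := by
  cases P with
  | A =>
    refine expect_congr _ fun gA _ => expect_congr _ fun gB _ => congrArg F (funext fun Q => ?_)
    cases Q <;> rfl
  | B =>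
    rw [expect_comm]
    refine expect_congr _ fun gA _ => expect_congr _ fun gB _ => congrArg F (funext fun Q => ?_)
    cases Q <;> rfl

section

variable {E : BitCrypto} {l : ℕ} {s : Sizes} {P : Party}

/-- After the exchange of re-encryptions the run is expressed with symbols, which by naturality are
evaluated with the keys only in the final view. -/
theorem near_view_aux (hE : E.Correct) (D : List Bool → Bool) (ε : ENNReal)
    (hε : ∀ g b c, E.IsCt l (E.genPk l g) b c → ∀ v : List (Bool ⊕ Option (Bits (E.ctLen l))),
      Near (expect (unif (Bits (E.reCoins l))) fun r =>
          ind (D (realize (fill (E.reenc l (E.genPk l g) c r) v))))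
        (expect (unif (Bits (E.encCoins l))) fun r =>
          ind (D (realize (fill (E.enc l (E.genPk l g) b r) v)))) ε)
    (d : Inputs s) (g : Party → Bits (E.genCoins l)) :
    Near (expect (runProgram E l g (improvedCWC s) (initState E l s d g)) fun st => ind (D (st.view P)))
      (expect (lrun (E.reCoins l) P (s.width + 1) symCt (improvedCWC s) (startState d [])) fun a =>
        ind (D (viewPrefix E l P (d P).bits g ++ realize (a.view.map (Sum.map id (evalSym E l g))))))
      ((improvedCWC s).length * ((s.width + 1 : ℕ) * ε)) := by
  have hv : (initState E l s d g).view P = viewPrefix E l P (d P).bits g := rfl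
  have h := near_real_lrun (P := P) (W := s.width + 1) hE D (fun K b c hc v => hε (g K) b c hc v) (improvedCWC s)
    (rel_initState E l g Eq d ((viewPrefix E l P (d P).bits g).map .inl))
    (by rw [hv]; exact (realize_inl _).symm) (fun a ha => by
      rw [startState_map] at ha
      exact (lrun_protocol le_rfl d _ a ha).1)
  refine h.trans (Near.of_eq ?_ 0) |>.mono (by rw [add_zero])
  refine (expect_lrun_protocol le_rfl d _ fun w => ind (D (realize w))).trans ?_
  have e : lrun (E.reCoins l) P (s.width + 1) (encWith E l g) (improvedCWC s) (startState d []) =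
      (lrun (E.reCoins l) P (s.width + 1) symCt (improvedCWC s) (startState d [])).map
        (LState.map (evalSym E l g)) := by
    rw [lrun_map, startState_map]
    rfl
  have := expect_lrun_protocol (rc := E.reCoins l) (P := P) (mk := encWith E l g) le_rfl d []
    fun w => ind (D (viewPrefix E l P (d P).bits g ++ realize w))
  rw [e, expect_map] at this
  simp only [LState.map, List.nil_append] at this
  rw [this]
  refine expect_congr _ fun t _ => ?_
  rw [realize_append, realize_inl]

/-- Evaluating hidden symbols gives encryptions that ignore plaintexts under the other party's key,
so the identity for ideal views applies. -/
theorem expect_hidden (D : List Bool → Bool) (d : Inputs s) (g : Party → Bits (E.genCoins l)) :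
    (expect (lrun (E.reCoins l) P (s.width + 1) (hideCt P) (improvedCWC s) (startState d [])) fun a =>
        ind (D (viewPrefix E l P (d P).bits g ++ realize (a.view.map (Sum.map id (evalSym E l g)))))) =
      expect (unif (Tape s (s.width + 1) (E.encCoins l) (E.reCoins l))) fun t =>
        ind (D (viewPrefix E l P (d P).bits g ++ realize ((idealScript P (s := s) (tape t) (resVal d)).view P
          (hiddenEnc E l g P) s (tape t)))) := by
  have e : lrun (E.reCoins l) P (s.width + 1) (hiddenEnc E l g P) (improvedCWC s) (startState d []) =
      (lrun (E.reCoins l) P (s.width + 1) (hideCt P) (improvedCWC s) (startState d [])).map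
        (LState.map (evalSym E l g)) := by
    rw [lrun_map, startState_map]
    rfl
  have := expect_lrun_ideal (rc := E.reCoins l) (P := P) (mk := hiddenEnc E l g P) d le_rfl
    (fun b r => by simp [hiddenEnc, P.other_ne]) (resVal d) (fun _ _ => rfl) []
    fun w => ind (D (viewPrefix E l P (d P).bits g ++ realize w))
  rw [e, expect_map] at this
  simpa only [LState.map, List.nil_append] using this

/-- The two hybrid arguments combined. Each contributes the number of instructions times the number
of bits times the error of a single exchange. -/
theorem near_view (hE : E.Correct) (D : List Bool → Bool) (ε δ : ENNReal)
    (hε : ∀ g b c, E.IsCt l (E.genPk l g) b c → ∀ v : List (Bool ⊕ Option (Bits (E.ctLen l))),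
      Near (expect (unif (Bits (E.reCoins l))) fun r =>
          ind (D (realize (fill (E.reenc l (E.genPk l g) c r) v))))
        (expect (unif (Bits (E.encCoins l))) fun r =>
          ind (D (realize (fill (E.enc l (E.genPk l g) b r) v)))) ε)
    (hδ : ∀ (gP : Bits (E.genCoins l)) (u : List Bool)
      (v : List (Bool ⊕ Option (SymCt (E.encCoins l)))),
      Near (expect (unif (Bits (E.encCoins l))) fun r => expect (unif (Bits (E.genCoins l))) fun gO =>
          ind (D (viewPrefix E l P u (keysOf P gP gO) ++
            realize ((fill (P.other, true, r) v).map (Sum.map id (evalSym E l (keysOf P gP gO)))))))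
        (expect (unif (Bits (E.encCoins l))) fun r => expect (unif (Bits (E.genCoins l))) fun gO =>
          ind (D (viewPrefix E l P u (keysOf P gP gO) ++
            realize ((fill (P.other, false, r) v).map (Sum.map id (evalSym E l (keysOf P gP gO)))))))
        δ)
    (d : Inputs s) :
    Near (expect (viewOf E l s d P) fun v => ind (D v))
      (expect (unif (Sample s (s.width + 1) (E.encCoins l) (E.reCoins l) (E.genCoins l))) fun z =>
        ind (D (simView E l s _ P (d P).bits (resVal d) z)))
      ((improvedCWC s).length * ((s.width + 1 : ℕ) * ε) + (improvedCWC s).length * ((s.width + 1 : ℕ) * δ)) := by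
  rw [viewOf, expect_map, execution_eq, expect_bind, expect_unif_prod, expect_unif_prod]
  simp only [expect_bind]
  rw [expect_keys P fun g => expect (runProgram E l g (improvedCWC s) (initState E l s d g)) fun st =>
    ind (D (st.view P))]
  have e2 := expect_keys P fun g => expect (unif (Tape s (s.width + 1) (E.encCoins l) (E.reCoins l))) fun t =>
    ind (D (viewPrefix E l P (d P).bits g ++ realize ((idealScript P (s := s) (tape t) (resVal d)).view P
          (hiddenEnc E l g P) s (tape t))))
  refine Near.mono (Near.trans ?_ (Near.of_eq e2.symm 0)) (by rw [add_zero])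
  refine Near.expect _ fun gP _ => ?_
  refine (Near.expect _ fun gO _ => near_view_aux hE D ε hε d (keysOf P gP gO)).trans ?_
  simp only [← expect_hidden]
  -- The symbolic run involves no keys, so the other party's keys may be drawn after it; they become
  -- part of the test.
  rw [expect_comm, expect_comm (unif (Bits (E.genCoins l)))]
  refine near_lrun_hide (P := P) (G := fun w => expect (unif (Bits (E.genCoins l))) fun gO =>
    ind (D (viewPrefix E l P (d P).bits (keysOf P gP gO) ++
      realize (w.map (Sum.map id (evalSym E l (keysOf P gP gO)))))))
    (fun v => hδ gP _ v) _ _ fun a ha => ?_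
  rw [startState_map] at ha
  exact (lrun_protocol le_rfl d _ a ha).1

end

/-- A polynomial number of hybrids, each with negligible error, gives a negligible total. The
polynomial length of the protocol is the remaining assumption `hlen`. -/
theorem isPrivate {E : BitCrypto} (hE : E.IsFHE) (hS : E.Secure)
    (hlen : ∀ s : ℕ → Sizes, PolyBounded (fun l => (s l).k) → PolyBounded (fun l => (s l).n) →
      PolyBounded (fun l => (s l).m) → PolyBounded fun l => (improvedCWC (s l)).length) :
    IsPrivate E := by
  intro s hk hpos hneg P
  obtain ⟨S, hS1, hS2⟩ := exists_simulator hE.2 hk hpos hneg P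
  refine ⟨S, hS1, fun d D hD => ?_⟩
  obtain ⟨ε, hε, hε'⟩ := exists_reenc_bound hS.2 hD
  obtain ⟨δ, hδ, hδ'⟩ := exists_ct_bound hS.1 hE.2 hD P
  have hn : PolyBounded fun l => (s l).n := (hpos .A).add (hpos .B)
  have hm : PolyBounded fun l => (s l).m := (hneg .A).add (hneg .B)
  have hw : PolyBounded fun l => (s l).width + 1 :=
    (PolyBounded.mono (hk.add (hn.mul hm)) fun l => Nat.size_le.2 Nat.lt_two_pow_self).add (.const 1)
  have hN := (hlen s hk hn hm).mul hw
  refine negligible_of_abs_le (negligible_add (negligible_poly_mul hε hN) (negligible_poly_mul hδ hN))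
    fun l => ?_
  rw [abs_abs]
  beta_reduce
  rw [prTrue_map, hS2, PMF.map_comp, prTrue_map]
  refine abs_sub_le_of_near (expect_ind_le _ _) (expect_ind_le _ _) (by positivity) ?_
  have hle : ∀ a : ℝ, ENNReal.ofReal a ≤ ENNReal.ofReal |a| := fun a =>
    ENNReal.ofReal_le_ofReal (le_abs_self a)
  refine (near_view hE.1 (fun v => D l (pad v) ()) (ENNReal.ofReal |ε l|) (ENNReal.ofReal |δ l|)
    (fun g b c hc v => (hε' l g b c hc v).mono (hle _))
    (fun gP u v => (hδ' l gP u v).mono (hle _)) (d l)).mono (le_of_eq ?_)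
  rw [ENNReal.ofReal_add (by positivity) (by positivity), ENNReal.ofReal_mul (by positivity),
    ENNReal.ofReal_mul (by positivity), ENNReal.ofReal_natCast]
  push_cast
  ring

/-! ### Time and space -/

/-- The length doubles at each level and fewer than `2 ^ (t + 1)` comparators are added, whence the
factor `t`. -/
theorem length_oddEvenMerge_le (t lo r : ℕ) : (oddEvenMerge t lo r).length ≤ 2 ^ t * t := by
  induction t using Nat.twoStepInduction generalizing lo r with
  | zero => simp [oddEvenMerge]
  | one => simp [oddEvenMerge]
  | more t _ ih =>
    have h1 := ih lo (2 * r)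
    have h2 := ih (lo + r) (2 * r)
    simp only [oddEvenMerge, List.length_append, List.length_map, List.length_range]
    have : 2 ^ (t + 2) * (t + 2) = 2 * (2 ^ (t + 1) * (t + 1)) + 2 ^ (t + 2) := by ring
    have : 2 ^ (t + 2) = 2 * 2 ^ (t + 1) := by ring
    omega

/-- Each level of sorting adds one merge, which brings the second factor `t`. -/
theorem length_oddEvenSort_le (t lo : ℕ) : (oddEvenSort t lo).length ≤ 2 ^ t * t * t := by
  induction t generalizing lo with
  | zero => simp [oddEvenSort]
  | succ t ih =>
    have h1 := ih lo
    have h2 := ih (lo + 2 ^ t)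
    have h3 := length_oddEvenMerge_le (t + 1) lo 1
    simp only [oddEvenSort, List.length_append]
    have e : 2 ^ (t + 1) * (t + 1) * (t + 1) =
        2 * (2 ^ t * t * t) + 2 ^ (t + 1) * (t + 1) + 2 ^ (t + 1) * t := by ring
    omega

theorem length_sortNetwork_le (k : ℕ) :
    (sortNetwork k).length ≤ 2 ^ Nat.clog 2 k * Nat.clog 2 k * Nat.clog 2 k :=
  (List.length_filter_le _ _).trans (length_oddEvenSort_le _ _)

theorem two_pow_clog_le {k : ℕ} (hk : 2 ≤ k) : 2 ^ Nat.clog 2 k ≤ 2 * k := by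
  have h := Nat.pow_pred_clog_lt_self (b := 2) (by norm_num) (show 1 < k by omega)
  have h0 : 0 < Nat.clog 2 k := Nat.clog_pos (by norm_num) hk
  have e : 2 ^ Nat.clog 2 k = 2 * 2 ^ (Nat.clog 2 k).pred := by
    rw [← pow_succ']; congr 1; rw [Nat.pred_eq_sub_one]; omega
  omega

theorem length_sortNetwork_le_poly (k : ℕ) : (sortNetwork k).length ≤ (2 * k + 1) * (2 * k + 1) * (2 * k + 1) := by
  have h : 2 ^ Nat.clog 2 k ≤ 2 * k + 1 := by
    by_cases hk : 2 ≤ k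
    · exact (two_pow_clog_le hk).trans (by omega)
    · interval_cases k <;> simp
  have h' : Nat.clog 2 k ≤ 2 * k + 1 := Nat.lt_two_pow_self.le.trans h
  exact (length_sortNetwork_le k).trans (Nat.mul_le_mul (Nat.mul_le_mul h h') h')

/-- For `k ≥ 2` the padded number of wires is at most `2 * k` and its logarithm at most twice that
of `k`; the product of these three factors gives the constant `8`. For `k = 1` there is no
comparator and the logarithm vanishes. -/
theorem length_sortNetwork_le_logb {k : ℕ} (hk : 1 ≤ k) :
    ((sortNetwork k).length : ℝ) ≤ 8 * (k * Real.logb 2 k ^ 2) := by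
  have h := length_sortNetwork_le k
  rcases hk.eq_or_lt with rfl | hk
  · simp at h
    simp [h]
  · have h2 := two_pow_clog_le hk
    have h3 := Nat.pow_pred_clog_lt_self (b := 2) (by norm_num) hk
    have hk0 : (0 : ℝ) < k := by positivity
    have l1 : 1 ≤ Real.logb 2 k := by
      rw [Real.le_logb_iff_rpow_le (by norm_num) hk0]
      simpa using (by exact_mod_cast hk : (2 : ℝ) ≤ k)
    have l2 : ((Nat.clog 2 k).pred : ℝ) ≤ Real.logb 2 k := by
      rw [Real.le_logb_iff_rpow_le (by norm_num) hk0, Real.rpow_natCast]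
      exact_mod_cast h3.le
    have l3 : (Nat.clog 2 k : ℝ) ≤ 2 * Real.logb 2 k := by
      have : Nat.clog 2 k ≤ (Nat.clog 2 k).pred + 1 := by rw [Nat.pred_eq_sub_one]; omega
      have : (Nat.clog 2 k : ℝ) ≤ (Nat.clog 2 k).pred + 1 := by exact_mod_cast this
      linarith
    have h2' : (2 : ℝ) ^ Nat.clog 2 k ≤ 2 * k := by exact_mod_cast h2
    have h' : ((sortNetwork k).length : ℝ) ≤ 2 ^ Nat.clog 2 k * Nat.clog 2 k * Nat.clog 2 k := by
      exact_mod_cast h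
    calc ((sortNetwork k).length : ℝ) ≤ 2 ^ Nat.clog 2 k * Nat.clog 2 k * Nat.clog 2 k := h'
      _ ≤ (2 * k) * (2 * Real.logb 2 k) * (2 * Real.logb 2 k) := by gcongr
      _ = 8 * (k * Real.logb 2 k ^ 2) := by ring

theorem length_improvedCWC_le (s : Sizes) : (improvedCWC s).length ≤
    200 * ((s.k + 1) * (s.n + 1) * (s.m + 1)) + 7 * (sortNetwork s.k).length := by
  have hn : s.n = s.npos .A + s.npos .B := rfl
  have hm : s.m = s.nneg .A + s.nneg .B := rfl
  simp only [improvedCWC, Protocol.shareData, Protocol.computeItems, Protocol.mixSend, Protocol.drawPerm,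
    Protocol.mixReply, Protocol.mixEnd, Protocol.sortItems, Protocol.openRanks, Protocol.moveStrings,
    Protocol.selectFeatures, Protocol.openResult, Protocol.forItems, Protocol.fields, loop,
    Protocol.compareExchange, List.length_append, List.length_flatMap, List.length_cons, List.length_nil,
    List.map_const', List.sum_replicate, List.length_range, List.length_reverse, List.length_map,
    smul_eq_mul]
  generalize (sortNetwork s.k).length = L
  generalize s.k = k
  rw [hn, hm]
  generalize s.npos .A = a
  generalize s.npos .B = b
  generalize s.nneg .A = c
  generalize s.nneg .B = e
  -- Both sides are polynomials in the sizes; given that the monomials are nonnegative, comparing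
  -- coefficients suffices.
  have h1 := Nat.zero_le (k * a * c)
  have h2 := Nat.zero_le (k * a * e)
  have h3 := Nat.zero_le (k * b * c)
  have h4 := Nat.zero_le (k * b * e)
  have h5 := Nat.zero_le (k * a)
  have h6 := Nat.zero_le (k * b)
  have h7 := Nat.zero_le (k * c)
  have h8 := Nat.zero_le (k * e)
  have h9 := Nat.zero_le (a * c)
  have h10 := Nat.zero_le (a * e)
  have h11 := Nat.zero_le (b * c)
  have h12 := Nat.zero_le (b * e)
  nlinarith

/-- The registers that occur in the protocol. -/
def Reg.Used (s : Sizes) : Reg → Prop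
  | .pos p i => p < s.n ∧ i < s.k
  | .neg q i => q < s.m ∧ i < s.k
  | .item i f | .mask i f | .noise i f => i < s.k ∧ f ∈ Protocol.fields s
  | .perm i | .key i | .label i | .pad i | .masked i | .rank i | .keep i | .sel i | .out i => i < s.k
  | .srt j h => j < s.k ∧ h < s.n * s.m
  | .z j h => j < s.k + 1 ∧ h < s.n * s.m
  | .cum h => h < s.n * s.m
  | .tmp t => t < 3

/-- The list of these registers. -/
def usedRegs (s : Sizes) : List Reg :=
  (grid s.n s.k).map (fun x => Reg.pos x.1 x.2) ++ (grid s.m s.k).map (fun x => Reg.neg x.1 x.2) ++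
  ((List.range s.k).flatMap fun i => (Protocol.fields s).map (Reg.item i)) ++
  ((List.range s.k).flatMap fun i => (Protocol.fields s).map (Reg.mask i)) ++
  ((List.range s.k).flatMap fun i => (Protocol.fields s).map (Reg.noise i)) ++
  ((List.range s.k).flatMap fun i => [.perm i, .key i, .label i, .pad i, .masked i, .rank i, .keep i,
    .sel i, .out i]) ++
  (grid s.k (s.n * s.m)).map (fun x => Reg.srt x.1 x.2) ++
  (grid (s.k + 1) (s.n * s.m)).map (fun x => Reg.z x.1 x.2) ++
  (List.range (s.n * s.m)).map Reg.cum ++ (List.range 3).map Reg.tmp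

theorem mem_usedRegs {s : Sizes} {r : Reg} (h : r.Used s) : r ∈ usedRegs s := by
  simp only [usedRegs, List.mem_append, List.mem_map, List.mem_flatMap, List.mem_range, Prod.exists,
    mem_grid]
  cases r <;> simp_all [Reg.Used]

theorem length_usedRegs_le (s : Sizes) :
    (usedRegs s).length ≤ 20 * ((s.k + 1) * (s.n + 1) * (s.m + 1)) := by
  simp only [usedRegs, List.length_append, List.length_map, length_grid, List.length_flatMap,
    List.map_const', List.sum_replicate, List.length_range, smul_eq_mul, Protocol.fields,
    List.length_cons, List.length_nil]
  generalize s.k = k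
  generalize s.n = n
  generalize s.m = m
  have h1 := Nat.zero_le (k * n * m)
  have h2 := Nat.zero_le (k * n)
  have h3 := Nat.zero_le (k * m)
  have h4 := Nat.zero_le (n * m)
  nlinarith

theorem forall_mem_loop {α : Instr → Prop} {n : ℕ} {body : ℕ → Program} :
    (∀ i ∈ loop n body, α i) ↔ ∀ j < n, ∀ i ∈ body j, α i := by
  simp only [loop, List.mem_flatMap, List.mem_range]
  grind

/-- All indices in the program are loop indices or results of bounded expressions. The nontrivial
cases are the shift to the data of `B`, the number `s.m * p + q` of a bit, and the wires of the
network. -/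
theorem regs_used (s : Sizes) : ∀ i ∈ improvedCWC s, ∀ r ∈ i.regs, r.2.Used s := by
  have hA : ∀ p, p < s.npos .A → p < s.n := fun p hp => by unfold Sizes.n; omega
  have hB : ∀ p, p < s.npos .B → s.npos .A + p < s.n := fun p hp => by unfold Sizes.n; omega
  have hA' : ∀ p, p < s.nneg .A → p < s.m := fun p hp => by unfold Sizes.m; omega
  have hB' : ∀ p, p < s.nneg .B → s.nneg .A + p < s.m := fun p hp => by unfold Sizes.m; omega
  have hbit : ∀ p q, p < s.n → q < s.m → s.m * p + q < s.n * s.m := fun p q hp hq => by nlinarith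
  have hnet : ∀ c ∈ sortNetwork s.k, c.1 < s.k ∧ c.2 < s.k := fun c hc => by
    have := mem_sortNetwork hc
    omega
  have hname : Field.name ∈ Protocol.fields s := by simp [Protocol.fields]
  have hweight : Field.weight ∈ Protocol.fields s := by simp [Protocol.fields]
  have hbits : ∀ h, h < s.n * s.m → Field.bit h ∈ Protocol.fields s := by simp [Protocol.fields]
  unfold improvedCWC
  simp only [List.forall_mem_append]
  refine ⟨⟨⟨⟨⟨⟨⟨⟨⟨⟨?_, ?_⟩, ?_⟩, ?_⟩, ?_⟩, ?_⟩, ?_⟩, ?_⟩, ?_⟩, ?_⟩, ?_⟩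
  all_goals
    simp only [Protocol.shareData, Protocol.computeItems, Protocol.mixSend, Protocol.drawPerm,
      Protocol.mixReply, Protocol.mixEnd, Protocol.sortItems, Protocol.openRanks, Protocol.moveStrings,
      Protocol.selectFeatures, Protocol.openResult, Protocol.forItems, Sizes.posStart, Sizes.negStart,
      Protocol.compareExchange, List.forall_mem_append, List.forall_mem_cons, forall_mem_loop,
      List.forall_mem_flatMap, List.forall_mem_map, List.mem_range, List.mem_reverse, Instr.regs, Reg.Used,
      List.not_mem_nil, false_imp_iff, implies_true, and_true, Nat.lt_add_one_iff]
  all_goals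
    simp +contextual only [hname, hweight, hbits, hA, hB, hA', hB', hbit, hnet, Nat.reduceLeDiff, and_self,
      implies_true, Nat.le_of_lt, Nat.succ_le_of_lt, Nat.zero_le, le_refl]

theorem space_improvedCWC_le (s : Sizes) :
    (improvedCWC s).space ≤ 40 * ((s.k + 1) * (s.n + 1) * (s.m + 1)) := by
  have hsub : (((improvedCWC s) : List Instr).flatMap Instr.regs).toFinset ⊆
      ([Party.A, Party.B].flatMap fun P => (usedRegs s).map (Prod.mk P)).toFinset := by
    rintro ⟨P, r⟩ h
    rw [List.mem_toFinset, List.mem_flatMap] at h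
    obtain ⟨i, hi, hr⟩ := h
    have := mem_usedRegs (regs_used s i hi _ hr)
    cases P <;> simp [this]
  refine (Finset.card_le_card hsub).trans ((List.toFinset_card_le _).trans ?_)
  have := length_usedRegs_le s
  simp only [List.flatMap_cons, List.flatMap_nil, List.length_append, List.length_map, List.length_nil]
  omega

/-- For privacy a crude cubic bound on the network suffices, and no logarithm is needed. -/
theorem polyBounded_length (s : ℕ → Sizes) (hk : PolyBounded fun l => (s l).k)
    (hn : PolyBounded fun l => (s l).n) (hm : PolyBounded fun l => (s l).m) :
    PolyBounded fun l => (improvedCWC (s l)).length := by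
  have c := PolyBounded.const
  have h2k := ((c 2).mul hk).add (c 1)
  exact PolyBounded.mono (((c 200).mul (((hk.add (c 1)).mul (hn.add (c 1))).mul (hm.add (c 1)))).add
    ((c 7).mul ((h2k.mul h2k).mul h2k))) fun l => (length_improvedCWC_le (s l)).trans
      (Nat.add_le_add_left (Nat.mul_le_mul_left _ (length_sortNetwork_le_poly _)) _)

/-- For positive sizes, `(k + 1) * (n + 1) * (m + 1)` is at most `8 * k * m * n`, which turns `200`
into `1600`. The network contributes `7 * 8` times `k log² k`, and the space only `320` times `k * m
* n`; both are below the common constant. -/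
theorem complexity (s : Sizes) (hk : 1 ≤ s.k) (hm : 1 ≤ s.m) (hn : 1 ≤ s.n) :
    ((improvedCWC s).time : ℝ) ≤ 1600 * ((s.k : ℝ) * s.m * s.n + s.k * (Real.logb 2 s.k) ^ 2) ∧
      ((improvedCWC s).space : ℝ) ≤ 1600 * ((s.k : ℝ) * s.m * s.n) := by
  have hT : (s.k + 1) * (s.n + 1) * (s.m + 1) ≤ 8 * (s.k * s.m * s.n) := by
    calc _ ≤ (2 * s.k) * (2 * s.n) * (2 * s.m) := by gcongr <;> omega
      _ = _ := by ring
  have h1 := length_improvedCWC_le s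
  have h2 := length_sortNetwork_le_logb hk
  have h3 := space_improvedCWC_le s
  have h4 : (improvedCWC s).time ≤ 1600 * (s.k * s.m * s.n) + 7 * (sortNetwork s.k).length := by
    unfold Program.time; omega
  have h5 : (improvedCWC s).space ≤ 1600 * (s.k * s.m * s.n) := by omega
  have h4' : ((improvedCWC s).time : ℝ) ≤ 1600 * (s.k * s.m * s.n) + 7 * (sortNetwork s.k).length := by
    exact_mod_cast h4
  refine ⟨?_, by exact_mod_cast h5⟩
  have : 0 ≤ (s.k : ℝ) * Real.logb 2 s.k ^ 2 := by positivity
  linarith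

end SecureCWC

theorem theorem2 :
    (∃ C : ℝ, ∀ s : SecureCWC.Sizes, 1 ≤ s.k → 1 ≤ s.m → 1 ≤ s.n →
      ((SecureCWC.improvedCWC s).time : ℝ) ≤
        C * ((s.k : ℝ) * s.m * s.n + s.k * (Real.logb 2 s.k) ^ 2) ∧
      ((SecureCWC.improvedCWC s).space : ℝ) ≤ C * ((s.k : ℝ) * s.m * s.n)) ∧
    ∀ E : SecureCWC.BitCrypto, E.IsFHE →
      SecureCWC.Simulates E ∧ (E.Secure → SecureCWC.IsPrivate E) := by
  exact ⟨⟨1600, fun s hk hm hn => SecureCWC.complexity s hk hm hn⟩, fun E hE =>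
    ⟨SecureCWC.simulates E hE.1,
      fun hS => SecureCWC.isPrivate hE hS SecureCWC.polyBounded_length⟩⟩
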